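/- Let $n\ge 1$, let $D=\{x\in\mathbb C^n:\ |x_k|<1,\ 1\le k\le n\}$ be the unit polydisk, let $\Omega\supseteq D$ be open, and let $f$ be plurisubharmonic on $\Omega$ with $f\le 0$ on $D$ and $f\not\equiv-\infty$ on $D$. Let $$h(u)=(2\pi)^{-n}\int_{[0,2\pi]^n} f(e^{u_1+i\theta_1},\dots,e^{u_n+i\theta_n})\,d\theta$$ be the convex image of $f$ (so $f(x)=h(\log|x_1|,\dots,\log|x_n|)$ if $f$ is invariant under the rotations $x_k\mapsto x_ke^{i\theta_k}$). It is considered for those $u\in(-\infty,0]^n$ such that the closed polydisk of radii $e^{u_k}$ is contained in $\Omega$: all $u\in(-\infty,0)^n$ if $\Omega=D$, and all $u\in(-\infty,0]^n$ if $\overline D\subset\Omega$. At these points $h$ is finite. Put $d=\partial+\bar\partial$, $d^c=(2\pi i)^{-1}(\partial-\bar\partial)$. The Lelong number of $f$ at $x$ is $\nu(f,x)=\lim_{r\to0}(\tau_{2n-2}r^{2n-2})^{-1}\sigma(B(x,r))$, where $\sigma=dd^cf\wedge\beta_1^{n-1}/(n-1)!$ with $\beta_1=\frac i2\partial\bar\partial|x|^2$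 is the trace measure of $dd^cf$, $B(x,r)$ is the Euclidean ball, and $\tau_{2n-2}$ is the volume of the unit ball of $\mathbb C^{n-1}$. The generic Lelong number along $D_k=\{x\in D:\ x_k=0\}$ is $\nu_k(f,0)=\inf_{x\in D_k}\nu(f,x)$. For $a\in(0,\infty)^n$ put $\varphi_a(x)=\max_k a_k^{-1}\log|x_k|$ and $$n(f,0,a)=(a_1\cdots a_n)\lim_{t\to-\infty}\int_{\{\varphi_a<t\}}dd^cf\wedge(dd^c\varphi_a)^{n-1},$$ where the measure $dd^cf\wedge(dd^c\varphi_a)^{n-1}$ on $D$ is the weak limit of $dd^cf\wedge(dd^cw_j)^{n-1}$ for smooth plurisubharmonic functions $w_j$ on $D$ decreasing to $\varphi_a$. Then the following holds. (a) For every $a\in(0,\infty)^n$ and every $u$ as above, $$\lim_{v\to-\infty}v^{-1}h(u_1+a_1v,\dots,u_n+a_nv)=n(f,0,a);$$ in particular the limit is independent of $u$. Moreover $$\lim_{v\to-\infty}v^{-1}h(u_1+v,\dots,u_n+v)=\lim_{v\to-\infty}\frac{\partial}{\partial v}h(u_1+v,\dots,u_n+v)=\nu(f,0),$$ where $\partial/\partial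 v$ may be read as the left or as the right derivative, both of which exist for every $v<0$. (b) For every $k$ and every $u$ as above, $$\lim_{v\to-\infty}v^{-1}h(u_1,\dots,u_{k-1},u_k+v,u_{k+1},\dots,u_n)=\nu_k(f,0);$$ in particular the limit is independent of $u$. Moreover, if $h_k(r,x')$ denotes the mean of $f$ over $\{|x_k|=r\}$ in the variable $x_k$, the remaining variables $x'\in\mathbb C^{n-1}$ being fixed, then there is a pluripolar subset $E$ of the unit polydisk $D'$ of $\mathbb C^{n-1}$ (that is, $E\subset\{g=-\infty\}$ for some plurisubharmonic $g\not\equiv-\infty$ on $D'$) such that $$\lim_{w\to0^+}(\log w)^{-1}h_k(wr,x')=\nu_k(f,0)\qquad\text{for all }x'\in D'\setminus E,\ 0<r\le1.$$ (c) $\sum_{k=1}^n\nu_k(f,0)\le\nu(f,0)$. -/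

import Mathlib

open MeasureTheory Filter Topology
open scoped ContDiff

noncomputable section

namespace Pluri

/-! ### Extended-real integrals and angular means -/

/-- The integral `∫ g⁺ dμ - ∫ g⁻ dμ` of an extended-real function. It is used only for functions
that are bounded above and measures that are finite, so that its value lies in `[-∞, ∞)`. -/
def eIntegral {α : Type*} [MeasurableSpace α] (μ : Measure α) (g : α → EReal) : EReal :=
  ((∫⁻ t, (g t).toENNReal ∂μ : ENNReal) : EReal) - ((∫⁻ t, (-g t).toENNReal ∂μ : ENNReal) : EReal)

/-- The normalized measure `dθ / 2π` on `(0, 2π]`. -/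
def angleMeasure : Measure ℝ :=
  (ENNReal.ofReal (2 * Real.pi))⁻¹ • volume.restrict (Set.Ioc 0 (2 * Real.pi))

/-- The mean value of `f (x₁ e^{iθ₁}, …, xₙ e^{iθₙ})` over all angles (the circled image of `f`). -/
def circledMean {n : ℕ} (f : (Fin n → ℂ) → EReal) (x : Fin n → ℂ) : EReal :=
  eIntegral (Measure.pi fun _ : Fin n => angleMeasure)
    (fun θ => f (fun k => x k * Complex.exp (θ k * Complex.I)))

/-- The convex image `u ↦ f_c (e^{u₁}, …, e^{uₙ})` of `f`. -/
def convexImage {n : ℕ} (f : (Fin n → ℂ) → EReal) (u : Fin n → ℝ) : EReal :=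
  circledMean f (fun k => (Real.exp (u k) : ℂ))

/-- The mean over the circle `|x_k| = r` in the `k`-th variable alone, the remaining variables
`y` being fixed. -/
def partialMean {n : ℕ} (f : (Fin (n + 1) → ℂ) → EReal) (k : Fin (n + 1)) (r : ℝ)
    (y : Fin n → ℂ) : EReal :=
  eIntegral angleMeasure (fun θ => f (k.insertNth ((r : ℂ) * Complex.exp (θ * Complex.I)) y))

/-! ### Plurisubharmonic functions and pluripolar sets -/

/-- `f` is plurisubharmonic on the open set `Ω` (the constant `-∞` is allowed): values in
`[-∞, ∞)`, upper semicontinuity, and the sub-mean value inequality on every closed complex disc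
contained in `Ω`. -/
structure PSHOn {n : ℕ} (f : (Fin n → ℂ) → EReal) (Ω : Set (Fin n → ℂ)) : Prop where
  lt_top : ∀ x ∈ Ω, f x < ⊤
  usc : UpperSemicontinuousOn f Ω
  subMean : ∀ x b : Fin n → ℂ, (∀ ζ : ℂ, ‖ζ‖ ≤ 1 → x + ζ • b ∈ Ω) →
    f x ≤ eIntegral angleMeasure (fun θ => f (x + Complex.exp (θ * Complex.I) • b))

/-- The unit polydisk. -/
def polydisk (n : ℕ) : Set (Fin n → ℂ) := {x | ∀ k, ‖x k‖ < 1}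

/-- `E` is a pluripolar subset of the (connected) open set `U`. -/
def IsPluripolarIn {n : ℕ} (E U : Set (Fin n → ℂ)) : Prop :=
  E ⊆ U ∧ ∃ g : (Fin n → ℂ) → EReal, PSHOn g U ∧ (∃ x ∈ U, g x ≠ ⊥) ∧ ∀ x ∈ E, g x = ⊥

/-- The finite points `u` of `{u_k ≤ 0}` for which the closed polydisk of radii `e^{u_k}` lies
in `Ω`. This is `(-∞, 0)ⁿ` if `Ω` is the open unit polydisk, and `(-∞, 0]ⁿ` if `Ω` contains the
closed unit polydisk. -/
def logDomain {n : ℕ} (Ω : Set (Fin n → ℂ)) : Set (Fin n → ℝ) :=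
  {u | (∀ k, u k ≤ 0) ∧ ∀ x : Fin n → ℂ, (∀ k, ‖x k‖ ≤ Real.exp (u k)) → x ∈ Ω}

/-! ### Test functions and complex Hessians -/

/-- Smooth real functions with compact support in `U`. -/
structure IsTest {n : ℕ} (U : Set (Fin n → ℂ)) (χ : (Fin n → ℂ) → ℝ) : Prop where
  smooth : ContDiff ℝ ∞ χ
  compact : HasCompactSupport χ
  supp : tsupport χ ⊆ U

/-- The second real directional derivative `∂_b ∂_c w (x)`. -/
def secondDeriv {n : ℕ} (w : (Fin n → ℂ) → ℝ) (x b c : Fin n → ℂ) : ℝ :=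
  fderiv ℝ (fderiv ℝ w) x b c

/-- The complex Hessian `∂²w / ∂x_k ∂x̄_l`. -/
def complexHessian {n : ℕ} (w : (Fin n → ℂ) → ℝ) (x : Fin n → ℂ) : Matrix (Fin n) (Fin n) ℂ :=
  Matrix.of fun k l =>
    ((secondDeriv w x (Pi.single k 1) (Pi.single l 1)
        + secondDeriv w x (Pi.single k Complex.I) (Pi.single l Complex.I) : ℝ)
      + (secondDeriv w x (Pi.single k 1) (Pi.single l Complex.I)
        - secondDeriv w x (Pi.single k Complex.I) (Pi.single l 1) : ℝ) * Complex.I) / 4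

/-! ### Lelong numbers

With `d = ∂ + ∂̄`, `d^c = (2πi)⁻¹ (∂ - ∂̄)` one has `dd^c = (i/π) ∂∂̄`. -/

/-- The open Euclidean ball. -/
def euclBall {n : ℕ} (x : Fin n → ℂ) (r : ℝ) : Set (Fin n → ℂ) :=
  {y | ∑ k, ‖y k - x k‖ ^ 2 < r ^ 2}

/-- `σ` is (on the unit polydisk) the trace measure `dd^c f ∧ β₁^{n-1} / (n-1)!` of `dd^c f`,
where `β₁ = (i/2) ∂∂̄ |x|²`: it represents the distribution
`χ ↦ ∫ f dd^c χ ∧ β₁^{n-1} / (n-1)! = (2/π) ∫ f tr (∂²χ/∂x_k∂x̄_l) dV`. -/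
def IsTraceMeasure {n : ℕ} (f : (Fin n → ℂ) → EReal) (σ : Measure (Fin n → ℂ)) : Prop :=
  (∀ K : Set (Fin n → ℂ), IsCompact K → K ⊆ polydisk n → σ K < ⊤) ∧
  ∀ χ : (Fin n → ℂ) → ℝ, IsTest (polydisk n) χ →
    ∫ x, χ x ∂σ = (2 / Real.pi) * ∫ x, (f x).toReal * (complexHessian χ x).trace.re

/-- `ν` is the Lelong number at `x` of `dd^c f`, for `f` plurisubharmonic on the unit polydisk of
`ℂ^{n+1}`: the limit of `σ (B (x, r)) / (τ_{2n} r^{2n})`, where `τ_{2n}` is the volume of the unit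
ball of `ℂⁿ`. -/
def IsLelongNumber {n : ℕ} (f : (Fin (n + 1) → ℂ) → EReal) (x : Fin (n + 1) → ℂ) (ν : ℝ) : Prop :=
  ∃ σ : Measure (Fin (n + 1) → ℂ), IsTraceMeasure f σ ∧
    Tendsto (fun r : ℝ => (σ (euclBall x r)).toReal /
        ((volume (euclBall (0 : Fin n → ℂ) 1)).toReal * r ^ (2 * n)))
      (𝓝[>] 0) (𝓝 ν)

/-- `ν` is the generic Lelong number of `dd^c f` along `{x ∈ D : x_k = 0}`: the infimum of the
Lelong numbers at the points of this set. -/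
def IsGenericLelongNumber {n : ℕ} (f : (Fin (n + 1) → ℂ) → EReal) (k : Fin (n + 1)) (ν : ℝ) :
    Prop :=
  (∀ x ∈ polydisk (n + 1), x k = 0 → ∃ m : ℝ, IsLelongNumber f x m) ∧
  IsGLB {m : ℝ | ∃ x ∈ polydisk (n + 1), x k = 0 ∧ IsLelongNumber f x m} ν

/-! ### Generalized Lelong numbers with respect to the weights `φ_a` -/

/-- The weight `φ_a (x) = sup_k a_k⁻¹ log |x_k|`. -/
def weight {n : ℕ} (a : Fin n → ℝ) (x : Fin n → ℂ) : EReal :=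
  ⨆ k, (((a k)⁻¹ : ℝ) : EReal) * ENNReal.log ‖x k‖ₑ

/-- For `w` smooth on the unit polydisk of `ℂ^{n+1}`, the distribution `dd^c f ∧ (dd^c w)ⁿ`, i.e.
`χ ↦ ∫ f dd^c χ ∧ (dd^c w)ⁿ`. For complex Hessians `A` of `w` and `B` of `χ` one has
`dd^c χ ∧ (dd^c w)ⁿ = (2/π)^{n+1} n! tr (adj(A) B) dV`. -/
def mixedMA {n : ℕ} (f : (Fin (n + 1) → ℂ) → EReal) (w χ : (Fin (n + 1) → ℂ) → ℝ) : ℝ :=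
  (2 / Real.pi) ^ (n + 1) * (n.factorial : ℝ) *
    ∫ x, (f x).toReal * ((complexHessian w x).adjugate * complexHessian χ x).trace.re

/-- `w` is a sequence of smooth plurisubharmonic functions on the unit polydisk that decreases
pointwise to `φ`. -/
structure IsDecreasingApprox {n : ℕ} (φ : (Fin n → ℂ) → EReal) (w : ℕ → (Fin n → ℂ) → ℝ) :
    Prop where
  smooth : ∀ j, ContDiffOn ℝ ∞ (w j) (polydisk n)
  psh : ∀ j, PSHOn (fun x => ((w j x : ℝ) : EReal)) (polydisk n)
  antitone : ∀ x ∈ polydisk n, Antitone fun j => w j x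
  tendsto : ∀ x ∈ polydisk n, Tendsto (fun j => ((w j x : ℝ) : EReal)) atTop (𝓝 (φ x))

/-- `μ` is (on the unit polydisk of `ℂ^{n+1}`) the measure `dd^c f ∧ (dd^c φ)ⁿ`: the weak limit of
`dd^c f ∧ (dd^c w_j)ⁿ` for smooth plurisubharmonic functions `w_j` decreasing to `φ`. -/
def IsMixedMAMeasure {n : ℕ} (f φ : (Fin (n + 1) → ℂ) → EReal)
    (μ : Measure (Fin (n + 1) → ℂ)) : Prop :=
  (∀ K : Set (Fin (n + 1) → ℂ), IsCompact K → K ⊆ polydisk (n + 1) → μ K < ⊤) ∧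
  ∃ w : ℕ → (Fin (n + 1) → ℂ) → ℝ, IsDecreasingApprox φ w ∧
    ∀ χ : (Fin (n + 1) → ℂ) → ℝ, IsTest (polydisk (n + 1)) χ →
      Tendsto (fun j => mixedMA f (w j) χ) atTop (𝓝 (∫ x, χ x ∂μ))

/-- `ν` is the generalized Lelong number `lim_{t → -∞} ∫_{φ < t} dd^c f ∧ (dd^c φ)ⁿ` at the origin
of `dd^c f` with respect to the weight `φ`. The measure `dd^c f ∧ (dd^c φ)ⁿ` is required to exist,
and the limit must not depend on the approximation used to obtain it. -/
def IsGeneralizedLelongNumber {n : ℕ} (f φ : (Fin (n + 1) → ℂ) → EReal) (ν : ℝ) : Prop :=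
  (∃ μ : Measure (Fin (n + 1) → ℂ), IsMixedMAMeasure f φ μ) ∧
  ∀ μ : Measure (Fin (n + 1) → ℂ), IsMixedMAMeasure f φ μ →
    Tendsto (fun t : ℝ => (μ {x | φ x < (t : EReal)}).toReal) atBot (𝓝 ν)

/-- `N = n(f, 0, a) = (a₁ ⋯ aₙ) ν(dd^c f, φ_a)`. -/
def IsDirectionalLelongNumber {n : ℕ} (f : (Fin (n + 1) → ℂ) → EReal) (a : Fin (n + 1) → ℝ)
    (N : ℝ) : Prop :=
  ∃ ν : ℝ, IsGeneralizedLelongNumber f (weight a) ν ∧ N = (∏ k, a k) * ν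

end Pluri

end

open MeasureTheory Filter Topology
open scoped ContDiff

noncomputable section

namespace Pluri

/-! ### Angular measures and rotations -/

/-! Put `q = pot f`, that is `-f` on the polydisk: nonnegative, lower semicontinuous, with the
super-mean value inequality on complex discs and hence on holomorphic discs. Along a curve `s ↦
(e^{u_k + s (v_k - u_k)})_k` the torus mean of `q` depends on `Re s` only and is again super-mean. A
minimum principle on a vertical strip compares it with affine functions (`strip_min_principle`), so
in logarithmic coordinates it is concave (`NegPSH.le_logMean_of_le`). A nonnegative concave function
on the negative orthant must decrease in each variable (`NegPSH.logMean_antitone`), and local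
integrability of `q` makes it finite. So the convex image `h` is convex, increasing and nonpositive,
and every limit in the theorem becomes an asymptotic slope `asympSlope h d`. Convexity makes these
slopes independent of the base point (`NegConvex.tendsto_slope`), and (c) follows by walking in the
direction `(1, …, 1)` one coordinate at a time (`NegConvex.sum_asympSlope_le`). Base points `u` on
the boundary of the orthant are absorbed by enlarging the polydisk slightly (`exists_rescaled`).

The slopes are identified with Lelong numbers through functions of `log S`, where `S = ∑ |x_k|^{2
(q_k + 1)}`. The mixed Monge-Ampère density of the weight `l log S` against `g (log S)` is `l^n g''
(log S)` times the density of a measure invariant under the dilations of `S`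
(`maDensity_comp_log_cone`). With `g''` the difference of two translated bumps, the tested mass is
an increment of the means of `f` over two shells. In logarithmic coordinates this is an average of
increments of `h` in the direction `(1 / (2 (q_k + 1)))_k`, and it tends to the slope in that
direction (`NegPSH.tendsto_coneMean`). The trace measure is the same computation with `S = |x|²` and
an extra exponential factor (`NegPSH.tendsto_lelong`).

For a general weight `φ_a`, the exponents are chosen so that `log S` is close to `2 P φ_a`, up to a
factor `c` near `1`. If one weight is glued to another by a smooth maximum, a test function whose
Hessian lives where the first dominates does not notice the second; positivity then orders the
masses (`NegPSH.maInt_le_of_lt`). So the masses of any approximants of `φ_a` are squeezed between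
those of multiples of `log S`, and `c → 1` gives the value (`NegPSH.tendsto_mixedMA`). Positivity of
`dd^c f ∧ (dd^c w)^n` comes from integration by parts, the cofactor matrix of a complex Hessian
being divergence free (`sum_wd_adjugate_eq_zero`). Existence of the measure is weak compactness plus
the Riesz theorems (`NegPSH.exists_mixedMAMeasure`).

For (b) let `L` be the slope in the `k`-th direction. The mean of `-f` over the circle `|x_k| = e^v`
is at least `-v L` over every point of the smaller polydisk (`NegPSH.le_sliceMean`). The normalized
excesses along a suitable sequence of radii are summable on one torus, and their sum is the negative
of a plurisubharmonic function that is `-∞` on the exceptional set `E` (`NegPSH.exists_pluripolar`).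
Off `E` the slope along the line is exactly `L`. Averaging slice means shows that every Lelong
number on `{x_k = 0}` is at least `L` and that equality holds over points off `E`. -/

/-- The point `e^{iθ}` of the unit circle. -/
def expI (θ : ℝ) : ℂ := Complex.exp (θ * Complex.I)

@[simp] lemma norm_expI (θ : ℝ) : ‖expI θ‖ = 1 := Complex.norm_exp_ofReal_mul_I θ

lemma continuous_expI : Continuous expI := by unfold expI; fun_prop

lemma measurable_expI : Measurable expI := continuous_expI.measurable

lemma expI_add (s t : ℝ) : expI (s + t) = expI s * expI t := by
  simp [expI, add_mul, Complex.exp_add]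

lemma exists_expI_eq {c : ℂ} (hc : ‖c‖ = 1) : ∃ t, expI t = c := by
  refine ⟨Complex.arg c, ?_⟩
  have := Complex.norm_mul_exp_arg_mul_I c
  rwa [hc, Complex.ofReal_one, one_mul] at this

instance : IsProbabilityMeasure angleMeasure := by
  refine ⟨?_⟩
  have h : (0 : ℝ) < 2 * Real.pi := by positivity
  simp only [angleMeasure, Measure.smul_apply, Measure.restrict_apply MeasurableSet.univ,
    Set.univ_inter, Real.volume_Ioc, sub_zero, smul_eq_mul]
  exact ENNReal.inv_mul_cancel (by simpa using h) ENNReal.ofReal_ne_top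

/-- Both `(0, 2π]` and `(t, t + 2π]` are fundamental domains for translation by `2πℤ`, which leaves
the integrand invariant. No measurability of `G` is needed, which later spares measurability side
conditions. -/
lemma lintegral_angle_expI_mul (G : ℂ → ENNReal) (c : ℂ) (hc : ‖c‖ = 1) :
    ∫⁻ θ, G (c * expI θ) ∂angleMeasure = ∫⁻ θ, G (expI θ) ∂angleMeasure := by
  obtain ⟨t, rfl⟩ := exists_expI_eq hc
  have h2 : (0 : ℝ) < 2 * Real.pi := by positivity
  simp only [angleMeasure, lintegral_smul_measure, ← expI_add]
  congr 1
  have h1 : ∫⁻ θ in Set.Ioc 0 (2 * Real.pi), G (expI (t + θ))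
      = ∫⁻ θ in Set.Ioc t (t + 2 * Real.pi), G (expI θ) := by
    rw [← lintegral_indicator measurableSet_Ioc, ← lintegral_indicator measurableSet_Ioc,
      ← lintegral_add_left_eq_self ((Set.Ioc t (t + 2 * Real.pi)).indicator _) t]
    congr 1
    ext θ
    simp only [Set.indicator, Set.mem_Ioc, lt_add_iff_pos_right, add_le_add_iff_left]
  rw [h1]
  have e1 := isAddFundamentalDomain_Ioc h2 t volume
  have e2 := isAddFundamentalDomain_Ioc h2 0 volume
  rw [zero_add] at e2
  refine e1.setLIntegral_eq e2 _ ?_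
  rintro ⟨g, hg⟩ x
  obtain ⟨k, rfl⟩ := AddSubgroup.mem_zmultiples_iff.1 hg
  congr 1
  change expI (k • (2 * Real.pi) + x) = expI x
  simp only [expI, zsmul_eq_mul]
  push_cast
  rw [add_mul, Complex.exp_add]
  have : Complex.exp ((k : ℂ) * (2 * Real.pi) * Complex.I) = 1 :=
    Complex.exp_eq_one_iff.2 ⟨k, by ring⟩
  rw [this, one_mul]

/-- The uniform probability measure on the unit circle of `ℂ`. -/
def circleMeasure : Measure ℂ := angleMeasure.map expI

instance : IsProbabilityMeasure circleMeasure :=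
  Measure.isProbabilityMeasure_map measurable_expI.aemeasurable

lemma measurePreserving_expI : MeasurePreserving expI angleMeasure circleMeasure :=
  ⟨measurable_expI, rfl⟩

lemma measurePreserving_mul_circle (c : ℂ) (hc : ‖c‖ = 1) :
    MeasurePreserving (fun z => c * z) circleMeasure circleMeasure := by
  refine ⟨measurable_const_mul c, Measure.ext fun s hs => ?_⟩
  have hm : Measurable (s.indicator (1 : ℂ → ENNReal)) := measurable_one.indicator hs
  rw [Measure.map_apply (measurable_const_mul c) hs, ← lintegral_indicator_one hs,
    ← lintegral_indicator_one (measurable_const_mul c hs), circleMeasure,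
    lintegral_map hm measurable_expI, lintegral_map (measurable_one.indicator
      (measurable_const_mul c hs)) measurable_expI]
  exact lintegral_angle_expI_mul (s.indicator 1) c hc

/-- The uniform probability measure on the angles of the `n`-torus. -/
def torusAngle (n : ℕ) : Measure (Fin n → ℝ) := Measure.pi fun _ => angleMeasure

instance (n : ℕ) : IsProbabilityMeasure (torusAngle n) := by
  unfold torusAngle; infer_instance

lemma measurePreserving_torus_expI (n : ℕ) :
    MeasurePreserving (fun (θ : Fin n → ℝ) k => expI (θ k)) (torusAngle n)
      (Measure.pi fun _ => circleMeasure) :=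
  measurePreserving_pi _ _ fun _ => measurePreserving_expI

lemma lintegral_torus_mul {n : ℕ} {G : (Fin n → ℂ) → ENNReal} (hG : Measurable G)
    {c : Fin n → ℂ} (hc : ∀ k, ‖c k‖ = 1) :
    ∫⁻ θ, G (fun k => c k * expI (θ k)) ∂torusAngle n
      = ∫⁻ θ, G (fun k => expI (θ k)) ∂torusAngle n := by
  have h1 : MeasurePreserving (fun (z : Fin n → ℂ) k => c k * z k)
      (Measure.pi fun _ => circleMeasure) (Measure.pi fun _ => circleMeasure) :=
    measurePreserving_pi _ _ fun k => measurePreserving_mul_circle (c k) (hc k)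
  rw [(measurePreserving_torus_expI n).lintegral_comp hG, ← h1.lintegral_comp hG]
  exact (measurePreserving_torus_expI n).lintegral_comp (hG.comp h1.measurable)

lemma measurePreserving_rotation {n : ℕ} {c : Fin n → ℂ} (hc : ∀ k, ‖c k‖ = 1) :
    MeasurePreserving (fun (y : Fin n → ℂ) k => c k * y k) volume volume := by
  have h (k : Fin n) : MeasurePreserving (fun z : ℂ => c k * z) volume volume := by
    have := (rotation ⟨c k, by simp [Submonoid.unitSphere, hc k]⟩).measurePreserving
    have e : ⇑(rotation ⟨c k, by simp [Submonoid.unitSphere, hc k]⟩) = fun z : ℂ => c k * z := by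
      ext z; rfl
    rwa [e] at this
  exact measurePreserving_pi _ _ h

/-! ### Negative plurisubharmonic functions on the unit polydisk -/

lemma polydisk_eq_ball (n : ℕ) : polydisk n = Metric.ball (0 : Fin n → ℂ) 1 := by
  ext x
  rw [mem_ball_zero_iff, pi_norm_lt_iff one_pos]
  rfl

lemma isOpen_polydisk (n : ℕ) : IsOpen (polydisk n) := by
  rw [polydisk_eq_ball]; exact Metric.isOpen_ball

/-- Negative plurisubharmonic functions `≢ -∞` on the unit polydisk. -/
structure NegPSH {n : ℕ} (f : (Fin n → ℂ) → EReal) : Prop where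
  psh : PSHOn f (polydisk n)
  nonpos : ∀ x ∈ polydisk n, f x ≤ 0
  exists_ne_bot : ∃ x ∈ polydisk n, f x ≠ ⊥

lemma PSHOn.mono {n : ℕ} {f : (Fin n → ℂ) → EReal} {U V : Set (Fin n → ℂ)} (hf : PSHOn f V)
    (h : U ⊆ V) : PSHOn f U :=
  ⟨fun x hx => hf.lt_top x (h hx), hf.usc.mono h,
    fun x b hb => hf.subMean x b fun ζ hζ => h (hb ζ hζ)⟩

lemma eIntegral_of_nonpos {α : Type*} [MeasurableSpace α] (μ : Measure α) {g : α → EReal}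
    (hg : ∀ t, g t ≤ 0) :
    eIntegral μ g = -((∫⁻ t, (-g t).toENNReal ∂μ : ENNReal) : EReal) := by
  have : ∀ t, (g t).toENNReal = 0 := fun t => EReal.toENNReal_of_nonpos (hg t)
  simp [eIntegral, this]

/-- The nonnegative function `-f` on the unit polydisk, extended by `0`. -/
def pot {n : ℕ} (f : (Fin n → ℂ) → EReal) : (Fin n → ℂ) → ENNReal :=
  (polydisk n).indicator fun x => (-f x).toENNReal

lemma pot_of_mem {n : ℕ} {f : (Fin n → ℂ) → EReal} {x : Fin n → ℂ} (hx : x ∈ polydisk n) :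
    pot f x = (-f x).toENNReal := Set.indicator_of_mem hx _

lemma NegPSH.eq_neg_pot {n : ℕ} {f : (Fin n → ℂ) → EReal} (hf : NegPSH f) {x : Fin n → ℂ}
    (hx : x ∈ polydisk n) : f x = -(pot f x : EReal) := by
  rw [pot_of_mem hx, EReal.coe_toENNReal, neg_neg]
  simpa using EReal.neg_le_neg_iff.2 (hf.nonpos x hx)

lemma NegPSH.eIntegral_eq {n : ℕ} {f : (Fin n → ℂ) → EReal} (hf : NegPSH f) {α : Type*}
    [MeasurableSpace α] (μ : Measure α) {γ : α → Fin n → ℂ} (hγ : ∀ t, γ t ∈ polydisk n) :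
    eIntegral μ (fun t => f (γ t)) = -((∫⁻ t, pot f (γ t) ∂μ : ENNReal) : EReal) := by
  rw [eIntegral_of_nonpos μ fun t => hf.nonpos _ (hγ t)]
  simp only [pot_of_mem (hγ _)]

/-- A nonnegative lower semicontinuous function on the unit polydisk, satisfying the super-mean
value inequality on complex discs. -/
structure SuperMean {n : ℕ} (q : (Fin n → ℂ) → ENNReal) : Prop where
  lsc : LowerSemicontinuousOn q (polydisk n)
  mean_le : ∀ x b : Fin n → ℂ, (∀ ζ : ℂ, ‖ζ‖ ≤ 1 → x + ζ • b ∈ polydisk n) →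
    ∫⁻ θ, q (x + expI θ • b) ∂angleMeasure ≤ q x

lemma NegPSH.superMean {n : ℕ} {f : (Fin n → ℂ) → EReal} (hf : NegPSH f) :
    SuperMean (pot f) := by
  constructor
  · intro x hx c hc
    have h := hf.psh.usc x hx (-(c : EReal)) (by
      change f x < _
      rw [hf.eq_neg_pot hx]
      exact EReal.neg_lt_neg_iff.2 (by exact_mod_cast hc))
    filter_upwards [h, self_mem_nhdsWithin] with y hy hyD
    rw [hf.eq_neg_pot hyD] at hy
    exact_mod_cast EReal.neg_lt_neg_iff.1 hy
  · intro x b hb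
    have h := hf.psh.subMean x b hb
    have h' : eIntegral angleMeasure (fun θ => f (x + expI θ • b)) = _ :=
      hf.eIntegral_eq angleMeasure fun θ => hb (expI θ) (by simp)
    have hx : x ∈ polydisk n := by simpa using hb 0 (by simp)
    change f x ≤ eIntegral angleMeasure (fun θ => f (x + expI θ • b)) at h
    rw [h', hf.eq_neg_pot hx] at h
    exact_mod_cast EReal.neg_le_neg_iff.1 h

/-- Conversely, a super-mean function gives a plurisubharmonic function. -/
lemma SuperMean.pshOn {n : ℕ} {q : (Fin n → ℂ) → ENNReal} (hq : SuperMean q) :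
    PSHOn (fun x => -(q x : EReal)) (polydisk n) := by
  refine ⟨fun x _ => ?_, ?_, ?_⟩
  · exact lt_of_le_of_lt (b := 0) (by simpa using EReal.coe_ennreal_nonneg _) (by simp)
  · intro x hx c hc
    have h := hq.lsc x hx
    by_cases hc0 : c ≤ 0
    · have h2 : (((-c).toENNReal : ENNReal) : EReal) = -c :=
        EReal.coe_toENNReal (by simpa using EReal.neg_le_neg_iff.2 hc0)
      have h1 : (-c).toENNReal < q x := by
        rw [← EReal.coe_ennreal_lt_coe_ennreal_iff, h2]
        exact EReal.neg_lt_comm.1 hc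
      filter_upwards [h _ h1] with y hy
      rw [gt_iff_lt, ← EReal.coe_ennreal_lt_coe_ennreal_iff, h2] at hy
      exact EReal.neg_lt_comm.1 hy
    · filter_upwards with y
      exact lt_of_le_of_lt (b := 0) (by simpa using EReal.coe_ennreal_nonneg _) (not_le.1 hc0)
  · intro x b hb
    rw [eIntegral_of_nonpos _ (fun t => by simpa using EReal.coe_ennreal_nonneg _)]
    simp only [neg_neg, EReal.toENNReal_coe]
    exact EReal.neg_le_neg_iff.2 (by exact_mod_cast hq.mean_le x b hb)

lemma measurable_of_lscOn {n : ℕ} {q : (Fin n → ℂ) → ENNReal}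
    (hq : LowerSemicontinuousOn q (polydisk n)) (h0 : ∀ x ∉ polydisk n, q x = 0) :
    Measurable q := by
  have : LowerSemicontinuous q := by
    intro x c hc
    by_cases hx : x ∈ polydisk n
    · have := hq x hx c hc
      rwa [(isOpen_polydisk n).nhdsWithin_eq hx] at this
    · rw [h0 x hx] at hc; exact absurd hc not_lt_zero
  exact this.measurable

lemma NegPSH.measurable_pot {n : ℕ} {f : (Fin n → ℂ) → EReal} (hf : NegPSH f) :
    Measurable (pot f) :=
  measurable_of_lscOn hf.superMean.lsc fun _ hx => Set.indicator_of_notMem hx _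

/-- Super-mean value inequality for kernels that are invariant under scalar rotations. -/
lemma SuperMean.lintegral_mul_le {n : ℕ} {q : (Fin n → ℂ) → ENNReal} (hq : SuperMean q)
    (hqm : Measurable q) {ψ : (Fin n → ℂ) → ENNReal} (hψ : Measurable ψ)
    (hrot : ∀ (c : ℂ) y, ‖c‖ = 1 → ψ (c • y) = ψ y) {x : Fin n → ℂ}
    (hsupp : ∀ y, ψ y ≠ 0 → ∀ ζ : ℂ, ‖ζ‖ ≤ 1 → x + ζ • y ∈ polydisk n) :
    ∫⁻ y, q (x + y) * ψ y ≤ q x * ∫⁻ y, ψ y := by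
  -- Lebesgue measure and `ψ` do not see the rotation `y ↦ e^{iθ} y`, so the integral may be
  -- averaged over `θ`; after Fubini the disc inequality applies for each fixed `y`.
  have h1 : ∀ θ : ℝ, ∫⁻ y, q (x + y) * ψ y = ∫⁻ y, q (x + expI θ • y) * ψ y := by
    intro θ
    have hm : MeasurePreserving (fun (y : Fin n → ℂ) k => expI θ * y k) volume volume :=
      measurePreserving_rotation (fun _ => norm_expI θ)
    rw [← hm.lintegral_comp (by fun_prop)]
    refine lintegral_congr fun y => ?_
    change q (x + expI θ • y) * ψ (expI θ • y) = _
    rw [hrot _ _ (norm_expI θ)]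
  have hm2 : Measurable fun p : ℝ × (Fin n → ℂ) => q (x + expI p.1 • p.2) * ψ p.2 := by
    have := measurable_expI
    fun_prop
  calc ∫⁻ y, q (x + y) * ψ y
      = ∫⁻ _θ : ℝ, (∫⁻ y, q (x + y) * ψ y) ∂angleMeasure := by simp
    _ = ∫⁻ θ, (∫⁻ y, q (x + expI θ • y) * ψ y) ∂angleMeasure := lintegral_congr h1
    _ = ∫⁻ y, ∫⁻ θ, q (x + expI θ • y) * ψ y ∂angleMeasure :=
        lintegral_lintegral_swap hm2.aemeasurable
    _ ≤ ∫⁻ y, q x * ψ y := by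
        refine lintegral_mono fun y => ?_
        rw [lintegral_mul_const _ (by have := measurable_expI; fun_prop)]
        by_cases hy : ψ y = 0
        · simp [hy]
        · exact mul_le_mul_left (hq.mean_le x y (hsupp y hy)) _
    _ = q x * ∫⁻ y, ψ y := lintegral_const_mul _ hψ

lemma SuperMean.lintegral_ball_le {n : ℕ} {q : (Fin n → ℂ) → ENNReal} (hq : SuperMean q)
    (hqm : Measurable q) {x : Fin n → ℂ} {r : ℝ} (hr : ‖x‖ + r ≤ 1) :
    ∫⁻ y in Metric.ball x r, q y ≤ q x * volume (Metric.ball x r) := by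
  have h := hq.lintegral_mul_le hqm (ψ := (Metric.ball 0 r).indicator 1)
    (measurable_one.indicator Metric.isOpen_ball.measurableSet) (x := x) (by
      intro c y hc
      simp [Set.indicator, norm_smul, hc]) (by
      intro y hy ζ hζ
      have hy' : ‖y‖ < r := by simpa using Set.mem_of_indicator_ne_zero hy
      rw [polydisk_eq_ball, mem_ball_zero_iff]
      calc ‖x + ζ • y‖ ≤ ‖x‖ + ‖ζ‖ * ‖y‖ := (norm_add_le _ _).trans (by rw [norm_smul])
        _ ≤ ‖x‖ + 1 * ‖y‖ := by gcongr
        _ < 1 := by linarith)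
  rw [lintegral_indicator_one Metric.isOpen_ball.measurableSet] at h
  have e : volume (Metric.ball x r) = volume (Metric.ball (0 : Fin n → ℂ) r) :=
    Measure.addHaar_ball_center _ _ _
  rw [e]
  refine le_trans (le_of_eq ?_) h
  rw [← lintegral_indicator Metric.isOpen_ball.measurableSet, ← lintegral_add_left_eq_self _ x]
  refine lintegral_congr fun y => ?_
  simp only [Set.indicator, Metric.mem_ball, dist_self_add_left, dist_zero_right, Pi.one_apply]
  split_ifs <;> simp

/-- Local integrability. -/
lemma SuperMean.lintegral_lt_top {n : ℕ} {q : (Fin n → ℂ) → ENNReal} (hq : SuperMean q)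
    (hqm : Measurable q) (hne : ∃ x ∈ polydisk n, q x ≠ ⊤) {K : Set (Fin n → ℂ)}
    (hK : IsCompact K) (hKD : K ⊆ polydisk n) : ∫⁻ x in K, q x < ⊤ := by
  -- Connectedness argument: the points near which `q` is integrable form an open set, the remaining
  -- points of the polydisk form an open set as well, and the former is nonempty.
  let good : Set (Fin n → ℂ) := {x | ∃ U ∈ 𝓝 x, ∫⁻ y in U, q y < ⊤}
  have hopen : IsOpen good := by
    rw [isOpen_iff_mem_nhds]
    rintro x ⟨U, hU, hUq⟩
    obtain ⟨V, hVU, hV, hxV⟩ := mem_nhds_iff.1 hU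
    filter_upwards [hV.mem_nhds hxV] with y hy
    exact ⟨V, hV.mem_nhds hy, (lintegral_mono_set hVU).trans_lt hUq⟩
  have hgood_of : ∀ x ∈ polydisk n, ∀ y, q y ≠ ⊤ → dist x y < (1 - ‖y‖) → x ∈ good := by
    intro x _ y hy hxy
    refine ⟨Metric.ball y (1 - ‖y‖), Metric.isOpen_ball.mem_nhds hxy, ?_⟩
    refine (hq.lintegral_ball_le hqm (by linarith)).trans_lt ?_
    exact ENNReal.mul_lt_top hy.lt_top measure_ball_lt_top
  have hbadopen : IsOpen {x ∈ polydisk n | x ∉ good} := by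
    rw [isOpen_iff_mem_nhds]
    rintro x ⟨hxD, hx⟩
    have hxn : ‖x‖ < 1 := by simpa [polydisk_eq_ball] using hxD
    -- A point `z` within `(1 - ‖x‖) / 4` of `x` satisfies `dist x z < 1 - ‖z‖`. So finiteness of `q
    -- z` would make `x` good; hence near a bad point `q` is identically `⊤`.
    have hr : 0 < (1 - ‖x‖) / 4 := by linarith
    filter_upwards [Metric.ball_mem_nhds x hr] with y hy
    have hyx : dist y x < (1 - ‖x‖) / 4 := hy
    have hyn : ‖y‖ ≤ ‖x‖ + dist y x := by
      have := norm_le_insert' y x; rwa [← dist_eq_norm] at this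
    have hyD : y ∈ polydisk n := by
      rw [polydisk_eq_ball, mem_ball_zero_iff]; linarith
    refine ⟨hyD, ?_⟩
    rintro ⟨U, hU, hUq⟩
    have hinf : ∀ z ∈ Metric.ball x ((1 - ‖x‖) / 4), q z = ⊤ := by
      intro z hz
      by_contra hz'
      have hzx : dist z x < (1 - ‖x‖) / 4 := hz
      refine hx (hgood_of x hxD z hz' ?_)
      have : ‖z‖ ≤ ‖x‖ + dist z x := by
        have := norm_le_insert' z x; rwa [← dist_eq_norm] at this
      rw [dist_comm]; linarith
    obtain ⟨V, hVU, hV, hyV⟩ := mem_nhds_iff.1 hU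
    have hW : IsOpen (V ∩ Metric.ball x ((1 - ‖x‖) / 4)) := hV.inter Metric.isOpen_ball
    have hpos : 0 < volume (V ∩ Metric.ball x ((1 - ‖x‖) / 4)) :=
      hW.measure_pos _ ⟨y, hyV, hy⟩
    have : ∫⁻ z in V ∩ Metric.ball x ((1 - ‖x‖) / 4), q z = ⊤ := by
      rw [setLIntegral_congr_fun hW.measurableSet fun z hz => hinf z hz.2]
      simp [ENNReal.top_mul hpos.ne']
    have h2 := lintegral_mono_set (μ := volume) (f := q)
      (Set.inter_subset_left.trans hVU : V ∩ Metric.ball x ((1 - ‖x‖) / 4) ⊆ U)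
    rw [this] at h2
    exact absurd hUq (not_lt.2 h2)
  have hconn : IsPreconnected (polydisk n) := by
    rw [polydisk_eq_ball]; exact (convex_ball _ _).isPreconnected
  obtain ⟨x₀, hx₀, hqx₀⟩ := hne
  have hsub : polydisk n ⊆ good := by
    refine hconn.subset_left_of_subset_union hopen hbadopen ?_ ?_ ?_
    · exact Set.disjoint_left.2 fun x hx hx' => hx'.2 hx
    · intro x hx
      by_cases h : x ∈ good
      · exact Or.inl h
      · exact Or.inr ⟨hx, h⟩
    · refine ⟨x₀, hx₀, hgood_of x₀ hx₀ x₀ hqx₀ ?_⟩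
      have : ‖x₀‖ < 1 := by simpa [polydisk_eq_ball] using hx₀
      simpa using this
  refine hK.induction_on (p := fun s => ∫⁻ x in s, q x < ⊤) (by simp)
    (fun s t hst ht => (lintegral_mono_set hst).trans_lt ht)
    (fun s t hs ht => (lintegral_union_le _ _ _).trans_lt (ENNReal.add_lt_top.2 ⟨hs, ht⟩)) ?_
  intro x hx
  obtain ⟨U, hU, h⟩ := hsub (hKD hx)
  exact ⟨U, mem_nhdsWithin_of_mem_nhds hU, h⟩

lemma NegPSH.exists_pot_ne_top {n : ℕ} {f : (Fin n → ℂ) → EReal} (hf : NegPSH f) :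
    ∃ x ∈ polydisk n, pot f x ≠ ⊤ := by
  obtain ⟨x, hx, h⟩ := hf.exists_ne_bot
  refine ⟨x, hx, fun h' => h ?_⟩
  rw [hf.eq_neg_pot hx, h']; rfl

lemma NegPSH.lintegral_pot_lt_top {n : ℕ} {f : (Fin n → ℂ) → EReal} (hf : NegPSH f)
    {K : Set (Fin n → ℂ)} (hK : IsCompact K) (hKD : K ⊆ polydisk n) :
    ∫⁻ x in K, pot f x < ⊤ :=
  hf.superMean.lintegral_lt_top hf.measurable_pot hf.exists_pot_ne_top hK hKD

/-! ### The Levi form and smooth subharmonic functions -/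

lemma two_le_infty : (2 : WithTop ℕ∞) ≤ ∞ := WithTop.coe_le_coe.2 (le_top : (2 : ℕ∞) ≤ ⊤)

section Levi

variable {E : Type*} [NormedAddCommGroup E] [NormedSpace ℂ E]

/-- Four times the Levi form of `w` at `x` in the direction `b`. -/
def levi (w : E → ℝ) (x b : E) : ℝ :=
  fderiv ℝ (fderiv ℝ w) x b b + fderiv ℝ (fderiv ℝ w) x (Complex.I • b) (Complex.I • b)

lemma levi_congr {w v : E → ℝ} {x : E} (h : w =ᶠ[𝓝 x] v) (b : E) : levi w x b = levi v x b := by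
  have h2 : fderiv ℝ w =ᶠ[𝓝 x] fderiv ℝ v := h.fderiv
  simp only [levi, h2.fderiv_eq]

lemma fderiv_fderiv_comp_holomorphic [CompleteSpace E] {F : E → ℝ} {γ : ℂ → E} (hγ : Differentiable ℂ γ) {s : ℂ}
    (hF : ContDiffAt ℝ 2 F (γ s)) (v : ℂ) :
    fderiv ℝ (fderiv ℝ (F ∘ γ)) s v v
      = fderiv ℝ (fderiv ℝ F) (γ s) (v • deriv γ s) (v • deriv γ s)
        + fderiv ℝ F (γ s) ((v * v) • deriv (deriv γ) s) := by
  have hγ' : Differentiable ℂ (deriv γ) := fun z =>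
    (hγ.differentiableOn.deriv isOpen_univ).differentiableAt univ_mem
  have hγd (z : ℂ) : HasFDerivAt γ ((ContinuousLinearMap.smulRight (1 : ℂ →L[ℂ] ℂ)
      (deriv γ z)).restrictScalars ℝ) z :=
    (hγ z).hasDerivAt.hasFDerivAt.restrictScalars ℝ
  have hγd' (z : ℂ) : HasFDerivAt (deriv γ) ((ContinuousLinearMap.smulRight (1 : ℂ →L[ℂ] ℂ)
      (deriv (deriv γ) z)).restrictScalars ℝ) z :=
    (hγ' z).hasDerivAt.hasFDerivAt.restrictScalars ℝ
  have hF1 : ∀ᶠ z in 𝓝 s, DifferentiableAt ℝ F (γ z) := by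
    have h1 := hF.eventually (by simp)
    exact (hγ.continuous.continuousAt.eventually h1).mono
      fun z hz => hz.differentiableAt (by norm_num)
  have hFd : DifferentiableAt ℝ (fderiv ℝ F) (γ s) :=
    (hF.fderiv_right (m := 1) (by norm_num)).differentiableAt (by norm_num)
  have e1 : fderiv ℝ (F ∘ γ) =ᶠ[𝓝 s] fun z => (fderiv ℝ F (γ z)).comp
      ((ContinuousLinearMap.smulRight (1 : ℂ →L[ℂ] ℂ) (deriv γ z)).restrictScalars ℝ) := by
    filter_upwards [hF1] with z hz
    exact (hz.hasFDerivAt.comp z (hγd z)).fderiv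
  have hdiff : DifferentiableAt ℝ (fderiv ℝ (F ∘ γ)) s := by
    have : ContDiffAt ℝ 2 (F ∘ γ) s :=
      hF.comp s ((hγ.contDiff (n := 2)).restrict_scalars ℝ).contDiffAt
    exact (this.fderiv_right (m := 1) (by norm_num)).differentiableAt (by norm_num)
  have e2 : fderiv ℝ (fderiv ℝ (F ∘ γ)) s v v
      = fderiv ℝ (fun z => fderiv ℝ F (γ z) (v • deriv γ z)) s v := by
    have h1 : (fun z => fderiv ℝ F (γ z) (v • deriv γ z))
        =ᶠ[𝓝 s] fun z => fderiv ℝ (F ∘ γ) z v := by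
      filter_upwards [e1] with z hz
      rw [hz]; simp
    rw [h1.fderiv_eq]
    have := (hdiff.hasFDerivAt.clm_apply (hasFDerivAt_const v s)).fderiv
    rw [this]; simp
  have e3 : HasFDerivAt (fun z => fderiv ℝ F (γ z)) _ s := hFd.hasFDerivAt.comp s (hγd s)
  have e4 := (e3.clm_apply ((hγd' s).const_smul v)).fderiv
  rw [e2]
  erw [e4]
  simp [smul_smul]
  ring

/-- In the second-order chain rule the term with `γ''` carries the factor `v * v`, which is `1` for
`v = 1` and `-1` for `v = I`; the two contributions cancel. -/
lemma levi_comp_holomorphic [CompleteSpace E] {F : E → ℝ} {γ : ℂ → E} (hγ : Differentiable ℂ γ) {s : ℂ}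
    (hF : ContDiffAt ℝ 2 F (γ s)) :
    levi (F ∘ γ) s 1 = levi F (γ s) (deriv γ s) := by
  simp only [levi, fderiv_fderiv_comp_holomorphic hγ hF, smul_eq_mul, mul_one, Complex.I_mul_I,
    one_smul, neg_smul, map_neg]
  ring

end Levi

/-- Under the exponential, circles about `0` become vertical segments of length `2π`; this
differentiates circle means with respect to the logarithm of the radius. -/
lemma hasDerivAt_integral_vertical {g : ℂ → ℝ} (hg : ContDiff ℝ 1 g) (t : ℝ) :
    HasDerivAt (fun t : ℝ => ∫ θ in (0)..(2 * Real.pi), g (t + θ * Complex.I))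
      (∫ θ in (0)..(2 * Real.pi), fderiv ℝ g (t + θ * Complex.I) 1) t := by
  have hc : Continuous fun p : ℝ × ℝ => fderiv ℝ g (p.1 + p.2 * Complex.I) 1 := by
    have := hg.continuous_fderiv (by norm_num)
    fun_prop
  obtain ⟨B, hB⟩ := (((isCompact_Icc (a := t - 1) (b := t + 1)).prod
    (isCompact_Icc (a := 0) (b := 2 * Real.pi))).image hc).isBounded.exists_norm_le
  have hpi : (0 : ℝ) ≤ 2 * Real.pi := by positivity
  have h0 := hg.continuous
  refine (intervalIntegral.hasDerivAt_integral_of_dominated_loc_of_deriv_le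
    (F := fun (t θ : ℝ) => g (t + θ * Complex.I))
    (F' := fun (t θ : ℝ) => fderiv ℝ g (t + θ * Complex.I) 1)
    (bound := fun _ => B) (Icc_mem_nhds (a := t - 1) (b := t + 1) (by linarith) (by linarith))
    ?_ ?_ ?_ ?_ ?_ ?_).2
  · exact Eventually.of_forall fun s => by
      have : Continuous fun θ : ℝ => g (s + θ * Complex.I) := by fun_prop
      exact this.aestronglyMeasurable
  · exact Continuous.intervalIntegrable (by fun_prop) _ _
  · have : Continuous fun θ : ℝ => fderiv ℝ g (t + θ * Complex.I) 1 := by fun_prop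
    exact this.aestronglyMeasurable
  · refine Eventually.of_forall fun θ hθ s hs => hB _ ⟨(s, θ), ⟨hs, ?_⟩, rfl⟩
    rw [Set.uIoc_of_le hpi] at hθ
    exact Set.Ioc_subset_Icc_self hθ
  · exact intervalIntegrable_const
  · refine Eventually.of_forall fun θ _ s _ => ?_
    have h1 : HasDerivAt (fun s : ℝ => (s : ℂ) + θ * Complex.I) 1 s := by
      simpa using (Complex.ofRealCLM.hasDerivAt (x := s)).add_const (θ * Complex.I)
    exact ((hg.differentiable (by norm_num)) _).hasFDerivAt.comp_hasDerivAt s h1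

/-- Let `r → -∞` in the chord inequality: after division by `t - r` the term with `m r` contributes
at most `0` in the limit, as `m` is bounded above, and `m t` gets weight tending to `1`. The proof
picks one `r` far enough to contradict `m t < m s`. -/
lemma le_of_convex_bddAbove {m : ℝ → ℝ} {s t B : ℝ} (hst : s < t)
    (hm : ∀ r < s, (t - r) * m s ≤ (t - s) * m r + (s - r) * m t) (hB : ∀ r < s, m r ≤ B) :
    m s ≤ m t := by
  by_contra hlt
  push Not at hlt
  set K := (t - s) * (|B| + |m s|) / (m s - m t) with hK
  have hpos : 0 < m s - m t := by linarith
  have hK0 : 0 ≤ K := by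
    have : 0 < t - s := by linarith
    positivity
  have h1 := hm (s - K - 1) (by linarith)
  have h2 := hB (s - K - 1) (by linarith)
  have h3 : K * (m s - m t) = (t - s) * (|B| + |m s|) := by
    rw [hK]; field_simp
  have h4 : (t - s) * m (s - K - 1) ≤ (t - s) * |B| :=
    mul_le_mul_of_nonneg_left (h2.trans (le_abs_self B)) (by linarith)
  have h5 : (t - s) * (- m s) ≤ (t - s) * |m s| :=
    mul_le_mul_of_nonneg_left (neg_le_abs _) (by linarith)
  nlinarith

/-- A smooth function with nonnegative Laplacian satisfies the sub-mean value inequality. -/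
lemma le_integral_circle_of_levi_nonneg {G : ℂ → ℝ} (hG : ContDiff ℝ ∞ G)
    (hlev : ∀ z : ℂ, ‖z‖ ≤ 1 → 0 ≤ levi G z 1) :
    2 * Real.pi * G 0 ≤ ∫ θ in (0)..(2 * Real.pi), G (expI θ) := by
  -- With `P = G ∘ exp`, the function `m t` is `2π` times the mean of `G` over `|z| = e^t`. It is
  -- convex for `t ≤ 0` and bounded near `-∞`, hence `m t ≤ m 0`, while `m t → 2π G 0`.
  set P : ℂ → ℝ := G ∘ Complex.exp with hP
  have hPs : ContDiff ℝ ∞ P := hG.comp ((Complex.contDiff_exp (𝕜 := ℂ)).restrict_scalars ℝ)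
  have hPs' : ContDiff ℝ ∞ (fderiv ℝ P) := hPs.fderiv_right (by simp)
  have hper (w : ℂ) : P (w + 2 * Real.pi * Complex.I) = P w := by
    simp [hP, Complex.exp_add, Complex.exp_two_pi_mul_I]
  have hlevP (w : ℂ) (hw : w.re ≤ 0) : 0 ≤ levi P w 1 := by
    have h1 : ContDiffAt ℝ 2 G (Complex.exp w) := hG.contDiffAt.of_le two_le_infty
    rw [hP, levi_comp_holomorphic Complex.differentiable_exp h1, Complex.deriv_exp]
    -- In one complex dimension the Levi form is `‖c‖²` times the Laplacian: the mixed terms cancel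
    -- by symmetry of the second derivative.
    have key : ∀ c : ℂ, levi G (Complex.exp w) c = ‖c‖ ^ 2 * levi G (Complex.exp w) 1 := by
      intro c
      have hsym : fderiv ℝ (fderiv ℝ G) (Complex.exp w) 1 Complex.I
          = fderiv ℝ (fderiv ℝ G) (Complex.exp w) Complex.I 1 :=
        (h1.isSymmSndFDerivAt (by simp)).eq 1 Complex.I
      have hc : c = c.re • (1 : ℂ) + c.im • Complex.I := by
        apply Complex.ext <;> simp
      have hIc : Complex.I • c = (-c.im) • (1 : ℂ) + c.re • Complex.I := by
        apply Complex.ext <;> simp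
      have hn : ‖c‖ ^ 2 = c.re ^ 2 + c.im ^ 2 := by
        rw [← Complex.normSq_eq_norm_sq, Complex.normSq_apply]; ring
      rw [levi, hIc, hn, levi]
      generalize c.re = a at *
      generalize c.im = b at *
      subst hc
      simp only [map_add, map_smul, add_apply, smul_apply,
        smul_eq_mul, mul_one, hsym]
      ring
    rw [key]
    have := hlev (Complex.exp w) (by rw [Complex.norm_exp]; exact Real.exp_le_one_iff.2 hw)
    positivity
  set m : ℝ → ℝ := fun t => ∫ θ in (0)..(2 * Real.pi), P (t + θ * Complex.I) with hm
  set m' : ℝ → ℝ := fun t => ∫ θ in (0)..(2 * Real.pi), fderiv ℝ P (t + θ * Complex.I) 1 with hm'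
  have hd1 (t : ℝ) : HasDerivAt m (m' t) t :=
    hasDerivAt_integral_vertical (hPs.of_le (by exact_mod_cast le_top)) t
  have hP1 : ContDiff ℝ 1 fun w => fderiv ℝ P w 1 :=
    (hPs'.clm_apply contDiff_const).of_le (by exact_mod_cast le_top)
  have happ (w v : ℂ) (c : ℂ) : fderiv ℝ (fun w => fderiv ℝ P w c) w v
      = fderiv ℝ (fderiv ℝ P) w v c := by
    have hd := (hPs'.differentiable (by simp)) w
    rw [(hd.hasFDerivAt.clm_apply (hasFDerivAt_const c w)).fderiv]; simp
  have hd2 (t : ℝ) : HasDerivAt m'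
      (∫ θ in (0)..(2 * Real.pi), fderiv ℝ (fderiv ℝ P) (t + θ * Complex.I) 1 1) t := by
    have := hasDerivAt_integral_vertical hP1 t
    simpa only [happ] using this
  have hc2 : Continuous (fderiv ℝ (fderiv ℝ P)) := hPs'.continuous_fderiv (by simp)
  -- The second derivative along the segment integrates to `0` by periodicity. It may therefore be
  -- added to `m''`, turning the integrand into the Laplacian.
  have hzero (t : ℝ) : ∫ θ in (0)..(2 * Real.pi),
      fderiv ℝ (fderiv ℝ P) (t + θ * Complex.I) Complex.I Complex.I = 0 := by
    have hder : ∀ θ ∈ Set.uIcc 0 (2 * Real.pi), HasDerivAt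
        (fun θ : ℝ => fderiv ℝ P (t + θ * Complex.I) Complex.I)
        (fderiv ℝ (fderiv ℝ P) (t + θ * Complex.I) Complex.I Complex.I) θ := by
      intro θ _
      have h1 : HasDerivAt (fun s : ℝ => (t : ℂ) + s * Complex.I) Complex.I θ := by
        simpa using ((Complex.ofRealCLM.hasDerivAt (x := θ)).mul_const Complex.I).const_add (t : ℂ)
      have h2 : DifferentiableAt ℝ (fun w => fderiv ℝ P w Complex.I) (t + θ * Complex.I) :=
        ((hPs'.clm_apply contDiff_const).differentiable (by simp)) _
      have := h2.hasFDerivAt.comp_hasDerivAt θ h1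
      rwa [happ] at this
    rw [intervalIntegral.integral_eq_sub_of_hasDerivAt hder
      (Continuous.intervalIntegrable (by fun_prop) _ _)]
    have hperd (w : ℂ) : fderiv ℝ P (w + 2 * Real.pi * Complex.I) = fderiv ℝ P w := by
      rw [← fderiv_comp_add_right]
      congr 1
      ext w; exact hper w
    have := hperd t
    push_cast
    rw [this]; simp
  have hconv : ConvexOn ℝ (Set.Iic 0) m := by
    refine convexOn_of_hasDerivWithinAt2_nonneg (f' := m')
      (f'' := fun t => ∫ θ in (0)..(2 * Real.pi), fderiv ℝ (fderiv ℝ P) (t + θ * Complex.I) 1 1)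
      (convex_Iic 0) (fun t _ => (hd1 t).continuousAt.continuousWithinAt)
      (fun t _ => (hd1 t).hasDerivWithinAt) (fun t _ => (hd2 t).hasDerivWithinAt) ?_
    intro t ht
    have ht0 : t ≤ 0 := le_of_lt (by simpa using ht)
    have hadd := intervalIntegral.integral_add (μ := volume) (a := 0) (b := 2 * Real.pi)
      (f := fun θ : ℝ => fderiv ℝ (fderiv ℝ P) (t + θ * Complex.I) 1 1)
      (g := fun θ : ℝ => fderiv ℝ (fderiv ℝ P) (t + θ * Complex.I) Complex.I Complex.I)
      (Continuous.intervalIntegrable (by fun_prop) _ _)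
      (Continuous.intervalIntegrable (by fun_prop) _ _)
    rw [hzero t, add_zero] at hadd
    rw [← hadd]
    refine intervalIntegral.integral_nonneg (by positivity) fun θ _ => ?_
    have := hlevP (t + θ * Complex.I) (by simpa using ht0)
    simpa [levi] using this
  obtain ⟨B, hB⟩ := ((isCompact_closedBall (0 : ℂ) 1).image hG.continuous).isBounded.exists_norm_le
  have hpi : (0 : ℝ) < 2 * Real.pi := by positivity
  have hle (t : ℝ) (ht : t < 0) : m t ≤ m 0 := by
    refine le_of_convex_bddAbove (B := 2 * Real.pi * B) ht ?_ ?_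
    · intro r hr
      have hr0 : 0 < 0 - r := by linarith
      have := hconv.2 (show r ∈ Set.Iic 0 by simp; linarith) (show (0 : ℝ) ∈ Set.Iic 0 by simp)
        (show 0 ≤ (0 - t) / (0 - r) from div_nonneg (by linarith) hr0.le)
        (show 0 ≤ (t - r) / (0 - r) from div_nonneg (by linarith) hr0.le) (by field_simp; ring)
      simp only [smul_eq_mul, mul_zero, add_zero] at this
      rw [show (0 - t) / (0 - r) * r = t by field_simp; ring] at this
      have h2 := mul_le_mul_of_nonneg_left this hr0.le
      calc (0 - r) * m t ≤ _ := h2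
        _ = _ := by field_simp
    · intro r hr
      have : m r ≤ ∫ θ in (0)..(2 * Real.pi), B := by
        refine intervalIntegral.integral_mono_on hpi.le (Continuous.intervalIntegrable
          (by have := hPs.continuous; fun_prop) _ _) intervalIntegrable_const fun θ _ => ?_
        refine (le_abs_self _).trans (hB _ ⟨_, ?_, rfl⟩)
        simp [Complex.norm_exp]; linarith
      simpa using this
  have h0 : m 0 = ∫ θ in (0)..(2 * Real.pi), G (expI θ) := by
    simp [hm, hP, expI]
  rw [← h0]
  refine le_of_forall_pos_le_add fun ε hε => ?_
  have hε' : 0 < ε / (2 * Real.pi) := by positivity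
  obtain ⟨δ, hδ, hGδ⟩ := Metric.continuousAt_iff.1 hG.continuous.continuousAt _ hε'
  -- Negativity of `t` allows the use of `hle`, and `e^t ≤ δ / 2` puts the whole circle where `G` is
  -- close to `G 0`.
  set t := min (-1) (Real.log (δ / 2)) with ht
  have h1 : 2 * Real.pi * (G 0 - ε / (2 * Real.pi)) ≤ m t := by
    have : ∫ θ in (0)..(2 * Real.pi), (G 0 - ε / (2 * Real.pi)) ≤ m t := by
      refine intervalIntegral.integral_mono_on hpi.le intervalIntegrable_const
        (Continuous.intervalIntegrable (by have := hPs.continuous; fun_prop) _ _) fun θ _ => ?_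
      have hd : dist (Complex.exp (t + θ * Complex.I)) 0 < δ := by
        rw [dist_zero_right, Complex.norm_exp]
        simp only [Complex.add_re, Complex.ofReal_re, Complex.mul_re, Complex.I_re, mul_zero,
          Complex.ofReal_im, Complex.I_im, mul_one, sub_self, add_zero]
        calc Real.exp t ≤ Real.exp (Real.log (δ / 2)) := Real.exp_le_exp.2 (min_le_right _ _)
          _ = δ / 2 := Real.exp_log (by linarith)
          _ < δ := by linarith
      have := hGδ hd
      rw [Real.dist_eq, abs_lt] at this
      simp only [hP, Function.comp]
      linarith
    rwa [intervalIntegral.integral_const, sub_zero, smul_eq_mul] at this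
  have h2 := hle t (lt_of_le_of_lt (min_le_left _ _) (by norm_num))
  have h3 : 2 * Real.pi * (G 0 - ε / (2 * Real.pi)) = 2 * Real.pi * G 0 - ε := by field_simp
  linarith

/-! ### Regularization of plurisubharmonic functions -/

lemma integral_angle (g : ℝ → ℝ) :
    ∫ θ, g θ ∂angleMeasure = (2 * Real.pi)⁻¹ * ∫ θ in (0)..(2 * Real.pi), g θ := by
  have h : (0 : ℝ) ≤ 2 * Real.pi := by positivity
  rw [angleMeasure, integral_smul_measure, intervalIntegral.integral_of_le h,
    ENNReal.toReal_inv, ENNReal.toReal_ofReal h, smul_eq_mul]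

section Levi

variable {E : Type*} [NormedAddCommGroup E] [NormedSpace ℂ E]

lemma levi_smul (w : E → ℝ) (x b : E) (ρ : ℝ) : levi w x ((ρ : ℂ) • b) = ρ ^ 2 * levi w x b := by
  have h1 : ((ρ : ℂ) • b) = ρ • b := Complex.coe_smul ρ b
  have h2 : Complex.I • (ρ • b) = ρ • (Complex.I • b) := smul_comm _ _ _
  simp only [levi, h1, h2, map_smul, smul_apply, smul_eq_mul]
  ring

lemma continuous_levi {w : E → ℝ} (hw : ContDiff ℝ ∞ w) (b : E) :
    Continuous fun x => levi w x b := by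
  have h1 : ContDiff ℝ ∞ (fderiv ℝ w) := hw.fderiv_right (by simp)
  have h2 := h1.continuous_fderiv (by simp)
  unfold levi
  fun_prop

lemma fderiv_fderiv_add {v w : E → ℝ} {x : E} (hv : ContDiffAt ℝ 2 v x)
    (hw : ContDiffAt ℝ 2 w x) (b c : E) :
    fderiv ℝ (fderiv ℝ (fun y => v y + w y)) x b c
      = fderiv ℝ (fderiv ℝ v) x b c + fderiv ℝ (fderiv ℝ w) x b c := by
  have e : fderiv ℝ (fun y => v y + w y) =ᶠ[𝓝 x] fun y => fderiv ℝ v y + fderiv ℝ w y := by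
    filter_upwards [hv.eventually (by simp), hw.eventually (by simp)] with y h1 h2
    exact fderiv_fun_add (h1.differentiableAt (by norm_num)) (h2.differentiableAt (by norm_num))
  rw [e.fderiv_eq, fderiv_fun_add
    ((hv.fderiv_right (m := 1) (by norm_num)).differentiableAt (by norm_num))
    ((hw.fderiv_right (m := 1) (by norm_num)).differentiableAt (by norm_num))]
  rfl

lemma levi_add {v w : E → ℝ} {x : E} (hv : ContDiffAt ℝ 2 v x) (hw : ContDiffAt ℝ 2 w x) (b : E) :
    levi (fun y => v y + w y) x b = levi v x b + levi w x b := by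
  simp only [levi, fderiv_fderiv_add hv hw]; ring

lemma fderiv_fderiv_const_mul {v : E → ℝ} {x : E} (c : ℝ) (a b : E) :
    fderiv ℝ (fderiv ℝ (fun y => c * v y)) x a b = c * fderiv ℝ (fderiv ℝ v) x a b := by
  have e : fderiv ℝ (fun y => c * v y) = fun y => c • fderiv ℝ v y := by
    ext1 y
    exact congrFun (fderiv_const_smul_field (𝕜 := ℝ) (f := v) c) y
  have e2 : fderiv ℝ (fun y => c • fderiv ℝ v y) x = c • fderiv ℝ (fderiv ℝ v) x :=
    congrFun (fderiv_const_smul_field (𝕜 := ℝ) (f := fderiv ℝ v) c) x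
  rw [e, e2]
  rfl

lemma levi_const_mul {v : E → ℝ} {x : E} (c : ℝ) (b : E) :
    levi (fun y => c * v y) x b = c * levi v x b := by
  simp only [levi, fderiv_fderiv_const_mul]; ring

end Levi

lemma contDiff_normSq : ContDiff ℝ ∞ fun z : ℂ => ‖z‖ ^ 2 := contDiff_norm_sq ℝ

lemma levi_normSq (z : ℂ) : levi (fun z : ℂ => ‖z‖ ^ 2) z 1 = 4 := by
  have e : (fun z : ℂ => ‖z‖ ^ 2) = fun z => z.re * z.re + z.im * z.im := by
    ext z; rw [← Complex.normSq_eq_norm_sq, Complex.normSq_apply]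
  have h1 : fderiv ℝ (fun z : ℂ => ‖z‖ ^ 2)
      = fun z => (2 : ℝ) • ((Complex.reCLM.smulRight Complex.reCLM
        + Complex.imCLM.smulRight Complex.imCLM : ℂ →L[ℝ] ℂ →L[ℝ] ℝ) z) := by
    ext1 z
    rw [e]
    have hr := Complex.reCLM.hasFDerivAt (x := z)
    have hi := Complex.imCLM.hasFDerivAt (x := z)
    refine ((hr.mul hr).add (hi.mul hi)).fderiv.trans ?_
    ext <;> (simp; ring)
  rw [levi, h1]
  rw [show (fun z => (2 : ℝ) • ((Complex.reCLM.smulRight Complex.reCLM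
        + Complex.imCLM.smulRight Complex.imCLM : ℂ →L[ℝ] ℂ →L[ℝ] ℝ) z))
      = ⇑((2 : ℝ) • (Complex.reCLM.smulRight Complex.reCLM
        + Complex.imCLM.smulRight Complex.imCLM : ℂ →L[ℝ] ℂ →L[ℝ] ℝ)) from rfl,
    ContinuousLinearMap.fderiv]
  simp
  norm_num

/-- Smooth functions satisfying the sub-mean value inequality have nonnegative Levi form. -/
lemma levi_nonneg_of_subMean {n : ℕ} {w : (Fin n → ℂ) → ℝ} (hw : ContDiff ℝ ∞ w)
    {x b : Fin n → ℂ} (h : ∀ᶠ ρ : ℝ in 𝓝[>] 0,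
      w x ≤ ∫ θ, w (x + (ρ * expI θ) • b) ∂angleMeasure) : 0 ≤ levi w x b := by
  by_contra hneg
  push Not at hneg
  set c := -levi w x b / 2 with hc
  have hc0 : 0 < c := by rw [hc]; linarith
  have hev : ∀ᶠ y in 𝓝 x, levi w y b < -c :=
    (continuous_levi hw b).continuousAt.eventually_lt_const (by rw [hc]; linarith)
  obtain ⟨δ, hδ, hball⟩ := Metric.eventually_nhds_iff.1 hev
  have hρ : ∀ᶠ ρ : ℝ in 𝓝[>] 0, ρ * ‖b‖ < δ := by
    have : Tendsto (fun ρ : ℝ => ρ * ‖b‖) (𝓝[>] 0) (𝓝 (0 * ‖b‖)) :=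
      (tendsto_id.mul_const _).mono_left nhdsWithin_le_nhds
    rw [zero_mul] at this
    exact this.eventually_lt_const hδ
  obtain ⟨ρ, ⟨hρm, hρδ⟩, hρ0⟩ := ((h.and hρ).and self_mem_nhdsWithin).exists
  have hρ0 : 0 < ρ := hρ0
  let γ : ℂ → Fin n → ℂ := fun ζ => x + ζ • ((ρ : ℂ) • b)
  have hγ : Differentiable ℂ γ := by fun_prop
  have hγ' (ζ : ℂ) : deriv γ ζ = (ρ : ℂ) • b := by
    have : HasDerivAt γ ((ρ : ℂ) • b) ζ := by
      have := ((hasDerivAt_id ζ).smul_const ((ρ : ℂ) • b)).const_add x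
      rwa [one_smul] at this
    exact this.deriv
  have hγs : ContDiff ℝ ∞ γ := by
    have : ContDiff ℂ ∞ γ := by fun_prop
    exact this.restrict_scalars ℝ
  have hwg : ContDiff ℝ ∞ (w ∘ γ) := hw.comp hγs
  -- On the small disc `-w ∘ γ` has Laplacian above `ρ² c`, and the quadratic correction has
  -- Laplacian `-ρ² c`, so `G` is still subharmonic. Its mean value inequality says that `w x`
  -- exceeds the mean of `w` by at least `ρ² c / 4`, contradicting the hypothesis.
  let G : ℂ → ℝ := fun ζ => (-1) * (w ∘ γ) ζ + (-(ρ ^ 2 * c / 4)) * ‖ζ‖ ^ 2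
  have hG : ContDiff ℝ ∞ G := (contDiff_const.mul hwg).add (contDiff_const.mul contDiff_normSq)
  have hlev (z : ℂ) (hz : ‖z‖ ≤ 1) : 0 ≤ levi G z 1 := by
    have h2 : ContDiffAt ℝ 2 (fun ζ => (-1) * (w ∘ γ) ζ) z :=
      ((contDiff_const.mul hwg).of_le two_le_infty).contDiffAt
    have h3 : ContDiffAt ℝ 2 (fun ζ : ℂ => (-(ρ ^ 2 * c / 4)) * ‖ζ‖ ^ 2) z :=
      ((contDiff_const.mul contDiff_normSq).of_le two_le_infty).contDiffAt
    rw [levi_add h2 h3, levi_const_mul, levi_const_mul, levi_normSq,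
      levi_comp_holomorphic hγ (hw.of_le two_le_infty).contDiffAt, hγ', levi_smul]
    have hlt : levi w (γ z) b < -c := by
      refine hball ?_
      have : dist (γ z) x = ‖z‖ * (ρ * ‖b‖) := by
        simp [γ, dist_eq_norm, norm_smul, abs_of_pos hρ0]
      rw [this]
      calc ‖z‖ * (ρ * ‖b‖) ≤ 1 * (ρ * ‖b‖) := by gcongr
        _ < δ := by linarith
    have hρ2 : 0 < ρ ^ 2 := by positivity
    nlinarith
  have hmain := le_integral_circle_of_levi_nonneg hG hlev
  rw [integral_angle] at hρm
  have hpi : (0 : ℝ) < 2 * Real.pi := by positivity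
  have e1 : ∫ θ in (0)..(2 * Real.pi), G (expI θ)
      = -(∫ θ in (0)..(2 * Real.pi), w (x + (ρ * expI θ) • b))
        - 2 * Real.pi * (ρ ^ 2 * c / 4) := by
    have e2 (θ : ℝ) : G (expI θ) = -w (x + (ρ * expI θ) • b) - ρ ^ 2 * c / 4 := by
      simp only [G, γ, Function.comp, smul_smul, norm_expI, mul_comm (expI θ)]; ring
    simp only [e2]
    have hcont : Continuous fun θ : ℝ => -w (x + (ρ * expI θ) • b) := by
      have := hw.continuous; have := continuous_expI; fun_prop
    rw [intervalIntegral.integral_sub (hcont.intervalIntegrable _ _)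
      (intervalIntegrable_const), intervalIntegral.integral_neg]
    rw [intervalIntegral.integral_const, sub_zero, smul_eq_mul]
  have e0 : G 0 = -w x := by simp [G, γ]
  rw [e1, e0] at hmain
  have h3 : 2 * Real.pi * w x ≤ ∫ θ in (0)..(2 * Real.pi), w (x + (ρ * expI θ) • b) := by
    have := mul_le_mul_of_nonneg_left hρm hpi.le
    rwa [← mul_assoc, mul_inv_cancel₀ hpi.ne', one_mul] at this
  have : 0 < 2 * Real.pi * (ρ ^ 2 * c / 4) := by positivity
  linarith

/-- A smooth bump function on `ℂⁿ` depending only on the Euclidean norm. -/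
def kernel (n : ℕ) (ε : ℝ) (y : Fin n → ℂ) : ℝ :=
  Real.smoothTransition (1 - ∑ k, ‖y k‖ ^ 2 / ε ^ 2)

lemma contDiff_kernel (n : ℕ) (ε : ℝ) : ContDiff ℝ ∞ (kernel n ε) := by
  refine Real.smoothTransition.contDiff.comp (contDiff_const.sub (ContDiff.sum fun k _ => ?_))
  exact (contDiff_normSq.comp (contDiff_apply ℝ ℂ k)).div_const _

lemma kernel_nonneg (n : ℕ) (ε : ℝ) (y : Fin n → ℂ) : 0 ≤ kernel n ε y :=
  Real.smoothTransition.nonneg _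

lemma kernel_ne_zero {n : ℕ} {ε : ℝ} (hε : 0 < ε) {y : Fin n → ℂ} (h : kernel n ε y ≠ 0) :
    ‖y‖ < ε := by
  rw [pi_norm_lt_iff hε]
  intro k
  by_contra hk
  refine h (Real.smoothTransition.zero_of_nonpos ?_)
  push Not at hk
  have h1 : 1 ≤ ‖y k‖ ^ 2 / ε ^ 2 := by
    rw [le_div_iff₀ (by positivity), one_mul]; gcongr
  have h2 := Finset.single_le_sum (f := fun k => ‖y k‖ ^ 2 / ε ^ 2) (fun k _ => by positivity)
    (Finset.mem_univ k)
  linarith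

lemma kernel_smul {n : ℕ} {ε : ℝ} {c : ℂ} (hc : ‖c‖ = 1) (y : Fin n → ℂ) :
    kernel n ε (c • y) = kernel n ε y := by simp [kernel, hc]

lemma hasCompactSupport_kernel {n : ℕ} {ε : ℝ} (hε : 0 < ε) : HasCompactSupport (kernel n ε) := by
  refine HasCompactSupport.of_support_subset_isCompact (isCompact_closedBall 0 ε) fun y hy => ?_
  simpa using (kernel_ne_zero hε hy).le

lemma integral_kernel_pos {n : ℕ} {ε : ℝ} (hε : 0 < ε) : 0 < ∫ y, kernel n ε y := by
  refine Continuous.integral_pos_of_hasCompactSupport_nonneg_nonzero (x := 0)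
    (contDiff_kernel n ε).continuous (hasCompactSupport_kernel hε) (kernel_nonneg n ε) ?_
  simp [kernel]

/-- The normalized kernel. -/
def nkernel (n : ℕ) (ε : ℝ) (y : Fin n → ℂ) : ℝ := (∫ y, kernel n ε y)⁻¹ * kernel n ε y

lemma contDiff_nkernel (n : ℕ) (ε : ℝ) : ContDiff ℝ ∞ (nkernel n ε) :=
  contDiff_const.mul (contDiff_kernel n ε)

lemma hasCompactSupport_nkernel {n : ℕ} {ε : ℝ} (hε : 0 < ε) :
    HasCompactSupport (nkernel n ε) := (hasCompactSupport_kernel hε).mul_left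

lemma nkernel_nonneg {n : ℕ} {ε : ℝ} (hε : 0 < ε) (y : Fin n → ℂ) : 0 ≤ nkernel n ε y :=
  mul_nonneg (inv_nonneg.2 (integral_kernel_pos hε).le) (kernel_nonneg _ _ _)

lemma nkernel_ne_zero {n : ℕ} {ε : ℝ} (hε : 0 < ε) {y : Fin n → ℂ} (h : nkernel n ε y ≠ 0) :
    ‖y‖ < ε := kernel_ne_zero hε (right_ne_zero_of_mul h)

lemma nkernel_smul {n : ℕ} {ε : ℝ} {c : ℂ} (hc : ‖c‖ = 1) (y : Fin n → ℂ) :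
    nkernel n ε (c • y) = nkernel n ε y := by rw [nkernel, nkernel, kernel_smul hc]

lemma lintegral_nkernel {n : ℕ} {ε : ℝ} (hε : 0 < ε) :
    ∫⁻ y, ENNReal.ofReal (nkernel n ε y) = 1 := by
  rw [← ofReal_integral_eq_lintegral_ofReal
    ((contDiff_nkernel n ε).continuous.integrable_of_hasCompactSupport
      (hasCompactSupport_nkernel hε)) (Eventually.of_forall (nkernel_nonneg hε))]
  simp [nkernel, integral_const_mul, inv_mul_cancel₀ (integral_kernel_pos (n := n) hε).ne']

/-- The mean of `q` against the normalized kernel. -/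
def smear {n : ℕ} (q : (Fin n → ℂ) → ENNReal) (ε : ℝ) (x : Fin n → ℂ) : ENNReal :=
  ∫⁻ y, q (x + y) * ENNReal.ofReal (nkernel n ε y)

section Smear

variable {n : ℕ} {q : (Fin n → ℂ) → ENNReal}

lemma SuperMean.smear_le (hq : SuperMean q) (hqm : Measurable q) {ε : ℝ} (hε : 0 < ε)
    {x : Fin n → ℂ} (hx : ‖x‖ + ε ≤ 1) : smear q ε x ≤ q x := by
  have h := hq.lintegral_mul_le hqm (ψ := fun y => ENNReal.ofReal (nkernel n ε y))
    (by have := (contDiff_nkernel n ε).continuous; fun_prop) (x := x)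
    (fun c y hc => by rw [nkernel_smul hc]) (fun y hy ζ hζ => by
      have hy' : ‖y‖ < ε := nkernel_ne_zero hε fun h => hy (by simp [h])
      rw [polydisk_eq_ball, mem_ball_zero_iff]
      calc ‖x + ζ • y‖ ≤ ‖x‖ + ‖ζ‖ * ‖y‖ := (norm_add_le _ _).trans (by rw [norm_smul])
        _ ≤ ‖x‖ + 1 * ‖y‖ := by gcongr
        _ < 1 := by linarith)
  rwa [lintegral_nkernel hε, mul_one] at h

/-- Every translate of `q` satisfies the disc inequality wherever the translated disc stays in the
polydisk, and `smear` is an average of translates; the room `ε` covers the support of the kernel. -/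
lemma SuperMean.smear_mean_le (hq : SuperMean q) (hqm : Measurable q) {ε : ℝ} (hε : 0 < ε)
    {x b : Fin n → ℂ} (hx : ‖x‖ + ‖b‖ + ε ≤ 1) :
    ∫⁻ θ, smear q ε (x + expI θ • b) ∂angleMeasure ≤ smear q ε x := by
  have hk := (contDiff_nkernel n ε).continuous.measurable
  have he := measurable_expI
  unfold smear
  rw [lintegral_lintegral_swap (by fun_prop)]
  refine lintegral_mono fun y => ?_
  rw [lintegral_mul_const _ (by fun_prop)]
  by_cases hy : nkernel n ε y = 0
  · simp [hy]
  refine mul_le_mul_left ?_ _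
  have hy' := nkernel_ne_zero hε hy
  have := hq.mean_le (x + y) b fun ζ hζ => by
    rw [polydisk_eq_ball, mem_ball_zero_iff]
    calc ‖x + y + ζ • b‖ ≤ ‖x‖ + ‖y‖ + ‖ζ‖ * ‖b‖ := by
          rw [← norm_smul]; exact (norm_add_le _ _).trans (by gcongr; exact norm_add_le _ _)
      _ ≤ ‖x‖ + ‖y‖ + 1 * ‖b‖ := by gcongr
      _ < 1 := by linarith
  simpa only [add_right_comm] using this

/-- Lower semicontinuity bounds the averages from below in the limit; the super-mean inequality
bounds each of them from above by `q x`. -/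
lemma SuperMean.tendsto_smear (hq : SuperMean q) (hqm : Measurable q) {x : Fin n → ℂ}
    (hx : x ∈ polydisk n) : Tendsto (fun ε => smear q ε x) (𝓝[>] 0) (𝓝 (q x)) := by
  have hx1 : ‖x‖ < 1 := by simpa [polydisk_eq_ball] using hx
  refine tendsto_order.2 ⟨fun c hc => ?_, fun c hc => ?_⟩
  · obtain ⟨c', hcc', hc'⟩ := exists_between hc
    have h := hq.lsc x hx c' hc'
    rw [(isOpen_polydisk n).nhdsWithin_eq hx] at h
    obtain ⟨δ, hδ, hball⟩ := Metric.eventually_nhds_iff.1 h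
    have hev : ∀ᶠ ε : ℝ in 𝓝[>] 0, ε < δ := nhdsWithin_le_nhds (Iio_mem_nhds hδ)
    filter_upwards [hev, self_mem_nhdsWithin] with ε hεδ (hε0 : 0 < ε)
    refine hcc'.trans_le ?_
    calc c' = ∫⁻ y : Fin n → ℂ, c' * ENNReal.ofReal (nkernel n ε y) := by
          have hk := (contDiff_nkernel n ε).continuous.measurable
          rw [lintegral_const_mul _ (by fun_prop), lintegral_nkernel hε0, mul_one]
      _ ≤ smear q ε x := by
          refine lintegral_mono fun y => ?_
          by_cases hy : nkernel n ε y = 0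
          · simp [hy]
          refine mul_le_mul_left ?_ _
          exact (hball (by simpa using (nkernel_ne_zero hε0 hy).trans hεδ)).le
  · have hev : ∀ᶠ ε : ℝ in 𝓝[>] 0, ε < 1 - ‖x‖ :=
      nhdsWithin_le_nhds (Iio_mem_nhds (by linarith))
    filter_upwards [hev, self_mem_nhdsWithin] with ε hε (hε0 : 0 < ε)
    exact (hq.smear_le hqm hε0 (by linarith)).trans_lt hc

/-- The smooth function representing `smear q ε` on the ball of radius `R - ε`. -/
def smoothSmear (q : (Fin n → ℂ) → ENNReal) (R ε : ℝ) : (Fin n → ℂ) → ℝ :=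
  convolution (nkernel n ε) ((Metric.closedBall 0 R).indicator fun x => (q x).toReal)
    (ContinuousLinearMap.lsmul ℝ ℝ) volume

lemma integrable_indicator_toReal (hqm : Measurable q) {R : ℝ}
    (hR : ∫⁻ x in Metric.closedBall 0 R, q x < ⊤) :
    Integrable ((Metric.closedBall (0 : Fin n → ℂ) R).indicator fun x => (q x).toReal) :=
  (integrable_indicator_iff Metric.isClosed_closedBall.measurableSet).2
    (integrable_toReal_of_lintegral_ne_top hqm.aemeasurable hR.ne)

lemma contDiff_smoothSmear (hqm : Measurable q) {R ε : ℝ} (hε : 0 < ε)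
    (hR : ∫⁻ x in Metric.closedBall 0 R, q x < ⊤) : ContDiff ℝ ∞ (smoothSmear q R ε) :=
  (hasCompactSupport_nkernel hε).contDiff_convolution_left _ (contDiff_nkernel n ε)
    (integrable_indicator_toReal hqm hR).locallyIntegrable

lemma smoothSmear_nonneg {R ε : ℝ} (hε : 0 < ε) (x : Fin n → ℂ) : 0 ≤ smoothSmear q R ε x := by
  refine integral_nonneg fun y => ?_
  simp only [ContinuousLinearMap.lsmul_apply, smul_eq_mul]
  exact mul_nonneg (nkernel_nonneg hε y) (Set.indicator_nonneg (fun _ _ => ENNReal.toReal_nonneg) _)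

/-- Truncating `q` to the closed ball makes it integrable on the whole space, so the convolution is
smooth. At distance at least `ε` from the boundary of that ball the kernel does not see the
truncation. -/
lemma ofReal_smoothSmear (hqm : Measurable q) {R ε : ℝ} (hε : 0 < ε)
    (hR : ∫⁻ x in Metric.closedBall 0 R, q x < ⊤) {x : Fin n → ℂ} (hx : ‖x‖ + ε ≤ R) :
    ENNReal.ofReal (smoothSmear q R ε x) = smear q ε x := by
  have hInt := integrable_indicator_toReal hqm hR
  have hk := (contDiff_nkernel n ε).continuous
  have hex : ConvolutionExistsAt (nkernel n ε)
      ((Metric.closedBall 0 R).indicator fun x => (q x).toReal) x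
      (ContinuousLinearMap.lsmul ℝ ℝ) volume :=
    (hasCompactSupport_nkernel hε).convolutionExists_left _ hk hInt.locallyIntegrable x
  have hint2 : Integrable fun t => nkernel n ε t *
      (Metric.closedBall 0 R).indicator (fun x => (q x).toReal) (x - t) := hex
  have e : smoothSmear q R ε x = ∫ t, nkernel n ε t *
      (Metric.closedBall 0 R).indicator (fun x => (q x).toReal) (x - t) := by
    simp [smoothSmear, convolution_def]
  rw [e, ofReal_integral_eq_lintegral_ofReal hint2 (Eventually.of_forall fun t =>
    mul_nonneg (nkernel_nonneg hε t) (Set.indicator_nonneg (fun _ _ => ENNReal.toReal_nonneg) _))]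
  rw [← lintegral_neg_eq_self, smear]
  have hae : ∀ᵐ y : Fin n → ℂ, x + y ∈ Metric.closedBall 0 R → q (x + y) < ⊤ := by
    have h1 : ∀ᵐ y : Fin n → ℂ, y ∈ Metric.closedBall 0 R → q y < ⊤ := by
      rw [← ae_restrict_iff' Metric.isClosed_closedBall.measurableSet]
      exact ae_lt_top hqm hR.ne
    exact (measurePreserving_add_left volume x).quasiMeasurePreserving.ae h1
  refine lintegral_congr_ae ?_
  filter_upwards [hae] with y hy
  have hneg : nkernel n ε (-y) = nkernel n ε y := by
    have := nkernel_smul (n := n) (ε := ε) (c := -1) (by simp) y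
    simpa using this
  rw [hneg, sub_neg_eq_add]
  by_cases h0 : nkernel n ε y = 0
  · simp [h0]
  have hmem : x + y ∈ Metric.closedBall 0 R := by
    rw [mem_closedBall_zero_iff]
    exact (norm_add_le _ _).trans (by linarith [nkernel_ne_zero hε h0])
  rw [Set.indicator_of_mem hmem, ENNReal.ofReal_mul (nkernel_nonneg hε y),
    ENNReal.ofReal_toReal (hy hmem).ne, mul_comm]

lemma SuperMean.levi_smoothSmear (hq : SuperMean q) (hqm : Measurable q) {R ε : ℝ} (hε : 0 < ε)
    (hR1 : R ≤ 1) (hR : ∫⁻ x in Metric.closedBall 0 R, q x < ⊤) {x : Fin n → ℂ}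
    (hx : ‖x‖ + ε < R) (b : Fin n → ℂ) :
    0 ≤ levi (fun x => (-1) * smoothSmear q R ε x) x b := by
  have hs := contDiff_smoothSmear hqm hε hR
  refine levi_nonneg_of_subMean (contDiff_const.mul hs) ?_
  have hρ : ∀ᶠ ρ : ℝ in 𝓝[>] 0, ρ * ‖b‖ < R - ‖x‖ - ε := by
    have : Tendsto (fun ρ : ℝ => ρ * ‖b‖) (𝓝[>] 0) (𝓝 (0 * ‖b‖)) :=
      (tendsto_id.mul_const _).mono_left nhdsWithin_le_nhds
    rw [zero_mul] at this
    exact this.eventually_lt_const (by linarith)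
  filter_upwards [hρ, self_mem_nhdsWithin] with ρ hρ (hρ0 : 0 < ρ)
  have hnb : ‖(ρ : ℂ) • b‖ = ρ * ‖b‖ := by simp [norm_smul, abs_of_pos hρ0]
  have h1 := hq.smear_mean_le hqm hε (x := x) (b := (ρ : ℂ) • b) (by rw [hnb]; linarith)
  have h2 (θ : ℝ) : smear q ε (x + expI θ • ((ρ : ℂ) • b))
      = ENNReal.ofReal (smoothSmear q R ε (x + (ρ * expI θ) • b)) := by
    rw [smul_smul, mul_comm, ofReal_smoothSmear hqm hε hR]
    have : ‖((ρ : ℂ) * expI θ) • b‖ = ρ * ‖b‖ := by simp [norm_smul, abs_of_pos hρ0]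
    linarith [norm_add_le x (((ρ : ℂ) * expI θ) • b)]
  have hcont : Continuous fun θ : ℝ => smoothSmear q R ε (x + (ρ * expI θ) • b) := by
    have := hs.continuous; have := continuous_expI; fun_prop
  have hInt : Integrable (fun θ : ℝ => smoothSmear q R ε (x + (ρ * expI θ) • b))
      angleMeasure := by
    refine Integrable.smul_measure ?_ (by simp [Real.pi_pos])
    exact (hcont.integrableOn_Icc (a := 0) (b := 2 * Real.pi)).mono_set Set.Ioc_subset_Icc_self
  simp only [h2] at h1
  rw [← ofReal_integral_eq_lintegral_ofReal hInt
    (Eventually.of_forall fun θ => smoothSmear_nonneg hε _),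
    ← ofReal_smoothSmear hqm hε hR hx.le, ENNReal.ofReal_le_ofReal_iff
      (smoothSmear_nonneg hε _)] at h1
  rw [integral_const_mul]
  linarith

end Smear

/-- Regularization of negative plurisubharmonic functions. -/
theorem NegPSH.exists_smooth_approx {n : ℕ} {f : (Fin n → ℂ) → EReal} (hf : NegPSH f) :
    ∃ F : ℕ → (Fin n → ℂ) → ℝ, (∀ j, ContDiff ℝ ∞ (F j)) ∧
      (∀ j x, F j x ≤ 0) ∧
      (∀ r < 1, ∀ᶠ j in atTop, ∀ x, ‖x‖ ≤ r →
        ENNReal.ofReal (-F j x) ≤ pot f x ∧ ∀ b, 0 ≤ levi (F j) x b) ∧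
      ∀ x ∈ polydisk n, Tendsto (fun j => ENNReal.ofReal (-F j x)) atTop (𝓝 (pot f x)) := by
  have hq := hf.superMean
  have hqm := hf.measurable_pot
  -- Truncation at radius `1 - ε j` keeps the domain of integration compact in the polydisk. No
  -- monotonicity in `j` is claimed: the bound of `-F j` by `pot f` suffices for Fatou and for
  -- dominated convergence.
  let ε : ℕ → ℝ := fun j => 1 / ((j : ℝ) + 1)
  let R : ℕ → ℝ := fun j => 1 - ε j
  have hε (j : ℕ) : 0 < ε j := Nat.one_div_pos_of_nat
  have hεlim : Tendsto ε atTop (𝓝 0) := tendsto_one_div_add_atTop_nhds_zero_nat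
  have hR (j : ℕ) : ∫⁻ x in Metric.closedBall 0 (R j), pot f x < ⊤ := by
    refine hf.lintegral_pot_lt_top (isCompact_closedBall _ _) ?_
    rw [polydisk_eq_ball]
    exact Metric.closedBall_subset_ball (by simp only [R]; linarith [hε j])
  have hev (r : ℝ) (hr : r < 1) : ∀ᶠ j in atTop, r + ε j < R j := by
    have : ∀ᶠ j in atTop, ε j < (1 - r) / 2 := hεlim.eventually_lt_const (by linarith)
    filter_upwards [this] with j hj
    simp only [R]; linarith
  refine ⟨fun j x => (-1) * smoothSmear (pot f) (R j) (ε j) x, fun j =>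
    contDiff_const.mul (contDiff_smoothSmear hqm (hε j) (hR j)), fun j x => ?_, ?_, ?_⟩
  · linarith [smoothSmear_nonneg (q := pot f) (R := R j) (hε j) x]
  · intro r hr
    filter_upwards [hev r hr] with j hj x hx
    refine ⟨?_, fun b => hq.levi_smoothSmear hqm (hε j) ?_ (hR j) (by linarith) b⟩
    · rw [neg_one_mul, neg_neg, ofReal_smoothSmear hqm (hε j) (hR j) (by linarith)]
      exact hq.smear_le hqm (hε j) (by simp only [R] at hj; linarith [hε j])
    · simp only [R]; linarith [hε j]
  · intro x hx
    have hx1 : ‖x‖ < 1 := by simpa [polydisk_eq_ball] using hx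
    have h1 : Tendsto (fun j => smear (pot f) (ε j) x) atTop (𝓝 (pot f x)) :=
      (hq.tendsto_smear hqm hx).comp
        (tendsto_nhdsWithin_iff.2 ⟨hεlim, Eventually.of_forall hε⟩)
    refine h1.congr' ?_
    filter_upwards [hev _ hx1] with j hj
    rw [neg_one_mul, neg_neg, ofReal_smoothSmear hqm (hε j) (hR j) hj.le]

/-! ### Holomorphic discs, the minimum principle, and torus means -/

lemma integrable_angle_of_continuous {g : ℝ → ℝ} (hg : Continuous g) :
    Integrable g angleMeasure := by
  refine Integrable.smul_measure ?_ (by simp [Real.pi_pos])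
  exact (hg.integrableOn_Icc (a := 0) (b := 2 * Real.pi)).mono_set Set.Ioc_subset_Icc_self

/-- Super-mean value inequality on holomorphic discs. -/
lemma NegPSH.mean_le_holomorphic {n : ℕ} {f : (Fin n → ℂ) → EReal} (hf : NegPSH f)
    {γ : ℂ → Fin n → ℂ} (hγ : Differentiable ℂ γ) (h : ∀ ζ : ℂ, ‖ζ‖ ≤ 1 → γ ζ ∈ polydisk n) :
    ∫⁻ θ, pot f (γ (expI θ)) ∂angleMeasure ≤ pot f (γ 0) := by
  -- For the smooth approximants the inequality is subharmonicity of `F j ∘ γ`. Its right-hand side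
  -- is at most `pot f (γ 0)` uniformly in `j`, so Fatou's lemma passes to the limit.
  obtain ⟨F, hFs, hF0, hFr, hFt⟩ := hf.exists_smooth_approx
  have hcomp : IsCompact (γ '' Metric.closedBall 0 1) :=
    (isCompact_closedBall 0 1).image hγ.continuous
  obtain ⟨r, hr1, hr⟩ : ∃ r < 1, ∀ ζ : ℂ, ‖ζ‖ ≤ 1 → ‖γ ζ‖ ≤ r := by
    obtain ⟨ζ₀, hζ₀, hmax⟩ := (isCompact_closedBall (0 : ℂ) 1).exists_isMaxOn
      ⟨0, by simp⟩ hγ.continuous.norm.continuousOn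
    refine ⟨‖γ ζ₀‖, ?_, fun ζ hζ => hmax (by simpa using hζ)⟩
    have := h ζ₀ (by simpa using hζ₀)
    simpa [polydisk_eq_ball] using this
  have hγs : ContDiff ℝ ∞ γ := (hγ.contDiff (n := ∞)).restrict_scalars ℝ
  have hexp := continuous_expI
  have hγc := hγ.continuous
  have hle : ∀ᶠ j in atTop, ∫⁻ θ, ENNReal.ofReal (-F j (γ (expI θ))) ∂angleMeasure
      ≤ pot f (γ 0) := by
    filter_upwards [hFr r hr1] with j hj
    refine le_trans ?_ (hj (γ 0) (hr 0 (by simp))).1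
    have hG : ContDiff ℝ ∞ (F j ∘ γ) := (hFs j).comp hγs
    have h1 := le_integral_circle_of_levi_nonneg hG fun z hz => by
      rw [levi_comp_holomorphic hγ ((hFs j).of_le two_le_infty).contDiffAt]
      exact (hj (γ z) (hr z hz)).2 _
    have hcF := (hFs j).continuous
    have hcont : Continuous fun θ => -F j (γ (expI θ)) := by fun_prop
    rw [← ofReal_integral_eq_lintegral_ofReal (integrable_angle_of_continuous hcont)
      (Eventually.of_forall fun θ => by simpa using hF0 j _)]
    refine ENNReal.ofReal_le_ofReal ?_
    rw [integral_neg, integral_angle]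
    have hpi : (0 : ℝ) < 2 * Real.pi := by positivity
    have := mul_le_mul_of_nonneg_left h1 (inv_nonneg.2 hpi.le)
    rw [← mul_assoc, inv_mul_cancel₀ hpi.ne', one_mul] at this
    simpa using this
  have hlim (θ : ℝ) : pot f (γ (expI θ))
      = liminf (fun j => ENNReal.ofReal (-F j (γ (expI θ)))) atTop :=
    (hFt _ (h _ (by simp))).liminf_eq.symm
  simp only [hlim]
  refine (lintegral_liminf_le fun j => ?_).trans ?_
  · have hcF := (hFs j).continuous
    have hcont : Continuous fun θ => -F j (γ (expI θ)) := by fun_prop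
    exact hcont.measurable.ennreal_ofReal
  · refine (liminf_le_liminf hle).trans ?_
    simp

lemma ofReal_integral_le_lintegral {α : Type*} [MeasurableSpace α] {μ : Measure α} {g : α → ℝ}
    (hg : Integrable g μ) : ENNReal.ofReal (∫ x, g x ∂μ) ≤ ∫⁻ x, ENNReal.ofReal (g x) ∂μ := by
  calc ENNReal.ofReal (∫ x, g x ∂μ) ≤ ENNReal.ofReal (∫ x, max (g x) 0 ∂μ) :=
        ENNReal.ofReal_le_ofReal (integral_mono hg hg.pos_part fun x => le_max_left _ _)
    _ = ∫⁻ x, ENNReal.ofReal (max (g x) 0) ∂μ :=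
        ofReal_integral_eq_lintegral_ofReal hg.pos_part
          (Eventually.of_forall fun x => le_max_right _ _)
    _ = ∫⁻ x, ENNReal.ofReal (g x) ∂μ := by
        refine lintegral_congr fun x => ?_
        rcases le_total (g x) 0 with h | h
        · simp [h, ENNReal.ofReal_of_nonpos h]
        · simp [h]

lemma expI_re (θ : ℝ) : (expI θ).re = Real.cos θ := by
  simp [expI, Complex.exp_ofReal_mul_I_re]

lemma integral_angle_quadratic (a b c : ℝ) :
    ∫ θ, (a + b * Real.cos θ + c * Real.cos θ ^ 2) ∂angleMeasure = a + c / 2 := by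
  have hpi : (0 : ℝ) < 2 * Real.pi := by positivity
  rw [integral_angle, intervalIntegral.integral_add, intervalIntegral.integral_add,
    intervalIntegral.integral_const_mul, intervalIntegral.integral_const_mul, integral_cos,
    integral_cos_sq, intervalIntegral.integral_const]
  · simp
    field_simp
  all_goals exact Continuous.intervalIntegrable (by fun_prop) _ _

/-- Minimum principle on a vertical strip, for periodic superharmonic functions. -/
lemma strip_min_principle {G : ℂ → ENNReal} {α β c₀ c₁ : ℝ}
    (lsc : LowerSemicontinuousOn G {s | α ≤ s.re ∧ s.re ≤ β})
    (per : ∀ s, G (s + 2 * Real.pi * Complex.I) = G s)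
    (mean : ∀ (s : ℂ) (ρ : ℝ), 0 < ρ → α ≤ s.re - ρ → s.re + ρ ≤ β →
      ∫⁻ θ, G (s + ρ * expI θ) ∂angleMeasure ≤ G s)
    (hα : ∀ s : ℂ, s.re = α → ENNReal.ofReal (c₀ + c₁ * α) ≤ G s)
    (hβ : ∀ s : ℂ, s.re = β → ENNReal.ofReal (c₀ + c₁ * β) ≤ G s)
    (s : ℂ) (hs : α ≤ s.re ∧ s.re ≤ β) : ENNReal.ofReal (c₀ + c₁ * s.re) ≤ G s := by
  -- The barrier `ε (x - α)(β - x)` vanishes on both edges, and its mean over a circle of radius `ρ`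
  -- falls short of its central value by `ε ρ² / 2`. An interior minimum of `G` plus the barrier
  -- minus the affine function below `0` would then violate the mean inequality. The constant `C`
  -- keeps all functions nonnegative; the minimum exists by semicontinuity on a period box.
  have key : ∀ ε : ℝ, 0 < ε →
      ENNReal.ofReal (c₀ + c₁ * s.re - ε * ((s.re - α) * (β - s.re))) ≤ G s := by
    intro ε hε
    set C : ℝ := |c₀| + |c₁| * (|α| + |β|) with hC
    set P : ℝ → ℝ := fun x => C + ε * ((x - α) * (β - x)) - (c₀ + c₁ * x) with hP
    have hP0 : ∀ x, α ≤ x → x ≤ β → 0 ≤ P x := by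
      intro x h1 h2
      have h3 : |x| ≤ |α| + |β| := by
        rw [abs_le]; constructor <;>
          linarith [neg_abs_le α, le_abs_self β, abs_nonneg α, abs_nonneg β]
      have h4 : c₁ * x ≤ |c₁| * (|α| + |β|) :=
        (le_abs_self _).trans (by rw [abs_mul]; gcongr)
      have h5 : 0 ≤ ε * ((x - α) * (β - x)) :=
        mul_nonneg hε.le (mul_nonneg (by linarith) (by linarith))
      simp only [hP]
      linarith [le_abs_self c₀]
    have hPc : Continuous P := by fun_prop
    let K : ℂ → ENNReal := fun s => G s + ENNReal.ofReal (P s.re)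
    have hKlsc : LowerSemicontinuousOn K {s | α ≤ s.re ∧ s.re ≤ β} := by
      refine lsc.add (Continuous.lowerSemicontinuous ?_ |>.lowerSemicontinuousOn _)
      exact ENNReal.continuous_ofReal.comp (hPc.comp Complex.continuous_re)
    let box : Set ℂ := Set.Icc α β ×ℂ Set.Icc 0 (2 * Real.pi)
    have hbox : IsCompact box := isCompact_Icc.reProdIm isCompact_Icc
    have hboxs : box ⊆ {s | α ≤ s.re ∧ s.re ≤ β} := fun s hs => hs.1
    have hpi : (0 : ℝ) < 2 * Real.pi := by positivity
    have hperK (s : ℂ) (k : ℤ) : K (s + k * (2 * Real.pi * Complex.I)) = K s := by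
      have hG : ∀ (k : ℕ) (s : ℂ), G (s + k * (2 * Real.pi * Complex.I)) = G s := by
        intro k
        induction k with
        | zero => simp
        | succ k ih =>
          intro s
          rw [Nat.cast_succ, add_mul, one_mul, ← add_assoc, per, ih]
      have hG' : G (s + k * (2 * Real.pi * Complex.I)) = G s := by
        rcases Int.eq_nat_or_neg k with ⟨m, rfl | rfl⟩
        · exact_mod_cast hG m s
        · rw [← hG m (s + _)]
          congr 1; push_cast; ring
      simp only [K, hG']
      simp
    have hred (s : ℂ) (hs : α ≤ s.re ∧ s.re ≤ β) : ∃ s' ∈ box, K s' = K s := by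
      obtain ⟨k, hk, -⟩ := existsUnique_add_zsmul_mem_Ico hpi s.im 0
      refine ⟨s + k * (2 * Real.pi * Complex.I), ⟨by simpa using hs, ?_⟩, hperK s k⟩
      simp only [zero_add, zsmul_eq_mul] at hk
      have : (s + k * (2 * Real.pi * Complex.I)).im = s.im + k * (2 * Real.pi) := by simp
      rw [Set.mem_preimage, this]
      exact Set.Ico_subset_Icc_self hk
    obtain ⟨s1, hs1, -⟩ := hred s hs
    obtain ⟨s₀, hs₀, hmin⟩ := (hKlsc.mono hboxs).exists_isMinOn ⟨s1, hs1⟩ hbox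
    have hminK : ∀ s : ℂ, α ≤ s.re ∧ s.re ≤ β → K s₀ ≤ K s := by
      intro s hs
      obtain ⟨s', hs', e⟩ := hred s hs
      rw [← e]; exact hmin hs'
    have hCK : ENNReal.ofReal C ≤ K s₀ := by
      by_contra hlt
      push Not at hlt
      have hbd (x : ℝ) (hx : (x - α) * (β - x) = 0) (hG : ENNReal.ofReal (c₀ + c₁ * x) ≤ G s₀)
          (hre : s₀.re = x) : False := by
        refine absurd hlt (not_lt.2 ?_)
        calc ENNReal.ofReal C = ENNReal.ofReal ((c₀ + c₁ * x) + P x) := by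
              simp only [hP, hx]; ring_nf
          _ ≤ ENNReal.ofReal (c₀ + c₁ * x) + ENNReal.ofReal (P x) := ENNReal.ofReal_add_le
          _ ≤ K s₀ := by simp only [K, hre]; gcongr
      have h0s := hboxs hs₀
      have hα' : α < s₀.re := lt_of_le_of_ne h0s.1 fun h =>
        hbd α (by ring) (hα _ h.symm) h.symm
      have hβ' : s₀.re < β := lt_of_le_of_ne h0s.2 fun h => hbd β (by ring) (hβ _ h) h
      set ρ := min (s₀.re - α) (β - s₀.re) with hρ
      have hρ0 : 0 < ρ := lt_min (by linarith) (by linarith)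
      have hρα : ρ ≤ s₀.re - α := min_le_left _ _
      have hρβ : ρ ≤ β - s₀.re := min_le_right _ _
      have hGtop : G s₀ ≠ ⊤ := fun h => by simp [K, h] at hlt
      set g := (G s₀).toReal with hg
      have hGg : G s₀ = ENNReal.ofReal g := (ENNReal.ofReal_toReal hGtop).symm
      have hm := mean s₀ ρ hρ0 (by linarith) (by linarith)
      have hre (θ : ℝ) : (s₀ + ρ * expI θ).re = s₀.re + ρ * Real.cos θ := by
        simp [expI_re]
      have hin (θ : ℝ) : α ≤ s₀.re + ρ * Real.cos θ ∧ s₀.re + ρ * Real.cos θ ≤ β := by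
        have h1 : -ρ ≤ ρ * Real.cos θ := by nlinarith [Real.neg_one_le_cos θ]
        have h2 : ρ * Real.cos θ ≤ ρ := by nlinarith [Real.cos_le_one θ]
        constructor <;> linarith
      have hlow (θ : ℝ) : ENNReal.ofReal (g + P s₀.re - P (s₀.re + ρ * Real.cos θ))
          ≤ G (s₀ + ρ * expI θ) := by
        have h1 := hminK (s₀ + ρ * expI θ) (by rw [hre]; exact hin θ)
        simp only [K, hre, hGg] at h1
        rw [← ENNReal.ofReal_add ENNReal.toReal_nonneg (hP0 _ h0s.1 h0s.2)] at h1
        rw [ENNReal.ofReal_sub _ (hP0 _ (hin θ).1 (hin θ).2)]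
        exact tsub_le_iff_right.2 h1
      have hInt : Continuous fun θ : ℝ => g + P s₀.re - P (s₀.re + ρ * Real.cos θ) := by fun_prop
      have h3 := (ofReal_integral_le_lintegral (integrable_angle_of_continuous hInt)).trans
        ((lintegral_mono hlow).trans hm)
      have h4 : ∫ θ, (g + P s₀.re - P (s₀.re + ρ * Real.cos θ)) ∂angleMeasure
          = g + ε * ρ ^ 2 / 2 := by
        rw [← integral_angle_quadratic g (c₁ * ρ - ε * ρ * (α + β - 2 * s₀.re)) (ε * ρ ^ 2)]
        congr 1; ext θ; simp only [hP]; ring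
      rw [h4, hGg, ENNReal.ofReal_le_ofReal_iff ENNReal.toReal_nonneg] at h3
      have : 0 < ε * ρ ^ 2 / 2 := by positivity
      linarith
    have h5 : ENNReal.ofReal C ≤ G s + ENNReal.ofReal (P s.re) := hCK.trans (hminK s hs)
    have h6 : ENNReal.ofReal (C - P s.re) ≤ G s := by
      rw [ENNReal.ofReal_sub _ (hP0 _ hs.1 hs.2)]
      exact tsub_le_iff_right.2 h5
    convert h6 using 2
    simp only [hP]; ring
  have hlim : Tendsto (fun ε : ℝ => ENNReal.ofReal (c₀ + c₁ * s.re - ε * ((s.re - α) * (β - s.re))))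
      (𝓝[>] 0) (𝓝 (ENNReal.ofReal (c₀ + c₁ * s.re - 0 * ((s.re - α) * (β - s.re))))) := by
    refine (ENNReal.continuous_ofReal.tendsto _).comp ?_
    exact (tendsto_const_nhds.sub (tendsto_id.mul_const _)).mono_left nhdsWithin_le_nhds
  rw [zero_mul, sub_zero] at hlim
  exact le_of_tendsto hlim (by filter_upwards [self_mem_nhdsWithin] with ε hε using key ε hε)

/-- Lower semicontinuity of integrals depending on a parameter. -/
lemma lowerSemicontinuousOn_lintegral {X A : Type*} [TopologicalSpace X]
    [FirstCountableTopology X] [MeasurableSpace A] {μ : Measure A} {Φ : X → A → ENNReal}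
    {D : Set X} (hm : ∀ x, Measurable (Φ x))
    (h : ∀ a, LowerSemicontinuousOn (fun x => Φ x a) D) :
    LowerSemicontinuousOn (fun x => ∫⁻ a, Φ x a ∂μ) D := by
  intro x hx c hc
  -- If semicontinuity fails, there is a sequence tending to `x` whose integrals stay at most `c`,
  -- and Fatou's lemma contradicts `c < ∫⁻ a, Φ x a ∂μ`.
  by_contra hnot
  obtain ⟨y, hy, hyc⟩ := exists_seq_forall_of_frequently (not_eventually.1 hnot)
  have h1 : ∫⁻ a, Φ x a ∂μ ≤ ∫⁻ a, liminf (fun j => Φ (y j) a) atTop ∂μ := by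
    refine lintegral_mono fun a => ?_
    refine (lowerSemicontinuousWithinAt_iff_le_liminf.1 (h a x hx)).trans ?_
    exact liminf_le_liminf_of_le hy
  have h2 := h1.trans (lintegral_liminf_le fun j => hm (y j))
  have h3 : liminf (fun j => ∫⁻ a, Φ (y j) a ∂μ) atTop ≤ c := by
    refine (liminf_le_liminf (Eventually.of_forall fun j => not_lt.1 (hyc j))).trans ?_
    simp
  exact absurd hc (not_lt.2 (h2.trans h3))

/-- The mean of `q` over the torus through `x`. -/
def torusMean {n : ℕ} (q : (Fin n → ℂ) → ENNReal) (x : Fin n → ℂ) : ENNReal :=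
  ∫⁻ θ, q (fun k => x k * expI (θ k)) ∂torusAngle n

/-- The torus mean in logarithmic coordinates. -/
def logMean {n : ℕ} (q : (Fin n → ℂ) → ENNReal) (u : Fin n → ℝ) : ENNReal :=
  torusMean q (fun k => (Real.exp (u k) : ℂ))

lemma mul_expI_mem {n : ℕ} {x : Fin n → ℂ} (hx : x ∈ polydisk n) (θ : Fin n → ℝ) :
    (fun k => x k * expI (θ k)) ∈ polydisk n := fun k => by simpa using hx k

lemma measurable_mul_expI {n : ℕ} :
    Measurable fun p : (Fin n → ℂ) × (Fin n → ℝ) => fun k => p.1 k * expI (p.2 k) := by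
  have := measurable_expI
  fun_prop

lemma measurable_torusMean {n : ℕ} {q : (Fin n → ℂ) → ENNReal} (hq : Measurable q) :
    Measurable (torusMean q) :=
  (hq.comp measurable_mul_expI).lintegral_prod_right'

lemma torusMean_congr_norm {n : ℕ} {q : (Fin n → ℂ) → ENNReal} (hq : Measurable q)
    {x y : Fin n → ℂ} (h : ∀ k, ‖x k‖ = ‖y k‖) : torusMean q x = torusMean q y := by
  have : ∀ k, ∃ c : ℂ, ‖c‖ = 1 ∧ x k = y k * c := by
    intro k
    by_cases hy : y k = 0
    · exact ⟨1, by simp, by simpa [hy] using h k⟩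
    · refine ⟨x k / y k, ?_, by field_simp⟩
      rw [norm_div, h k, div_self (by simpa using hy)]
  choose c hc hxy using this
  have hq' : Measurable fun z : Fin n → ℂ => q fun k => y k * z k := by fun_prop
  rw [torusMean, torusMean, ← lintegral_torus_mul hq' hc]
  simp only [hxy, mul_assoc]

lemma torusMean_eq_logMean {n : ℕ} {q : (Fin n → ℂ) → ENNReal} (hq : Measurable q)
    {x : Fin n → ℂ} (hx : ∀ k, x k ≠ 0) : torusMean q x = logMean q fun k => Real.log ‖x k‖ :=
  torusMean_congr_norm hq fun k => by
    rw [Real.exp_log (norm_pos_iff.2 (hx k))]; simp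

section TorusMean

variable {n : ℕ} {f : (Fin n → ℂ) → EReal}

/-- Rotating the coordinates of a holomorphic disc gives another holomorphic disc in the polydisk;
the inequality is integrated over the rotations. -/
lemma NegPSH.torusMean_mean_le (hf : NegPSH f)
    {γ : ℂ → Fin n → ℂ} (hγ : Differentiable ℂ γ) (h : ∀ ζ : ℂ, ‖ζ‖ ≤ 1 → γ ζ ∈ polydisk n) :
    ∫⁻ φ, torusMean (pot f) (γ (expI φ)) ∂angleMeasure ≤ torusMean (pot f) (γ 0) := by
  unfold torusMean
  have hm := hf.measurable_pot
  have he := measurable_expI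
  have hγm := hγ.continuous.measurable
  rw [lintegral_lintegral_swap (by fun_prop)]
  refine lintegral_mono fun θ => ?_
  refine hf.mean_le_holomorphic (γ := fun ζ k => γ ζ k * expI (θ k)) ?_
    fun ζ hζ => mul_expI_mem (h ζ hζ) θ
  rw [differentiable_pi]
  intro k
  exact ((differentiable_pi.1 hγ) k).mul_const _

lemma NegPSH.lsc_torusMean (hf : NegPSH f) :
    LowerSemicontinuousOn (torusMean (pot f)) (polydisk n) := by
  refine lowerSemicontinuousOn_lintegral (fun x => ?_) fun θ => ?_
  · have hm := hf.measurable_pot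
    have he := measurable_expI
    fun_prop
  · refine hf.superMean.lsc.comp (g := fun x : Fin n → ℂ => fun k => x k * expI (θ k)) ?_
      fun x hx => mul_expI_mem hx θ
    exact Continuous.continuousOn (by fun_prop)

lemma exp_mem_polydisk {u : Fin n → ℝ} (hu : ∀ k, u k < 0) :
    (fun k => (Real.exp (u k) : ℂ)) ∈ polydisk n := fun k => by
  rw [Complex.norm_real, Real.norm_eq_abs, abs_of_pos (Real.exp_pos _)]
  exact Real.exp_lt_one_iff.2 (hu k)

/-- Concavity of the logarithmic torus mean. -/
lemma NegPSH.le_logMean_of_le (hf : NegPSH f) {u v : Fin n → ℝ} (hu : ∀ k, u k < 0)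
    (hv : ∀ k, v k < 0) {A B t : ℝ} (ht : 0 ≤ t) (ht1 : t ≤ 1)
    (hA : ENNReal.ofReal A ≤ logMean (pot f) u) (hB : ENNReal.ofReal B ≤ logMean (pot f) v) :
    ENNReal.ofReal ((1 - t) * A + t * B) ≤ logMean (pot f) fun k => (1 - t) * u k + t * v k := by
  have hneg (x : ℝ) (h0 : 0 ≤ x) (h1 : x ≤ 1) (k : Fin n) : u k + x * (v k - u k) < 0 := by
    have : u k + x * (v k - u k) = (1 - x) * u k + x * v k := by ring
    rw [this]
    rcases eq_or_lt_of_le h0 with h | h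
    · rw [← h]; simpa using hu k
    · have : (1 - x) * u k ≤ 0 := mul_nonpos_of_nonneg_of_nonpos (by linarith) (hu k).le
      have : x * v k < 0 := mul_neg_of_pos_of_neg h (hv k)
      linarith
  -- The curve `γ` is not `2πi`-periodic, but its torus mean is, since it depends on `s.re` only.
  -- The values at `0` and `1` enter through real lower bounds `A` and `B` because finiteness is not
  -- yet known.
  let γ : ℂ → Fin n → ℂ := fun s k => Complex.exp (u k + s * (v k - u k))
  have hγ : Differentiable ℂ γ := by
    rw [differentiable_pi]; intro k; fun_prop
  have hγn (s : ℂ) (k : Fin n) : ‖γ s k‖ = Real.exp (u k + s.re * (v k - u k)) := by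
    simp [γ, Complex.norm_exp]
  have hγD (s : ℂ) (hs : 0 ≤ s.re ∧ s.re ≤ 1) : γ s ∈ polydisk n := fun k => by
    rw [hγn]; exact Real.exp_lt_one_iff.2 (hneg _ hs.1 hs.2 k)
  have hlog (s : ℂ) : torusMean (pot f) (γ s)
      = logMean (pot f) fun k => u k + s.re * (v k - u k) :=
    torusMean_congr_norm hf.measurable_pot fun k => by
      rw [hγn, Complex.norm_real, Real.norm_eq_abs, abs_of_pos (Real.exp_pos _)]
  have h := strip_min_principle (G := fun s => torusMean (pot f) (γ s)) (α := 0) (β := 1)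
    (c₀ := A) (c₁ := B - A)
    (hf.lsc_torusMean.comp hγ.continuous.continuousOn hγD)
    (fun s => by simp [hlog]) (fun s ρ hρ h0 h1 => ?_) (fun s hs => ?_) (fun s hs => ?_)
    (t : ℂ) (by simp [ht, ht1])
  · rw [hlog] at h
    convert h using 2
    · simp; ring
    · ext k; simp; ring
  · have := hf.torusMean_mean_le (γ := fun ζ => γ (s + ρ * ζ)) (by fun_prop) fun ζ hζ => by
      refine hγD _ ?_
      have h2 : |ζ.re| ≤ 1 := (Complex.abs_re_le_norm ζ).trans hζ
      rw [abs_le] at h2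
      simp only [Complex.add_re, Complex.mul_re, Complex.ofReal_re, Complex.ofReal_im, zero_mul,
        sub_zero]
      constructor <;> nlinarith
    simpa using this
  · rw [hlog, hs]; simpa using hA
  · rw [hlog, hs]; simpa using hB

/-- Continue the segment from `v` through `u` to `u - T (v - u)`, where the mean is at least `0`.
Concavity gives at `u` the lower bound `T / (T + 1)` times the value at `v`; let `T → ∞`. -/
lemma NegPSH.logMean_antitone (hf : NegPSH f) {u v : Fin n → ℝ} (huv : ∀ k, u k ≤ v k)
    (hv : ∀ k, v k < 0) : logMean (pot f) v ≤ logMean (pot f) u := by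
  refine ENNReal.le_of_forall_nnreal_lt fun A hA => ?_
  have hA' : ENNReal.ofReal A ≤ logMean (pot f) v := by simpa using hA.le
  have key : ∀ T : ℝ, 0 < T → ENNReal.ofReal (T / (T + 1) * A) ≤ logMean (pot f) u := by
    intro T hT
    have h := hf.le_logMean_of_le (u := fun k => u k - T * (v k - u k)) (v := v) (A := 0)
      (t := T / (T + 1)) (fun k => by
        have : 0 ≤ T * (v k - u k) := mul_nonneg hT.le (by linarith [huv k])
        linarith [huv k, hv k]) hv (by positivity) (by rw [div_le_one (by positivity)]; linarith)
      (by simp) hA'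
    convert h using 2
    · ring
    · ext k; field_simp; ring
  have hlim : Tendsto (fun T : ℝ => ENNReal.ofReal (T / (T + 1) * A)) atTop
      (𝓝 (ENNReal.ofReal (1 * A))) := by
    refine (ENNReal.continuous_ofReal.tendsto _).comp (Tendsto.mul_const _ ?_)
    have h1 : Tendsto (fun T : ℝ => 1 - 1 / (T + 1)) atTop (𝓝 (1 - 0)) :=
      tendsto_const_nhds.sub ((tendsto_const_nhds (x := (1 : ℝ))).div_atTop
        (tendsto_atTop_add_const_right _ _ tendsto_id))
    rw [sub_zero] at h1
    refine h1.congr' ?_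
    filter_upwards [eventually_gt_atTop 0] with T hT
    field_simp
    ring
  have := le_of_tendsto hlim (by filter_upwards [eventually_gt_atTop 0] with T hT using key T hT)
  simpa using this

/-- Against a weight invariant under all coordinate rotations, `pot f` may be replaced by its torus
mean: Fubini and rotation invariance of Lebesgue measure. -/
lemma NegPSH.lintegral_torusMean (hf : NegPSH f) {K : (Fin n → ℂ) → ENNReal} (hK : Measurable K)
    (hrot : ∀ (c : Fin n → ℂ) y, (∀ k, ‖c k‖ = 1) → K (fun k => c k * y k) = K y) :
    ∫⁻ x, torusMean (pot f) x * K x = ∫⁻ x, pot f x * K x := by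
  have hm := hf.measurable_pot
  have he := measurable_expI
  calc ∫⁻ x, torusMean (pot f) x * K x
      = ∫⁻ x, ∫⁻ θ, pot f (fun k => x k * expI (θ k)) * K x ∂torusAngle n := by
        refine lintegral_congr fun x => ?_
        rw [lintegral_mul_const _ (by fun_prop)]; rfl
    _ = ∫⁻ θ, (∫⁻ x, pot f (fun k => x k * expI (θ k)) * K x) ∂torusAngle n :=
        lintegral_lintegral_swap (by fun_prop)
    _ = ∫⁻ _θ, (∫⁻ x, pot f x * K x) ∂torusAngle n := by
        refine lintegral_congr fun θ => ?_
        have hr : MeasurePreserving (fun (y : Fin n → ℂ) k => expI (θ k) * y k) volume volume :=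
          measurePreserving_rotation fun k => norm_expI (θ k)
        rw [← hr.lintegral_comp (f := fun x => pot f x * K x) (by fun_prop)]
        refine lintegral_congr fun x => ?_
        rw [hrot _ _ fun k => norm_expI (θ k)]
        simp only [mul_comm]
    _ = ∫⁻ x, pot f x * K x := by simp

lemma ae_coord_ne_zero (n : ℕ) : ∀ᵐ x : Fin n → ℂ, ∀ k, x k ≠ 0 := by
  rw [ae_all_iff]
  intro k
  exact measure_mono_null (fun x hx => by simpa using hx)
    (Measure.pi_hyperplane (fun _ : Fin n => (volume : Measure ℂ)) k 0)

/-- Local integrability makes the torus mean finite at almost every point of a small ball. Such a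
point with `‖x k‖ ≤ e^{u k}` exists, and monotonicity carries finiteness to `u`. -/
lemma NegPSH.logMean_lt_top (hf : NegPSH f) {u : Fin n → ℝ} (hu : ∀ k, u k < 0) :
    logMean (pot f) u < ⊤ := by
  obtain ⟨r, hr0, hr1, hr⟩ : ∃ r : ℝ, 0 < r ∧ r < 1 ∧ ∀ k, r ≤ Real.exp (u k) := by
    have hex : ∃ c : ℝ, c < 0 ∧ ∀ k, c ≤ u k := by
      refine ⟨-(1 + ∑ k, |u k|), ?_, fun k => ?_⟩
      · have : 0 ≤ ∑ k, |u k| := Finset.sum_nonneg fun k _ => abs_nonneg _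
        linarith
      · have := Finset.single_le_sum (f := fun k => |u k|) (fun k _ => abs_nonneg _)
          (Finset.mem_univ k)
        linarith [neg_abs_le (u k)]
    obtain ⟨c, hc, hck⟩ := hex
    exact ⟨Real.exp c, Real.exp_pos _, Real.exp_lt_one_iff.2 hc, fun k => Real.exp_le_exp.2 (hck k)⟩
  have hball : MeasurableSet (Metric.ball (0 : Fin n → ℂ) r) := Metric.isOpen_ball.measurableSet
  have h1 : ∫⁻ x in Metric.ball 0 r, torusMean (pot f) x < ⊤ := by
    have h2 := hf.lintegral_torusMean (K := (Metric.ball 0 r).indicator 1)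
      (measurable_one.indicator hball) (fun c y hc => by
        have : (fun k => c k * y k) ∈ Metric.ball (0 : Fin n → ℂ) r ↔ y ∈ Metric.ball 0 r := by
          simp [pi_norm_lt_iff hr0, hc]
        by_cases hy : y ∈ Metric.ball 0 r
        · rw [Set.indicator_of_mem hy, Set.indicator_of_mem (this.2 hy)]; rfl
        · rw [Set.indicator_of_notMem hy, Set.indicator_of_notMem (mt this.1 hy)])
    have e (g : (Fin n → ℂ) → ENNReal) : ∫⁻ x in Metric.ball 0 r, g x
        = ∫⁻ x, g x * (Metric.ball 0 r).indicator 1 x := by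
      rw [← lintegral_indicator hball]
      refine lintegral_congr fun x => ?_
      by_cases hx : x ∈ Metric.ball 0 r
      · simp [Set.indicator_of_mem hx]
      · simp [Set.indicator_of_notMem hx]
    rw [e, h2, ← e]
    refine (lintegral_mono_set Metric.ball_subset_closedBall).trans_lt
      (hf.lintegral_pot_lt_top (isCompact_closedBall 0 r) ?_)
    rw [polydisk_eq_ball]
    exact Metric.closedBall_subset_ball hr1
  have h2 := ae_lt_top (measurable_torusMean hf.measurable_pot) h1.ne
  have hpos : volume (Metric.ball (0 : Fin n → ℂ) r) ≠ 0 := (Metric.measure_ball_pos _ _ hr0).ne'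
  have hne : (ae (volume.restrict (Metric.ball (0 : Fin n → ℂ) r))).NeBot := by
    rw [ae_neBot]; simpa using hpos
  obtain ⟨x, ⟨hxt, hx0⟩, hxb⟩ := ((h2.and (ae_restrict_of_ae (ae_coord_ne_zero n))).and
    (ae_restrict_mem hball)).exists
  rw [torusMean_eq_logMean hf.measurable_pot hx0] at hxt
  refine (hf.logMean_antitone (fun k => ?_) hu).trans_lt hxt
  have h3 : ‖x k‖ ≤ Real.exp (u k) :=
    ((norm_le_pi_norm x k).trans (mem_ball_zero_iff.1 hxb).le).trans (hr k)
  rw [← Real.log_exp (u k)]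
  exact Real.log_le_log (norm_pos_iff.2 (hx0 k)) h3

/-- The convex image of a negative plurisubharmonic function, as a real function. -/
def convexReal {n : ℕ} (f : (Fin n → ℂ) → EReal) (u : Fin n → ℝ) : ℝ :=
  -(logMean (pot f) u).toReal

lemma NegPSH.ofReal_neg_convexReal (hf : NegPSH f) {u : Fin n → ℝ} (hu : ∀ k, u k < 0) :
    ENNReal.ofReal (-convexReal f u) = logMean (pot f) u := by
  rw [convexReal, neg_neg, ENNReal.ofReal_toReal (hf.logMean_lt_top hu).ne]

lemma NegPSH.convexImage_eq (hf : NegPSH f) {u : Fin n → ℝ} (hu : ∀ k, u k < 0) :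
    convexImage f u = (convexReal f u : ℝ) := by
  have h := hf.eIntegral_eq (torusAngle n)
    (γ := fun θ k => (Real.exp (u k) : ℂ) * expI (θ k)) fun θ => mul_expI_mem (exp_mem_polydisk hu) θ
  refine h.trans ?_
  have h2 : ((logMean (pot f) u : ENNReal) : EReal) = (((logMean (pot f) u).toReal : ℝ) : EReal) :=
    (EReal.coe_toReal (by simpa using (hf.logMean_lt_top hu).ne) (by simp)).symm.trans (by simp)
  rw [convexReal, EReal.coe_neg, ← h2]
  rfl

lemma convexReal_nonpos (u : Fin n → ℝ) : convexReal f u ≤ 0 :=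
  neg_nonpos.2 ENNReal.toReal_nonneg

/-- The open negative orthant. -/
def negOrthant (n : ℕ) : Set (Fin n → ℝ) := {u | ∀ k, u k < 0}

lemma convex_negOrthant (n : ℕ) : Convex ℝ (negOrthant n) := by
  have : negOrthant n = Set.pi Set.univ fun _ => Set.Iio (0 : ℝ) := by
    ext u; simp [negOrthant]
  rw [this]
  exact convex_pi fun k _ => convex_Iio 0

lemma NegPSH.convexOn_convexReal (hf : NegPSH f) :
    ConvexOn ℝ (negOrthant n) (convexReal f) := by
  refine ⟨convex_negOrthant n, fun u hu v hv a b ha hb hab => ?_⟩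
  have h := hf.le_logMean_of_le hu hv hb (by linarith) (hf.ofReal_neg_convexReal hu).le
    (hf.ofReal_neg_convexReal hv).le
  have hw : a • u + b • v ∈ negOrthant n := convex_negOrthant n hu hv ha hb hab
  have e : (fun k => (1 - b) * u k + b * v k) = a • u + b • v := by
    ext k; simp [← hab]
  rw [e, ← hf.ofReal_neg_convexReal hw, ENNReal.ofReal_le_ofReal_iff
    (neg_nonneg.2 (convexReal_nonpos _)), show 1 - b = a by linarith] at h
  simp only [smul_eq_mul]
  linarith

lemma NegPSH.convexReal_mono (hf : NegPSH f) {u v : Fin n → ℝ} (huv : ∀ k, u k ≤ v k)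
    (hv : ∀ k, v k < 0) : convexReal f u ≤ convexReal f v := by
  refine neg_le_neg ?_
  exact ENNReal.toReal_mono (hf.logMean_lt_top fun k => (huv k).trans_lt (hv k)).ne
    (hf.logMean_antitone huv hv)

end TorusMean

/-! ### Asymptotic slopes of convex functions -/

/-- Asymptotic slope at `-∞` of a convex increasing function. -/
lemma exists_slope_atBot {g : ℝ → ℝ} (hg : ConvexOn ℝ (Set.Iic 0) g)
    (hm : MonotoneOn g (Set.Iic 0)) :
    ∃ L : ℝ, 0 ≤ L ∧ Tendsto (fun v => g v / v) atBot (𝓝 L) ∧ ∀ v ≤ 0, g v ≤ g 0 + v * L := by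
  have h0 : (0 : ℝ) ∈ Set.Iic (0 : ℝ) := by simp
  -- Capping the argument at `-1` avoids the quotient at `0` and makes the difference quotient
  -- monotone on all of `ℝ`, so that its limit at `-∞` is its infimum.
  set s : ℝ → ℝ := fun v => (g (min v (-1)) - g 0) / (min v (-1)) with hs
  have hneg (v : ℝ) : min v (-1) < 0 := lt_of_le_of_lt (min_le_right _ _) (by norm_num)
  have hsec (x y : ℝ) (hx : x < 0) (hy : y < 0) (hxy : x ≤ y) :
      (g x - g 0) / x ≤ (g y - g 0) / y := by
    have := hg.secant_mono h0 (show x ∈ Set.Iic 0 from hx.le) (show y ∈ Set.Iic 0 from hy.le)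
      hx.ne hy.ne hxy
    simpa using this
  have hsmono : Monotone s := fun a b hab =>
    hsec _ _ (hneg a) (hneg b) (min_le_min_right _ hab)
  have hsnn (x : ℝ) (hx : x < 0) : 0 ≤ (g x - g 0) / x :=
    div_nonneg_of_nonpos (by linarith [hm (show x ∈ Set.Iic 0 from hx.le) h0 hx.le]) hx.le
  have hbdd : BddBelow (Set.range s) := ⟨0, by rintro _ ⟨v, rfl⟩; exact hsnn _ (hneg v)⟩
  have hlim := tendsto_atBot_ciInf hsmono hbdd
  refine ⟨⨅ v, s v, le_ciInf fun v => hsnn _ (hneg v), ?_, ?_⟩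
  · have h1 : Tendsto (fun v : ℝ => g 0 / v + s v) atBot (𝓝 (0 + ⨅ v, s v)) :=
      (tendsto_const_nhds.div_atBot tendsto_id).add hlim
    rw [zero_add] at h1
    refine h1.congr' ?_
    filter_upwards [eventually_le_atBot (-1)] with v hv
    have hv0 : v ≠ 0 := by linarith
    simp only [hs, min_eq_left hv]
    field_simp
    ring
  · intro v hv
    rcases hv.eq_or_lt with rfl | hv
    · simp
    have h1 : (⨅ v, s v) ≤ (g v - g 0) / v := by
      refine (ciInf_le hbdd v).trans (hsec _ _ (hneg v) hv (min_le_left _ _))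
    rw [le_div_iff_of_neg hv] at h1
    linarith

/-- Difference quotients of a convex function decrease to its asymptotic slope. -/
lemma tendsto_slope_atBot {g : ℝ → ℝ} {c L : ℝ} (hg : ConvexOn ℝ (Set.Iio c) g)
    (hL : Tendsto (fun v => g v / v) atBot (𝓝 L)) {δ : ℝ} (hδ : 0 < δ) :
    Tendsto (fun v => (g v - g (v - δ)) / δ) atBot (𝓝 L) ∧
      (∀ v < c, L ≤ (g v - g (v - δ)) / δ) ∧
      ∀ v w, v ≤ w → w < c → (g v - g (v - δ)) / δ ≤ (g w - g (w - δ)) / δ := by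
  have hmono : ∀ v w, v ≤ w → w < c → (g v - g (v - δ)) / δ ≤ (g w - g (w - δ)) / δ := by
    intro v w hvw hw
    rcases hvw.eq_or_lt with rfl | hvw
    · rfl
    have m1 : v - δ ∈ Set.Iio c := by simp; linarith
    have m2 : v ∈ Set.Iio c := by simp; linarith
    have m3 : w ∈ Set.Iio c := hw
    have m4 : w - δ ∈ Set.Iio c := by simp; linarith
    have h1 := hg.secant_mono m1 m2 m3 (by linarith) (by linarith) hvw.le
    have h2 := hg.secant_mono m3 m1 m4 (by linarith) (by linarith) (by linarith)
    have e1 : (g v - g (v - δ)) / (v - (v - δ)) = (g v - g (v - δ)) / δ := by congr 1; ring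
    have e2 : (g (w - δ) - g w) / (w - δ - w) = (g w - g (w - δ)) / δ := by
      rw [show w - δ - w = -δ by ring, div_neg, ← neg_div, neg_sub]
    have e3 : (g (v - δ) - g w) / (v - δ - w) = (g w - g (v - δ)) / (w - (v - δ)) := by
      rw [← neg_div_neg_eq]; congr 1 <;> ring
    rw [e1] at h1; rw [e2, e3] at h2
    exact h1.trans h2
  have hscale (v₀ : ℝ) : Tendsto (fun w => (g v₀ - g w) / (v₀ - w)) atBot (𝓝 L) := by
    have h1 : Tendsto (fun w : ℝ => (g v₀ / w - g w / w) / (v₀ / w - 1)) atBot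
        (𝓝 ((0 - L) / (0 - 1))) :=
      ((tendsto_const_nhds.div_atBot tendsto_id).sub hL).div
        ((tendsto_const_nhds.div_atBot tendsto_id).sub_const 1) (by norm_num)
    rw [show (0 - L) / (0 - 1) = L by ring] at h1
    refine h1.congr' ?_
    filter_upwards [eventually_lt_atBot 0, eventually_lt_atBot v₀] with w hw hw2
    have : v₀ - w ≠ 0 := by linarith
    have : v₀ / w - 1 ≠ 0 := by
      rw [div_sub_one hw.ne]; exact div_ne_zero (by linarith) hw.ne
    rw [div_sub_div_same, div_sub_one hw.ne, div_div_div_cancel_right₀ hw.ne]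
  have hge : ∀ v < c, L ≤ (g v - g (v - δ)) / δ := by
    intro v hv
    refine le_of_tendsto (hscale v) ?_
    filter_upwards [eventually_lt_atBot (v - δ)] with w hw
    have m1 : v ∈ Set.Iio c := hv
    have m2 : w ∈ Set.Iio c := by simp; linarith
    have m3 : v - δ ∈ Set.Iio c := by simp; linarith
    have h2 := hg.secant_mono m1 m2 m3 (by linarith) (by linarith) (by linarith)
    have e2 : (g (v - δ) - g v) / (v - δ - v) = (g v - g (v - δ)) / δ := by
      rw [show v - δ - v = -δ by ring, div_neg, ← neg_div, neg_sub]
    have e3 : (g w - g v) / (w - v) = (g v - g w) / (v - w) := by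
      rw [← neg_div_neg_eq]; congr 1 <;> ring
    rw [e2, e3] at h2
    exact h2
  refine ⟨?_, hge, hmono⟩
  -- This expression is the slope of the chord over `[v, v / 2]`, which dominates the chord slope
  -- over `[v - δ, v]` and tends to `2 L - L`.
  have hup : Tendsto (fun v : ℝ => 2 * (g v / v) - g (v / 2) / (v / 2)) atBot (𝓝 (2 * L - L)) :=
    (hL.const_mul 2).sub (hL.comp (tendsto_id.atBot_div_const (by norm_num)))
  rw [show 2 * L - L = L by ring] at hup
  refine tendsto_of_tendsto_of_tendsto_of_le_of_le' tendsto_const_nhds hup ?_ ?_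
  · filter_upwards [eventually_lt_atBot c] with v hv using hge v hv
  · filter_upwards [eventually_lt_atBot (2 * c), eventually_lt_atBot 0] with v hv hv0
    have m1 : v ∈ Set.Iio c := by simp; by_cases h : 0 ≤ c <;> linarith
    have m2 : v / 2 ∈ Set.Iio c := by simp; linarith
    have m3 : v - δ ∈ Set.Iio c := by simp at m1 ⊢; linarith
    have h2 := hg.secant_mono m1 m3 m2 (by linarith) (by linarith) (by linarith)
    have e2 : (g (v - δ) - g v) / (v - δ - v) = (g v - g (v - δ)) / δ := by
      rw [show v - δ - v = -δ by ring, div_neg, ← neg_div, neg_sub]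
    rw [e2] at h2
    refine h2.trans (le_of_eq ?_)
    have : v / 2 - v ≠ 0 := by linarith
    field_simp
    ring

/-- Nonpositive increasing convex functions on the negative orthant. -/
structure NegConvex {n : ℕ} (h : (Fin n → ℝ) → ℝ) : Prop where
  convexOn : ConvexOn ℝ (negOrthant n) h
  mono : ∀ u v : Fin n → ℝ, u ≤ v → v ∈ negOrthant n → h u ≤ h v
  nonpos : ∀ u, h u ≤ 0

lemma NegPSH.negConvex {n : ℕ} {f : (Fin n → ℂ) → EReal} (hf : NegPSH f) :
    NegConvex (convexReal f) :=
  ⟨hf.convexOn_convexReal, fun _ _ h hv => hf.convexReal_mono h hv, convexReal_nonpos⟩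

section NegConvex

variable {n : ℕ} {h : (Fin n → ℝ) → ℝ}

lemma add_smul_mem_negOrthant {u d : Fin n → ℝ} (hu : u ∈ negOrthant n) (hd : 0 ≤ d) {v : ℝ}
    (hv : v ≤ 0) : u + v • d ∈ negOrthant n := fun k => by
  have := mul_nonpos_of_nonpos_of_nonneg hv (hd k)
  have := hu k
  simp only [Pi.add_apply, Pi.smul_apply, smul_eq_mul] at *
  linarith

lemma isOpen_negOrthant (n : ℕ) : IsOpen (negOrthant n) := by
  have : negOrthant n = Set.pi Set.univ fun _ => Set.Iio (0 : ℝ) := by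
    ext u; simp [negOrthant]
  rw [this]
  exact isOpen_set_pi Set.finite_univ fun _ _ => isOpen_Iio

lemma neg_one_mem_negOrthant : (-1 : Fin n → ℝ) ∈ negOrthant n := fun k => by simp

lemma NegConvex.convexOn_line (hh : NegConvex h) {u d : Fin n → ℝ} {s : Set ℝ} (hs : Convex ℝ s)
    (hsu : ∀ v ∈ s, u + v • d ∈ negOrthant n) : ConvexOn ℝ s fun v => h (u + v • d) := by
  refine ⟨hs, fun v hv w hw a b ha hb hab => ?_⟩
  have := hh.convexOn.2 (hsu v hv) (hsu w hw) ha hb hab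
  convert this using 2
  ext k
  simp only [Pi.add_apply, Pi.smul_apply, smul_eq_mul]
  linear_combination (-u k) * hab

lemma NegConvex.exists_slope (hh : NegConvex h) {u d : Fin n → ℝ} (hu : u ∈ negOrthant n)
    (hd : 0 ≤ d) : ∃ L : ℝ, 0 ≤ L ∧ Tendsto (fun v : ℝ => h (u + v • d) / v) atBot (𝓝 L) ∧
      ∀ v ≤ 0, h (u + v • d) ≤ h u + v * L := by
  have h1 := exists_slope_atBot (g := fun v : ℝ => h (u + v • d))
    (hh.convexOn_line (convex_Iic 0) fun v hv => add_smul_mem_negOrthant hu hd hv) ?_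
  · simpa using h1
  · intro v hv w hw hvw
    refine hh.mono _ _ (fun k => ?_) (add_smul_mem_negOrthant hu hd hw)
    simp only [Pi.add_apply, Pi.smul_apply, smul_eq_mul]
    have := mul_le_mul_of_nonneg_right hvw (hd k)
    linarith

/-- The slope at `-∞` of `h` in the direction `d`. -/
def asympSlope {n : ℕ} (h : (Fin n → ℝ) → ℝ) (d : Fin n → ℝ) : ℝ :=
  limUnder atBot fun v : ℝ => h (-1 + v • d) / v

/-- Prolong the segment from `u` to `u'` slightly to a point of the orthant. Then `u' + v • d` is a
convex combination of this fixed point and of `u + (v / t) • d`; after division by `v < 0` the fixed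
point drops out in the limit. -/
lemma NegConvex.slope_le_slope (hh : NegConvex h) {u u' d : Fin n → ℝ} (hu : u ∈ negOrthant n)
    (hu' : u' ∈ negOrthant n) (hd : 0 ≤ d) {L L' : ℝ}
    (hL : Tendsto (fun v : ℝ => h (u + v • d) / v) atBot (𝓝 L))
    (hL' : Tendsto (fun v : ℝ => h (u' + v • d) / v) atBot (𝓝 L')) : L ≤ L' := by
  obtain ⟨ε, hε0, hε⟩ : ∃ ε : ℝ, 0 < ε ∧ u' + ε • (u' - u) ∈ negOrthant n := by
    have hc : Continuous fun ε : ℝ => u' + ε • (u' - u) := by fun_prop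
    have : ∀ᶠ ε : ℝ in 𝓝 0, u' + ε • (u' - u) ∈ negOrthant n :=
      hc.continuousAt.eventually ((isOpen_negOrthant n).mem_nhds (by simpa using hu'))
    have := (this.filter_mono (nhdsWithin_le_nhds (s := Set.Ioi 0))).and self_mem_nhdsWithin
    obtain ⟨ε, h1, h2⟩ := this.exists
    exact ⟨ε, h2, h1⟩
  set t := ε / (1 + ε) with ht
  have ht0 : 0 < t := by positivity
  have ht1 : 1 - t = 1 / (1 + ε) := by rw [ht]; field_simp; ring
  have hlim : Tendsto (fun v : ℝ => ((1 - t) * h (u' + ε • (u' - u))) / v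
      + h (u + (v / t) • d) / (v / t)) atBot (𝓝 (0 + L)) :=
    (tendsto_const_nhds.div_atBot tendsto_id).add
      (hL.comp (tendsto_id.atBot_div_const ht0))
  rw [zero_add] at hlim
  refine le_of_tendsto_of_tendsto hlim hL' ?_
  filter_upwards [eventually_lt_atBot 0] with v hv
  have hvt : v / t ≤ 0 := div_nonpos_of_nonpos_of_nonneg hv.le ht0.le
  have h1 := hh.convexOn.2 hε (add_smul_mem_negOrthant hu hd hvt)
    (show 0 ≤ 1 - t by rw [ht1]; positivity) ht0.le (by ring)
  have e : (1 - t) • (u' + ε • (u' - u)) + t • (u + (v / t) • d) = u' + v • d := by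
    ext k
    simp only [Pi.add_apply, Pi.smul_apply, Pi.sub_apply, smul_eq_mul]
    rw [ht1, ht]
    field_simp
    ring
  rw [e] at h1
  simp only [smul_eq_mul] at h1
  have h2 := div_le_div_of_nonpos_of_le hv.le h1
  refine le_trans (le_of_eq ?_) h2
  field_simp

lemma NegConvex.tendsto_slope (hh : NegConvex h) {u d : Fin n → ℝ} (hu : u ∈ negOrthant n)
    (hd : 0 ≤ d) : Tendsto (fun v : ℝ => h (u + v • d) / v) atBot (𝓝 (asympSlope h d)) := by
  obtain ⟨L, -, hL, -⟩ := hh.exists_slope neg_one_mem_negOrthant hd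
  obtain ⟨L', -, hL', -⟩ := hh.exists_slope hu hd
  have e : asympSlope h d = L := hL.limUnder_eq
  rw [e, le_antisymm (hh.slope_le_slope neg_one_mem_negOrthant hu hd hL hL')
    (hh.slope_le_slope hu neg_one_mem_negOrthant hd hL' hL)]
  exact hL'

/-- The difference quotients from the base point decrease to the slope as `v → -∞`, so each is at
least the slope; multiplication by `v ≤ 0` reverses the inequality. -/
lemma NegConvex.le_add_slope (hh : NegConvex h) {u d : Fin n → ℝ} (hu : u ∈ negOrthant n)
    (hd : 0 ≤ d) {v : ℝ} (hv : v ≤ 0) : h (u + v • d) ≤ h u + v * asympSlope h d := by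
  obtain ⟨L, -, hL, hle⟩ := hh.exists_slope hu hd
  rw [tendsto_nhds_unique (hh.tendsto_slope hu hd) hL]
  exact hle v hv

lemma NegConvex.asympSlope_nonneg (hh : NegConvex h) {d : Fin n → ℝ} (hd : 0 ≤ d) :
    0 ≤ asympSlope h d := by
  obtain ⟨L, h0, hL, -⟩ := hh.exists_slope neg_one_mem_negOrthant hd
  rwa [tendsto_nhds_unique (hh.tendsto_slope neg_one_mem_negOrthant hd) hL]

/-- Going from `-1` to `-1 + v • 1` one coordinate at a time, each move changes `h` by at most `v`
times the slope in that direction, whatever the point already reached. Dividing by `v < 0` gives the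
inequality; this is part (c). -/
lemma NegConvex.sum_asympSlope_le (hh : NegConvex h) :
    ∑ k, asympSlope h (Pi.single k 1) ≤ asympSlope h 1 := by
  have key : ∀ (S : Finset (Fin n)) (v : ℝ), v ≤ 0 → h (-1 + v • ∑ k ∈ S, Pi.single k 1)
      ≤ h (-1) + v * ∑ k ∈ S, asympSlope h (Pi.single k 1) := by
    intro S v hv
    have hnn (S : Finset (Fin n)) : (0 : Fin n → ℝ) ≤ ∑ k ∈ S, Pi.single k 1 :=
      Finset.sum_nonneg fun k _ => by simp
    induction S using Finset.induction_on with
    | empty => simp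
    | insert k S hk ih =>
      rw [Finset.sum_insert hk, Finset.sum_insert hk]
      have h1 := hh.le_add_slope (add_smul_mem_negOrthant neg_one_mem_negOrthant (hnn S) hv)
        (d := Pi.single k 1) (by simp) hv
      have e : (-1 : Fin n → ℝ) + v • (Pi.single k 1 + ∑ k ∈ S, Pi.single k 1)
          = -1 + v • ∑ k ∈ S, Pi.single k 1 + v • Pi.single k 1 := by
        rw [smul_add]; abel
      rw [e]
      linarith
  have e1 : ∑ k, Pi.single k 1 = (1 : Fin n → ℝ) := Finset.univ_sum_single 1
  have hlim : Tendsto (fun v : ℝ => h (-1) / v + ∑ k, asympSlope h (Pi.single k 1)) atBot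
      (𝓝 (0 + ∑ k, asympSlope h (Pi.single k 1))) :=
    (tendsto_const_nhds.div_atBot tendsto_id).add tendsto_const_nhds
  rw [zero_add] at hlim
  refine le_of_tendsto_of_tendsto hlim
    (hh.tendsto_slope neg_one_mem_negOrthant (d := 1) zero_le_one) ?_
  filter_upwards [eventually_lt_atBot 0] with v hv
  have h1 := key Finset.univ v hv.le
  rw [e1] at h1
  have h2 := div_le_div_of_nonpos_of_le hv.le h1
  rwa [add_div, mul_div_cancel_left₀ _ hv.ne] at h2

lemma NegConvex.asympSlope_mono (hh : NegConvex h) {d d' : Fin n → ℝ} (hd : 0 ≤ d)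
    (hdd' : d ≤ d') : asympSlope h d ≤ asympSlope h d' := by
  refine le_of_tendsto_of_tendsto (hh.tendsto_slope neg_one_mem_negOrthant hd)
    (hh.tendsto_slope neg_one_mem_negOrthant (hd.trans hdd')) ?_
  filter_upwards [eventually_lt_atBot 0] with v hv
  refine div_le_div_of_nonpos_of_le hv.le (hh.mono _ _ (fun k => ?_)
    (add_smul_mem_negOrthant neg_one_mem_negOrthant hd hv.le))
  have := mul_le_mul_of_nonpos_left (hdd' k) hv.le
  simp only [Pi.add_apply, Pi.smul_apply, smul_eq_mul]
  linarith

lemma NegConvex.asympSlope_smul (hh : NegConvex h) {d : Fin n → ℝ} (hd : 0 ≤ d) {c : ℝ}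
    (hc : 0 < c) : asympSlope h (c • d) = c * asympSlope h d := by
  refine tendsto_nhds_unique (hh.tendsto_slope neg_one_mem_negOrthant (smul_nonneg hc.le hd)) ?_
  have h1 := ((hh.tendsto_slope neg_one_mem_negOrthant hd).comp
    (tendsto_id.atBot_mul_const hc)).const_mul c
  refine h1.congr' ?_
  filter_upwards [eventually_lt_atBot 0] with v hv
  have : v ≠ 0 := hv.ne
  simp only [Function.comp, id, smul_smul]
  field_simp

/-- The point `u` itself may lie outside the orthant, as long as the half-line `v < c` lies inside;
shells need this, since their points have coordinates of either size before dilation. -/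
lemma NegConvex.slope_quotient (hh : NegConvex h) {u d : Fin n → ℝ} {c : ℝ} (hd : 0 ≤ d)
    (hu : ∀ v < c, u + v • d ∈ negOrthant n) {δ : ℝ} (hδ : 0 < δ) :
    Tendsto (fun v : ℝ => (h (u + v • d) - h (u + (v - δ) • d)) / δ) atBot
        (𝓝 (asympSlope h d)) ∧
      (∀ v < c, asympSlope h d ≤ (h (u + v • d) - h (u + (v - δ) • d)) / δ) ∧
      ∀ v w, v ≤ w → w < c → (h (u + v • d) - h (u + (v - δ) • d)) / δ
        ≤ (h (u + w • d) - h (u + (w - δ) • d)) / δ := by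
  refine tendsto_slope_atBot (g := fun v : ℝ => h (u + v • d))
    (hh.convexOn_line (convex_Iio c) fun v hv => hu v hv) ?_ hδ
  have h1 : u + (c - 1) • d ∈ negOrthant n := hu _ (by linarith)
  have h2 := hh.tendsto_slope h1 hd
  have h3 := (h2.comp (tendsto_atBot_add_const_right _ (-(c - 1)) tendsto_id))
  have h4 : Tendsto (fun v : ℝ => 1 + (-(c - 1)) / v) atBot (𝓝 (1 + 0)) :=
    tendsto_const_nhds.add (tendsto_const_nhds.div_atBot tendsto_id)
  have h5 := h3.mul h4
  rw [add_zero, mul_one] at h5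
  refine h5.congr' ?_
  filter_upwards [eventually_lt_atBot 0, eventually_lt_atBot (c - 1)] with v hv hv2
  have e : u + (c - 1) • d + (v + -(c - 1)) • d = u + v • d := by
    rw [add_assoc, ← add_smul]; congr 2; ring
  simp only [Function.comp, id, e]
  have : v ≠ 0 := hv.ne
  have : v + -(c - 1) ≠ 0 := by linarith
  field_simp

end NegConvex

/-! ### Convex images up to the boundary -/

/-- Subtracting an upper bound `M` reduces integrals of functions bounded above to nonpositive ones.
The identity of positive and negative parts is checked pointwise in `[0, ∞]`; the only infinite case
is an infinite negative part on both sides. -/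
lemma eIntegral_of_le {α : Type*} [MeasurableSpace α] {μ : Measure α} [IsProbabilityMeasure μ]
    {g : α → EReal} (hgm : Measurable g) {M : ℝ} (hM : 0 ≤ M) (hg : ∀ t, g t ≤ M) :
    eIntegral μ g = M + -((∫⁻ t, (-(g t - M)).toENNReal ∂μ : ENNReal) : EReal) := by
  have hp (t : α) : (-(g t - M)).toENNReal + (g t).toENNReal
      = ENNReal.ofReal M + (-g t).toENNReal := by
    induction h : g t with
    | bot => simp
    | top => have := hg t; simp [h] at this
    | coe x =>
      have hx : x ≤ M := by have := hg t; rw [h] at this; exact_mod_cast this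
      have e1 : (-((x : EReal) - (M : EReal))) = ((M - x : ℝ) : EReal) := by
        rw [← EReal.coe_sub, ← EReal.coe_neg]; congr 1; ring
      have e2 : (-(x : EReal)) = ((-x : ℝ) : EReal) := rfl
      rw [e1, e2, EReal.toENNReal_of_ne_top (EReal.coe_ne_top _),
        EReal.toENNReal_of_ne_top (EReal.coe_ne_top _), EReal.toENNReal_of_ne_top (EReal.coe_ne_top _)]
      simp only [EReal.toReal_coe]
      rcases le_total 0 x with h0 | h0
      · rw [← ENNReal.ofReal_add (by linarith) h0, ENNReal.ofReal_of_nonpos (by linarith : -x ≤ 0)]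
        simp
      · rw [ENNReal.ofReal_of_nonpos h0, add_zero, ← ENNReal.ofReal_add hM (by linarith)]
        congr 1
  have hm1 : Measurable fun t => (g t).toENNReal := hgm.ereal_toENNReal
  have hI : (∫⁻ t, (-(g t - M)).toENNReal ∂μ) + ∫⁻ t, (g t).toENNReal ∂μ
      = ENNReal.ofReal M + ∫⁻ t, (-g t).toENNReal ∂μ := by
    rw [← lintegral_add_right _ hm1, lintegral_congr hp, lintegral_add_left (by fun_prop)]
    simp
  have hfin : ∫⁻ t, (g t).toENNReal ∂μ ≠ ⊤ := by
    refine ne_top_of_le_ne_top ENNReal.ofReal_ne_top (b := ENNReal.ofReal M) ?_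
    calc ∫⁻ t, (g t).toENNReal ∂μ ≤ ∫⁻ _t, ENNReal.ofReal M ∂μ :=
          lintegral_mono fun t => by
            have := EReal.toENNReal_le_toENNReal (hg t)
            simpa using this
      _ = ENNReal.ofReal M := by simp
  rw [eIntegral]
  generalize ∫⁻ t, (-(g t - M)).toENNReal ∂μ = I at *
  generalize ∫⁻ t, (g t).toENNReal ∂μ = p at *
  generalize ∫⁻ t, (-g t).toENNReal ∂μ = m at *
  by_cases hm : m = ⊤
  · have hIt : I = ⊤ := by
      by_contra h
      rw [hm] at hI
      simp [ENNReal.add_eq_top, h, hfin] at hI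
    lift p to NNReal using hfin
    rw [hm, hIt]
    simp
  · have hIt : I ≠ ⊤ := by
      intro h
      rw [h] at hI
      simp [hm, eq_comm (a := (⊤ : ENNReal)), ENNReal.add_eq_top] at hI
    lift p to NNReal using hfin
    lift m to NNReal using hm
    lift I to NNReal using hIt
    have h1 : (I : ℝ) + p = M + m := by
      have := congrArg ENNReal.toReal hI
      rwa [ENNReal.toReal_add (by simp) (by simp), ENNReal.toReal_add (by simp) (by simp),
        ENNReal.toReal_ofReal hM] at this
    have h2 : ((p : ℝ) - m) = M + -(I : ℝ) := by linarith
    have h3 : ((((p : ℝ) - m : ℝ)) : EReal) = ((M + -(I : ℝ) : ℝ) : EReal) := by rw [h2]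
    rw [EReal.coe_sub, EReal.coe_add, EReal.coe_neg] at h3
    exact h3

lemma measurable_comp_of_pshOn {n : ℕ} {f : (Fin n → ℂ) → EReal} {Ω : Set (Fin n → ℂ)}
    (hf : PSHOn f Ω) {α : Type*} [TopologicalSpace α] [MeasurableSpace α] [OpensMeasurableSpace α]
    {γ : α → Fin n → ℂ} (hγ : Continuous γ) (h : ∀ t, γ t ∈ Ω) : Measurable fun t => f (γ t) := by
  have h1 : UpperSemicontinuousOn (fun t => f (γ t)) Set.univ :=
    hf.usc.comp hγ.continuousOn fun t _ => h t
  exact (upperSemicontinuousOn_univ_iff.1 h1).measurable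

/-- Recentring and rescaling of a plurisubharmonic function to the unit polydisk. -/
lemma PSHOn.rescale {n : ℕ} {f : (Fin n → ℂ) → EReal} {Ω : Set (Fin n → ℂ)} (hf : PSHOn f Ω)
    {M : ℝ} (hM : 0 ≤ M) (p c : Fin n → ℂ)
    (hΩ : ∀ x ∈ polydisk n, (fun k => p k + c k * x k) ∈ Ω)
    (hle : ∀ x ∈ polydisk n, f (fun k => p k + c k * x k) ≤ M) :
    PSHOn (fun x => f (fun k => p k + c k * x k) - M) (polydisk n) := by
  have hcont : Continuous fun (x : Fin n → ℂ) k => p k + c k * x k := by fun_prop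
  refine ⟨fun x hx => ?_, ?_, fun x b hb => ?_⟩
  · have := hf.lt_top _ (hΩ x hx)
    exact (EReal.sub_lt_iff (by simp) (by simp)).2 (by simpa using this)
  · have h1 : UpperSemicontinuousOn (fun x => f (fun k => p k + c k * x k)) (polydisk n) :=
      hf.usc.comp hcont.continuousOn hΩ
    intro x hx y hy
    have hy' : f (fun k => p k + c k * x k) < y + M := by
      rwa [EReal.sub_lt_iff (by simp) (by simp)] at hy
    filter_upwards [h1 x hx _ hy'] with z hz
    rwa [EReal.sub_lt_iff (by simp) (by simp)]
  · have h1 := hf.subMean (fun k => p k + c k * x k) (fun k => c k * b k) fun ζ hζ => by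
      have := hΩ _ (hb ζ hζ)
      convert this using 2 with k
      simp; ring
    have hγ (θ : ℝ) : x + expI θ • b ∈ polydisk n := hb _ (by simp)
    have e1 (θ : ℝ) : (fun k => p k + c k * x k) + Complex.exp (θ * Complex.I) • (fun k => c k * b k)
        = fun k => p k + c k * (x + expI θ • b) k := by
      ext k; simp [expI]; ring
    simp only [e1] at h1
    have hm : Measurable fun θ : ℝ => f (fun k => p k + c k * (x + expI θ • b) k) := by
      refine measurable_comp_of_pshOn hf ?_ fun θ => hΩ _ (hγ θ)
      have := continuous_expI
      fun_prop
    rw [eIntegral_of_le hm hM fun θ => hle _ (hγ θ)] at h1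
    have h2 : eIntegral angleMeasure (fun θ => f (fun k => p k + c k * (x + expI θ • b) k) - M)
        = _ := eIntegral_of_nonpos angleMeasure fun θ => by
      have := EReal.sub_le_sub (hle _ (hγ θ)) (le_refl (M : EReal))
      refine this.trans (le_of_eq ?_)
      rw [← EReal.coe_sub, sub_self]; rfl
    change _ ≤ eIntegral angleMeasure (fun θ => f (fun k => p k + c k * (x + expI θ • b) k) - M)
    rw [h2, EReal.sub_le_iff_le_add (by simp) (by simp), add_comm]
    exact h1

/-- Local integrability forces finiteness almost everywhere, hence somewhere in every nonempty open
subset of the polydisk. -/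
lemma NegPSH.exists_mem_ne_bot {n : ℕ} {f : (Fin n → ℂ) → EReal} (hf : NegPSH f)
    {U : Set (Fin n → ℂ)} (hU : IsOpen U) (hne : (U ∩ polydisk n).Nonempty) :
    ∃ x ∈ U ∩ polydisk n, f x ≠ ⊥ := by
  obtain ⟨x, hxU, hxD⟩ := hne
  obtain ⟨r, hr, hrs⟩ := Metric.nhds_basis_closedBall.mem_iff.1
    ((hU.inter (isOpen_polydisk n)).mem_nhds ⟨hxU, hxD⟩)
  have h1 := hf.lintegral_pot_lt_top (isCompact_closedBall x r) fun y hy => (hrs hy).2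
  have h2 := ae_lt_top hf.measurable_pot h1.ne
  have hne : (ae (volume.restrict (Metric.closedBall x r))).NeBot := by
    rw [ae_neBot]
    simpa using ((Metric.measure_ball_pos volume x hr).trans_le
      (measure_mono Metric.ball_subset_closedBall)).ne'
  obtain ⟨y, hy, hyb⟩ := (h2.and (ae_restrict_mem
    Metric.isClosed_closedBall.measurableSet)).exists
  refine ⟨y, hrs hyb, fun h => ?_⟩
  rw [pot_of_mem (hrs hyb).2, h] at hy
  simp at hy

/-- Near a point of the logarithmic domain, the convex image is, up to a translation and an
additive constant, that of a negative plurisubharmonic function on the unit polydisk. -/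
lemma exists_rescaled {n : ℕ} {Ω : Set (Fin n → ℂ)} (hΩ : IsOpen Ω)
    {f : (Fin n → ℂ) → EReal} (hf : PSHOn f Ω) (hfD : NegPSH f)
    {u : Fin n → ℝ} (hu : u ∈ logDomain Ω) :
    ∃ (δ M : ℝ) (g : (Fin n → ℂ) → EReal), 0 < δ ∧ NegPSH g ∧
      ∀ v : Fin n → ℝ, (∀ k, v k < δ) →
        convexImage f (fun k => u k + v k) = ((convexReal g (fun k => v k - δ) + M : ℝ) : EReal) := by
  obtain ⟨hu0, huΩ⟩ := hu
  let K : Set (Fin n → ℂ) := Set.pi Set.univ fun k => Metric.closedBall 0 (Real.exp (u k))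
  have hK : IsCompact K := isCompact_univ_pi fun k => isCompact_closedBall _ _
  have hKΩ : K ⊆ Ω := fun x hx => huΩ x fun k => by simpa [K] using hx k (Set.mem_univ k)
  obtain ⟨ε, hε, hεΩ⟩ := hK.exists_cthickening_subset_open hΩ hKΩ
  -- Since `e^{u k} ≤ 1`, enlarging the radii by the factor `e^δ = 1 + ε` moves points by at most
  -- `ε`, so the enlarged closed polydisk still lies in `Ω`.
  set δ := Real.log (1 + ε) with hδ
  have hδ0 : 0 < δ := Real.log_pos (by linarith)
  have hexpδ : Real.exp δ = 1 + ε := Real.exp_log (by linarith)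
  have hbig (x : Fin n → ℂ) (hx : ∀ k, ‖x k‖ ≤ Real.exp (u k + δ)) : x ∈ Ω := by
    refine hεΩ (Metric.mem_cthickening_of_dist_le x (fun k => (Real.exp (-δ) : ℂ) * x k) ε K ?_ ?_)
    · intro k _
      simp only [mem_closedBall_zero_iff, norm_mul, Complex.norm_real, Real.norm_eq_abs,
        abs_of_pos (Real.exp_pos _)]
      calc Real.exp (-δ) * ‖x k‖ ≤ Real.exp (-δ) * Real.exp (u k + δ) := by gcongr; exact hx k
        _ = Real.exp (u k) := by rw [← Real.exp_add]; ring_nf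
    · rw [dist_pi_le_iff hε.le]
      intro k
      have h1 : 0 ≤ 1 - Real.exp (-δ) := by
        have := Real.exp_le_one_iff.2 (by linarith : -δ ≤ 0); linarith
      have h2 : x k - (Real.exp (-δ) : ℂ) * x k = ((1 - Real.exp (-δ) : ℝ) : ℂ) * x k := by
        push_cast; ring
      rw [dist_eq_norm, h2, norm_mul, Complex.norm_real, Real.norm_eq_abs, abs_of_nonneg h1]
      calc (1 - Real.exp (-δ)) * ‖x k‖ ≤ (1 - Real.exp (-δ)) * Real.exp (u k + δ) := by
            gcongr; exact hx k
        _ = Real.exp (u k) * (Real.exp δ - 1) := by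
            rw [Real.exp_add, Real.exp_neg]; field_simp
        _ ≤ 1 * (Real.exp δ - 1) := by
            have : Real.exp (u k) ≤ 1 := Real.exp_le_one_iff.2 (hu0 k)
            have h3 : 0 ≤ Real.exp δ - 1 := by rw [hexpδ]; linarith
            gcongr
        _ = ε := by rw [hexpδ]; ring
  let K' : Set (Fin n → ℂ) := Set.pi Set.univ fun k => Metric.closedBall 0 (Real.exp (u k + δ))
  have hK' : IsCompact K' := isCompact_univ_pi fun k => isCompact_closedBall _ _
  have hK'Ω : K' ⊆ Ω := fun x hx => hbig x fun k => by simpa [K'] using hx k (Set.mem_univ k)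
  -- An upper semicontinuous function attains its maximum on the compact polydisk. The bound is
  -- raised to be nonnegative because `PSHOn.rescale` requires this; `f` may well be positive
  -- outside the unit polydisk.
  obtain ⟨M, hM0, hM⟩ : ∃ M : ℝ, 0 ≤ M ∧ ∀ x ∈ K', f x ≤ M := by
    obtain ⟨x₀, hx₀, hmax⟩ := (hf.usc.mono hK'Ω).exists_isMaxOn
      ⟨0, fun k _ => by simp [Real.exp_nonneg]⟩ hK'
    refine ⟨max (f x₀).toReal 0, le_max_right _ _, fun x hx => (hmax hx).trans ?_⟩
    refine (EReal.le_coe_toReal (hf.lt_top _ (hK'Ω hx₀)).ne).trans ?_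
    exact_mod_cast le_max_left _ _
  let c : Fin n → ℂ := fun k => (Real.exp (u k + δ) : ℂ)
  have hcn (k : Fin n) : ‖c k‖ = Real.exp (u k + δ) := by
    rw [Complex.norm_real, Real.norm_eq_abs, abs_of_pos (Real.exp_pos _)]
  have hmem (x : Fin n → ℂ) (hx : x ∈ polydisk n) : (fun k => 0 + c k * x k) ∈ K' := by
    intro k _
    simp only [zero_add, mem_closedBall_zero_iff, norm_mul, hcn]
    exact mul_le_of_le_one_right (Real.exp_nonneg _) (hx k).le
  let g : (Fin n → ℂ) → EReal := fun x => f (fun k => 0 + c k * x k) - M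
  have hgle (x : Fin n → ℂ) (hx : x ∈ polydisk n) : g x ≤ 0 := by
    have := EReal.sub_le_sub (hM _ (hmem x hx)) (le_refl (M : EReal))
    refine this.trans (le_of_eq ?_)
    rw [← EReal.coe_sub, sub_self]; rfl
  have hg : NegPSH g := by
    refine ⟨hf.rescale hM0 0 c (fun x hx => hK'Ω (hmem x hx)) fun x hx => hM _ (hmem x hx),
      hgle, ?_⟩
    let U : Set (Fin n → ℂ) := Set.pi Set.univ fun k => Metric.ball 0 (Real.exp (u k + δ))
    have hU : IsOpen U := isOpen_set_pi Set.finite_univ fun _ _ => Metric.isOpen_ball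
    obtain ⟨y, hy, hyb⟩ := hfD.exists_mem_ne_bot hU ⟨0, fun k _ => by simp [Real.exp_pos],
      fun k => by simp⟩
    have hck (k : Fin n) : c k ≠ 0 := by
      rw [← norm_pos_iff, hcn]; exact Real.exp_pos _
    refine ⟨fun k => y k / c k, fun k => ?_, ?_⟩
    · have := hy.1 k (Set.mem_univ k)
      rw [mem_ball_zero_iff] at this
      rw [norm_div, hcn, div_lt_one (Real.exp_pos _)]
      exact this
    · have e : (fun k => (0 : ℂ) + c k * (y k / c k)) = y := by
        ext k
        have := hck k
        field_simp
        ring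
      simp only [g, e]
      rw [sub_eq_add_neg, ← EReal.coe_neg]
      simp [EReal.add_eq_bot_iff, hyb, -EReal.coe_neg]
  refine ⟨δ, M, g, hδ0, hg, fun v hv => ?_⟩
  have hvn : ∀ k, v k - δ < 0 := fun k => by linarith [hv k]
  have e1 (θ : Fin n → ℝ) : (fun k => ((Real.exp (u k + v k) : ℝ) : ℂ) * expI (θ k))
      = fun k => 0 + c k * ((Real.exp (v k - δ) : ℂ) * expI (θ k)) := by
    ext k
    rw [zero_add, ← mul_assoc, ← Complex.ofReal_mul, ← Real.exp_add]
    rw [show u k + δ + (v k - δ) = u k + v k by ring]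
  have hin (θ : Fin n → ℝ) : (fun k => ((Real.exp (v k - δ) : ℝ) : ℂ) * expI (θ k)) ∈ polydisk n :=
    mul_expI_mem (exp_mem_polydisk hvn) θ
  have hme : Measurable fun θ : Fin n → ℝ =>
      f (fun k => ((Real.exp (u k + v k) : ℝ) : ℂ) * expI (θ k)) := by
    refine measurable_comp_of_pshOn hf ?_ fun θ => ?_
    · have := continuous_expI
      fun_prop
    · rw [e1]; exact hK'Ω (hmem _ (hin θ))
  have h1 : convexImage f (fun k => u k + v k) = _ :=
    eIntegral_of_le (μ := torusAngle n) hme hM0 fun θ => by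
      rw [e1]; exact hM _ (hmem _ (hin θ))
  have h2 := hg.convexImage_eq hvn
  have h3 := eIntegral_of_nonpos (torusAngle n) (g := fun θ : Fin n → ℝ =>
    g (fun k => ((Real.exp (v k - δ) : ℝ) : ℂ) * expI (θ k))) fun θ => hgle _ (hin θ)
  have h4 : convexImage g (fun k => v k - δ) = _ := h3
  rw [h1, EReal.coe_add, ← h2, h4, add_comm]
  simp only [e1]
  rfl

lemma isNegPSH_of_pshOn {n : ℕ} {Ω : Set (Fin n → ℂ)} (hD : polydisk n ⊆ Ω)
    {f : (Fin n → ℂ) → EReal} (hf : PSHOn f Ω) (hneg : ∀ x ∈ polydisk n, f x ≤ 0)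
    (hne : ∃ x ∈ polydisk n, f x ≠ ⊥) : NegPSH f := ⟨hf.mono hD, hneg, hne⟩

/-! ### Limits of difference quotients of the convex image -/

section ConvexImage

variable {n : ℕ} {Ω : Set (Fin n → ℂ)} {f : (Fin n → ℂ) → EReal} {u : Fin n → ℝ}

lemma convexImage_finite (hΩ : IsOpen Ω) (hf : PSHOn f Ω) (hfD : NegPSH f)
    (hu : u ∈ logDomain Ω) : convexImage f u ≠ ⊥ ∧ convexImage f u ≠ ⊤ := by
  obtain ⟨δ, M, g, hδ, hg, h⟩ := exists_rescaled hΩ hf hfD hu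
  have := h 0 fun k => by simpa using hδ
  simp only [Pi.zero_apply, add_zero] at this
  rw [this]
  exact ⟨EReal.coe_ne_bot _, EReal.coe_ne_top _⟩

/-- `exists_rescaled`, together with the equality of the asymptotic slopes. -/
lemma exists_rescaled_slope (hΩ : IsOpen Ω) (hf : PSHOn f Ω) (hfD : NegPSH f)
    (hu : u ∈ logDomain Ω) :
    ∃ (δ M : ℝ) (h : (Fin n → ℝ) → ℝ), 0 < δ ∧ NegConvex h ∧
      (∀ v : Fin n → ℝ, (∀ k, v k < δ) →
        convexImage f (fun k => u k + v k) = ((h (fun k => v k - δ) + M : ℝ) : EReal)) ∧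
      ∀ d : Fin n → ℝ, 0 ≤ d → asympSlope h d = asympSlope (convexReal f) d := by
  obtain ⟨δ, M, g, hδ, hg, h⟩ := exists_rescaled hΩ hf hfD hu
  refine ⟨δ, M, convexReal g, hδ, hg.negConvex, h, fun d hd => ?_⟩
  -- The ray starting at `u - 1` lies in the region where both convex images are defined. There they
  -- differ by a translation and the constant `M`, neither of which changes slopes.
  have h1 := hg.negConvex.tendsto_slope (u := fun _ => -1 - δ) (fun k => by
    show -1 - δ < 0
    linarith) hd
  have hu1 : (fun k => u k - 1) ∈ negOrthant n := fun k => by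
    show u k - 1 < 0
    linarith [hu.1 k]
  have h2 := hfD.negConvex.tendsto_slope hu1 hd
  have h3 : Tendsto (fun v : ℝ => M / v) atBot (𝓝 0) := tendsto_const_nhds.div_atBot tendsto_id
  have h4 := h1.add h3
  rw [add_zero] at h4
  refine tendsto_nhds_unique h4 (h2.congr' ?_)
  filter_upwards [eventually_lt_atBot 0] with v hv
  have hvd (k : Fin n) : v * d k ≤ 0 := mul_nonpos_of_nonpos_of_nonneg hv.le (hd k)
  have e1 := h (fun k => -1 + v * d k) fun k => by linarith [hvd k]
  have e2 := hfD.convexImage_eq (u := (fun k => u k - 1) + v • d)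
    (add_smul_mem_negOrthant hu1 hd hv.le)
  have e3 : (fun k => u k + (-1 + v * d k)) = (fun k => u k - 1) + v • d := by
    ext k; simp; ring
  have e4 : (fun k => -1 + v * d k - δ) = (fun _ => -1 - δ) + v • d := by
    ext k; simp; ring
  rw [e3, e2, e4] at e1
  rw [EReal.coe_eq_coe_iff.1 e1, add_div]

lemma tendsto_convexImage (hΩ : IsOpen Ω) (hf : PSHOn f Ω) (hfD : NegPSH f)
    (hu : u ∈ logDomain Ω) {d : Fin n → ℝ} (hd : 0 ≤ d) :
    Tendsto (fun v : ℝ => ((v⁻¹ : ℝ) : EReal) * convexImage f (fun k => u k + d k * v)) atBot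
      (𝓝 (asympSlope (convexReal f) d : EReal)) := by
  obtain ⟨δ, M, h, hδ, hh, hr, hs⟩ := exists_rescaled_slope hΩ hf hfD hu
  have h1 := hh.tendsto_slope (u := fun _ => -δ) (fun k => by
    show -δ < 0
    linarith) hd
  have h3 : Tendsto (fun v : ℝ => M / v) atBot (𝓝 0) := tendsto_const_nhds.div_atBot tendsto_id
  have h4 := h1.add h3
  rw [add_zero, hs d hd] at h4
  refine ((continuous_coe_real_ereal.tendsto _).comp h4).congr' ?_
  filter_upwards [eventually_lt_atBot 0] with v hv
  have hvd (k : Fin n) : d k * v ≤ 0 := mul_nonpos_of_nonneg_of_nonpos (hd k) hv.le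
  rw [hr (fun k => d k * v) fun k => by linarith [hvd k], ← EReal.coe_mul]
  have e4 : (fun k => d k * v - δ) = (fun _ => -δ) + v • d := by
    ext k; simp; ring
  simp only [Function.comp, e4]
  congr 1
  ring

lemma tendsto_convexImage_update (hΩ : IsOpen Ω) (hf : PSHOn f Ω) (hfD : NegPSH f)
    (hu : u ∈ logDomain Ω) (k : Fin n) :
    Tendsto (fun v : ℝ => ((v⁻¹ : ℝ) : EReal) * convexImage f (Function.update u k (u k + v))) atBot
      (𝓝 (asympSlope (convexReal f) (Pi.single k 1) : EReal)) := by
  refine (tendsto_convexImage hΩ hf hfD hu (d := Pi.single k 1) (by simp)).congr fun v => ?_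
  congr 2
  ext l
  by_cases h : l = k
  · subst h; simp
  · simp [h]

/-- Convexity squeezes both one-sided derivatives at `v` between the unit-step difference quotients
ending at `v` and at `v + 1`, which have the same limit. The margin `δ > 0` keeps all these points
in the domain. -/
lemma exists_deriv_convexImage (hΩ : IsOpen Ω) (hf : PSHOn f Ω) (hfD : NegPSH f)
    (hu : u ∈ logDomain Ω) :
    ∃ dl dr : ℝ → ℝ,
      (∀ v < 0,
        HasDerivWithinAt (fun s : ℝ => (convexImage f (fun k => u k + s)).toReal)
          (dl v) (Set.Iio v) v ∧
        HasDerivWithinAt (fun s : ℝ => (convexImage f (fun k => u k + s)).toReal)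
          (dr v) (Set.Ioi v) v) ∧
      Tendsto dl atBot (𝓝 (asympSlope (convexReal f) 1)) ∧
      Tendsto dr atBot (𝓝 (asympSlope (convexReal f) 1)) := by
  obtain ⟨δ, M, h, hδ, hh, hr, hs⟩ := exists_rescaled_slope hΩ hf hfD hu
  have hmem (v : ℝ) (hv : v < δ) : (fun _ => -δ) + v • (1 : Fin n → ℝ) ∈ negOrthant n := by
    intro k
    simp only [Pi.add_apply, Pi.smul_apply, Pi.one_apply, smul_eq_mul, mul_one]
    linarith
  set G : ℝ → ℝ := fun s => h ((fun _ => -δ) + s • (1 : Fin n → ℝ)) with hG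
  have hGc : ConvexOn ℝ (Set.Iio δ) G := hh.convexOn_line (convex_Iio δ) hmem
  have hFG (s : ℝ) (hsδ : s < δ) : (convexImage f (fun k => u k + s)).toReal = G s + M := by
    rw [hr (fun _ => s) fun _ => hsδ, EReal.toReal_coe]
    congr 2
    ext k; simp; ring
  have hInt (v : ℝ) (hv : v < δ) : v ∈ interior (Set.Iio δ) := by simpa using hv
  have hquot := (hh.slope_quotient (u := fun _ => -δ) (d := 1) zero_le_one hmem one_pos).1
  rw [hs 1 zero_le_one] at hquot
  have hlow (v : ℝ) (hv : v < δ) : (G v - G (v - 1)) / 1 ≤ derivWithin G (Set.Iio v) v := by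
    have := hGc.slope_le_leftDeriv_of_mem_interior (x := v - 1) (y := v)
      (show v - 1 < δ by linarith) (hInt v hv) (by linarith)
    rw [slope_def_field] at this
    simpa using this
  have hupp (v : ℝ) (hv : v + 1 < δ) :
      derivWithin G (Set.Ioi v) v ≤ (G (v + 1) - G (v + 1 - 1)) / 1 := by
    have := hGc.rightDeriv_le_slope_of_mem_interior (x := v) (y := v + 1)
      (hInt v (by linarith)) (show v + 1 < δ from hv) (by linarith)
    rw [slope_def_field] at this
    simpa using this
  have hlr (v : ℝ) (hv : v < δ) := hGc.leftDeriv_le_rightDeriv_of_mem_interior (hInt v hv)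
  have hquot' := hquot.comp (tendsto_atBot_add_const_right atBot (1 : ℝ) tendsto_id)
  refine ⟨fun v => derivWithin G (Set.Iio v) v, fun v => derivWithin G (Set.Ioi v) v,
    fun v hv => ⟨?_, ?_⟩, ?_, ?_⟩
  · refine ((hGc.hasDerivWithinAt_leftDeriv_of_mem_interior (hInt v (by linarith))).add_const M
      ).congr_of_eventuallyEq ?_ (hFG v (by linarith))
    filter_upwards [self_mem_nhdsWithin] with s hs'
    exact hFG s (lt_trans hs' (by linarith))
  · refine ((hGc.hasDerivWithinAt_rightDeriv_of_mem_interior (hInt v (by linarith))).add_const M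
      ).congr_of_eventuallyEq ?_ (hFG v (by linarith))
    filter_upwards [nhdsWithin_le_nhds (Iio_mem_nhds (show v < δ by linarith))] with s hs'
    exact hFG s hs'
  · refine tendsto_of_tendsto_of_tendsto_of_le_of_le' hquot hquot' ?_ ?_
    · filter_upwards [eventually_lt_atBot δ] with v hv using hlow v hv
    · filter_upwards [eventually_lt_atBot (δ - 1)] with v hv
      exact (hlr v (by linarith)).trans (hupp v (by linarith))
  · refine tendsto_of_tendsto_of_tendsto_of_le_of_le' hquot hquot' ?_ ?_
    · filter_upwards [eventually_lt_atBot δ] with v hv using (hlow v hv).trans (hlr v hv)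
    · filter_upwards [eventually_lt_atBot (δ - 1)] with v hv
      exact hupp v (by linarith)

end ConvexImage

/-! ### Means in one variable -/

section Slice

variable {n : ℕ} {f : (Fin (n + 1) → ℂ) → EReal}

lemma lintegral_torus_insertNth {G : (Fin (n + 1) → ℝ) → ENNReal} (hG : Measurable G)
    (k : Fin (n + 1)) :
    ∫⁻ θ, G θ ∂torusAngle (n + 1)
      = ∫⁻ θ, ∫⁻ t, G (k.insertNth t θ) ∂angleMeasure ∂torusAngle n := by
  have hi : Measurable fun p : ℝ × (Fin n → ℝ) => (k.insertNth p.1 p.2 : Fin (n + 1) → ℝ) :=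
    (by fun_prop : Continuous fun p : ℝ × (Fin n → ℝ) =>
      (k.insertNth p.1 p.2 : Fin (n + 1) → ℝ)).measurable
  have h := (measurePreserving_piFinSuccAbove (fun _ : Fin (n + 1) => angleMeasure) k).symm
  have h2 := h.lintegral_comp hG
  rw [lintegral_lintegral_swap (f := fun (θ : Fin n → ℝ) (t : ℝ) => G (k.insertNth t θ))
    (hG.comp (hi.comp measurable_swap)).aemeasurable]
  rw [torusAngle, ← h2, lintegral_prod]
  · rfl
  · exact (hG.comp hi).aemeasurable

/-- The mean of `-f` over the circle `|x_k| = e^v`. -/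
def sliceMean {n : ℕ} (f : (Fin (n + 1) → ℂ) → EReal) (k : Fin (n + 1)) (v : ℝ)
    (y : Fin n → ℂ) : ENNReal :=
  ∫⁻ θ, pot f (k.insertNth ((Real.exp v : ℂ) * expI θ) y) ∂angleMeasure

lemma insertNth_mem_polydisk {k : Fin (n + 1)} {z : ℂ} {y : Fin n → ℂ} :
    (k.insertNth z y : Fin (n + 1) → ℂ) ∈ polydisk (n + 1) ↔ ‖z‖ < 1 ∧ y ∈ polydisk n := by
  simp [polydisk, Fin.forall_iff_succAbove k]

lemma measurable_insertNth (k : Fin (n + 1)) :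
    Measurable fun p : ℂ × (Fin n → ℂ) => (k.insertNth p.1 p.2 : Fin (n + 1) → ℂ) :=
  (by fun_prop : Continuous fun p : ℂ × (Fin n → ℂ) =>
      (k.insertNth p.1 p.2 : Fin (n + 1) → ℂ)).measurable

lemma norm_exp_mul_expI (v θ : ℝ) : ‖(Real.exp v : ℂ) * expI θ‖ = Real.exp v := by
  rw [norm_mul, norm_expI, mul_one, Complex.norm_real, Real.norm_eq_abs,
    abs_of_pos (Real.exp_pos _)]

lemma NegPSH.measurable_slice (hf : NegPSH f) (k : Fin (n + 1)) (v : ℝ) :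
    Measurable fun p : (Fin n → ℂ) × ℝ =>
      pot f (k.insertNth ((Real.exp v : ℂ) * expI p.2) p.1) := by
  have he := measurable_expI
  exact hf.measurable_pot.comp ((measurable_insertNth k).comp (by fun_prop :
    Measurable fun p : (Fin n → ℂ) × ℝ => ((Real.exp v : ℂ) * expI p.2, p.1)))

lemma NegPSH.measurable_sliceMean (hf : NegPSH f) (k : Fin (n + 1)) (v : ℝ) :
    Measurable (sliceMean f k v) :=
  (hf.measurable_slice k v).lintegral_prod_right'

/-- Torus means are torus means of means in one variable. -/
lemma NegPSH.lintegral_torus_eq_slice (hf : NegPSH f) (k : Fin (n + 1)) {x c : Fin (n + 1) → ℂ}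
    (hx : x k = 0) {v : ℝ} (hc : c k = Real.exp v) :
    ∫⁻ θ, pot f (fun j => x j + c j * expI (θ j)) ∂torusAngle (n + 1)
      = ∫⁻ θ, sliceMean f k v (fun j => x (k.succAbove j) + c (k.succAbove j) * expI (θ j))
          ∂torusAngle n := by
  have he := measurable_expI
  have hm := hf.measurable_pot
  rw [lintegral_torus_insertNth (by fun_prop) k]
  refine lintegral_congr fun θ => lintegral_congr fun t => ?_
  congr 1
  rw [Fin.eq_insertNth_iff]
  refine ⟨by simp [hx, hc], ?_⟩
  ext j
  simp [Fin.removeNth]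

lemma NegPSH.superMean_sliceMean (hf : NegPSH f) (k : Fin (n + 1)) {v : ℝ} (hv : v < 0) :
    SuperMean (sliceMean f k v) := by
  have hexp : Real.exp v < 1 := Real.exp_lt_one_iff.2 hv
  have hmem (θ : ℝ) (y : Fin n → ℂ) (hy : y ∈ polydisk n) :
      (k.insertNth ((Real.exp v : ℂ) * expI θ) y : Fin (n + 1) → ℂ) ∈ polydisk (n + 1) :=
    insertNth_mem_polydisk.2 ⟨by rwa [norm_exp_mul_expI], hy⟩
  refine ⟨lowerSemicontinuousOn_lintegral
    (Φ := fun y θ => pot f (k.insertNth ((Real.exp v : ℂ) * expI θ) y)) (fun y => ?_) fun θ => ?_,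
    fun y b hb => ?_⟩
  · have hec := continuous_expI
    refine hf.measurable_pot.comp (Continuous.measurable ?_)
    fun_prop
  · refine hf.superMean.lsc.comp
      (g := fun y : Fin n → ℂ => (k.insertNth ((Real.exp v : ℂ) * expI θ) y : Fin (n + 1) → ℂ)) ?_
      fun y hy => hmem θ y hy
    exact Continuous.continuousOn (by fun_prop)
  · unfold sliceMean
    have he := measurable_expI
    rw [lintegral_lintegral_swap (f := fun φ θ : ℝ =>
      pot f (k.insertNth ((Real.exp v : ℂ) * expI θ) (y + expI φ • b)))]
    · refine lintegral_mono fun θ => ?_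
      have e (ζ : ℂ) : k.insertNth ((Real.exp v : ℂ) * expI θ) y + ζ • k.insertNth (0 : ℂ) b
          = (k.insertNth ((Real.exp v : ℂ) * expI θ) (y + ζ • b) : Fin (n + 1) → ℂ) := by
        rw [Fin.eq_insertNth_iff]
        refine ⟨by simp, ?_⟩
        ext j
        simp [Fin.removeNth]
      have h := hf.superMean.mean_le (k.insertNth ((Real.exp v : ℂ) * expI θ) y)
        (k.insertNth 0 b) fun ζ hζ => by
          rw [e]; exact hmem θ _ (hb ζ hζ)
      simp only [e] at h
      exact h
    · have hec := continuous_expI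
      refine (hf.measurable_pot.comp (Continuous.measurable ?_)).aemeasurable
      fun_prop

/-- A super-mean function dominates its means over tori. -/
lemma SuperMean.lintegral_torus_le {q : (Fin n → ℂ) → ENNReal} (hq : SuperMean q)
    (hqm : Measurable q) {y c : Fin n → ℂ}
    (h : ∀ z : Fin n → ℂ, (∀ k, ‖z k‖ ≤ ‖c k‖) → y + z ∈ polydisk n) :
    ∫⁻ θ, q (fun j => y j + c j * expI (θ j)) ∂torusAngle n ≤ q y := by
  have he := measurable_expI
  -- A common rotation `φ` of all angles can be inserted for free. For fixed `θ` the average over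
  -- `φ` is a mean over the disc through `y` in direction `(c j e^{iθ j})_j`.
  have h1 (φ : ℝ) : ∫⁻ θ, q (fun j => y j + c j * expI (θ j)) ∂torusAngle n
      = ∫⁻ θ, q (fun j => y j + c j * (expI φ * expI (θ j))) ∂torusAngle n := by
    have := lintegral_torus_mul (G := fun z : Fin n → ℂ => q fun j => y j + c j * z j)
      (by fun_prop) (c := fun _ => expI φ) fun _ => norm_expI φ
    exact this.symm
  calc ∫⁻ θ, q (fun j => y j + c j * expI (θ j)) ∂torusAngle n
      = ∫⁻ φ, ∫⁻ θ, q (fun j => y j + c j * (expI φ * expI (θ j))) ∂torusAngle n ∂angleMeasure := by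
        simp only [← h1]; simp
    _ = ∫⁻ θ, ∫⁻ φ, q (fun j => y j + c j * (expI φ * expI (θ j))) ∂angleMeasure ∂torusAngle n :=
        lintegral_lintegral_swap (by fun_prop)
    _ ≤ ∫⁻ _θ, q y ∂torusAngle n := by
        refine lintegral_mono fun θ => ?_
        have := hq.mean_le y (fun j => c j * expI (θ j)) fun ζ hζ => h _ fun k => by
          simp only [Pi.smul_apply, smul_eq_mul, norm_mul, norm_expI, mul_one]
          exact mul_le_of_le_one_left (norm_nonneg _) hζ
        refine le_trans (le_of_eq (lintegral_congr fun φ => ?_)) this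
        congr 1
        ext j
        simp; ring
    _ = q y := by simp

/-- Averaging a circle mean over the remaining angles gives back the full torus mean; this transfers
bounds for the convex image to slice means. -/
lemma NegPSH.torusMean_sliceMean (hf : NegPSH f) (k : Fin (n + 1)) (v : ℝ) {y : Fin n → ℂ}
    (hy : ∀ j, y j ≠ 0) : torusMean (sliceMean f k v) y
      = logMean (pot f) (k.insertNth v fun j => Real.log ‖y j‖) := by
  have h := hf.lintegral_torus_eq_slice k (x := 0) (c := k.insertNth (Real.exp v : ℂ) y) (v := v)
    rfl (by simp)
  simp only [Pi.zero_apply, zero_add, Fin.insertNth_apply_succAbove] at h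
  rw [torusMean, ← h]
  change torusMean (pot f) (k.insertNth (Real.exp v : ℂ) y) = _
  refine torusMean_congr_norm hf.measurable_pot fun j => ?_
  rcases Fin.eq_self_or_eq_succAbove k j with rfl | ⟨l, rfl⟩
  · simp
  · simp [Real.exp_log (norm_pos_iff.2 (hy l))]

/-- The convex image lies below its asymptote. -/
lemma NegConvex.insertNth_le {h : (Fin (n + 1) → ℝ) → ℝ} (hh : NegConvex h) (k : Fin (n + 1))
    {v : ℝ} (hv : v < 0) {u : Fin n → ℝ} (hu : u ∈ negOrthant n) :
    h (k.insertNth v u) ≤ v * asympSlope h (Pi.single k 1) := by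
  -- The asymptote bound is started at the `k`-th coordinate `-ε`, where `h ≤ 0`; then `ε → 0`.
  have key : ∀ ε : ℝ, 0 < ε → ε < -v →
      h (k.insertNth v u) ≤ (v + ε) * asympSlope h (Pi.single k 1) := by
    intro ε hε hεv
    have h1 := hh.le_add_slope (u := k.insertNth (-ε) u) (d := Pi.single k 1) (v := v + ε)
      (by simpa [negOrthant, Fin.forall_iff_succAbove k, hε] using hu) (by simp) (by linarith)
    have e : (k.insertNth (-ε) u : Fin (n + 1) → ℝ) + (v + ε) • Pi.single k 1
        = k.insertNth v u := by
      rw [Fin.eq_insertNth_iff]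
      refine ⟨by simp, ?_⟩
      ext j
      simp [Fin.removeNth]
    rw [e] at h1
    linarith [hh.nonpos (k.insertNth (-ε) u)]
  have hlim : Tendsto (fun ε : ℝ => (v + ε) * asympSlope h (Pi.single k 1)) (𝓝[>] 0)
      (𝓝 ((v + 0) * asympSlope h (Pi.single k 1))) :=
    ((tendsto_const_nhds.add tendsto_id).mul_const _).mono_left nhdsWithin_le_nhds
  rw [add_zero] at hlim
  refine ge_of_tendsto hlim ?_
  filter_upwards [self_mem_nhdsWithin, nhdsWithin_le_nhds (Iio_mem_nhds (by linarith : 0 < -v))]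
    with ε h1 h2 using key ε h1 h2

lemma NegPSH.le_logMean_insertNth (hf : NegPSH f) (k : Fin (n + 1))
    {v : ℝ} (hv : v < 0) {u : Fin n → ℝ} (hu : u ∈ negOrthant n) :
    ENNReal.ofReal (-v * asympSlope (convexReal f) (Pi.single k 1))
      ≤ logMean (pot f) (k.insertNth v u) := by
  rw [← hf.ofReal_neg_convexReal (u := k.insertNth v u)
    ((Fin.forall_iff_succAbove k).2 ⟨by simpa using hv, fun j => by simpa using hu j⟩)]
  refine ENNReal.ofReal_le_ofReal ?_
  linarith [hf.negConvex.insertNth_le k hv hu]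

lemma lintegral_ball_torusMean {q : (Fin n → ℂ) → ENNReal} (hm : Measurable q) {r : ℝ}
    (hr : 0 < r) : ∫⁻ x in Metric.ball 0 r, torusMean q x = ∫⁻ x in Metric.ball 0 r, q x := by
  have he := measurable_expI
  unfold torusMean
  rw [lintegral_lintegral_swap (by fun_prop)]
  have h (θ : Fin n → ℝ) : ∫⁻ x in Metric.ball (0 : Fin n → ℂ) r, q (fun k => x k * expI (θ k))
      = ∫⁻ x in Metric.ball 0 r, q x := by
    have hr' : MeasurePreserving (fun (y : Fin n → ℂ) k => expI (θ k) * y k) volume volume :=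
      measurePreserving_rotation fun k => norm_expI (θ k)
    have h2 := hr'.setLIntegral_comp_preimage (s := Metric.ball 0 r)
      Metric.isOpen_ball.measurableSet hm
    have h3 : (fun (y : Fin n → ℂ) k => expI (θ k) * y k) ⁻¹' Metric.ball 0 r
        = Metric.ball 0 r := by
      ext y
      simp [pi_norm_lt_iff hr]
    rw [← h2, h3]
    simp only [mul_comm]
  simp only [h]
  simp

/-- Lower bound of the slice means near the centre. -/
lemma NegPSH.le_sliceMean_of_small (hf : NegPSH f) (k : Fin (n + 1)) {v : ℝ} (hv : v < 0)
    {ε : ℝ} (hε : 0 < ε) (hε' : ε < 1 / 2) {y : Fin n → ℂ} (hy : ‖y‖ ≤ ε) :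
    ENNReal.ofReal ((1 - 2 * ε) ^ (2 * n) * (-v * asympSlope (convexReal f) (Pi.single k 1)))
      ≤ sliceMean f k v y := by
  set A := -v * asympSlope (convexReal f) (Pi.single k 1) with hA
  have hA0 : 0 ≤ A := mul_nonneg (by linarith) (hf.negConvex.asympSlope_nonneg (by simp))
  have hr0 : 0 < 1 / 2 - ε := by linarith
  -- The ball of radius `1/2` about `y` contains the ball of radius `1/2 - ε` about `0`. On the
  -- latter the slice mean may be replaced by its torus mean, which is at least `A`. The ratio of
  -- the volumes is `(1 - 2ε)^{2n}`.
  have h1 := (hf.superMean_sliceMean k hv).lintegral_ball_le (hf.measurable_sliceMean k v)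
    (x := y) (r := 1 / 2) (by linarith)
  have h2 : ∫⁻ x in Metric.ball 0 (1 / 2 - ε), sliceMean f k v x
      ≤ ∫⁻ x in Metric.ball y (1 / 2), sliceMean f k v x := by
    refine lintegral_mono_set (Metric.ball_subset_ball' ?_)
    rw [dist_comm, dist_zero_right]
    linarith
  have h3 : ENNReal.ofReal A * volume (Metric.ball (0 : Fin n → ℂ) (1 / 2 - ε))
      ≤ ∫⁻ x in Metric.ball 0 (1 / 2 - ε), sliceMean f k v x := by
    rw [← lintegral_ball_torusMean (hf.measurable_sliceMean k v) hr0, ← setLIntegral_const]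
    refine lintegral_mono_ae ?_
    filter_upwards [ae_restrict_of_ae (ae_coord_ne_zero n),
      ae_restrict_mem Metric.isOpen_ball.measurableSet] with x hx hxb
    rw [hf.torusMean_sliceMean k v hx]
    refine hf.le_logMean_insertNth k hv fun j => Real.log_neg (norm_pos_iff.2 (hx j)) ?_
    have := (norm_le_pi_norm x j).trans_lt (mem_ball_zero_iff.1 hxb)
    linarith
  have h4 := h3.trans (h2.trans h1)
  have hfr : Module.finrank ℝ (Fin n → ℂ) = 2 * n := by
    simp [Module.finrank_pi_fintype, mul_comm]
  rw [Measure.addHaar_ball_of_pos _ _ hr0,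
    Measure.addHaar_ball_of_pos _ y (by norm_num : (0 : ℝ) < 1 / 2), hfr,
    ← mul_assoc, ← mul_assoc, ENNReal.mul_le_mul_iff_left (Metric.measure_ball_pos _ _ one_pos).ne'
      measure_ball_lt_top.ne, ← ENNReal.ofReal_mul hA0] at h4
  have e : (1 - 2 * ε) ^ (2 * n) * A = A * (1 / 2 - ε) ^ (2 * n) * 2 ^ (2 * n) := by
    rw [mul_assoc, ← mul_pow]; ring
  rw [e, ENNReal.ofReal_mul (by positivity)]
  calc _ ≤ sliceMean f k v y * ENNReal.ofReal ((1 / 2) ^ (2 * n)) * ENNReal.ofReal (2 ^ (2 * n)) := by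
        gcongr
    _ = _ := by
        rw [mul_assoc, ← ENNReal.ofReal_mul (by positivity), ← mul_pow]
        norm_num

/-- The slice means dominate the generic slope at every point. -/
lemma NegPSH.le_sliceMean (hf : NegPSH f) (k : Fin (n + 1)) {v : ℝ} (hv : v < 0)
    {y : Fin n → ℂ} (hy : y ∈ polydisk n) :
    ENNReal.ofReal (-v * asympSlope (convexReal f) (Pi.single k 1)) ≤ sliceMean f k v y := by
  set L := asympSlope (convexReal f) (Pi.single k 1) with hL
  have hL0 : 0 ≤ L := hf.negConvex.asympSlope_nonneg (by simp)
  obtain ⟨R, hR1, hR⟩ : ∃ R : ℝ, 1 < R ∧ R * ‖y‖ < 1 := by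
    rw [polydisk_eq_ball, mem_ball_zero_iff] at hy
    rcases eq_or_lt_of_le (norm_nonneg y) with h | h
    · exact ⟨2, by norm_num, by rw [← h]; norm_num⟩
    · refine ⟨(1 + ‖y‖⁻¹) / 2, ?_, ?_⟩
      · have := one_lt_inv₀ h |>.2 hy; linarith
      · rw [div_mul_eq_mul_div, add_mul, inv_mul_cancel₀ h.ne']; linarith
  set l := Real.log R with hl
  have hl0 : 0 < l := Real.log_pos hR1
  have hexpl : Real.exp l = R := Real.exp_log (by linarith)
  -- Move along `s ↦ e^s y` while the logarithm of the radius moves as `v + α s`. On the left edge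
  -- `Re s = log ε` the point is near `0` and `NegPSH.le_sliceMean_of_small` applies with a much
  -- smaller circle. On the right edge `Re s = log R` the trivial bound `0` is used. The choice of
  -- `α` makes the logarithmic radius on the right edge equal to `-ε`, so interpolation at `s = 0`
  -- loses only an amount that vanishes with `ε`.
  have key : ∀ ε : ℝ, 0 < ε → ε < 1 / 2 → ε < -v →
      ENNReal.ofReal ((1 - 2 * ε) ^ (2 * n) * ((-v - ε) * L)) ≤ sliceMean f k v y := by
    intro ε hε hε' hεv
    set α := (-v - ε) / l with hα
    have hα0 : 0 < α := div_pos (by linarith) hl0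
    have hαl : α * l = -v - ε := div_mul_cancel₀ _ hl0.ne'
    set a := Real.log ε with ha
    have ha0 : a < 0 := Real.log_neg hε (by linarith)
    set G : ℂ → ENNReal := fun s =>
      ∫⁻ θ, pot f (k.insertNth (Complex.exp (v + α * s) * expI θ) fun j => Complex.exp s * y j)
        ∂angleMeasure with hG
    have hmem (s : ℂ) (hs : s.re ≤ l) (θ : ℝ) : (k.insertNth (Complex.exp (v + α * s) * expI θ)
        (fun j => Complex.exp s * y j) : Fin (n + 1) → ℂ) ∈ polydisk (n + 1) := by
      rw [insertNth_mem_polydisk]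
      constructor
      · rw [norm_mul, norm_expI, mul_one, Complex.norm_exp, Real.exp_lt_one_iff]
        simp only [Complex.add_re, Complex.ofReal_re, Complex.re_ofReal_mul]
        have := mul_le_mul_of_nonneg_left hs hα0.le
        linarith
      · intro j
        rw [norm_mul, Complex.norm_exp]
        have h1 := norm_le_pi_norm y j
        have h2 : Real.exp s.re ≤ R := by rw [← hexpl]; exact Real.exp_le_exp.2 hs
        calc Real.exp s.re * ‖y j‖ ≤ R * ‖y‖ := by gcongr
          _ < 1 := hR
    have he := measurable_expI
    have hec := continuous_expI
    have hGs (s : ℂ) : G s = sliceMean f k (v + α * s.re) fun j => Complex.exp s * y j := by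
      obtain ⟨t, ht⟩ : ∃ t, Complex.exp (v + α * s) = (Real.exp (v + α * s.re) : ℂ) * expI t := by
        refine ⟨α * s.im, ?_⟩
        rw [expI, Complex.ofReal_exp, ← Complex.exp_add]
        congr 1
        conv_lhs => rw [← Complex.re_add_im s]
        push_cast; ring
      simp only [hG, ht]
      have := lintegral_angle_expI_mul (fun z => pot f (k.insertNth
        ((Real.exp (v + α * s.re) : ℂ) * z) fun j => Complex.exp s * y j)) (expI t) (norm_expI t)
      simp only [← mul_assoc] at this
      exact this
    set B := (1 - 2 * ε) ^ (2 * n) * (-(v + α * a) * L) with hB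
    have hva : v + α * a < 0 := by
      have := mul_neg_of_pos_of_neg hα0 ha0
      linarith
    have hB0 : 0 ≤ B := mul_nonneg (pow_nonneg (by linarith) _) (mul_nonneg (by linarith) hL0)
    have h := strip_min_principle (G := G) (α := a) (β := l) (c₀ := B * l / (l - a))
      (c₁ := -B / (l - a)) ?_ ?_ ?_ ?_ ?_ 0 ⟨by simpa using ha0.le, by simpa using hl0.le⟩
    · have h0 : G 0 = sliceMean f k v y := by rw [hGs]; simp
      rw [h0] at h
      refine le_trans (ENNReal.ofReal_le_ofReal ?_) h
      simp only [Complex.zero_re, mul_zero, add_zero]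
      rw [le_div_iff₀ (by linarith), hB]
      have hp : 0 ≤ (1 - 2 * ε) ^ (2 * n) := pow_nonneg (by linarith) _
      have : (-v - ε) * (l - a) ≤ -(v + α * a) * l := by
        have e : -(v + α * a) * l = -v * l - (α * l) * a := by ring
        rw [e, hαl]
        nlinarith
      calc _ = (1 - 2 * ε) ^ (2 * n) * L * ((-v - ε) * (l - a)) := by ring
        _ ≤ (1 - 2 * ε) ^ (2 * n) * L * (-(v + α * a) * l) := by gcongr
        _ = _ := by ring
    · refine lowerSemicontinuousOn_lintegral (Φ := fun s θ => pot f (k.insertNth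
          (Complex.exp (v + α * s) * expI θ) fun j => Complex.exp s * y j))
        (fun s => hf.measurable_pot.comp (Continuous.measurable (by fun_prop))) fun θ => ?_
      refine hf.superMean.lsc.comp (g := fun s : ℂ => (k.insertNth (Complex.exp (v + α * s) * expI θ)
        (fun j => Complex.exp s * y j) : Fin (n + 1) → ℂ)) ?_ fun s hs => hmem s hs.2 θ
      exact Continuous.continuousOn (by fun_prop)
    · intro s
      rw [hGs, hGs, Complex.exp_add, Complex.exp_two_pi_mul_I]
      simp
    · intro s ρ hρ _ hs
      simp only [hG]
      rw [lintegral_lintegral_swap (f := fun (φ θ : ℝ) => pot f (k.insertNth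
        (Complex.exp (v + α * (s + ρ * expI φ)) * expI θ)
        fun j => Complex.exp (s + ρ * expI φ) * y j))]
      · refine lintegral_mono fun θ => ?_
        have := hf.mean_le_holomorphic (γ := fun ζ => (k.insertNth
          (Complex.exp (v + α * (s + ρ * ζ)) * expI θ)
          (fun j => Complex.exp (s + ρ * ζ) * y j) : Fin (n + 1) → ℂ)) ?_ fun ζ hζ => ?_
        · simpa using this
        · rw [differentiable_pi]
          intro j
          rcases Fin.eq_self_or_eq_succAbove k j with rfl | ⟨m, rfl⟩
          · simp only [Fin.insertNth_apply_same]; fun_prop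
          · simp only [Fin.insertNth_apply_succAbove]; fun_prop
        · refine hmem _ ?_ θ
          have h2 := (le_abs_self _).trans ((Complex.abs_re_le_norm ζ).trans hζ)
          simp only [Complex.add_re, Complex.re_ofReal_mul]
          nlinarith
      · refine (hf.measurable_pot.comp (Continuous.measurable ?_)).aemeasurable
        fun_prop
    · intro s hs
      have e : B * l / (l - a) + -B / (l - a) * a = B := by
        have : l - a ≠ 0 := by linarith
        field_simp
        ring
      rw [e, hGs, hs]
      refine hf.le_sliceMean_of_small k hva hε hε' ?_
      rw [pi_norm_le_iff_of_nonneg hε.le]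
      intro j
      rw [norm_mul, Complex.norm_exp, hs, Real.exp_log hε]
      exact mul_le_of_le_one_right hε.le (hy j).le
    · intro s hs
      have e : B * l / (l - a) + -B / (l - a) * l = 0 := by ring
      rw [e]
      simp
  have hlim : Tendsto (fun ε : ℝ => ENNReal.ofReal ((1 - 2 * ε) ^ (2 * n) * ((-v - ε) * L)))
      (𝓝[>] 0) (𝓝 (ENNReal.ofReal ((1 - 2 * 0) ^ (2 * n) * ((-v - 0) * L)))) := by
    refine (ENNReal.continuous_ofReal.tendsto _).comp (Tendsto.mono_left ?_ nhdsWithin_le_nhds)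
    exact (by fun_prop : Continuous fun ε : ℝ => (1 - 2 * ε) ^ (2 * n) * ((-v - ε) * L)).tendsto 0
  simp only [mul_zero, sub_zero, one_pow, one_mul] at hlim
  refine le_of_tendsto hlim ?_
  filter_upwards [self_mem_nhdsWithin, nhdsWithin_le_nhds (Iio_mem_nhds (by linarith : 0 < -v)),
    nhdsWithin_le_nhds (Iio_mem_nhds (by norm_num : (0 : ℝ) < 1 / 2))] with ε h1 h2 h3
  exact key ε h1 h3 h2

end Slice

/-! ### Generic slopes -/

/-- The base point need not lie in the orthant, only some point of its line; this covers the base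
point `0` and the limiting radius `1`. -/
lemma NegConvex.tendsto_slope_shift {n : ℕ} {h : (Fin n → ℝ) → ℝ} (hh : NegConvex h)
    {u d : Fin n → ℝ} {c : ℝ} (hd : 0 ≤ d) (hu : u + c • d ∈ negOrthant n) :
    Tendsto (fun v : ℝ => h (u + v • d) / v) atBot (𝓝 (asympSlope h d)) := by
  have h3 := (hh.tendsto_slope hu hd).comp (tendsto_atBot_add_const_right _ (-c) tendsto_id)
  have h4 : Tendsto (fun v : ℝ => 1 + (-c) / v) atBot (𝓝 (1 + 0)) :=
    tendsto_const_nhds.add (tendsto_const_nhds.div_atBot tendsto_id)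
  have h5 := h3.mul h4
  rw [add_zero, mul_one] at h5
  refine h5.congr' ?_
  filter_upwards [eventually_lt_atBot 0, eventually_lt_atBot c] with v hv hv2
  have e : u + c • d + (v + -c) • d = u + v • d := by
    rw [add_assoc, ← add_smul]; congr 2; ring
  simp only [Function.comp, id, e]
  have : v ≠ 0 := hv.ne
  have : v + -c ≠ 0 := by linarith
  field_simp

/-! ### Restriction to lines parallel to a coordinate axis. -/

section Line

variable {n : ℕ} {f : (Fin (n + 1) → ℂ) → EReal}

/-- Restriction to a line parallel to the `k`-th axis. -/
lemma NegPSH.restrictLine (hf : NegPSH f) (k : Fin (n + 1)) {y : Fin n → ℂ} (hy : y ∈ polydisk n)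
    (hne : ∃ z : ℂ, ‖z‖ < 1 ∧ f (k.insertNth z y) ≠ ⊥) :
    NegPSH fun z : Fin 1 → ℂ => f (k.insertNth (z 0) y) := by
  have hmem (z : Fin 1 → ℂ) (hz : z ∈ polydisk 1) :
      (k.insertNth (z 0) y : Fin (n + 1) → ℂ) ∈ polydisk (n + 1) :=
    insertNth_mem_polydisk.2 ⟨hz 0, hy⟩
  have e (z b : Fin 1 → ℂ) (ζ : ℂ) : (k.insertNth (z 0) y : Fin (n + 1) → ℂ)
      + ζ • k.insertNth (b 0) (0 : Fin n → ℂ) = k.insertNth ((z + ζ • b) 0) y := by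
    rw [Fin.eq_insertNth_iff]
    refine ⟨by simp, ?_⟩
    ext j
    simp [Fin.removeNth]
  refine ⟨⟨fun z hz => hf.psh.lt_top _ (hmem z hz), ?_, fun z b hb => ?_⟩,
    fun z hz => hf.nonpos _ (hmem z hz), ?_⟩
  · refine hf.psh.usc.comp (g := fun z : Fin 1 → ℂ => (k.insertNth (z 0) y : Fin (n + 1) → ℂ)) ?_ hmem
    exact Continuous.continuousOn (by fun_prop)
  · have h := hf.psh.subMean (k.insertNth (z 0) y) (k.insertNth (b 0) 0) fun ζ hζ => by
      rw [e]; exact hmem _ (hb ζ hζ)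
    simp only [e] at h
    exact h
  · obtain ⟨z, hz, h⟩ := hne
    exact ⟨fun _ => z, fun _ => hz, h⟩

lemma NegPSH.logMean_restrictLine (hf : NegPSH f) (k : Fin (n + 1)) {y : Fin n → ℂ}
    (hy : y ∈ polydisk n) (hne : ∃ z : ℂ, ‖z‖ < 1 ∧ f (k.insertNth z y) ≠ ⊥) {v : ℝ} (hv : v < 0) :
    logMean (pot fun z : Fin 1 → ℂ => f (k.insertNth (z 0) y)) (fun _ => v)
      = sliceMean f k v y := by
  have hg := hf.restrictLine k hy hne
  have hm := hg.measurable_pot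
  have he := measurable_expI
  rw [logMean, torusMean, lintegral_torus_insertNth (by fun_prop) 0]
  have h (θ : Fin 0 → ℝ) : ∫⁻ t, pot (fun z : Fin 1 → ℂ => f (k.insertNth (z 0) y))
      (fun j => (Real.exp v : ℂ) * expI ((Fin.insertNth 0 t θ : Fin 1 → ℝ) j)) ∂angleMeasure
      = sliceMean f k v y := by
    refine lintegral_congr fun t => ?_
    have hz : ‖(Real.exp v : ℂ) * expI t‖ < 1 := by
      rw [norm_exp_mul_expI]; exact Real.exp_lt_one_iff.2 hv
    rw [pot_of_mem, pot_of_mem (insertNth_mem_polydisk.2 ⟨hz, hy⟩)]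
    · simp
    · intro j
      obtain rfl : j = 0 := Subsingleton.elim _ _
      simpa using hz
  simp only [h]
  simp

end Line

/-! ### Sums of super-mean functions -/

lemma SuperMean.tsum {n : ℕ} {q : ℕ → (Fin n → ℂ) → ENNReal} (hq : ∀ j, SuperMean (q j))
    (hqm : ∀ j, Measurable (q j)) : SuperMean fun y => ∑' j, q j y := by
  refine ⟨lowerSemicontinuousOn_tsum fun j => (hq j).lsc, fun y b hb => ?_⟩
  have he := measurable_expI
  rw [lintegral_tsum fun j => by have := hqm j; fun_prop]
  exact ENNReal.tsum_le_tsum fun j => (hq j).mean_le y b hb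

/-- The hypothesis `c ≤ a * q` ensures that the subtraction in `[0, ∞]` is never truncated, so it
commutes with means. -/
lemma SuperMean.mul_sub {n : ℕ} {q : (Fin n → ℂ) → ENNReal} (hq : SuperMean q)
    (hqm : Measurable q) {a c : NNReal} (hc : ∀ y ∈ polydisk n, (c : ENNReal) ≤ a * q y) :
    SuperMean fun y => a * q y - c := by
  refine ⟨fun y hy t ht => ?_, fun y b hb => ?_⟩
  · have h1 : LowerSemicontinuousOn (fun y => a * q y) (polydisk n) := by
      have hcont : Continuous fun t : ENNReal => a * t := ENNReal.continuous_const_mul (by simp)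
      exact hcont.comp_lowerSemicontinuousOn hq.lsc fun s t hst => by dsimp only; gcongr
    change t < a * q y - c at ht
    rw [lt_tsub_iff_right] at ht
    filter_upwards [h1 y hy _ ht] with z hz
    exact lt_tsub_iff_right.2 hz
  · have he := measurable_expI
    have h0 (θ : ℝ) : (c : ENNReal) ≤ a * q (y + expI θ • b) := hc _ (hb _ (by simp))
    rw [lintegral_sub (by fun_prop) (by simp) (Eventually.of_forall h0),
      lintegral_const_mul _ (by fun_prop)]
    simp only [lintegral_const, measure_univ, mul_one]
    gcongr
    exact hq.mean_le y b hb

/-! ### Slopes along generic lines and at points of the coordinate hyperplanes. -/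

section Generic

variable {n : ℕ} {f : (Fin (n + 1) → ℂ) → EReal}

/-- Outside a pluripolar set, the slope along lines parallel to the `k`-th axis is the generic
one. -/
lemma NegPSH.exists_pluripolar (hf : NegPSH f) (k : Fin (n + 1)) :
    ∃ E : Set (Fin n → ℂ), IsPluripolarIn E (polydisk n) ∧ (∃ y ∈ polydisk n, y ∉ E) ∧
      ∀ y ∈ polydisk n, y ∉ E → ∃ g : (Fin 1 → ℂ) → EReal, NegPSH g ∧
        (∀ v < 0, logMean (pot g) (fun _ => v) = sliceMean f k v y) ∧
        asympSlope (convexReal g) 1 = asympSlope (convexReal f) (Pi.single k 1) := by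
  set L := asympSlope (convexReal f) (Pi.single k 1) with hL
  have hL0 : 0 ≤ L := hf.negConvex.asympSlope_nonneg (by simp)
  have hins (v : ℝ) : (k.insertNth v (fun _ => -1) : Fin (n + 1) → ℝ)
      = k.insertNth 0 (fun _ => -1) + v • Pi.single k 1 := by
    symm
    rw [Fin.eq_insertNth_iff]
    refine ⟨by simp, ?_⟩
    ext j
    simp [Fin.removeNth]
  have hneg (v : ℝ) (hv : v < 0) : (k.insertNth v (fun _ => -1) : Fin (n + 1) → ℝ)
      ∈ negOrthant (n + 1) :=
    (Fin.forall_iff_succAbove k).2 ⟨by simpa using hv, fun j => by simp⟩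
  have hlim : Tendsto (fun v : ℝ => convexReal f (k.insertNth v fun _ => -1) / v) atBot (𝓝 L) := by
    have := hf.negConvex.tendsto_slope_shift (u := k.insertNth 0 (fun _ => -1))
      (d := Pi.single k 1) (c := -1) (by simp) (by rw [← hins]; exact hneg _ (by norm_num))
    simpa only [← hins] using this
  -- Radii `v j → -∞` at which the quotient over the torus `|y_l| = e^{-1}` is within `2^{-j}` of
  -- `L`; the geometric rate makes the excesses summable.
  have hex (j : ℕ) : ∃ v : ℝ, v < -(j : ℝ) ∧ v < 0 ∧
      convexReal f (k.insertNth v fun _ => -1) / v < L + (1 / 2) ^ j := by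
    have h1 : L < L + (1 / 2 : ℝ) ^ j := by
      have : (0 : ℝ) < (1 / 2) ^ j := by positivity
      linarith
    exact ((eventually_lt_atBot (-(j : ℝ))).and ((eventually_lt_atBot 0).and
      (hlim.eventually (gt_mem_nhds h1)))).exists
  choose v hvj hv0 hvL using hex
  let a : ℕ → NNReal := fun j => Real.toNNReal (-(v j))⁻¹
  have ha (j : ℕ) : ((a j : ENNReal)) = ENNReal.ofReal (-(v j))⁻¹ := rfl
  let c : NNReal := Real.toNNReal L
  have hqm (j : ℕ) := hf.measurable_sliceMean k (v j)
  have hsm (j : ℕ) := hf.superMean_sliceMean k (hv0 j)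
  have hcle (j : ℕ) (y : Fin n → ℂ) (hy : y ∈ polydisk n) :
      (c : ENNReal) ≤ a j * sliceMean f k (v j) y := by
    have h1 := hf.le_sliceMean k (hv0 j) hy
    calc (c : ENNReal) = ENNReal.ofReal (-(v j))⁻¹ * ENNReal.ofReal (-(v j) * L) := by
          rw [← ENNReal.ofReal_mul (inv_nonneg.2 (by linarith [hv0 j])), ← mul_assoc,
            inv_mul_cancel₀ (by linarith [hv0 j]), one_mul]
          rfl
      _ ≤ _ := by rw [ha]; gcongr
  -- The normalized excess over the universal lower bound `L`. It is nonnegative at every point by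
  -- `NegPSH.le_sliceMean`, hence super-mean, and so is the sum over `j`.
  let q : ℕ → (Fin n → ℂ) → ENNReal := fun j y => a j * sliceMean f k (v j) y - c
  have hq (j : ℕ) : SuperMean (q j) := (hsm j).mul_sub (hqm j) (hcle j)
  have hqmeas (j : ℕ) : Measurable (q j) := by
    have := hqm j
    exact (this.const_mul _).sub_const _
  have hQ := SuperMean.tsum hq hqmeas
  have he := measurable_expI
  have hQm : Measurable fun y => ∑' j, q j y := Measurable.tsum hqmeas
  let y₀ : Fin n → ℂ := fun _ => (Real.exp (-1) : ℂ)
  have hy₀ : y₀ ∈ polydisk n := exp_mem_polydisk (u := fun _ => -1) fun _ => by norm_num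
  have hy₀D (θ : Fin n → ℝ) : (fun l => y₀ l * expI (θ l)) ∈ polydisk n := mul_expI_mem hy₀ θ
  have hmean (j : ℕ) : torusMean (q j) y₀ ≤ ENNReal.ofReal ((1 / 2) ^ j) := by
    have h1 := hf.torusMean_sliceMean k (v j) (y := y₀) fun l => by
      simp only [y₀]; exact_mod_cast (Real.exp_pos _).ne'
    have h2 : (fun l : Fin n => Real.log ‖y₀ l‖) = fun _ => -1 := by
      ext l
      simp only [y₀, Complex.norm_real, Real.norm_eq_abs, abs_of_pos (Real.exp_pos _),
        Real.log_exp]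
    rw [h2, ← hf.ofReal_neg_convexReal (hneg _ (hv0 j))] at h1
    have h3 : torusMean (q j) y₀ = a j * torusMean (sliceMean f k (v j)) y₀ - c := by
      unfold torusMean
      have := hqm j
      simp only [q]
      rw [lintegral_sub (by fun_prop) (by simp)
        (Eventually.of_forall fun θ => hcle j _ (hy₀D θ)), lintegral_const_mul _ (by fun_prop)]
      simp
    rw [h3, h1, ha, ← ENNReal.ofReal_mul (inv_nonneg.2 (by linarith [hv0 j])),
      tsub_le_iff_right]
    have h4 : ((c : NNReal) : ENNReal) = ENNReal.ofReal L := rfl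
    rw [h4, ← ENNReal.ofReal_add (by positivity) hL0]
    refine ENNReal.ofReal_le_ofReal ?_
    have h5 := (hvL j).le
    have h6 : (-(v j))⁻¹ * -convexReal f (k.insertNth (v j) fun _ => -1)
        = convexReal f (k.insertNth (v j) fun _ => -1) / v j := by
      have := (hv0 j).ne
      field_simp
    linarith
  -- The sum has finite mean over one torus and is therefore finite somewhere. So its negative is an
  -- admissible plurisubharmonic function, and `E` is the set where the sum diverges.
  have hfin : torusMean (fun y => ∑' j, q j y) y₀ < ⊤ := by
    have hθm : Measurable fun (θ : Fin n → ℝ) l => y₀ l * expI (θ l) := by fun_prop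
    unfold torusMean
    rw [lintegral_tsum (f := fun j (θ : Fin n → ℝ) => q j fun l => y₀ l * expI (θ l))
      fun j => ((hqmeas j).comp hθm).aemeasurable]
    refine (ENNReal.tsum_le_tsum hmean).trans_lt ?_
    rw [← ENNReal.ofReal_tsum_of_nonneg (fun _ => by positivity) summable_geometric_two]
    exact ENNReal.ofReal_lt_top
  obtain ⟨θ₀, hθ₀⟩ := (ae_lt_top (by fun_prop) hfin.ne).exists
  refine ⟨{y | y ∈ polydisk n ∧ ∑' j, q j y = ⊤}, ⟨fun y hy => hy.1, _, hQ.pshOn,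
    ⟨_, hy₀D θ₀, fun h => ?_⟩, fun y hy => by simp [hy.2]⟩, ⟨_, hy₀D θ₀, fun h => hθ₀.ne h.2⟩, ?_⟩
  · have : ((∑' j, q j (fun l => y₀ l * expI (θ₀ l)) : ENNReal) : EReal) = ⊤ := by
      simpa using h
    exact hθ₀.ne (EReal.coe_ennreal_eq_top_iff.1 this)
  intro y hy hyE
  have hyfin : ∑' j, q j y ≠ ⊤ := fun h => hyE ⟨hy, h⟩
  have hq0 := ENNReal.tendsto_atTop_zero_of_tsum_ne_top hyfin
  have hHfin (j : ℕ) : sliceMean f k (v j) y ≠ ⊤ := by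
    intro h
    have h1 : q j y = ⊤ := by
      simp only [q, h]
      have : (a j : ENNReal) ≠ 0 := by
        rw [ha]; simpa using (hv0 j)
      simp [ENNReal.mul_top this]
    exact ENNReal.ne_top_of_tsum_ne_top hyfin j h1
  have hne : ∃ z : ℂ, ‖z‖ < 1 ∧ f (k.insertNth z y) ≠ ⊥ := by
    have hm : Measurable fun θ : ℝ => pot f (k.insertNth ((Real.exp (v 0) : ℂ) * expI θ) y) := by
      have := continuous_expI
      exact hf.measurable_pot.comp (Continuous.measurable (by fun_prop))
    obtain ⟨θ, hθ⟩ := (ae_lt_top hm (hHfin 0)).exists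
    have hz : ‖(Real.exp (v 0) : ℂ) * expI θ‖ < 1 := by
      rw [norm_exp_mul_expI]; exact Real.exp_lt_one_iff.2 (hv0 0)
    refine ⟨_, hz, fun h => hθ.ne ?_⟩
    rw [pot_of_mem (insertNth_mem_polydisk.2 ⟨hz, hy⟩), h]
    simp
  have hg := hf.restrictLine k hy hne
  have hgl := fun v (hv : v < 0) => hf.logMean_restrictLine k hy hne hv
  refine ⟨_, hg, hgl, ?_⟩
  set g : (Fin 1 → ℂ) → EReal := fun z => f (k.insertNth (z 0) y)
  have h1 := hg.negConvex.tendsto_slope_shift (u := 0) (d := 1) (c := -1) zero_le_one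
    (fun _ => by simp)
  have hvbot : Tendsto v atTop atBot := by
    refine tendsto_atBot_mono (fun j => (hvj j).le) ?_
    exact tendsto_neg_atTop_atBot.comp tendsto_natCast_atTop_atTop
  have h2 := h1.comp hvbot
  -- Off `E` the terms `q j y` tend to `0`. They measure exactly how far the quotient along the line
  -- at radius `v j` is from `L`, and one sequence suffices to identify a slope known to exist.
  have hbound (j : ℕ) : convexReal g (0 + v j • 1) / v j = L + (q j y).toReal := by
    have e : (0 : Fin 1 → ℝ) + v j • 1 = fun _ => v j := by ext; simp
    have h3 : (q j y).toReal = (-(v j))⁻¹ * (sliceMean f k (v j) y).toReal - L := by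
      simp only [q]
      rw [ENNReal.toReal_sub_of_le (hcle j y hy) (ENNReal.mul_ne_top (by simp) (hHfin j)),
        ENNReal.toReal_mul, ha, ENNReal.toReal_ofReal (inv_nonneg.2 (by linarith [hv0 j]))]
      congr 1
      exact Real.coe_toNNReal _ hL0
    rw [e, h3, convexReal, hgl _ (hv0 j)]
    have := (hv0 j).ne
    field_simp
    ring
  have h4 : Tendsto (fun j => L + (q j y).toReal) atTop (𝓝 (L + 0)) := by
    refine tendsto_const_nhds.add ?_
    have := (ENNReal.tendsto_toReal ENNReal.zero_ne_top).comp hq0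
    rwa [ENNReal.toReal_zero] at this
  rw [add_zero] at h4
  refine tendsto_nhds_unique h2 (h4.congr fun j => ?_)
  exact (hbound j).symm

lemma NegPSH.tendsto_partialMean (hf : NegPSH f) (k : Fin (n + 1)) {y : Fin n → ℂ}
    (hy : y ∈ polydisk n) {g : (Fin 1 → ℂ) → EReal} (hg : NegPSH g)
    (hgl : ∀ v < 0, logMean (pot g) (fun _ => v) = sliceMean f k v y) {r : ℝ} (hr : 0 < r)
    (hr1 : r ≤ 1) :
    Tendsto (fun w : ℝ => (((Real.log w)⁻¹ : ℝ) : EReal) * partialMean f k (w * r) y)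
      (𝓝[>] 0) (𝓝 (asympSlope (convexReal g) 1 : EReal)) := by
  have hlr : Real.log r ≤ 0 := Real.log_nonpos hr.le hr1
  have h1 := (hg.negConvex.tendsto_slope_shift (u := fun _ => Real.log r) (d := 1) (c := -1)
    zero_le_one (fun _ => by
      show Real.log r + -1 * 1 < 0
      linarith)).comp Real.tendsto_log_nhdsGT_zero
  refine ((continuous_coe_real_ereal.tendsto _).comp h1).congr' ?_
  filter_upwards [self_mem_nhdsWithin, nhdsWithin_le_nhds (Iio_mem_nhds one_pos)] with w hw hw1
  have hw0 : (0 : ℝ) < w := hw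
  have hlw : Real.log w < 0 := Real.log_neg hw0 hw1
  have e1 : (fun _ => Real.log r) + Real.log w • (1 : Fin 1 → ℝ) = fun _ => Real.log (w * r) := by
    ext
    rw [Real.log_mul hw0.ne' hr.ne']
    simp [add_comm]
  have hwr : Real.log (w * r) < 0 := by
    rw [Real.log_mul hw0.ne' hr.ne']; linarith
  have h2 := hf.eIntegral_eq angleMeasure
    (γ := fun θ => k.insertNth (((w * r : ℝ) : ℂ) * expI θ) y) fun θ => by
      rw [insertNth_mem_polydisk]
      refine ⟨?_, hy⟩
      rw [norm_mul, norm_expI, mul_one, Complex.norm_real, Real.norm_eq_abs,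
        abs_of_pos (mul_pos hw0 hr)]
      exact (Real.log_neg_iff (mul_pos hw0 hr)).1 hwr
  have h3 : partialMean f k (w * r) y = ((convexReal g fun _ => Real.log (w * r) : ℝ) : EReal) := by
    refine h2.trans ?_
    rw [convexReal, hgl _ hwr, EReal.coe_neg]
    have h4 : sliceMean f k (Real.log (w * r)) y ≠ ⊤ := by
      rw [← hgl _ hwr]
      exact (hg.logMean_lt_top fun _ => hwr).ne
    have h5 : sliceMean f k (Real.log (w * r)) y
        = ∫⁻ θ, pot f (k.insertNth (((w * r : ℝ) : ℂ) * expI θ) y) ∂angleMeasure := by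
      rw [sliceMean, Real.exp_log (mul_pos hw0 hr)]
    rw [← h5]
    lift sliceMean f k (Real.log (w * r)) y to NNReal using h4 with s
    rfl
  simp only [Function.comp, e1]
  rw [h3, ← EReal.coe_mul]
  congr 1
  ring

/-- The polydisk of radius `ρ` about `x` lies in the unit polydisk; recentring turns the Lelong
number at `x` into one at the origin. -/
lemma NegPSH.recentre {m : ℕ} {f : (Fin m → ℂ) → EReal} (hf : NegPSH f) {x : Fin m → ℂ} {ρ : ℝ}
    (hρ : 0 < ρ) (hx : ‖x‖ + ρ ≤ 1) : NegPSH fun z => f fun k => x k + (ρ : ℂ) * z k := by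
  have hmem (z : Fin m → ℂ) (hz : z ∈ polydisk m) :
      (fun k => x k + (ρ : ℂ) * z k) ∈ polydisk m := fun k => by
    calc ‖x k + (ρ : ℂ) * z k‖ ≤ ‖x k‖ + ρ * ‖z k‖ := by
          refine (norm_add_le _ _).trans (le_of_eq ?_)
          rw [norm_mul, Complex.norm_real, Real.norm_eq_abs, abs_of_pos hρ]
      _ < ‖x‖ + ρ * 1 := by
          have := norm_le_pi_norm x k
          have := mul_lt_mul_of_pos_left (hz k) hρ
          linarith
      _ ≤ 1 := by linarith
  have h := hf.psh.rescale le_rfl x (fun _ => (ρ : ℂ)) hmem fun z hz => by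
    simpa using hf.nonpos _ (hmem z hz)
  simp only [EReal.coe_zero, sub_zero] at h
  refine ⟨h, fun z hz => hf.nonpos _ (hmem z hz), ?_⟩
  have hxD : x ∈ polydisk m := by
    rw [polydisk_eq_ball, mem_ball_zero_iff]; linarith
  obtain ⟨w, ⟨hw, -⟩, hwb⟩ := hf.exists_mem_ne_bot (Metric.isOpen_ball (x := x) (ε := ρ))
    ⟨x, Metric.mem_ball_self hρ, hxD⟩
  have hρ' : (ρ : ℂ) ≠ 0 := by exact_mod_cast hρ.ne'
  refine ⟨fun k => (w k - x k) / ρ, fun k => ?_, ?_⟩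
  · have h1 : ‖w k - x k‖ < ρ := by
      rw [mem_ball_iff_norm] at hw
      exact (norm_le_pi_norm (w - x) k).trans_lt hw
    rw [norm_div, Complex.norm_real, Real.norm_eq_abs, abs_of_pos hρ, div_lt_one hρ]
    exact h1
  · have e : (fun k => x k + (ρ : ℂ) * ((w k - x k) / ρ)) = w := by
      ext k; field_simp; ring
    rwa [e]

/-- Because `x k = 0`, the `k`-th circle stays centred at the origin, so the torus mean about `x` is
an average of slice means over a torus about the remaining coordinates. -/
lemma NegPSH.logMean_recentre_eq (hf : NegPSH f) {x : Fin (n + 1) → ℂ} {ρ : ℝ}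
    (hρ : 0 < ρ) (hx : ‖x‖ + ρ ≤ 1) (k : Fin (n + 1)) (hxk : x k = 0) {v : ℝ} (hv : v < 0) :
    logMean (pot fun z => f fun k => x k + (ρ : ℂ) * z k) (fun _ => v)
      = ∫⁻ θ, sliceMean f k (Real.log ρ + v)
          (fun j => x (k.succAbove j) + (Real.exp (Real.log ρ + v) : ℂ) * expI (θ j))
          ∂torusAngle n := by
  have h := hf.lintegral_torus_eq_slice k (x := x) (c := fun _ => (Real.exp (Real.log ρ + v) : ℂ))
    (v := Real.log ρ + v) hxk rfl
  rw [← h, logMean, torusMean]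
  refine lintegral_congr fun θ => ?_
  have hin : (fun k => ((Real.exp v : ℝ) : ℂ) * expI (θ k)) ∈ polydisk (n + 1) :=
    mul_expI_mem (exp_mem_polydisk fun _ => hv) θ
  have e : (fun j => x j + (ρ : ℂ) * (((Real.exp v : ℝ) : ℂ) * expI (θ j)))
      = fun j => x j + (Real.exp (Real.log ρ + v) : ℂ) * expI (θ j) := by
    ext j
    rw [Real.exp_add, Real.exp_log hρ]
    push_cast; ring
  rw [pot_of_mem hin, pot_of_mem]
  · rw [e]
  · intro j
    calc _ ≤ ‖x j‖ + Real.exp (Real.log ρ + v) := by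
          refine (norm_add_le _ _).trans (le_of_eq ?_)
          rw [norm_exp_mul_expI]
      _ < ‖x‖ + ρ := by
          have h1 := norm_le_pi_norm x j
          have h2 : Real.exp (Real.log ρ + v) < ρ := by
            rw [Real.exp_add, Real.exp_log hρ]
            exact mul_lt_of_lt_one_right hρ (Real.exp_lt_one_iff.2 hv)
          linarith
      _ ≤ 1 := hx

/-- The slope at a point of `{x_k = 0}` is at least the generic one. -/
lemma NegPSH.le_asympSlope_recentre (hf : NegPSH f) {x : Fin (n + 1) → ℂ} {ρ : ℝ}
    (hρ : 0 < ρ) (hx : ‖x‖ + ρ ≤ 1) (k : Fin (n + 1)) (hxk : x k = 0) :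
    asympSlope (convexReal f) (Pi.single k 1)
      ≤ asympSlope (convexReal fun z => f fun k => x k + (ρ : ℂ) * z k) 1 := by
  set L := asympSlope (convexReal f) (Pi.single k 1) with hL
  have hL0 : 0 ≤ L := hf.negConvex.asympSlope_nonneg (by simp)
  have hg := hf.recentre hρ hx
  have hlρ : Real.log ρ ≤ 0 := Real.log_nonpos hρ.le (by linarith [norm_nonneg x])
  have h1 := hg.negConvex.tendsto_slope_shift (u := 0) (d := 1) (c := -1) zero_le_one
    (fun _ => by simp)
  have h2 : Tendsto (fun v : ℝ => Real.log ρ * L / v + L) atBot (𝓝 (0 + L)) :=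
    (tendsto_const_nhds.div_atBot tendsto_id).add tendsto_const_nhds
  rw [zero_add] at h2
  refine le_of_tendsto_of_tendsto h2 h1 ?_
  filter_upwards [eventually_lt_atBot 0] with v hv
  have e : (0 : Fin (n + 1) → ℝ) + v • 1 = fun _ => v := by ext; simp
  rw [e]
  -- The lower bound for slice means holds at every point, so it survives averaging over any torus
  -- in the polydisk.
  have h3 : ENNReal.ofReal (-(Real.log ρ + v) * L)
      ≤ logMean (pot fun z => f fun k => x k + (ρ : ℂ) * z k) (fun _ => v) := by
    rw [hf.logMean_recentre_eq hρ hx k hxk hv]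
    calc ENNReal.ofReal (-(Real.log ρ + v) * L)
        = ∫⁻ _θ, ENNReal.ofReal (-(Real.log ρ + v) * L) ∂torusAngle n := by simp
      _ ≤ _ := by
        refine lintegral_mono fun θ => hf.le_sliceMean k (by linarith) fun j => ?_
        calc _ ≤ ‖x (k.succAbove j)‖ + Real.exp (Real.log ρ + v) := by
              refine (norm_add_le _ _).trans (le_of_eq ?_)
              rw [norm_exp_mul_expI]
          _ < ‖x‖ + ρ := by
              have h1 := norm_le_pi_norm x (k.succAbove j)
              have h2 : Real.exp (Real.log ρ + v) < ρ := by
                rw [Real.exp_add, Real.exp_log hρ]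
                exact mul_lt_of_lt_one_right hρ (Real.exp_lt_one_iff.2 hv)
              linarith
          _ ≤ 1 := hx
  rw [← hg.ofReal_neg_convexReal fun _ => hv, ENNReal.ofReal_le_ofReal_iff
    (neg_nonneg.2 (convexReal_nonpos _))] at h3
  have h4 : convexReal (fun z => f fun k => x k + (ρ : ℂ) * z k) (fun _ => v)
      ≤ (Real.log ρ + v) * L := by linarith
  have h5 := div_le_div_of_nonpos_of_le hv.le h4
  refine le_trans (le_of_eq ?_) h5
  have := hv.ne
  field_simp

/-- The slope at a generic point of `{x_k = 0}` is at most the slope along the `k`-th axis. -/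
lemma NegPSH.asympSlope_recentre_le (hf : NegPSH f) {x : Fin (n + 1) → ℂ} {ρ : ℝ}
    (hρ : 0 < ρ) (hx : ‖x‖ + ρ ≤ 1) (k : Fin (n + 1)) (hxk : x k = 0)
    {g : (Fin 1 → ℂ) → EReal} (hg : NegPSH g)
    (hgl : ∀ v < 0, logMean (pot g) (fun _ => v) = sliceMean f k v (k.removeNth x)) :
    asympSlope (convexReal fun z => f fun k => x k + (ρ : ℂ) * z k) 1
      ≤ asympSlope (convexReal g) 1 := by
  have hF := hf.recentre hρ hx
  have hlρ : Real.log ρ ≤ 0 := Real.log_nonpos hρ.le (by linarith [norm_nonneg x])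
  have h1 := hF.negConvex.tendsto_slope_shift (u := 0) (d := 1) (c := -1) zero_le_one
    (fun _ => by simp)
  have h2 := hg.negConvex.tendsto_slope_shift (u := fun _ => Real.log ρ) (d := 1) (c := -1)
    zero_le_one (fun _ => by
      show Real.log ρ + -1 * 1 < 0
      linarith)
  refine le_of_tendsto_of_tendsto h1 h2 ?_
  filter_upwards [eventually_lt_atBot 0] with v hv
  have e : (0 : Fin (n + 1) → ℝ) + v • 1 = fun _ => v := by ext; simp
  have e' : (fun _ => Real.log ρ) + v • (1 : Fin 1 → ℝ) = fun _ => Real.log ρ + v := by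
    ext; simp
  rw [e, e']
  have hv' : Real.log ρ + v < 0 := by linarith
  refine div_le_div_of_nonpos_of_le hv.le (neg_le_neg ?_)
  refine ENNReal.toReal_mono (hg.logMean_lt_top fun _ => hv').ne ?_
  rw [hf.logMean_recentre_eq hρ hx k hxk hv, hgl _ hv']
  -- The average of the slice mean over a torus is at most its value at the centre, which is the
  -- mean along the single line through `x`.
  refine (hf.superMean_sliceMean k hv').lintegral_torus_le (hf.measurable_sliceMean k _)
    (y := k.removeNth x) (c := fun _ => (Real.exp (Real.log ρ + v) : ℂ)) fun z hz j => ?_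
  have h3 := hz j
  rw [Complex.norm_real, Real.norm_eq_abs, abs_of_pos (Real.exp_pos _)] at h3
  calc _ ≤ ‖x (k.succAbove j)‖ + Real.exp (Real.log ρ + v) :=
        (norm_add_le _ _).trans (add_le_add le_rfl h3)
    _ < ‖x‖ + ρ := by
        have h1 := norm_le_pi_norm x (k.succAbove j)
        have h2 : Real.exp (Real.log ρ + v) < ρ := by
          rw [Real.exp_add, Real.exp_log hρ]
          exact mul_lt_of_lt_one_right hρ (Real.exp_lt_one_iff.2 hv)
        linarith
    _ ≤ 1 := hx

end Generic

/-! ### Wirtinger derivatives and the divergence of the cofactor matrix -/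

section Jacobi

variable {E : Type*} [NormedAddCommGroup E] [NormedSpace ℝ E]

lemma contDiff_det {m : ℕ} {A : E → Matrix (Fin m) (Fin m) ℂ}
    (hA : ∀ i j, ContDiff ℝ ∞ fun x => A x i j) : ContDiff ℝ ∞ fun x => (A x).det := by
  simp only [Matrix.det_apply']
  exact ContDiff.sum fun σ _ => contDiff_const.mul (contDiff_prod fun i _ => hA _ _)

lemma contDiff_adjugate {m : ℕ} {A : E → Matrix (Fin m) (Fin m) ℂ}
    (hA : ∀ i j, ContDiff ℝ ∞ fun x => A x i j) (i j : Fin m) :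
    ContDiff ℝ ∞ fun x => (A x).adjugate i j := by
  simp only [Matrix.adjugate_apply]
  refine contDiff_det fun k l => ?_
  by_cases h : k = j
  · subst h; simp only [Matrix.updateRow_self]; exact contDiff_const
  · simp only [Matrix.updateRow_ne h]; exact hA k l

/-- Jacobi's formula. -/
lemma fderiv_det {m : ℕ} {A : E → Matrix (Fin m) (Fin m) ℂ} {x : E}
    (hA : ∀ i j, DifferentiableAt ℝ (fun x => A x i j) x) (v : E) :
    fderiv ℝ (fun x => (A x).det) x v
      = ∑ i, ∑ j, (A x).adjugate i j * fderiv ℝ (fun x => A x j i) x v := by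
  have h1 (σ : Equiv.Perm (Fin m)) : HasFDerivAt (fun x => ∏ i, A x (σ i) i)
      (∑ i, (∏ j ∈ Finset.univ.erase i, A x (σ j) j) • fderiv ℝ (fun x => A x (σ i) i) x) x :=
    HasFDerivAt.finsetProd fun i _ => (hA _ _).hasFDerivAt
  have h2 : HasFDerivAt (fun x => (A x).det) (∑ σ : Equiv.Perm (Fin m),
      (((Equiv.Perm.sign σ : ℤ) : ℂ)) • ∑ i, (∏ j ∈ Finset.univ.erase i, A x (σ j) j) •
        fderiv ℝ (fun x => A x (σ i) i) x) x := by
    simp only [Matrix.det_apply']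
    exact HasFDerivAt.fun_sum fun σ _ => (h1 σ).const_mul _
  rw [h2.fderiv]
  simp only [sum_apply, smul_apply, smul_eq_mul]
  -- By Cramer's rule this inner sum is the determinant with column `i` differentiated.
  have h3 (i : Fin m) : ∑ j, (A x).adjugate i j * fderiv ℝ (fun x => A x j i) x v
      = ((A x).updateCol i fun j => fderiv ℝ (fun x => A x j i) x v).det := by
    rw [← Matrix.cramer_apply, Matrix.cramer_eq_adjugate_mulVec]
    rfl
  simp only [h3, Matrix.det_apply', Finset.mul_sum]
  rw [Finset.sum_comm]
  refine Finset.sum_congr rfl fun i _ => Finset.sum_congr rfl fun σ _ => ?_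
  rw [← Finset.mul_prod_erase Finset.univ _ (Finset.mem_univ i), Matrix.updateCol_self]
  have h4 : ∏ j ∈ Finset.univ.erase i,
      (A x).updateCol i (fun j => fderiv ℝ (fun x => A x j i) x v) (σ j) j
      = ∏ j ∈ Finset.univ.erase i, A x (σ j) j :=
    Finset.prod_congr rfl fun j hj => by rw [Matrix.updateCol_ne (Finset.ne_of_mem_erase hj)]
  rw [h4]
  ring

end Jacobi

section Wirtinger

variable {n : ℕ}

/-- The operator `(∂/∂a_k + σ ∂/∂b_k) / 2`, where `x_k = a_k + i b_k`; one has `∂_k = wd (-i) k` and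
`∂̄_k = wd i k`. -/
def wd (σ : ℂ) (k : Fin n) (g : (Fin n → ℂ) → ℂ) (x : Fin n → ℂ) : ℂ :=
  (fderiv ℝ g x (Pi.single k 1) + σ * fderiv ℝ g x (Pi.single k Complex.I)) / 2

lemma contDiff_fderiv_apply {g : (Fin n → ℂ) → ℂ} (hg : ContDiff ℝ ∞ g) (v : Fin n → ℂ) :
    ContDiff ℝ ∞ fun x => fderiv ℝ g x v :=
  (hg.fderiv_right (by simp)).clm_apply contDiff_const

lemma contDiff_wd {g : (Fin n → ℂ) → ℂ} (hg : ContDiff ℝ ∞ g) (σ : ℂ) (k : Fin n) :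
    ContDiff ℝ ∞ (wd σ k g) :=
  ((contDiff_fderiv_apply hg _).add (contDiff_const.mul (contDiff_fderiv_apply hg _))).div_const _

lemma wd_mul {g h : (Fin n → ℂ) → ℂ} {x : Fin n → ℂ} (hg : DifferentiableAt ℝ g x)
    (hh : DifferentiableAt ℝ h x) (σ : ℂ) (k : Fin n) :
    wd σ k (fun y => g y * h y) x = wd σ k g x * h x + g x * wd σ k h x := by
  simp only [wd, fderiv_fun_mul hg hh, add_apply,
    smul_apply, smul_eq_mul]
  ring

lemma wd_sum {ι : Type*} {s : Finset ι} {g : ι → (Fin n → ℂ) → ℂ} {x : Fin n → ℂ}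
    (hg : ∀ i ∈ s, DifferentiableAt ℝ (g i) x) (σ : ℂ) (k : Fin n) :
    wd σ k (fun y => ∑ i ∈ s, g i y) x = ∑ i ∈ s, wd σ k (g i) x := by
  simp only [wd, fderiv_fun_sum hg, sum_apply, Finset.mul_sum,
    ← Finset.sum_add_distrib, Finset.sum_div]

lemma wd_comm {g : (Fin n → ℂ) → ℂ} (hg : ContDiff ℝ ∞ g) (σ τ : ℂ) (k l : Fin n)
    (x : Fin n → ℂ) : wd σ k (wd τ l g) x = wd τ l (wd σ k g) x := by
  have hd (y : Fin n → ℂ) : DifferentiableAt ℝ (fderiv ℝ g) y :=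
    (hg.fderiv_right (m := ∞) (by simp)).differentiable (by simp) y
  have key (τ : ℂ) (l : Fin n) (v : Fin n → ℂ) : fderiv ℝ (wd τ l g) x v
      = (fderiv ℝ (fderiv ℝ g) x v (Pi.single l 1)
        + τ * fderiv ℝ (fderiv ℝ g) x v (Pi.single l Complex.I)) / 2 := by
    have h1 (u : Fin n → ℂ) : HasFDerivAt (fun y => fderiv ℝ g y u)
        ((fderiv ℝ (fderiv ℝ g) x).flip u) x := by
      simpa using (hd x).hasFDerivAt.clm_apply (hasFDerivAt_const u x)
    have h2 := ((h1 (Pi.single l 1)).add ((h1 (Pi.single l Complex.I)).const_mul τ)).mul_const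
      (2⁻¹ : ℂ)
    have h3 : fderiv ℝ (wd τ l g) x = _ := (h2.congr_of_eventuallyEq
      (Eventually.of_forall fun y => by simp [wd, div_eq_mul_inv])).fderiv
    rw [h3]
    simp [div_eq_mul_inv]
    ring
  have hsymm (u v : Fin n → ℂ) : fderiv ℝ (fderiv ℝ g) x u v = fderiv ℝ (fderiv ℝ g) x v u :=
    (hg.contDiffAt.isSymmSndFDerivAt (by simpa using two_le_infty)) u v
  unfold wd
  change (fderiv ℝ (wd τ l g) x _ + σ * fderiv ℝ (wd τ l g) x _) / 2
    = (fderiv ℝ (wd σ k g) x _ + τ * fderiv ℝ (wd σ k g) x _) / 2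
  rw [key, key, key, key, hsymm (Pi.single l 1) (Pi.single k 1),
    hsymm (Pi.single l 1) (Pi.single k Complex.I), hsymm (Pi.single l Complex.I) (Pi.single k 1),
    hsymm (Pi.single l Complex.I) (Pi.single k Complex.I)]
  ring

lemma contDiff_ofReal_comp {w : (Fin n → ℂ) → ℝ} (hw : ContDiff ℝ ∞ w) :
    ContDiff ℝ ∞ fun x => (w x : ℂ) := Complex.ofRealCLM.contDiff.comp hw

lemma fderiv_ofReal_comp {w : (Fin n → ℂ) → ℝ} {x : Fin n → ℂ} (hw : DifferentiableAt ℝ w x)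
    (v : Fin n → ℂ) : fderiv ℝ (fun x => (w x : ℂ)) x v = (fderiv ℝ w x v : ℂ) := by
  have := (Complex.ofRealCLM.hasFDerivAt (x := w x)).comp x hw.hasFDerivAt
  have h2 : fderiv ℝ (fun x => (w x : ℂ)) x = _ := this.fderiv
  rw [h2]; simp

/-- The complex Hessian in terms of Wirtinger derivatives. -/
lemma complexHessian_eq_wd {w : (Fin n → ℂ) → ℝ} (hw : ContDiff ℝ ∞ w) (x : Fin n → ℂ)
    (k l : Fin n) : complexHessian w x k l
      = wd (-Complex.I) k (wd Complex.I l fun y => (w y : ℂ)) x := by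
  have hd : DifferentiableAt ℝ (fderiv ℝ w) x :=
    (hw.fderiv_right (m := ∞) (by simp)).differentiable (by simp) x
  have key (v : Fin n → ℂ) : fderiv ℝ (wd Complex.I l fun y => (w y : ℂ)) x v
      = ((fderiv ℝ (fderiv ℝ w) x v (Pi.single l 1) : ℂ)
        + Complex.I * (fderiv ℝ (fderiv ℝ w) x v (Pi.single l Complex.I) : ℂ)) / 2 := by
    have h1 (u : Fin n → ℂ) : HasFDerivAt (fun y => ((fderiv ℝ w y u : ℝ) : ℂ))
        (Complex.ofRealCLM.comp ((fderiv ℝ (fderiv ℝ w) x).flip u)) x := by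
      have := hd.hasFDerivAt.clm_apply (hasFDerivAt_const u x)
      rw [ContinuousLinearMap.comp_zero, zero_add] at this
      exact (Complex.ofRealCLM.hasFDerivAt (x := fderiv ℝ w x u)).comp x this
    have h2 := ((h1 (Pi.single l 1)).add ((h1 (Pi.single l Complex.I)).const_mul
      Complex.I)).mul_const (2⁻¹ : ℂ)
    have hdw (y : Fin n → ℂ) : DifferentiableAt ℝ w y := hw.differentiable (by simp) y
    have h3 : fderiv ℝ (wd Complex.I l fun y => (w y : ℂ)) x = _ := (h2.congr_of_eventuallyEq
      (Eventually.of_forall fun y => by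
        simp [wd, div_eq_mul_inv, fderiv_ofReal_comp (hdw y)])).fderiv
    rw [h3]
    simp [div_eq_mul_inv]
    ring
  rw [wd, key, key]
  simp only [complexHessian, Matrix.of_apply, secondDeriv]
  push_cast
  linear_combination ((fderiv ℝ (fderiv ℝ w) x (Pi.single k Complex.I)
    (Pi.single l Complex.I) : ℂ) / 4) * Complex.I_sq

lemma contDiff_complexHessian {w : (Fin n → ℂ) → ℝ} (hw : ContDiff ℝ ∞ w) (k l : Fin n) :
    ContDiff ℝ ∞ fun x => complexHessian w x k l := by
  simp only [complexHessian_eq_wd hw]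
  exact contDiff_wd (contDiff_wd (contDiff_ofReal_comp hw) _ _) _ _

/-- The rows of the cofactor matrix of a complex Hessian are divergence free. -/
lemma sum_wd_adjugate_eq_zero {w : (Fin n → ℂ) → ℝ} (hw : ContDiff ℝ ∞ w) {x : Fin n → ℂ}
    (hx : IsUnit (complexHessian w x).det) (l : Fin n) :
    ∑ m, wd (-Complex.I) m (fun y => (complexHessian w y).adjugate l m) x = 0 := by
  set A := complexHessian w with hA
  have hAs := contDiff_complexHessian hw
  have hCs (i j : Fin n) : ContDiff ℝ ∞ fun y => (A y).adjugate i j := contDiff_adjugate hAs i j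
  have hAd (i j : Fin n) (y : Fin n → ℂ) : DifferentiableAt ℝ (fun y => A y i j) y :=
    (hAs i j).differentiable (by simp) y
  have hCd (i j : Fin n) (y : Fin n → ℂ) : DifferentiableAt ℝ (fun y => (A y).adjugate i j) y :=
    (hCs i j).differentiable (by simp) y
  set V : Fin n → ℂ := fun l => ∑ m, wd (-Complex.I) m (fun y => (A y).adjugate l m) x with hV
  have hcomm (k m l : Fin n) : wd (-Complex.I) m (fun y => A y k l) x
      = wd (-Complex.I) k (fun y => A y m l) x := by
    have e (k : Fin n) : (fun y => A y k l)
        = wd (-Complex.I) k (wd Complex.I l fun y => (w y : ℂ)) := by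
      ext y; exact complexHessian_eq_wd hw y k l
    rw [e, e, wd_comm (contDiff_wd (contDiff_ofReal_comp hw) _ _)]
  have hjac (k : Fin n) : wd (-Complex.I) k (fun y => (A y).det) x
      = ∑ l, ∑ m, (A x).adjugate l m * wd (-Complex.I) k (fun y => A y m l) x := by
    rw [wd, fderiv_det fun i j => hAd i j x, fderiv_det fun i j => hAd i j x]
    simp only [wd, Finset.mul_sum, ← Finset.sum_add_distrib, Finset.sum_div]
    refine Finset.sum_congr rfl fun i _ => Finset.sum_congr rfl fun j _ => ?_
    ring
  -- Differentiate `A * adj A = det A • 1` and sum over `m`. By `hcomm` and Jacobi's formula the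
  -- terms with a derivative of `A` add up to the derivative of `det A` on the right, so `A` kills
  -- the vector of divergences. Invertibility of `A` then gives `V = 0`.
  have hAV : (A x).mulVec V = 0 := by
    ext k
    have h1 (m : Fin n) : wd (-Complex.I) m (fun y => ∑ l, A y k l * (A y).adjugate l m) x
        = ∑ l, (wd (-Complex.I) m (fun y => A y k l) x * (A x).adjugate l m
          + A x k l * wd (-Complex.I) m (fun y => (A y).adjugate l m) x) := by
      rw [wd_sum (g := fun l y => A y k l * (A y).adjugate l m)
        fun l _ => (hAd k l x).mul (hCd l m x)]
      exact Finset.sum_congr rfl fun l _ => wd_mul (hAd k l x) (hCd l m x) _ _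
    have h2 (m : Fin n) : wd (-Complex.I) m (fun y => ∑ l, A y k l * (A y).adjugate l m) x
        = if k = m then wd (-Complex.I) k (fun y => (A y).det) x else 0 := by
      have e : (fun y => ∑ l, A y k l * (A y).adjugate l m)
          = fun y => if k = m then (A y).det else 0 := by
        ext y
        have := congrFun (congrFun (Matrix.mul_adjugate (A y)) k) m
        rw [Matrix.mul_apply] at this
        rw [this, Matrix.smul_apply, Matrix.one_apply]
        simp
      rw [e]
      by_cases h : k = m
      · subst h; simp
      · simp [h, wd]
    have h3 : ∑ m, wd (-Complex.I) m (fun y => ∑ l, A y k l * (A y).adjugate l m) x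
        = wd (-Complex.I) k (fun y => (A y).det) x := by simp [h2]
    simp only [h1, Finset.sum_add_distrib] at h3
    rw [hjac] at h3
    have h4 : ∑ m, ∑ l, wd (-Complex.I) m (fun y => A y k l) x * (A x).adjugate l m
        = ∑ l, ∑ m, (A x).adjugate l m * wd (-Complex.I) k (fun y => A y m l) x := by
      rw [Finset.sum_comm]
      refine Finset.sum_congr rfl fun l _ => Finset.sum_congr rfl fun m _ => ?_
      rw [hcomm k m l, mul_comm]
    rw [h4, add_eq_left] at h3
    simp only [Matrix.mulVec, dotProduct, hV, Finset.mul_sum, Pi.zero_apply]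
    rw [Finset.sum_comm]
    exact h3
  have hV0 : V = 0 := by
    have := congrArg (fun u => (A x)⁻¹.mulVec u) hAV
    simpa [Matrix.mulVec_mulVec, Matrix.nonsing_inv_mul _ hx] using this
  exact congrFun hV0 l

lemma hasCompactSupport_fderiv_apply {g : (Fin n → ℂ) → ℂ} (hg : HasCompactSupport g)
    (v : Fin n → ℂ) : HasCompactSupport fun x => fderiv ℝ g x v :=
  (hg.fderiv (𝕜 := ℝ)).comp_left (g := fun L : (Fin n → ℂ) →L[ℝ] ℂ => L v) rfl

lemma integral_wd_eq_zero {g : (Fin n → ℂ) → ℂ} (hg : ContDiff ℝ ∞ g) (hc : HasCompactSupport g)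
    (σ : ℂ) (k : Fin n) : ∫ x, wd σ k g x = 0 := by
  have hInt (v : Fin n → ℂ) : Integrable fun x => fderiv ℝ g x v :=
    (contDiff_fderiv_apply hg v).continuous.integrable_of_hasCompactSupport
      (hasCompactSupport_fderiv_apply hc v)
  have h0 (v : Fin n → ℂ) : ∫ x, fderiv ℝ g x v = 0 := by
    have := integral_mul_fderiv_eq_neg_fderiv_mul_of_integrable (μ := volume)
      (f := fun _ : Fin n → ℂ => (1 : ℂ)) (g := g) (v := v) (by simp) (by simpa using hInt v)
      (by simpa using hg.continuous.integrable_of_hasCompactSupport hc)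
      (fun x _ => by fun_prop) (fun x _ => hg.differentiable (by simp) x)
    simpa using this
  simp only [wd]
  rw [integral_div, integral_add (hInt _) ((hInt _).const_mul _), integral_const_mul, h0, h0]
  simp

lemma wd_of_notMem_tsupport {g : (Fin n → ℂ) → ℂ} {x : Fin n → ℂ} (hx : x ∉ tsupport g) (σ : ℂ)
    (k : Fin n) : wd σ k g x = 0 := by
  simp [wd, fderiv_of_notMem_tsupport (𝕜 := ℝ) hx]

lemma tsupport_ofReal_comp (w : (Fin n → ℂ) → ℝ) : tsupport (fun x => (w x : ℂ)) = tsupport w := by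
  unfold tsupport
  congr 1
  ext x; simp

lemma complexHessian_of_notMem_tsupport {w : (Fin n → ℂ) → ℝ} {x : Fin n → ℂ}
    (hx : x ∉ tsupport w) : complexHessian w x = 0 := by
  have h : fderiv ℝ (fderiv ℝ w) x = 0 :=
    fderiv_of_notMem_tsupport (𝕜 := ℝ) fun h => hx (tsupport_fderiv_subset ℝ h)
  ext k l
  simp [complexHessian, secondDeriv, h]

/-- Integration by parts against the cofactor matrix. -/
lemma integral_cofactor_by_parts {w u v : (Fin n → ℂ) → ℝ} (hw : ContDiff ℝ ∞ w)
    (hu : ContDiff ℝ ∞ u) (hv : ContDiff ℝ ∞ v) {K : Set (Fin n → ℂ)} (hK : IsCompact K)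
    (huv : tsupport u ⊆ K ∨ tsupport v ⊆ K)
    (hA : ∀ x ∈ K, IsUnit (complexHessian w x).det) :
    ∫ x, (u x : ℂ) * ((complexHessian w x).adjugate * complexHessian v x).trace
      = -∫ x, ∑ l, ∑ k, wd (-Complex.I) k (fun y => (u y : ℂ)) x * (complexHessian w x).adjugate l k
          * wd Complex.I l (fun y => (v y : ℂ)) x := by
  set U : (Fin n → ℂ) → ℂ := fun y => (u y : ℂ) with hU
  set V : (Fin n → ℂ) → ℂ := fun y => (v y : ℂ) with hV
  set C := fun x => (complexHessian w x).adjugate with hC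
  have hUs : ContDiff ℝ ∞ U := contDiff_ofReal_comp hu
  have hVs : ContDiff ℝ ∞ V := contDiff_ofReal_comp hv
  have hCs (i j : Fin n) : ContDiff ℝ ∞ fun y => C y i j :=
    contDiff_adjugate (contDiff_complexHessian hw) i j
  have hvl (l : Fin n) := contDiff_wd hVs Complex.I l
  have huk (k : Fin n) := contDiff_wd hUs (-Complex.I) k
  have hout (x : Fin n → ℂ) (hx : x ∉ K) : (U x = 0 ∧ ∀ k, wd (-Complex.I) k U x = 0) ∨
      ((∀ l, wd Complex.I l V x = 0) ∧ complexHessian v x = 0) := by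
    rcases huv with h | h
    · have hx' : x ∉ tsupport u := fun h' => hx (h h')
      refine Or.inl ⟨by simp [hU, image_eq_zero_of_notMem_tsupport hx'], fun k => ?_⟩
      exact wd_of_notMem_tsupport (by rwa [hU, tsupport_ofReal_comp]) _ _
    · have hx' : x ∉ tsupport v := fun h' => hx (h h')
      refine Or.inr ⟨fun l => ?_, complexHessian_of_notMem_tsupport hx'⟩
      exact wd_of_notMem_tsupport (by rwa [hV, tsupport_ofReal_comp]) _ _
  have hcs {g : (Fin n → ℂ) → ℂ} (hg : ∀ x ∉ K, g x = 0) : HasCompactSupport g :=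
    HasCompactSupport.intro hK hg
  have hG (l k : Fin n) : ContDiff ℝ ∞ fun y => C y l k * (U y * wd Complex.I l V y) :=
    (hCs l k).mul (hUs.mul (hvl l))
  have hGc (l k : Fin n) : HasCompactSupport fun y => C y l k * (U y * wd Complex.I l V y) :=
    hcs fun x hx => by rcases hout x hx with h | h <;> simp [h.1]
  have hd {g : (Fin n → ℂ) → ℂ} (hg : ContDiff ℝ ∞ g) (x : Fin n → ℂ) : DifferentiableAt ℝ g x :=
    hg.differentiable (by simp) x
  -- Product rule for the divergence of `C * (U ∂̄V)`. The term where `C` is differentiated vanishes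
  -- on `K` because the cofactor matrix is divergence free, and off `K` because one of the two
  -- functions vanishes there; so the determinant need not be controlled off `K`.
  have hexp (x : Fin n → ℂ) : ∑ l, ∑ k, wd (-Complex.I) k
        (fun y => C y l k * (U y * wd Complex.I l V y)) x
      = (∑ l, ∑ k, wd (-Complex.I) k U x * C x l k * wd Complex.I l V x)
        + U x * (C x * complexHessian v x).trace := by
    have h1 (l k : Fin n) : wd (-Complex.I) k
        (fun y => C y l k * (U y * wd Complex.I l V y)) x
        = wd (-Complex.I) k (fun y => C y l k) x * (U x * wd Complex.I l V x)
          + (wd (-Complex.I) k U x * C x l k * wd Complex.I l V x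
            + U x * (C x l k * complexHessian v x k l)) := by
      rw [wd_mul (hd (hCs l k) x) (hd (hUs.mul (hvl l)) x), wd_mul (hd hUs x) (hd (hvl l) x),
        complexHessian_eq_wd hv]
      ring
    have h2 (l : Fin n) : ∑ k, wd (-Complex.I) k (fun y => C y l k) x
        * (U x * wd Complex.I l V x) = 0 := by
      by_cases hx : x ∈ K
      · rw [← Finset.sum_mul, sum_wd_adjugate_eq_zero hw (hA x hx) l, zero_mul]
      · rcases hout x hx with h | h <;> simp [h.1]
    simp only [h1, Finset.sum_add_distrib, h2, zero_add]
    congr 1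
    simp only [Matrix.trace, Matrix.diag, Matrix.mul_apply, Finset.mul_sum]
  have hInt (l k : Fin n) : Integrable fun x => wd (-Complex.I) k
      (fun y => C y l k * (U y * wd Complex.I l V y)) x := by
    refine (contDiff_wd (hG l k) (-Complex.I) k).continuous.integrable_of_hasCompactSupport ?_
    exact HasCompactSupport.intro (hGc l k) fun x hx => wd_of_notMem_tsupport hx _ _
  have hzero : ∫ x, ∑ l, ∑ k, wd (-Complex.I) k
      (fun y => C y l k * (U y * wd Complex.I l V y)) x = 0 := by
    rw [integral_finsetSum _ fun l _ => integrable_finsetSum _ fun k _ => hInt l k]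
    refine Finset.sum_eq_zero fun l _ => ?_
    rw [integral_finsetSum _ fun k _ => hInt l k]
    exact Finset.sum_eq_zero fun k _ => integral_wd_eq_zero (hG l k) (hGc l k) _ _
  have hi1 : Integrable fun x => U x * (C x * complexHessian v x).trace := by
    refine Continuous.integrable_of_hasCompactSupport ?_ (hcs fun x hx => ?_)
    · refine hUs.continuous.mul ?_
      simp only [Matrix.trace, Matrix.diag, Matrix.mul_apply]
      exact continuous_finsetSum _ fun i _ => continuous_finsetSum _ fun j _ =>
        (hCs i j).continuous.mul (contDiff_complexHessian hv j i).continuous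
    · rcases hout x hx with h | h
      · simp [h.1]
      · simp [h.2]
  have hi2 : Integrable fun x => ∑ l, ∑ k, wd (-Complex.I) k U x * C x l k
      * wd Complex.I l V x := by
    refine integrable_finsetSum _ fun l _ => integrable_finsetSum _ fun k _ =>
      Continuous.integrable_of_hasCompactSupport
        (((huk k).continuous.mul (hCs l k).continuous).mul (hvl l).continuous)
        (hcs fun x hx => ?_)
    rcases hout x hx with h | h
    · simp [h.2]
    · simp [h.1]
  simp only [hexp] at hzero
  rw [integral_add hi2 hi1] at hzero
  linear_combination hzero

end Wirtinger

/-! ### Positivity of mixed Monge-Ampère operators -/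

section Hessian

open scoped ComplexOrder MatrixOrder

variable {n : ℕ}

lemma complexHessian_congr {w v : (Fin n → ℂ) → ℝ} {x : Fin n → ℂ} (h : w =ᶠ[𝓝 x] v) :
    complexHessian w x = complexHessian v x := by
  have h2 : fderiv ℝ w =ᶠ[𝓝 x] fderiv ℝ v := h.fderiv
  simp only [complexHessian, secondDeriv, h2.fderiv_eq]

lemma complexHessian_add {v w : (Fin n → ℂ) → ℝ} {x : Fin n → ℂ} (hv : ContDiffAt ℝ 2 v x)
    (hw : ContDiffAt ℝ 2 w x) :
    complexHessian (fun y => v y + w y) x = complexHessian v x + complexHessian w x := by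
  ext k l
  simp only [complexHessian, secondDeriv, fderiv_fderiv_add hv hw, Matrix.of_apply,
    Matrix.add_apply]
  push_cast
  ring

lemma complexHessian_const_mul {v : (Fin n → ℂ) → ℝ} {x : Fin n → ℂ} (c : ℝ) :
    complexHessian (fun y => c * v y) x = (c : ℂ) • complexHessian v x := by
  ext k l
  simp only [complexHessian, secondDeriv, fderiv_fderiv_const_mul, Matrix.of_apply,
    Matrix.smul_apply, smul_eq_mul]
  push_cast
  ring

lemma complexHessian_const (c : ℝ) (x : Fin n → ℂ) :
    complexHessian (fun _ : Fin n → ℂ => c) x = 0 := by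
  ext k l
  simp [complexHessian, secondDeriv]

lemma isHermitian_complexHessian {w : (Fin n → ℂ) → ℝ} {x : Fin n → ℂ} (hw : ContDiffAt ℝ 2 w x) :
    (complexHessian w x).IsHermitian := by
  have hs (u v : Fin n → ℂ) : fderiv ℝ (fderiv ℝ w) x u v = fderiv ℝ (fderiv ℝ w) x v u :=
    (hw.isSymmSndFDerivAt (by simp)) u v
  ext k l
  simp only [complexHessian, secondDeriv, Matrix.conjTranspose_apply, Matrix.of_apply]
  rw [hs (Pi.single l 1) (Pi.single k 1), hs (Pi.single l 1) (Pi.single k Complex.I),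
    hs (Pi.single l Complex.I) (Pi.single k 1),
    hs (Pi.single l Complex.I) (Pi.single k Complex.I)]
  simp
  ring

/-- The Levi form in terms of the complex Hessian. -/
lemma levi_eq_complexHessian (w : (Fin n → ℂ) → ℝ) (x b : Fin n → ℂ) :
    levi w x b = 4 * (star (star b) ⬝ᵥ (complexHessian w x).mulVec (star b)).re := by
  have hb (c : Fin n → ℂ) : c = ∑ k, ((c k).re • (Pi.single k (1 : ℂ) : Fin n → ℂ)
      + (c k).im • (Pi.single k Complex.I : Fin n → ℂ)) := by
    ext k
    simp only [Finset.sum_apply, Pi.add_apply, Pi.smul_apply, Pi.single_apply, smul_ite, smul_zero,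
      Finset.sum_add_distrib, Finset.sum_ite_eq, Finset.mem_univ, if_true]
    simp [Complex.re_add_im]
  have hB (c : Fin n → ℂ) : fderiv ℝ (fderiv ℝ w) x c c = ∑ k, ∑ l,
      ((c k).re * (c l).re * secondDeriv w x (Pi.single k 1) (Pi.single l 1)
      + (c k).re * (c l).im * secondDeriv w x (Pi.single k 1) (Pi.single l Complex.I)
      + (c k).im * (c l).re * secondDeriv w x (Pi.single k Complex.I) (Pi.single l 1)
      + (c k).im * (c l).im * secondDeriv w x (Pi.single k Complex.I) (Pi.single l Complex.I)) := by
    conv_lhs => rw [hb c]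
    simp only [map_sum, map_add, map_smul, sum_apply, add_apply, smul_apply, smul_eq_mul,
      secondDeriv, Finset.mul_sum, ← Finset.sum_add_distrib]
    rw [Finset.sum_comm]
    refine Finset.sum_congr rfl fun k _ => Finset.sum_congr rfl fun l _ => ?_
    ring
  rw [levi, hB, hB]
  simp only [star_star, dotProduct, Matrix.mulVec, Finset.mul_sum, Complex.re_sum,
    ← Finset.sum_add_distrib]
  refine Finset.sum_congr rfl fun k _ => Finset.sum_congr rfl fun l _ => ?_
  simp [complexHessian]
  ring

lemma posSemidef_complexHessian {w : (Fin n → ℂ) → ℝ} {x : Fin n → ℂ} (hw : ContDiffAt ℝ 2 w x)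
    (h : ∀ b, 0 ≤ levi w x b) : (complexHessian w x).PosSemidef := by
  have hH := isHermitian_complexHessian hw
  refine Matrix.PosSemidef.of_dotProduct_mulVec_nonneg hH fun b => ?_
  have h1 := h (star b)
  rw [levi_eq_complexHessian] at h1
  simp only [star_star] at h1
  have h2 := hH.im_star_dotProduct_mulVec_self b
  rw [Complex.nonneg_iff]
  refine ⟨by linarith, ?_⟩
  exact h2.symm

lemma fderiv_fderiv_normSq_coord (j : Fin n) (x b c : Fin n → ℂ) :
    fderiv ℝ (fderiv ℝ fun y : Fin n → ℂ => ‖y j‖ ^ 2) x b c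
      = 2 * ((b j).re * (c j).re + (b j).im * (c j).im) ∧
    fderiv ℝ (fun y : Fin n → ℂ => ‖y j‖ ^ 2) x b
      = 2 * ((x j).re * (b j).re + (x j).im * (b j).im) := by
  let P : (Fin n → ℂ) →L[ℝ] ℂ := ContinuousLinearMap.proj j
  let R : (Fin n → ℂ) →L[ℝ] ℝ := Complex.reCLM.comp P
  let T : (Fin n → ℂ) →L[ℝ] ℝ := Complex.imCLM.comp P
  have e : (fun y : Fin n → ℂ => ‖y j‖ ^ 2) = fun y => R y * R y + T y * T y := by
    ext y
    rw [← Complex.normSq_eq_norm_sq, Complex.normSq_apply]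
    rfl
  have h1 : fderiv ℝ (fun y : Fin n → ℂ => ‖y j‖ ^ 2)
      = fun y => (2 : ℝ) • ((R.smulRight R + T.smulRight T :
        (Fin n → ℂ) →L[ℝ] (Fin n → ℂ) →L[ℝ] ℝ) y) := by
    ext1 y
    rw [e]
    have h := ((R.hasFDerivAt (x := y)).mul (R.hasFDerivAt (x := y))).add
      ((T.hasFDerivAt (x := y)).mul (T.hasFDerivAt (x := y)))
    refine h.fderiv.trans ?_
    ext v
    simp
    ring
  constructor
  · rw [h1]
    have := ((R.smulRight R + T.smulRight T :
      (Fin n → ℂ) →L[ℝ] (Fin n → ℂ) →L[ℝ] ℝ).hasFDerivAt (x := x)).const_smul (2 : ℝ)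
    rw [show fderiv ℝ (fun y => (2 : ℝ) • ((R.smulRight R + T.smulRight T :
      (Fin n → ℂ) →L[ℝ] (Fin n → ℂ) →L[ℝ] ℝ) y)) x = _ from this.fderiv]
    simp [R, T, P]
    ring
  · rw [h1]
    simp [R, T, P]
    ring

lemma contDiff_normSq_coord (j : Fin n) : ContDiff ℝ ∞ fun y : Fin n → ℂ => ‖y j‖ ^ 2 :=
  contDiff_normSq.comp (contDiff_apply ℝ ℂ j)

lemma complexHessian_normSq_coord (j : Fin n) (x : Fin n → ℂ) :
    complexHessian (fun y => ‖y j‖ ^ 2) x = Matrix.single j j 1 := by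
  ext k l
  simp only [complexHessian, secondDeriv, (fderiv_fderiv_normSq_coord j x _ _).1, Matrix.of_apply,
    Matrix.single_apply]
  by_cases hk : j = k
  · subst hk
    by_cases hl : j = l
    · subst hl
      simp
      norm_num
    · simp [hl]
  · simp [hk]

lemma complexHessian_sum {ι : Type*} (s : Finset ι) {w : ι → (Fin n → ℂ) → ℝ} {x : Fin n → ℂ}
    (hw : ∀ i, ContDiffAt ℝ 2 (w i) x) :
    complexHessian (fun y => ∑ i ∈ s, w i y) x = ∑ i ∈ s, complexHessian (w i) x := by
  induction s using Finset.cons_induction with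
  | empty => simp [complexHessian_const]
  | cons i s hi ih =>
    simp only [Finset.sum_cons]
    rw [complexHessian_add (hw i) (ContDiffAt.sum fun j _ => hw j), ih]

lemma complexHessian_normSq (x : Fin n → ℂ) :
    complexHessian (fun y => ∑ j, ‖y j‖ ^ 2) x = 1 := by
  rw [complexHessian_sum _ fun j => ((contDiff_normSq_coord j).of_le two_le_infty).contDiffAt]
  simp only [complexHessian_normSq_coord]
  exact (Matrix.sum_single_one)

end Hessian

/-! ### Positivity of the mixed operator, first for smooth functions, then by approximation. -/

section Positivity

open scoped ComplexOrder MatrixOrder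

variable {n : ℕ} {f : (Fin n → ℂ) → EReal}

lemma NegPSH.toReal_eq (hf : NegPSH f) {x : Fin n → ℂ} (hx : x ∈ polydisk n) :
    (f x).toReal = -(pot f x).toReal := by
  rw [hf.eq_neg_pot hx, EReal.toReal_neg_eq, EReal.toReal_coe_ennreal]

lemma NegPSH.mul_eq (hf : NegPSH f) {K : Set (Fin n → ℂ)} (hKD : K ⊆ polydisk n)
    {φ : (Fin n → ℂ) → ℝ} (hφ : ∀ x ∉ K, φ x = 0) (x : Fin n → ℂ) :
    (f x).toReal * φ x = -(pot f x).toReal * φ x := by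
  by_cases hx : x ∈ K
  · rw [hf.toReal_eq (hKD hx)]
  · simp [hφ x hx]

lemma NegPSH.integrable_mul (hf : NegPSH f) {K : Set (Fin n → ℂ)} (hK : IsCompact K)
    (hKD : K ⊆ polydisk n) {φ : (Fin n → ℂ) → ℝ} (hφc : ContinuousOn φ K)
    (hφ : ∀ x ∉ K, φ x = 0) : Integrable fun x => (f x).toReal * φ x := by
  have h1 : IntegrableOn (fun x => (pot f x).toReal) K :=
    integrable_toReal_of_lintegral_ne_top hf.measurable_pot.aemeasurable
      (hf.lintegral_pot_lt_top hK hKD).ne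
  have h2 := (h1.neg.mul_continuousOn hφc hK)
  rw [integrableOn_iff_integrable_of_support_subset] at h2
  · exact h2.congr (Eventually.of_forall fun x => (hf.mul_eq hKD hφ x).symm)
  · intro x hx
    by_contra hxK
    exact hx (by simp [hφ x hxK])

/-- Positivity can be checked on smooth plurisubharmonic functions. -/
lemma NegPSH.integral_nonneg_of_smooth (hf : NegPSH f) {K : Set (Fin n → ℂ)} (hK : IsCompact K)
    (hKD : K ⊆ polydisk n) {φ : (Fin n → ℂ) → ℝ} (hφc : Continuous φ) (hφ : ∀ x ∉ K, φ x = 0)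
    (h : ∀ F : (Fin n → ℂ) → ℝ, ContDiff ℝ ∞ F → (∀ x ∈ K, ∀ b, 0 ≤ levi F x b) →
      0 ≤ ∫ x, F x * φ x) : 0 ≤ ∫ x, (f x).toReal * φ x := by
  obtain ⟨F, hFs, hF0, hFr, hFt⟩ := hf.exists_smooth_approx
  obtain ⟨r, hr1, hr⟩ : ∃ r < 1, ∀ x ∈ K, ‖x‖ ≤ r := by
    rcases K.eq_empty_or_nonempty with rfl | hne
    · exact ⟨0, by norm_num, by simp⟩
    · obtain ⟨x₀, hx₀, hmax⟩ := hK.exists_isMaxOn hne continuous_norm.continuousOn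
      refine ⟨‖x₀‖, ?_, fun x hx => hmax hx⟩
      simpa [polydisk_eq_ball] using hKD hx₀
  have hae : ∀ᵐ x, x ∈ K → pot f x < ⊤ :=
    ae_imp_of_ae_restrict (ae_lt_top hf.measurable_pot (hf.lintegral_pot_lt_top hK hKD).ne)
  -- Dominated convergence: on `K` the approximants are bounded by `pot f`, which is integrable on
  -- compact sets.
  have hlim : Tendsto (fun j => ∫ x, F j x * φ x) atTop (𝓝 (∫ x, (f x).toReal * φ x)) := by
    have hInt := (hf.integrable_mul hK hKD hφc.continuousOn hφ).norm
    refine tendsto_integral_filter_of_dominated_convergence _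
      (Eventually.of_forall fun j => ((hFs j).continuous.mul hφc).aestronglyMeasurable)
      ?_ hInt ?_
    · filter_upwards [hFr r hr1] with j hj
      filter_upwards [hae] with x hx
      by_cases hxK : x ∈ K
      · rw [norm_mul, norm_mul]
        gcongr
        rw [hf.toReal_eq (hKD hxK), norm_neg, Real.norm_eq_abs, Real.norm_eq_abs,
          abs_of_nonneg ENNReal.toReal_nonneg, abs_of_nonpos (hF0 j x)]
        have := ENNReal.toReal_mono (hx hxK).ne (hj x (hr x hxK)).1
        rwa [ENNReal.toReal_ofReal (by linarith [hF0 j x])] at this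
      · simp [hφ x hxK]
    · filter_upwards [hae] with x hx
      by_cases hxK : x ∈ K
      · rw [hf.toReal_eq (hKD hxK)]
        refine Tendsto.mul_const _ ?_
        have := ((ENNReal.tendsto_toReal (hx hxK).ne).comp (hFt x (hKD hxK))).neg
        refine this.congr fun j => ?_
        simp [ENNReal.toReal_ofReal (show 0 ≤ -F j x by linarith [hF0 j x])]
      · simp [hφ x hxK]
  refine ge_of_tendsto hlim ?_
  filter_upwards [hFr r hr1] with j hj
  exact h (F j) (hFs j) fun x hx b => (hj x (hr x hx)).2 b

/-- The density of `dd^c χ ∧ (dd^c w)ⁿ`, up to a constant. -/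
def maDensity (w χ : (Fin n → ℂ) → ℝ) (x : Fin n → ℂ) : ℝ :=
  ((complexHessian w x).adjugate * complexHessian χ x).trace.re

/-- Write `Q = B^* B`; by cyclicity the trace is that of the positive semidefinite matrix `B P B^*`.
-/
lemma trace_mul_nonneg {P Q : Matrix (Fin n) (Fin n) ℂ} (hP : P.PosSemidef) (hQ : Q.PosSemidef) :
    0 ≤ (P * Q).trace.re := by
  obtain ⟨B, rfl⟩ := CStarAlgebra.nonneg_iff_eq_star_mul_self.mp hQ.nonneg
  rw [Matrix.star_eq_conjTranspose]
  have h := (hP.mul_mul_conjTranspose_same B).trace_nonneg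
  rw [← Matrix.mul_assoc, Matrix.trace_mul_comm, ← Matrix.mul_assoc]
  exact (Complex.nonneg_iff.1 h).1

/-- For an invertible matrix the adjugate is `det A • A⁻¹`, and both factors are positive. -/
lemma posSemidef_adjugate {A : Matrix (Fin n) (Fin n) ℂ} (hA : A.PosDef) :
    A.adjugate.PosSemidef := by
  have hdet : IsUnit A.det := isUnit_iff_ne_zero.2 hA.det_pos.ne'
  have e : A.adjugate = A.det • A⁻¹ := by
    rw [Matrix.inv_def, smul_smul, Ring.mul_inverse_cancel _ hdet, one_smul]
  rw [e]
  exact hA.inv.posSemidef.smul hA.det_pos.le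

lemma continuous_maDensity {w χ : (Fin n → ℂ) → ℝ} (hw : ContDiff ℝ ∞ w) (hχ : ContDiff ℝ ∞ χ) :
    Continuous (maDensity w χ) := by
  refine Complex.continuous_re.comp ?_
  simp only [Matrix.trace, Matrix.diag, Matrix.mul_apply]
  exact continuous_finsetSum _ fun i _ => continuous_finsetSum _ fun j _ =>
    (contDiff_adjugate (contDiff_complexHessian hw) i j).continuous.mul
      (contDiff_complexHessian hχ j i).continuous

lemma maDensity_of_notMem {w χ : (Fin n → ℂ) → ℝ} {x : Fin n → ℂ} (hx : x ∉ tsupport χ) :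
    maDensity w χ x = 0 := by
  simp [maDensity, complexHessian_of_notMem_tsupport hx]

/-- Symmetry of the mixed Monge-Ampère operator. -/
lemma integral_maDensity_symm {w u v : (Fin n → ℂ) → ℝ} (hw : ContDiff ℝ ∞ w)
    (hu : ContDiff ℝ ∞ u) (hv : ContDiff ℝ ∞ v) (hvc : HasCompactSupport v)
    (hA : ∀ x ∈ tsupport v, IsUnit (complexHessian w x).det) :
    ∫ x, u x * maDensity w v x = ∫ x, v x * maDensity w u x := by
  have h1 := integral_cofactor_by_parts hw hu hv hvc (Or.inr subset_rfl) hA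
  have h2 := integral_cofactor_by_parts hw hv hu hvc (Or.inl subset_rfl) hA
  have hInt {a b : (Fin n → ℂ) → ℝ} (ha : ContDiff ℝ ∞ a) (hb : ContDiff ℝ ∞ b)
      (h : ∀ x ∉ tsupport v, a x = 0 ∨ complexHessian b x = 0) : Integrable fun x =>
        (a x : ℂ) * ((complexHessian w x).adjugate * complexHessian b x).trace := by
    refine Continuous.integrable_of_hasCompactSupport ?_ (HasCompactSupport.intro hvc fun x hx => ?_)
    · refine (contDiff_ofReal_comp ha).continuous.mul ?_
      simp only [Matrix.trace, Matrix.diag, Matrix.mul_apply]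
      exact continuous_finsetSum _ fun i _ => continuous_finsetSum _ fun j _ =>
        (contDiff_adjugate (contDiff_complexHessian hw) i j).continuous.mul
          (contDiff_complexHessian hb j i).continuous
    · rcases h x hx with h | h <;> simp [h]
  have hre {a b : (Fin n → ℂ) → ℝ} (ha : ContDiff ℝ ∞ a) (hb : ContDiff ℝ ∞ b)
      (h : ∀ x ∉ tsupport v, a x = 0 ∨ complexHessian b x = 0) : ∫ x, a x * maDensity w b x
      = (∫ x, (a x : ℂ) * ((complexHessian w x).adjugate * complexHessian b x).trace).re := by
    rw [← RCLike.re_eq_complex_re, ← integral_re (hInt ha hb h)]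
    refine integral_congr_ae (Eventually.of_forall fun x => ?_)
    simp [maDensity]
  rw [hre hu hv fun x hx => Or.inr (complexHessian_of_notMem_tsupport hx),
    hre hv hu fun x hx => Or.inl (image_eq_zero_of_notMem_tsupport hx), h1, h2]
  simp only [Complex.neg_re]
  congr 1
  -- The two integrals produced by integration by parts are complex conjugates of each other, since
  -- the cofactor matrix is Hermitian and `u`, `v` are real; their real parts agree.
  rw [← Complex.conj_re, ← integral_conj]
  congr 2
  ext x
  have hd {g : (Fin n → ℂ) → ℝ} (hg : ContDiff ℝ ∞ g) : DifferentiableAt ℝ g x :=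
    hg.differentiable (by simp) x
  have hwd {g : (Fin n → ℂ) → ℝ} (hg : ContDiff ℝ ∞ g) (σ : ℂ) (k : Fin n) :
      (starRingEnd ℂ) (wd σ k (fun y => (g y : ℂ)) x)
        = wd ((starRingEnd ℂ) σ) k (fun y => (g y : ℂ)) x := by
    simp only [wd, fderiv_ofReal_comp (hd hg), map_div₀, map_add, map_mul, Complex.conj_ofReal,
      map_ofNat]
  have hC (k l : Fin n) : (starRingEnd ℂ) ((complexHessian w x).adjugate l k)
      = (complexHessian w x).adjugate k l := by
    have h := (isHermitian_complexHessian (hw.of_le two_le_infty).contDiffAt (x := x)).adjugate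
    exact h.apply k l
  simp only [map_sum, map_mul, hwd hu, hwd hv, hC, map_neg, Complex.conj_I, neg_neg]
  rw [Finset.sum_comm]
  refine Finset.sum_congr rfl fun k _ => Finset.sum_congr rfl fun l _ => ?_
  ring

/-- Positivity, nondegenerate case. -/
lemma NegPSH.integral_maDensity_nonneg_of_posDef (hf : NegPSH f) {w χ : (Fin n → ℂ) → ℝ}
    (hw : ContDiff ℝ ∞ w) (hχ : IsTest (polydisk n) χ) (hχ0 : ∀ x, 0 ≤ χ x)
    (hA : ∀ x ∈ tsupport χ, (complexHessian w x).PosDef) :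
    0 ≤ ∫ x, (f x).toReal * maDensity w χ x := by
  refine hf.integral_nonneg_of_smooth hχ.compact hχ.supp (continuous_maDensity hw hχ.smooth)
    (fun x hx => maDensity_of_notMem hx) fun F hF hlevi => ?_
  -- Symmetry moves the derivatives from `χ` to `F`. The density is then the trace of a product of
  -- two positive semidefinite matrices, weighted by `χ ≥ 0`.
  rw [integral_maDensity_symm hw hF hχ.smooth hχ.compact fun x hx =>
    isUnit_iff_ne_zero.2 (hA x hx).det_pos.ne']
  refine integral_nonneg fun x => ?_
  by_cases hx : x ∈ tsupport χ
  · exact mul_nonneg (hχ0 x) (trace_mul_nonneg (posSemidef_adjugate (hA x hx))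
      (posSemidef_complexHessian (hF.of_le two_le_infty).contDiffAt (hlevi x hx)))
  · simp [image_eq_zero_of_notMem_tsupport hx]

/-- Positivity for globally smooth weights. -/
lemma NegPSH.integral_maDensity_nonneg (hf : NegPSH f) {w χ : (Fin n → ℂ) → ℝ}
    (hw : ContDiff ℝ ∞ w) (hχ : IsTest (polydisk n) χ) (hχ0 : ∀ x, 0 ≤ χ x)
    (hA : ∀ x ∈ tsupport χ, ∀ b, 0 ≤ levi w x b) :
    0 ≤ ∫ x, (f x).toReal * maDensity w χ x := by
  let N : (Fin n → ℂ) → ℝ := fun y => ∑ j, ‖y j‖ ^ 2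
  have hN : ContDiff ℝ ∞ N := ContDiff.sum fun j _ => contDiff_normSq_coord j
  -- Adding `τ |x|²` adds `τ` times the identity to the Hessian and makes it positive definite; then
  -- `τ → 0`.
  let wt : ℝ → (Fin n → ℂ) → ℝ := fun τ y => w y + τ * N y
  have hwt (τ : ℝ) : ContDiff ℝ ∞ (wt τ) := hw.add (contDiff_const.mul hN)
  have hHess (τ : ℝ) (x : Fin n → ℂ) :
      complexHessian (wt τ) x = complexHessian w x + (τ : ℂ) • 1 := by
    rw [complexHessian_add (hw.of_le two_le_infty).contDiffAt
      ((contDiff_const.mul hN).of_le two_le_infty).contDiffAt, complexHessian_const_mul,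
      complexHessian_normSq]
  have hpos (τ : ℝ) (hτ : 0 < τ) : 0 ≤ ∫ x, (f x).toReal * maDensity (wt τ) χ x := by
    refine hf.integral_maDensity_nonneg_of_posDef (hwt τ) hχ hχ0 fun x hx => ?_
    rw [hHess]
    have h1 := posSemidef_complexHessian (hw.of_le two_le_infty).contDiffAt (hA x hx)
    have h2 : ((τ : ℂ) • (1 : Matrix (Fin n) (Fin n) ℂ)).PosDef :=
      Matrix.PosDef.one.smul (by exact_mod_cast hτ)
    exact h2.posSemidef_add h1
  have hcont : Continuous fun p : ℝ × (Fin n → ℂ) => maDensity (wt p.1) χ p.2 := by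
    simp only [maDensity, hHess]
    have h1 : Continuous fun p : ℝ × (Fin n → ℂ) => complexHessian w p.2 + (p.1 : ℂ) • 1 := by
      refine Continuous.add ?_ (by fun_prop)
      exact continuous_matrix fun i j => (contDiff_complexHessian hw i j).continuous.comp
        continuous_snd
    have h2 : Continuous fun p : ℝ × (Fin n → ℂ) => complexHessian χ p.2 :=
      continuous_matrix fun i j => (contDiff_complexHessian hχ.smooth i j).continuous.comp
        continuous_snd
    exact Complex.continuous_re.comp (h1.matrix_adjugate.matrix_mul h2).matrix_trace
  obtain ⟨C, hC⟩ := ((isCompact_Icc (a := (0 : ℝ)) (b := 1)).prod hχ.compact).exists_bound_of_continuousOn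
    hcont.continuousOn
  have hlim : Tendsto (fun τ => ∫ x, (f x).toReal * maDensity (wt τ) χ x) (𝓝[>] 0)
      (𝓝 (∫ x, (f x).toReal * maDensity w χ x)) := by
    have hInt : Integrable fun x => ‖(f x).toReal * (tsupport χ).indicator (fun _ => C) x‖ := by
      refine (hf.integrable_mul hχ.compact hχ.supp ?_ fun x hx => Set.indicator_of_notMem hx _).norm
      exact continuousOn_const.congr fun x hx => Set.indicator_of_mem hx _
    refine tendsto_integral_filter_of_dominated_convergence _ ?_ ?_ hInt ?_
    · exact Eventually.of_forall fun τ => (hf.integrable_mul hχ.compact hχ.supp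
        (continuous_maDensity (hwt τ) hχ.smooth).continuousOn
        fun x hx => maDensity_of_notMem hx).aestronglyMeasurable
    · filter_upwards [self_mem_nhdsWithin, nhdsWithin_le_nhds (Iio_mem_nhds one_pos)] with τ h0 h1
      refine Eventually.of_forall fun x => ?_
      by_cases hx : x ∈ tsupport χ
      · rw [Set.indicator_of_mem hx, norm_mul, norm_mul]
        gcongr
        exact (hC (τ, x) ⟨⟨h0.le, h1.le⟩, hx⟩).trans (le_abs_self C)
      · rw [maDensity_of_notMem hx, mul_zero, norm_zero]
        exact norm_nonneg _
    · refine Eventually.of_forall fun x => Tendsto.const_mul _ ?_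
      have hcurry {Φ : ℝ × (Fin n → ℂ) → ℝ} (hΦ : Continuous Φ) :
          Continuous fun τ => Φ (τ, x) := by fun_prop
      have h2 := (hcurry hcont).tendsto 0
      have e : maDensity (wt 0) χ x = maDensity w χ x := by simp [wt]
      rw [e] at h2
      exact h2.mono_left nhdsWithin_le_nhds
  exact ge_of_tendsto hlim (by filter_upwards [self_mem_nhdsWithin] with τ hτ using hpos τ hτ)

end Positivity

/-! ### Smooth plurisubharmonic weights -/

lemma eIntegral_coe {α : Type*} [MeasurableSpace α] {μ : Measure α} {g : α → ℝ}
    (hg : Integrable g μ) : eIntegral μ (fun t => (g t : EReal)) = ((∫ t, g t ∂μ : ℝ) : EReal) := by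
  have e1 (t : α) : ((g t : ℝ) : EReal).toENNReal = ENNReal.ofReal (g t) :=
    EReal.toENNReal_of_ne_top (EReal.coe_ne_top _)
  have e2 (t : α) : (-((g t : ℝ) : EReal)).toENNReal = ENNReal.ofReal (-g t) := by
    rw [← EReal.coe_neg]
    exact EReal.toENNReal_of_ne_top (EReal.coe_ne_top _)
  rw [eIntegral, integral_eq_lintegral_pos_part_sub_lintegral_neg_part hg]
  simp only [e1, e2]
  have h1 : ∫⁻ t, ENNReal.ofReal (g t) ∂μ ≠ ⊤ :=
    ne_top_of_le_ne_top ((hasFiniteIntegral_iff_norm _).1 hg.2).ne (lintegral_mono fun t =>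
      ENNReal.ofReal_le_ofReal (le_abs_self _))
  have h2 : ∫⁻ t, ENNReal.ofReal (-g t) ∂μ ≠ ⊤ :=
    ne_top_of_le_ne_top ((hasFiniteIntegral_iff_norm _).1 hg.2).ne (lintegral_mono fun t =>
      ENNReal.ofReal_le_ofReal (neg_le_abs _))
  rw [EReal.coe_sub, ← EReal.toReal_coe_ennreal, ← EReal.toReal_coe_ennreal,
    EReal.coe_toReal (by simpa using h1) (by simp), EReal.coe_toReal (by simpa using h2) (by simp)]

section Cutoff

variable {n : ℕ}

lemma exists_smooth_cutoff {K : Set (Fin n → ℂ)} (hK : IsCompact K) (hKD : K ⊆ polydisk n) :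
    ∃ ψ : (Fin n → ℂ) → ℝ, IsTest (polydisk n) ψ ∧ (∀ᶠ x in 𝓝ˢ K, ψ x = 1) ∧
      ∀ x, ψ x ∈ Set.Icc (0 : ℝ) 1 := by
  obtain ⟨K', hK', hKK', hK'D⟩ := exists_compact_between hK (isOpen_polydisk n) hKD
  obtain ⟨ψ, h1, h0, hψ⟩ := exists_contMDiffMap_one_nhds_of_subset_interior
    (modelWithCornersSelf ℝ (Fin n → ℂ)) (n := ⊤) hK.isClosed hKK'
  have hs : tsupport ψ ⊆ K' := by
    refine closure_minimal (fun x hx => ?_) hK'.isClosed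
    by_contra hxK
    exact hx (h0 x hxK)
  exact ⟨ψ, ⟨ψ.contMDiff.contDiff, hK'.of_isClosed_subset (isClosed_tsupport _) hs,
    hs.trans hK'D⟩, h1, hψ⟩

/-- Weights are smooth on the polydisk only. Near the support of a test function they may be
replaced by globally smooth ones, for which integration by parts is available. -/
lemma exists_contDiff_eventuallyEq {w : (Fin n → ℂ) → ℝ} (hw : ContDiffOn ℝ ∞ w (polydisk n))
    {K : Set (Fin n → ℂ)} (hK : IsCompact K) (hKD : K ⊆ polydisk n) :
    ∃ v : (Fin n → ℂ) → ℝ, ContDiff ℝ ∞ v ∧ ∀ x ∈ K, v =ᶠ[𝓝 x] w := by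
  obtain ⟨ψ, hψ, hψ1, -⟩ := exists_smooth_cutoff hK hKD
  refine ⟨fun x => ψ x * w x, contDiff_iff_contDiffAt.2 fun x => ?_, fun x hx => ?_⟩
  · by_cases hx : x ∈ tsupport ψ
    · exact hψ.smooth.contDiffAt.mul (hw.contDiffAt ((isOpen_polydisk n).mem_nhds (hψ.supp hx)))
    · refine contDiffAt_const (c := (0 : ℝ)) |>.congr_of_eventuallyEq ?_
      filter_upwards [notMem_tsupport_iff_eventuallyEq.1 hx] with y hy
      simp [hy]
  · filter_upwards [(eventually_nhdsSet_iff_forall.1 hψ1) x hx] with y hy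
    simp [hy]

/-- Smooth functions on the polydisk with nonnegative Levi form. -/
structure SmoothPSH (w : (Fin n → ℂ) → ℝ) : Prop where
  smooth : ContDiffOn ℝ ∞ w (polydisk n)
  levi_nonneg : ∀ x ∈ polydisk n, ∀ b, 0 ≤ levi w x b

lemma SmoothPSH.contDiffAt {w : (Fin n → ℂ) → ℝ} (hw : SmoothPSH w) {x : Fin n → ℂ}
    (hx : x ∈ polydisk n) : ContDiffAt ℝ ∞ w x :=
  hw.smooth.contDiffAt ((isOpen_polydisk n).mem_nhds hx)

/-- Replace `w` by a globally smooth function equal to it near `x`. Only discs inside that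
neighbourhood matter, and on them the extended-real mean is the ordinary integral. -/
lemma smoothPSH_of_pshOn {w : (Fin n → ℂ) → ℝ} (hw : ContDiffOn ℝ ∞ w (polydisk n))
    (hp : PSHOn (fun x => (w x : EReal)) (polydisk n)) : SmoothPSH w := by
  refine ⟨hw, fun x hx b => ?_⟩
  obtain ⟨v, hv, hvw⟩ := exists_contDiff_eventuallyEq hw (K := {x}) isCompact_singleton (by simpa)
  have hvx := hvw x rfl
  rw [← levi_congr hvx]
  refine levi_nonneg_of_subMean hv ?_
  obtain ⟨r, hr, hrU⟩ := Metric.mem_nhds_iff.1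
    (Filter.inter_mem hvx ((isOpen_polydisk n).mem_nhds hx))
  have hsmall : ∀ᶠ ρ : ℝ in 𝓝[>] 0, ρ * ‖b‖ < r := by
    have h : Tendsto (fun ρ : ℝ => ρ * ‖b‖) (𝓝[>] 0) (𝓝 0) := by
      have : Continuous fun ρ : ℝ => ρ * ‖b‖ := by fun_prop
      simpa using (this.tendsto 0).mono_left nhdsWithin_le_nhds
    exact h.eventually_lt_const hr
  filter_upwards [hsmall, self_mem_nhdsWithin] with ρ hρ hρ0
  have hmem (ζ : ℂ) (hζ : ‖ζ‖ ≤ 1) : x + ζ • ((ρ : ℂ) • b) ∈ Metric.ball x r := by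
    rw [mem_ball_iff_norm, add_sub_cancel_left, norm_smul, norm_smul, Complex.norm_real,
      Real.norm_eq_abs, abs_of_pos hρ0]
    have : 0 ≤ ρ * ‖b‖ := mul_nonneg (le_of_lt hρ0) (norm_nonneg _)
    nlinarith [norm_nonneg ζ]
  have h1 := hp.subMean x ((ρ : ℂ) • b) fun ζ hζ => (hrU (hmem ζ hζ)).2
  have e (θ : ℝ) : x + Complex.exp (θ * Complex.I) • ((ρ : ℂ) • b) = x + (ρ * expI θ) • b := by
    rw [smul_smul, mul_comm]; rfl
  have e2 (θ : ℝ) : w (x + (ρ * expI θ) • b) = v (x + (ρ * expI θ) • b) := by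
    rw [← e]
    exact (hrU (hmem _ (norm_expI θ).le)).1.symm
  simp only [e, e2] at h1
  have hc : Continuous fun θ => v (x + (ρ * expI θ) • b) := by
    have := hv.continuous
    have := continuous_expI
    fun_prop
  have hInt : Integrable (fun θ => v (x + (ρ * expI θ) • b)) angleMeasure := by
    refine Integrable.smul_measure ?_ (by simp [Real.pi_pos])
    exact (hc.integrableOn_Icc (a := 0) (b := 2 * Real.pi)).mono_set Set.Ioc_subset_Icc_self
  rw [eIntegral_coe hInt, ← hvx.self_of_nhds] at h1
  exact_mod_cast h1

/-- The Levi form and the Hessian of a composition with a function of one real variable. -/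
lemma fderiv_fderiv_comp {E : Type*} [NormedAddCommGroup E] [NormedSpace ℝ E] {u : E → ℝ}
    {G : ℝ → ℝ} {x : E} (hu : ContDiffAt ℝ 2 u x) (hG : ContDiffAt ℝ 2 G (u x)) (b c : E) :
    fderiv ℝ (fderiv ℝ fun y => G (u y)) x b c
      = deriv G (u x) * fderiv ℝ (fderiv ℝ u) x b c
        + deriv (deriv G) (u x) * (fderiv ℝ u x b * fderiv ℝ u x c) := by
  have e : fderiv ℝ (fun y => G (u y)) =ᶠ[𝓝 x] fun y => deriv G (u y) • fderiv ℝ u y := by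
    filter_upwards [hu.eventually (by simp),
      hu.continuousAt.eventually (hG.eventually (by simp))] with y h1 h2
    exact ((h2.differentiableAt (by norm_num)).hasDerivAt.comp_hasFDerivAt y
      (h1.differentiableAt (by norm_num)).hasFDerivAt).fderiv
  have hdG : DifferentiableAt ℝ (deriv G) (u x) := by
    have h := (hG.fderiv_right (m := 1) (by norm_num)).differentiableAt (by norm_num)
    have h3 := h.clm_apply (differentiableAt_const (1 : ℝ))
    exact h3
  have hdu : DifferentiableAt ℝ (fderiv ℝ u) x :=
    (hu.fderiv_right (m := 1) (by norm_num)).differentiableAt (by norm_num)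
  have h1 : HasFDerivAt (fun y => deriv G (u y)) (deriv (deriv G) (u x) • fderiv ℝ u x) x :=
    hdG.hasDerivAt.comp_hasFDerivAt x (hu.differentiableAt (by norm_num)).hasFDerivAt
  have h2 := h1.smul hdu.hasFDerivAt
  rw [e.fderiv_eq]
  have h3 := h2.fderiv
  rw [show fderiv ℝ (fun y => deriv G (u y) • fderiv ℝ u y) x = _ from h3]
  simp
  ring

/-- The Wirtinger gradient `∂u/∂x_k`. -/
def wirtinger (u : (Fin n → ℂ) → ℝ) (x : Fin n → ℂ) (k : Fin n) : ℂ :=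
  ((fderiv ℝ u x (Pi.single k 1) : ℂ) - Complex.I * fderiv ℝ u x (Pi.single k Complex.I)) / 2

lemma complexHessian_comp {u : (Fin n → ℂ) → ℝ} {G : ℝ → ℝ} {x : Fin n → ℂ}
    (hu : ContDiffAt ℝ 2 u x) (hG : ContDiffAt ℝ 2 G (u x)) :
    complexHessian (fun y => G (u y)) x = ((deriv G (u x) : ℝ) : ℂ) • complexHessian u x
      + ((deriv (deriv G) (u x) : ℝ) : ℂ) •
        Matrix.vecMulVec (wirtinger u x) (star (wirtinger u x)) := by
  ext k l
  simp only [complexHessian, secondDeriv, fderiv_fderiv_comp hu hG, Matrix.of_apply,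
    Matrix.add_apply, Matrix.smul_apply, smul_eq_mul, Matrix.vecMulVec_apply, wirtinger,
    Pi.star_apply]
  simp only [Complex.star_def, map_div₀, map_sub, map_mul, Complex.conj_ofReal, Complex.conj_I,
    map_ofNat]
  push_cast
  ring_nf
  rw [Complex.I_sq]
  ring

lemma levi_comp {E : Type*} [NormedAddCommGroup E] [NormedSpace ℂ E] {u : E → ℝ} {G : ℝ → ℝ}
    {x : E} (hu : ContDiffAt ℝ 2 u x) (hG : ContDiffAt ℝ 2 G (u x)) (b : E) :
    levi (fun y => G (u y)) x b = deriv G (u x) * levi u x b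
      + deriv (deriv G) (u x) * (fderiv ℝ u x b ^ 2 + fderiv ℝ u x (Complex.I • b) ^ 2) := by
  simp only [levi, fderiv_fderiv_comp hu hG]
  ring

end Cutoff

/-! ### The regularized positive part -/

/-- A smooth convex function with derivative `0` on `(-∞, 0]` and `1` on `[1, ∞)`. -/
def ramp (t : ℝ) : ℝ := ∫ s in (0)..t, Real.smoothTransition s

lemma deriv_ramp : deriv ramp = Real.smoothTransition := by
  ext t
  exact (intervalIntegral.integral_hasDerivAt_right
    (Real.smoothTransition.continuous.intervalIntegrable _ _)
    (Real.smoothTransition.continuous.stronglyMeasurableAtFilter _ _)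
    Real.smoothTransition.continuous.continuousAt).deriv

lemma contDiff_ramp : ContDiff ℝ ∞ ramp := by
  rw [contDiff_infty_iff_deriv, deriv_ramp]
  refine ⟨fun t => ?_, Real.smoothTransition.contDiff⟩
  exact (intervalIntegral.integral_hasDerivAt_right
    (Real.smoothTransition.continuous.intervalIntegrable _ _)
    (Real.smoothTransition.continuous.stronglyMeasurableAtFilter _ _)
    Real.smoothTransition.continuous.continuousAt).differentiableAt

lemma deriv_smoothTransition_nonneg (t : ℝ) : 0 ≤ deriv Real.smoothTransition t :=
  Real.smoothTransition.monotone.deriv_nonneg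

lemma deriv_smoothTransition_of_neg {t : ℝ} (ht : t < 0) : deriv Real.smoothTransition t = 0 := by
  have : Real.smoothTransition =ᶠ[𝓝 t] fun _ => 0 := by
    filter_upwards [Iio_mem_nhds ht] with s hs
    exact Real.smoothTransition.zero_of_nonpos hs.le
  rw [this.deriv_eq, deriv_const]

lemma deriv_smoothTransition_of_one_lt {t : ℝ} (ht : 1 < t) :
    deriv Real.smoothTransition t = 0 := by
  have : Real.smoothTransition =ᶠ[𝓝 t] fun _ => 1 := by
    filter_upwards [Ioi_mem_nhds ht] with s hs
    exact Real.smoothTransition.one_of_one_le hs.le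
  rw [this.deriv_eq, deriv_const]

/-! ### The mixed Monge-Ampère functional and the comparison of weights. -/

section MixedMA

variable {n : ℕ} {f : (Fin n → ℂ) → EReal}

/-- The distribution `χ ↦ ∫ f tr (adj (∂∂̄w) ∂∂̄χ) dV`. -/
def maInt (f : (Fin n → ℂ) → EReal) (w χ : (Fin n → ℂ) → ℝ) : ℝ :=
  ∫ x, (f x).toReal * maDensity w χ x

lemma maInt_congr {w v χ : (Fin n → ℂ) → ℝ} (hχ : IsTest (polydisk n) χ)
    (h : ∀ x ∈ polydisk n, complexHessian χ x = 0 ∨ complexHessian w x = complexHessian v x) :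
    maInt f w χ = maInt f v χ := by
  unfold maInt
  congr 1
  ext x
  by_cases hx : x ∈ tsupport χ
  · rcases h x (hχ.supp hx) with h | h <;> simp [maDensity, h]
  · simp [maDensity_of_notMem hx]

lemma IsTest.sub {U : Set (Fin n → ℂ)} {χ χ' : (Fin n → ℂ) → ℝ} (h : IsTest U χ)
    (h' : IsTest U χ') : IsTest U fun x => χ x - χ' x where
  smooth := h.smooth.sub h'.smooth
  compact := h.compact.sub h'.compact
  supp := (tsupport_sub χ χ').trans (Set.union_subset h.supp h'.supp)

lemma continuousOn_maDensity {w χ : (Fin n → ℂ) → ℝ} (hw : ContDiffOn ℝ ∞ w (polydisk n))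
    (hχ : IsTest (polydisk n) χ) : ContinuousOn (maDensity w χ) (tsupport χ) := by
  obtain ⟨v, hv, hvw⟩ := exists_contDiff_eventuallyEq hw hχ.compact hχ.supp
  refine (continuous_maDensity hv hχ.smooth).continuousOn.congr fun x hx => ?_
  simp only [maDensity, complexHessian_congr (hvw x hx)]

lemma NegPSH.integrable_maDensity (hf : NegPSH f) {w χ : (Fin n → ℂ) → ℝ}
    (hw : ContDiffOn ℝ ∞ w (polydisk n)) (hχ : IsTest (polydisk n) χ) :
    Integrable fun x => (f x).toReal * maDensity w χ x :=
  hf.integrable_mul hχ.compact hχ.supp (continuousOn_maDensity hw hχ)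
    fun _ hx => maDensity_of_notMem hx

lemma NegPSH.maInt_nonneg (hf : NegPSH f) {w χ : (Fin n → ℂ) → ℝ} (hw : SmoothPSH w)
    (hχ : IsTest (polydisk n) χ) (hχ0 : ∀ x, 0 ≤ χ x) : 0 ≤ maInt f w χ := by
  obtain ⟨v, hv, hvw⟩ := exists_contDiff_eventuallyEq hw.smooth hχ.compact hχ.supp
  have h : maInt f w χ = maInt f v χ := by
    refine maInt_congr hχ fun x _ => ?_
    by_cases hx : x ∈ tsupport χ
    · exact Or.inr (complexHessian_congr (hvw x hx)).symm
    · exact Or.inl (complexHessian_of_notMem_tsupport hx)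
  rw [h]
  refine hf.integral_maDensity_nonneg hv hχ hχ0 fun x hx b => ?_
  rw [levi_congr (hvw x hx)]
  exact hw.levi_nonneg x (hχ.supp hx) b

lemma complexHessian_sub {v w : (Fin n → ℂ) → ℝ} {x : Fin n → ℂ} (hv : ContDiffAt ℝ 2 v x)
    (hw : ContDiffAt ℝ 2 w x) :
    complexHessian (fun y => v y - w y) x = complexHessian v x - complexHessian w x := by
  have h := complexHessian_add hv (w := fun y => (-1) * w y) (contDiffAt_const.mul hw)
  rw [complexHessian_const_mul] at h
  simpa [sub_eq_add_neg] using h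

lemma NegPSH.maInt_sub (hf : NegPSH f) {w χ χ' : (Fin n → ℂ) → ℝ}
    (hw : ContDiffOn ℝ ∞ w (polydisk n)) (hχ : IsTest (polydisk n) χ)
    (hχ' : IsTest (polydisk n) χ') :
    maInt f w (fun x => χ x - χ' x) = maInt f w χ - maInt f w χ' := by
  rw [maInt, maInt, maInt, ← integral_sub (hf.integrable_maDensity hw hχ)
    (hf.integrable_maDensity hw hχ')]
  congr 1
  ext x
  simp only [maDensity]
  rw [complexHessian_sub (hχ.smooth.of_le two_le_infty).contDiffAt
    (hχ'.smooth.of_le two_le_infty).contDiffAt, Matrix.mul_sub, Matrix.trace_sub, Complex.sub_re]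
  ring

lemma NegPSH.maInt_mono (hf : NegPSH f) {w χ χ' : (Fin n → ℂ) → ℝ} (hw : SmoothPSH w)
    (hχ : IsTest (polydisk n) χ) (hχ' : IsTest (polydisk n) χ') (h : ∀ x, χ' x ≤ χ x) :
    maInt f w χ' ≤ maInt f w χ := by
  have := hf.maInt_nonneg hw (hχ.sub hχ') fun x => sub_nonneg.2 (h x)
  rw [hf.maInt_sub hw.smooth hχ hχ'] at this
  linarith

lemma maInt_const_mul_right (w χ : (Fin n → ℂ) → ℝ) (c : ℝ) :
    maInt f w (fun x => c * χ x) = c * maInt f w χ := by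
  rw [maInt, maInt, ← integral_const_mul]
  congr 1
  ext x
  simp only [maDensity, complexHessian_const_mul, Matrix.mul_smul, Matrix.trace_smul, smul_eq_mul,
    Complex.re_ofReal_mul]
  ring

lemma complexHessian_affine {w : (Fin n → ℂ) → ℝ} (c d : ℝ) (x : Fin n → ℂ) :
    complexHessian (fun y => c * w y + d) x = (c : ℂ) • complexHessian w x := by
  have h : fderiv ℝ (fun y => c * w y + d) = fderiv ℝ (fun y => c * w y) := by
    ext1 y
    exact fderiv_add_const d
  rw [← complexHessian_const_mul]
  simp only [complexHessian, secondDeriv, h]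

/-- The adjugate is homogeneous of degree `n - 1`, and additive constants have no Hessian. -/
lemma maInt_affine_left (w χ : (Fin n → ℂ) → ℝ) (c d : ℝ) :
    maInt f (fun x => c * w x + d) χ = c ^ (n - 1) * maInt f w χ := by
  rw [maInt, maInt, ← integral_const_mul]
  congr 1
  ext x
  simp only [maDensity, complexHessian_affine, Matrix.adjugate_smul, Fintype.card_fin,
    Matrix.smul_mul, Matrix.trace_smul, smul_eq_mul]
  rw [← Complex.ofReal_pow, Complex.re_ofReal_mul]
  ring

lemma SmoothPSH.affine {w : (Fin n → ℂ) → ℝ} (hw : SmoothPSH w) {c : ℝ} (hc : 0 ≤ c) (d : ℝ) :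
    SmoothPSH fun x => c * w x + d := by
  refine ⟨(contDiffOn_const.mul hw.smooth).add contDiffOn_const, fun x hx b => ?_⟩
  have h : fderiv ℝ (fun y => c * w y + d) = fderiv ℝ (fun y => c * w y) := by
    ext1 y
    exact fderiv_add_const d
  have h2 := levi_const_mul (v := w) (x := x) c b
  rw [levi, h]
  rw [levi] at h2
  rw [h2]
  exact mul_nonneg hc (hw.levi_nonneg x hx b)

/-- Gluing of two weights along `{w ≈ v}`. -/
lemma SmoothPSH.glue {w v : (Fin n → ℂ) → ℝ} (hw : SmoothPSH w) (hv : SmoothPSH v) :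
    SmoothPSH fun x => v x + ramp (w x - v x) := by
  refine ⟨hv.smooth.add (contDiff_ramp.comp_contDiffOn (hw.smooth.sub hv.smooth)),
    fun x hx b => ?_⟩
  have hw2 := (hw.contDiffAt hx).of_le two_le_infty
  have hv2 := (hv.contDiffAt hx).of_le two_le_infty
  have hr : ContDiffAt ℝ 2 ramp (w x - v x) := (contDiff_ramp.of_le two_le_infty).contDiffAt
  have hc : ContDiffAt ℝ 2 (fun y => ramp (w y - v y)) x :=
    (contDiff_ramp.of_le two_le_infty).comp_contDiffAt x (hw2.sub hv2)
  have hd : levi (fun y => w y - v y) x b = levi w x b - levi v x b := by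
    have h := levi_add hw2 (w := fun y => (-1) * v y) (contDiffAt_const.mul hv2) b
    rw [levi_const_mul] at h
    simpa [sub_eq_add_neg] using h
  -- The Levi form of the glued function is a convex combination of those of `v` and `w`, with
  -- weights `1 - ramp'` and `ramp'`, plus the nonnegative term with `ramp''`.
  rw [levi_add hv2 hc, levi_comp (hw2.sub hv2) hr, hd, deriv_ramp]
  have h0 := Real.smoothTransition.nonneg (w x - v x)
  have h1 := Real.smoothTransition.le_one (w x - v x)
  have h2 := mul_nonneg (deriv_smoothTransition_nonneg (w x - v x))
    (add_nonneg (sq_nonneg (fderiv ℝ (fun y => w y - v y) x b))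
      (sq_nonneg (fderiv ℝ (fun y => w y - v y) x (Complex.I • b))))
  have h3 := mul_nonneg h0 (hw.levi_nonneg x hx b)
  have h4 := mul_nonneg (sub_nonneg.2 h1) (hv.levi_nonneg x hx b)
  nlinarith

lemma SmoothPSH.complexHessian_glue {w v : (Fin n → ℂ) → ℝ} (hw : SmoothPSH w)
    (hv : SmoothPSH v) {x : Fin n → ℂ} (hx : x ∈ polydisk n) :
    (w x < v x → complexHessian (fun x => v x + ramp (w x - v x)) x = complexHessian v x) ∧
    (v x + 1 < w x → complexHessian (fun x => v x + ramp (w x - v x)) x = complexHessian w x) := by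
  have hw2 := (hw.contDiffAt hx).of_le two_le_infty
  have hv2 := (hv.contDiffAt hx).of_le two_le_infty
  have hr : ContDiffAt ℝ 2 ramp (w x - v x) := (contDiff_ramp.of_le two_le_infty).contDiffAt
  have hc : ContDiffAt ℝ 2 (fun y => ramp (w y - v y)) x :=
    (contDiff_ramp.of_le two_le_infty).comp_contDiffAt x (hw2.sub hv2)
  rw [complexHessian_add hv2 hc, complexHessian_comp (hw2.sub hv2) hr,
    complexHessian_sub hw2 hv2, deriv_ramp]
  constructor
  · intro h
    rw [deriv_smoothTransition_of_neg (by linarith),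
      Real.smoothTransition.zero_of_nonpos (by linarith)]
    simp
  · intro h
    rw [deriv_smoothTransition_of_one_lt (by linarith),
      Real.smoothTransition.one_of_one_le (by linarith)]
    simp

/-- Comparison of the masses of two weights. -/
lemma NegPSH.maInt_le_of_lt (hf : NegPSH f) {w v χ χ' : (Fin n → ℂ) → ℝ} (hw : SmoothPSH w)
    (hv : SmoothPSH v) (hχ : IsTest (polydisk n) χ) (hχ' : IsTest (polydisk n) χ')
    (hle : ∀ x, χ' x ≤ χ x) (h1 : ∀ x ∈ polydisk n, complexHessian χ' x = 0 ∨ v x + 1 < w x)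
    (h2 : ∀ x ∈ polydisk n, complexHessian χ x = 0 ∨ w x < v x) :
    maInt f w χ' ≤ maInt f v χ := by
  -- The glued weight has the Hessian of `w` where `χ'` has a Hessian and that of `v` where `χ` has
  -- one. For this single weight the inequality is monotonicity in the test function.
  have hg := hw.glue hv
  rw [← maInt_congr hχ' fun x hx => (h1 x hx).imp_right (hw.complexHessian_glue hv hx).2,
    ← maInt_congr hχ fun x hx => (h2 x hx).imp_right (hw.complexHessian_glue hv hx).1]
  exact hf.maInt_mono hg hχ hχ' hle

end MixedMA

/-! ### Weights that are functions of `∑ |x_k|^{2 (q_k + 1)}` -/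

section Cone

variable {n : ℕ}

/-- The function `∑ |x_k|^{2 (q_k + 1)}`. -/
def cone (q : Fin n → ℕ) (x : Fin n → ℂ) : ℝ := ∑ k, (‖x k‖ ^ 2) ^ (q k + 1)

/-- The diagonal entries of the complex Hessian of `cone q`. -/
def coneDiag (q : Fin n → ℕ) (x : Fin n → ℂ) (k : Fin n) : ℝ :=
  ((q k : ℝ) + 1) ^ 2 * (‖x k‖ ^ 2) ^ q k

lemma cone_nonneg (q : Fin n → ℕ) (x : Fin n → ℂ) : 0 ≤ cone q x :=
  Finset.sum_nonneg fun _ _ => by positivity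

lemma coneDiag_nonneg (q : Fin n → ℕ) (x : Fin n → ℂ) (k : Fin n) : 0 ≤ coneDiag q x k := by
  unfold coneDiag; positivity

lemma cone_pos {q : Fin n → ℕ} {x : Fin n → ℂ} (hx : x ≠ 0) : 0 < cone q x := by
  obtain ⟨k, hk⟩ := Function.ne_iff.1 hx
  exact Finset.sum_pos' (fun _ _ => by positivity) ⟨k, Finset.mem_univ k, by
    have : 0 < ‖x k‖ := norm_pos_iff.2 hk
    positivity⟩

lemma cone_zero (q : Fin n → ℕ) : cone q 0 = 0 := by simp [cone]

lemma contDiff_cone (q : Fin n → ℕ) : ContDiff ℝ ∞ (cone q) :=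
  ContDiff.sum fun k _ => (contDiff_normSq_coord k).pow _

lemma continuous_cone (q : Fin n → ℕ) : Continuous (cone q) := (contDiff_cone q).continuous

lemma mem_polydisk_of_cone_lt_one {q : Fin n → ℕ} {x : Fin n → ℂ} (hx : cone q x < 1) :
    x ∈ polydisk n := fun k => by
  by_contra hk
  push Not at hk
  have h1 : (1 : ℝ) ≤ (‖x k‖ ^ 2) ^ (q k + 1) := one_le_pow₀ (one_le_pow₀ hk)
  have h2 := Finset.single_le_sum (f := fun k => (‖x k‖ ^ 2) ^ (q k + 1))
    (fun _ _ => by positivity) (Finset.mem_univ k)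
  exact absurd hx (not_lt.2 (h1.trans h2))

lemma deriv_pow_succ (q : ℕ) : deriv (fun t : ℝ => t ^ (q + 1)) = fun t => ((q : ℝ) + 1) * t ^ q := by
  ext t
  simp

lemma wirtinger_normSq_coord (j : Fin n) (x : Fin n → ℂ) :
    wirtinger (fun y => ‖y j‖ ^ 2) x = Pi.single j (star (x j)) := by
  ext k
  simp only [wirtinger, (fderiv_fderiv_normSq_coord j x _ 0).2]
  by_cases hk : j = k
  · subst hk
    simp only [Pi.single_eq_same]
    apply Complex.ext <;> (simp; try ring)
  · simp [hk]

lemma complexHessian_cone (q : Fin n → ℕ) (x : Fin n → ℂ) :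
    complexHessian (cone q) x = Matrix.diagonal fun k => (coneDiag q x k : ℂ) := by
  have hu (j : Fin n) : ContDiffAt ℝ 2 (fun y : Fin n → ℂ => ‖y j‖ ^ 2) x :=
    ((contDiff_normSq_coord j).of_le two_le_infty).contDiffAt
  unfold cone
  rw [complexHessian_sum _ fun j => (hu j).pow _]
  have h (j : Fin n) : complexHessian (fun y => (‖y j‖ ^ 2) ^ (q j + 1)) x
      = Matrix.single j j (coneDiag q x j : ℂ) := by
    rw [complexHessian_comp (G := fun t => t ^ (q j + 1)) (hu j)
      (contDiff_id.pow _).contDiffAt, complexHessian_normSq_coord, wirtinger_normSq_coord,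
      deriv_pow_succ]
    have h2 : deriv (fun t : ℝ => ((q j : ℝ) + 1) * t ^ q j) (‖x j‖ ^ 2)
        = ((q j : ℝ) + 1) * (q j * (‖x j‖ ^ 2) ^ (q j - 1)) := by simp
    rw [h2]
    ext k l
    simp only [Matrix.add_apply, Matrix.smul_apply, Matrix.vecMulVec_apply, Matrix.single_apply,
      Pi.star_apply, smul_eq_mul]
    by_cases hk : j = k
    · subst hk
      by_cases hl : j = l
      · subst hl
        simp only [and_self, if_true, Pi.single_eq_same, star_star]
        have h3 : star (x j) * x j = ((‖x j‖ ^ 2 : ℝ) : ℂ) := by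
          rw [Complex.star_def, Complex.conj_mul']; push_cast; rfl
        rw [h3]
        have h4 : (q j : ℝ) * (‖x j‖ ^ 2) ^ (q j - 1) * ‖x j‖ ^ 2 = q j * (‖x j‖ ^ 2) ^ q j := by
          rcases Nat.eq_zero_or_pos (q j) with h0 | h0
          · simp [h0]
          · rw [mul_assoc, ← pow_succ, Nat.sub_add_cancel h0]
        rw [mul_one, ← Complex.ofReal_mul, ← Complex.ofReal_add, coneDiag]
        congr 1
        linear_combination ((q j : ℝ) + 1) * h4
      · simp [hl, Ne.symm hl]
    · simp [hk, Ne.symm hk]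
  simp only [h]
  ext k l
  simp only [Matrix.sum_apply, Matrix.single_apply, Matrix.diagonal_apply]
  by_cases hkl : k = l
  · subst hkl; simp
  · simp only [hkl, if_false]
    exact Finset.sum_eq_zero fun j _ => if_neg fun h => hkl (h.1.symm.trans h.2)

/-- The vector `(x̄_k / (q_k + 1))`. -/
def coneVec (q : Fin n → ℕ) (x : Fin n → ℂ) (k : Fin n) : ℂ := star (x k) / ((q k : ℂ) + 1)

lemma wirtinger_cone (q : Fin n → ℕ) (x : Fin n → ℂ) (k : Fin n) :
    wirtinger (cone q) x k = (coneDiag q x k : ℂ) * coneVec q x k := by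
  have hu (j : Fin n) : HasFDerivAt (fun y : Fin n → ℂ => (‖y j‖ ^ 2) ^ (q j + 1))
      ((((q j : ℝ) + 1) * (‖x j‖ ^ 2) ^ q j) • fderiv ℝ (fun y : Fin n → ℂ => ‖y j‖ ^ 2) x) x := by
    have h := ((contDiff_normSq_coord j).differentiable (by simp) x).hasFDerivAt
    have h2 := (hasDerivAt_pow (q j + 1) (‖x j‖ ^ 2)).comp_hasFDerivAt x h
    exact h2.congr_fderiv (by simp)
  have h := (HasFDerivAt.fun_sum (u := Finset.univ) fun j _ => hu j).fderiv
  have e (b : Fin n → ℂ) : fderiv ℝ (cone q) x b = ∑ j, (((q j : ℝ) + 1) * (‖x j‖ ^ 2) ^ q j)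
      * (2 * ((x j).re * (b j).re + (x j).im * (b j).im)) := by
    unfold cone
    rw [h]
    simp only [sum_apply, smul_apply, smul_eq_mul, (fderiv_fderiv_normSq_coord _ x _ 0).2]
  have hq : ((q k : ℂ) + 1) ≠ 0 := by exact_mod_cast Nat.succ_ne_zero (q k)
  have e1 : fderiv ℝ (cone q) x (Pi.single k 1)
      = (((q k : ℝ) + 1) * (‖x k‖ ^ 2) ^ q k) * (2 * (x k).re) := by
    rw [e, Finset.sum_eq_single k (fun j _ hj => by simp [hj]) (by simp)]
    simp
  have e2 : fderiv ℝ (cone q) x (Pi.single k Complex.I)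
      = (((q k : ℝ) + 1) * (‖x k‖ ^ 2) ^ q k) * (2 * (x k).im) := by
    rw [e, Finset.sum_eq_single k (fun j _ hj => by simp [hj]) (by simp)]
    simp
  rw [wirtinger, e1, e2, coneVec, coneDiag]
  have h3 : star (x k) = ((x k).re : ℂ) - (x k).im * Complex.I := by
    apply Complex.ext <;> simp
  rw [h3]
  field_simp
  push_cast
  ring

/-- Euler's identity for `cone q`: the vector `coneVec q x` points along the dilations. -/
lemma sum_coneVec (q : Fin n → ℕ) (x : Fin n → ℂ) :
    star (wirtinger (cone q) x) ⬝ᵥ coneVec q x = (cone q x : ℂ) := by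
  simp only [dotProduct, Pi.star_apply, wirtinger_cone, cone, Complex.ofReal_sum]
  refine Finset.sum_congr rfl fun k _ => ?_
  have hq : ((q k : ℂ) + 1) ≠ 0 := by exact_mod_cast Nat.succ_ne_zero (q k)
  have h3 : x k * star (x k) = ((‖x k‖ : ℝ) : ℂ) ^ 2 := by
    rw [Complex.star_def, Complex.mul_conj']
  have h4 : star ((q k : ℂ) + 1) = (q k : ℂ) + 1 := by simp
  rw [coneVec, star_mul, star_div₀, star_star, h4, coneDiag, Complex.star_def, Complex.conj_ofReal]
  push_cast
  rw [pow_succ, ← h3]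
  simp only [Complex.star_def]
  field_simp
  ring

/-- `P` is a rank-one projection, so `det (1 - t P) = 1 - t` and `adj (1 - t P) = (1 - t) 1 + t P`
for `t ≠ 1`. The singular case `t = 1` follows by continuity. -/
lemma adjugate_one_sub_vecMulVec {u v : Fin n → ℂ} (h : v ⬝ᵥ u = 1) :
    (1 - Matrix.vecMulVec u v).adjugate = Matrix.vecMulVec u v := by
  set P := Matrix.vecMulVec u v with hP
  have hPP : P * P = P := by
    rw [hP, Matrix.vecMulVec_mul_vecMulVec, h, one_smul]
  have hdet (t : ℂ) : (1 - t • P).det = 1 - t := by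
    have h1 := Matrix.det_one_add_replicateCol_mul_replicateRow (ι := Unit) (-(t • u)) v
    rw [dotProduct_neg, dotProduct_smul, h, ← Matrix.vecMulVec_eq] at h1
    rw [Matrix.neg_vecMulVec, Matrix.smul_vecMulVec] at h1
    simpa [sub_eq_add_neg] using h1
  have hadj (t : ℂ) (ht : t ≠ 1) : (1 - t • P).adjugate = (1 - t) • 1 + t • P := by
    have ht' : 1 - t ≠ 0 := sub_ne_zero.2 ht.symm
    have h1 : (1 - t • P) * ((1 - t) • 1 + t • P) = (1 - t) • 1 := by
      simp only [Matrix.mul_add, Matrix.sub_mul, Matrix.one_mul, Matrix.mul_smul, Matrix.smul_mul,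
        Matrix.mul_one, hPP]
      module
    have h2 := congrArg (fun M => (1 - t • P).adjugate * M) h1
    simp only [← Matrix.mul_assoc, Matrix.adjugate_mul, hdet, Matrix.smul_mul, Matrix.one_mul,
      Matrix.mul_smul, Matrix.mul_one] at h2
    exact (smul_right_injective _ ht' h2).symm
  have hc : Continuous fun t : ℂ => (1 - t • P).adjugate :=
    Continuous.matrix_adjugate (by fun_prop)
  have hc2 : Continuous fun t : ℂ => (1 - t) • (1 : Matrix (Fin n) (Fin n) ℂ) + t • P := by fun_prop
  have := congrFun (hc.ext_on (dense_compl_singleton (1 : ℂ)) hc2 fun t ht => hadj t ht) 1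
  simpa using this

/-- The second derivatives of a function of `log ∘ cone q`. -/
lemma complexHessian_comp_log_cone {q : Fin n → ℕ} {x : Fin n → ℂ} (hx : x ≠ 0) {g : ℝ → ℝ}
    (hg : ContDiff ℝ ∞ g) :
    complexHessian (fun y => g (Real.log (cone q y))) x
      = ((deriv g (Real.log (cone q x)) / cone q x : ℝ) : ℂ) •
          Matrix.diagonal (fun k => (coneDiag q x k : ℂ))
        + (((deriv (deriv g) (Real.log (cone q x)) - deriv g (Real.log (cone q x)))
            / cone q x ^ 2 : ℝ) : ℂ) •
          Matrix.vecMulVec (wirtinger (cone q) x) (star (wirtinger (cone q) x)) := by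
  have hS := cone_pos (q := q) hx
  have hd := hg.differentiable (by simp)
  have hd2 : Differentiable ℝ (deriv g) :=
    (contDiff_infty_iff_deriv.1 hg).2.differentiable (by simp)
  have hG : ContDiffAt ℝ 2 (fun s => g (Real.log s)) (cone q x) :=
    (hg.of_le two_le_infty).contDiffAt.comp _ (Real.contDiffAt_log.2 hS.ne')
  have h1 {s : ℝ} (hs : 0 < s) : deriv (fun s => g (Real.log s)) s = deriv g (Real.log s) / s := by
    have := ((hd (Real.log s)).hasDerivAt.comp s (Real.hasDerivAt_log hs.ne')).deriv
    rw [div_eq_mul_inv]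
    exact this
  have h2 : deriv (deriv fun s => g (Real.log s)) (cone q x)
      = (deriv (deriv g) (Real.log (cone q x)) - deriv g (Real.log (cone q x)))
        / cone q x ^ 2 := by
    have e : deriv (fun s => g (Real.log s)) =ᶠ[𝓝 (cone q x)] fun s => deriv g (Real.log s) / s := by
      filter_upwards [Ioi_mem_nhds hS] with s hs using h1 hs
    rw [e.deriv_eq]
    have := (((hd2 (Real.log (cone q x))).hasDerivAt.comp _
      (Real.hasDerivAt_log hS.ne')).div (hasDerivAt_id _) hS.ne').deriv
    refine this.trans ?_
    simp only [id, Function.comp_apply]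
    field_simp
  rw [complexHessian_comp (G := fun s => g (Real.log s))
    ((contDiff_cone q).of_le two_le_infty).contDiffAt hG, h1 hS, h2, complexHessian_cone]

/-- The mixed Monge-Ampère density of two functions of `log ∘ cone q`. -/
lemma maDensity_comp_log_cone {q : Fin (n + 1) → ℕ} {x : Fin (n + 1) → ℂ} (hx : x ≠ 0)
    {F g : ℝ → ℝ} (hF : ContDiff ℝ ∞ F) (hg : ContDiff ℝ ∞ g)
    (hF2 : deriv (deriv F) (Real.log (cone q x)) = 0) :
    maDensity (fun y => F (Real.log (cone q y))) (fun y => g (Real.log (cone q y))) x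
      = deriv F (Real.log (cone q x)) ^ n * (deriv (deriv g) (Real.log (cone q x))
        * ((∏ k, coneDiag q x k) / cone q x ^ (n + 1))) := by
  have hS := (cone_pos (q := q) hx).ne'
  have hSc : (cone q x : ℂ) ≠ 0 := by exact_mod_cast hS
  set S := cone q x with hSdef
  set v := wirtinger (cone q) x with hv
  set u := coneVec q x with hu
  set d : Fin (n + 1) → ℂ := fun k => (coneDiag q x k : ℂ) with hd
  set t := Real.log S
  have hDu : Matrix.vecMulVec v (star v) = Matrix.diagonal d * Matrix.vecMulVec u (star v) := by
    rw [Matrix.mul_vecMulVec]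
    congr 1
    ext k
    rw [Matrix.mulVec_diagonal, hv, wirtinger_cone]
  have huv : star v ⬝ᵥ u = (S : ℂ) := sum_coneVec q x
  -- Since `F'' = 0`, the Hessian of the weight is a multiple of `D (1 - P)` with `D` diagonal and
  -- `P` the projection along the dilations. It is degenerate: its adjugate is `P adj D` up to a
  -- factor, and pairing with the Hessian of `g (log S)` leaves only `g''`. Zero entries of `D` are
  -- harmless because nothing is inverted.
  have hw : complexHessian (fun y => F (Real.log (cone q y))) x = ((deriv F t / S : ℝ) : ℂ) •
      (Matrix.diagonal d * (1 - Matrix.vecMulVec ((S : ℂ)⁻¹ • u) (star v))) := by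
    rw [complexHessian_comp_log_cone hx hF, ← hv, hDu, hF2, Matrix.mul_sub, Matrix.smul_vecMulVec,
      Matrix.mul_smul, Matrix.mul_one, smul_sub, smul_smul]
    have e : (((0 - deriv F t) / S ^ 2 : ℝ) : ℂ) = -(((deriv F t / S : ℝ) : ℂ) * (S : ℂ)⁻¹) := by
      push_cast
      field_simp
      ring
    change _ + (((0 - deriv F t) / S ^ 2 : ℝ) : ℂ) • _ = _
    rw [e, neg_smul, ← sub_eq_add_neg]
  have hχ : complexHessian (fun y => g (Real.log (cone q y))) x = Matrix.diagonal d *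
      (((deriv g t / S : ℝ) : ℂ) • 1
        + (((deriv (deriv g) t - deriv g t) / S ^ 2 : ℝ) : ℂ) • Matrix.vecMulVec u (star v)) := by
    rw [complexHessian_comp_log_cone hx hg, ← hv, hDu, Matrix.mul_add, Matrix.mul_smul,
      Matrix.mul_smul, Matrix.mul_one]
  rw [maDensity, hw, hχ, Matrix.adjugate_smul, Matrix.adjugate_mul_distrib,
    adjugate_one_sub_vecMulVec (by rw [dotProduct_smul, huv, smul_eq_mul, inv_mul_cancel₀ hSc]),
    Matrix.smul_mul, Matrix.mul_assoc, ← Matrix.mul_assoc (Matrix.adjugate _), Matrix.adjugate_mul,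
    Matrix.det_diagonal, Matrix.smul_mul, Matrix.one_mul, Matrix.mul_smul, Matrix.mul_add,
    Matrix.mul_smul, Matrix.mul_smul, Matrix.mul_one, Matrix.vecMulVec_mul_vecMulVec, huv]
  simp only [Matrix.trace_smul, Matrix.trace_add, Matrix.trace_vecMulVec, smul_dotProduct,
    Matrix.vecMulVec_smul, dotProduct_comm u, huv, smul_eq_mul, Fintype.card_fin,
    Nat.add_sub_cancel]
  rw [hd, ← Complex.ofReal_prod, inv_mul_cancel₀ hSc]
  rw [← Complex.ofReal_one]
  simp only [← Complex.ofReal_mul, ← Complex.ofReal_add, ← Complex.ofReal_pow, Complex.ofReal_re,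
    div_pow]
  field_simp
  ring

/-- The trace of the complex Hessian of a function of `log |x|²`. -/
lemma trace_complexHessian_comp_log {x : Fin (n + 1) → ℂ} (hx : x ≠ 0) {g : ℝ → ℝ}
    (hg : ContDiff ℝ ∞ g) :
    (complexHessian (fun y => g (Real.log (cone 0 y))) x).trace.re
      = (n * deriv g (Real.log (cone 0 x)) + deriv (deriv g) (Real.log (cone 0 x)))
        / cone 0 x := by
  have hS := (cone_pos (q := 0) hx).ne'
  have hdiag (k : Fin (n + 1)) : coneDiag 0 x k = 1 := by simp [coneDiag]
  have hvec : coneVec 0 x = wirtinger (cone 0) x := by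
    ext k
    rw [wirtinger_cone, hdiag]
    simp
  have huv := sum_coneVec 0 x
  rw [hvec] at huv
  rw [complexHessian_comp_log_cone hx hg, Matrix.trace_add, Matrix.trace_smul, Matrix.trace_smul,
    Matrix.trace_vecMulVec, dotProduct_comm, huv, Matrix.trace_diagonal]
  simp only [hdiag, smul_eq_mul, Complex.ofReal_one, Finset.sum_const, Finset.card_univ,
    Fintype.card_fin, nsmul_eq_mul, mul_one]
  rw [← Complex.ofReal_natCast]
  simp only [← Complex.ofReal_mul, ← Complex.ofReal_add, Complex.ofReal_re]
  push_cast
  field_simp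
  ring

end Cone

/-! ### The invariant measure of a weighted cone -/

section ConeMeasure

variable {n : ℕ} (q : Fin (n + 1) → ℕ)

/-- The density of the measure that is invariant under the dilations of `cone q`. -/
def coneDensity (x : Fin (n + 1) → ℂ) : ℝ := (∏ k, coneDiag q x k) / cone q x ^ (n + 1)

/-- The direction of the dilations of `cone q`. -/
def coneDir (k : Fin (n + 1)) : ℝ := (2 * ((q k : ℝ) + 1))⁻¹

/-- The dilations of `cone q`. -/
def dilate (s : ℝ) (x : Fin (n + 1) → ℂ) : Fin (n + 1) → ℂ :=
  fun k => Real.exp (s * coneDir q k) • x k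

/-- The measure invariant under the dilations of `cone q`. -/
def coneMeasure : Measure (Fin (n + 1) → ℂ) :=
  volume.withDensity fun x => ENNReal.ofReal (coneDensity q x)

lemma coneDir_pos (k : Fin (n + 1)) : 0 < coneDir q k := by unfold coneDir; positivity

lemma coneDensity_nonneg (x : Fin (n + 1) → ℂ) : 0 ≤ coneDensity q x :=
  div_nonneg (Finset.prod_nonneg fun k _ => coneDiag_nonneg q x k)
    (pow_nonneg (cone_nonneg q x) _)

lemma norm_dilate (s : ℝ) (x : Fin (n + 1) → ℂ) (k : Fin (n + 1)) :
    ‖dilate q s x k‖ ^ 2 = Real.exp (2 * (s * coneDir q k)) * ‖x k‖ ^ 2 := by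
  rw [dilate, norm_smul, mul_pow, Real.norm_eq_abs, abs_of_pos (Real.exp_pos _), ← Real.exp_nat_mul]
  norm_num

lemma coneDir_mul (k : Fin (n + 1)) (s : ℝ) :
    ((q k : ℝ) + 1) * (2 * (s * coneDir q k)) = s := by
  unfold coneDir
  field_simp

lemma cone_dilate (s : ℝ) (x : Fin (n + 1) → ℂ) : cone q (dilate q s x) = Real.exp s * cone q x := by
  simp only [cone, norm_dilate, Finset.mul_sum, mul_pow, ← Real.exp_nat_mul]
  refine Finset.sum_congr rfl fun k _ => ?_
  have := coneDir_mul q k s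
  rw [Nat.cast_succ, this]

/-- For each coordinate the Jacobian factor times the change of `coneDiag` is `e^s`, and the `n + 1`
factors cancel the change of `cone q ^ (n + 1)`. -/
lemma coneDensity_dilate (s : ℝ) (x : Fin (n + 1) → ℂ) :
    (∏ k, Real.exp (s * coneDir q k) ^ 2) * coneDensity q (dilate q s x) = coneDensity q x := by
  have h1 (k : Fin (n + 1)) : Real.exp (s * coneDir q k) ^ 2 * coneDiag q (dilate q s x) k
      = Real.exp s * coneDiag q x k := by
    have h2 : Real.exp (s * coneDir q k) ^ 2 * Real.exp (2 * (s * coneDir q k)) ^ q k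
        = Real.exp s := by
      rw [← Real.exp_nat_mul, ← Real.exp_nat_mul, ← Real.exp_add]
      congr 1
      rw [← coneDir_mul q k s]
      push_cast
      unfold coneDir
      field_simp
      ring
    rw [coneDiag, coneDiag, norm_dilate, mul_pow, ← h2]
    ring
  rw [coneDensity, cone_dilate, ← mul_div_assoc, ← Finset.prod_mul_distrib,
    Finset.prod_congr rfl fun k _ => h1 k, Finset.prod_mul_distrib, Finset.prod_const,
    Finset.card_univ, Fintype.card_fin, mul_pow, coneDensity]
  have := (Real.exp_pos s).ne'
  rw [mul_div_mul_left _ _ (pow_ne_zero _ this)]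

lemma measurable_coneDensity : Measurable (coneDensity q) := by
  unfold coneDensity coneDiag
  have := (continuous_cone q).measurable
  fun_prop

lemma continuous_dilate (s : ℝ) : Continuous (dilate q s) := by unfold dilate; fun_prop

lemma lintegral_dilate {φ : (Fin (n + 1) → ℂ) → ENNReal} (hφ : Measurable φ) (s : ℝ) :
    ∫⁻ x, φ x = ENNReal.ofReal (∏ k, Real.exp (s * coneDir q k) ^ 2) * ∫⁻ x, φ (dilate q s x) := by
  let L : (Fin (n + 1) → ℂ) →ₗ[ℝ] (Fin (n + 1) → ℂ) := LinearMap.pi fun k =>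
    (Real.exp (s * coneDir q k) • LinearMap.id : ℂ →ₗ[ℝ] ℂ).comp (LinearMap.proj k)
  have hdet : LinearMap.det L = ∏ k, Real.exp (s * coneDir q k) ^ 2 := by
    rw [LinearMap.det_pi]
    simp [LinearMap.det_smul, Complex.finrank_real_complex]
  have hpos : 0 < ∏ k, Real.exp (s * coneDir q k) ^ 2 := Finset.prod_pos fun k _ => by positivity
  have hmap := Measure.map_linearMap_addHaar_eq_smul_addHaar (volume : Measure (Fin (n + 1) → ℂ))
    (f := L) (by rw [hdet]; exact hpos.ne')
  have h1 : ∫⁻ x, φ (dilate q s x) = ∫⁻ x, φ x ∂(Measure.map L volume) := by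
    exact (lintegral_map hφ (continuous_dilate q s).measurable).symm
  rw [h1, hmap, lintegral_smul_measure, smul_eq_mul, ← mul_assoc, hdet, abs_of_pos (inv_pos.2 hpos),
    ← ENNReal.ofReal_mul hpos.le, mul_inv_cancel₀ hpos.ne', ENNReal.ofReal_one, one_mul]

lemma lintegral_coneMeasure {φ : (Fin (n + 1) → ℂ) → ENNReal} (hφ : Measurable φ) :
    ∫⁻ x, φ x ∂coneMeasure q = ∫⁻ x, φ x * ENNReal.ofReal (coneDensity q x) := by
  rw [coneMeasure, lintegral_withDensity_eq_lintegral_mul _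
    (measurable_coneDensity q).ennreal_ofReal hφ]
  simp only [Pi.mul_apply, mul_comm]

lemma lintegral_coneMeasure_dilate {φ : (Fin (n + 1) → ℂ) → ENNReal} (hφ : Measurable φ) (s : ℝ) :
    ∫⁻ x, φ (dilate q s x) ∂coneMeasure q = ∫⁻ x, φ x ∂coneMeasure q := by
  have hm := (measurable_coneDensity q).ennreal_ofReal
  have hd := (continuous_dilate q s).measurable
  have hφm : Measurable fun x => φ x * ENNReal.ofReal (coneDensity q x) := hφ.mul hm
  have hpos : 0 < ∏ k, Real.exp (s * coneDir q k) ^ 2 := Finset.prod_pos fun k _ => by positivity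
  rw [lintegral_coneMeasure q hφ, lintegral_coneMeasure q (φ := fun x => φ (dilate q s x)) (hφ.comp hd),
    lintegral_dilate q hφm s, ← lintegral_const_mul _ (f := fun x => φ (dilate q s x)
      * ENNReal.ofReal (coneDensity q (dilate q s x))) (hφm.comp hd)]
  refine lintegral_congr fun x => ?_
  rw [mul_left_comm, ← ENNReal.ofReal_mul hpos.le, coneDensity_dilate]

lemma ae_ne_zero_coneMeasure : ∀ᵐ x ∂coneMeasure q, ∀ k, x k ≠ 0 :=
  withDensity_absolutelyContinuous _ _ (ae_coord_ne_zero (n + 1))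

lemma ae_pos_coneMeasure : ∀ᵐ x ∂coneMeasure q, 0 < cone q x := by
  filter_upwards [ae_ne_zero_coneMeasure q] with x hx
  exact cone_pos fun h => hx 0 (by simp [h])

lemma lintegral_log_cone_sub {F : ℝ → ENNReal} (hF : Measurable F) (s : ℝ) :
    ∫⁻ x, F (Real.log (cone q x) - s) ∂coneMeasure q
      = ∫⁻ x, F (Real.log (cone q x)) ∂coneMeasure q := by
  have hc := (continuous_cone q).measurable
  have hl := Real.measurable_log
  rw [← lintegral_coneMeasure_dilate q (φ := fun x => F (Real.log (cone q x) - s))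
    (by fun_prop) s]
  refine lintegral_congr_ae ?_
  filter_upwards [ae_pos_coneMeasure q] with x hx
  rw [cone_dilate, Real.log_mul (Real.exp_ne_zero _) hx.ne', Real.log_exp]
  congr 1
  ring

instance : SFinite (coneMeasure q) := by unfold coneMeasure; infer_instance

/-- The image of the invariant measure under `log ∘ cone q` is a multiple of Lebesgue measure. -/
lemma lintegral_log_cone_mul {F m : ℝ → ENNReal} (hF : Measurable F) (hm : Measurable m) :
    (∫⁻ t, m t) * ∫⁻ x, F (Real.log (cone q x)) ∂coneMeasure q
      = (∫⁻ t, F t) * ∫⁻ x, m (Real.log (cone q x)) ∂coneMeasure q := by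
  have hc := (continuous_cone q).measurable
  have hl := Real.measurable_log
  -- This is the proof of uniqueness of Haar measure on `ℝ`: the image measure is translation
  -- invariant, and Fubini with the substitution `t ↦ log S - t` exchanges the roles of `F` and `m`.
  calc (∫⁻ t, m t) * ∫⁻ x, F (Real.log (cone q x)) ∂coneMeasure q
      = ∫⁻ t, ∫⁻ x, m t * F (Real.log (cone q x) - t) ∂coneMeasure q := by
        rw [← lintegral_mul_const _ hm]
        refine lintegral_congr fun t => ?_
        rw [lintegral_const_mul _ (by fun_prop), lintegral_log_cone_sub q hF]
    _ = ∫⁻ x, (∫⁻ t, m t * F (Real.log (cone q x) - t)) ∂coneMeasure q :=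
        lintegral_lintegral_swap
          (f := fun t x => m t * F (Real.log (cone q x) - t)) (by fun_prop)
    _ = ∫⁻ x, (∫⁻ t, m (Real.log (cone q x) - t) * F t) ∂coneMeasure q := by
        refine lintegral_congr fun x => ?_
        rw [← lintegral_sub_left_eq_self (μ := (volume : Measure ℝ)) _ (Real.log (cone q x))]
        simp only [sub_sub_cancel]
    _ = ∫⁻ t, ∫⁻ x, m (Real.log (cone q x) - t) * F t ∂coneMeasure q :=
        lintegral_lintegral_swap
          (f := fun x t => m (Real.log (cone q x) - t) * F t) (by fun_prop)
    _ = _ := by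
        rw [← lintegral_mul_const _ hF]
        refine lintegral_congr fun t => ?_
        rw [lintegral_mul_const _ (by fun_prop), lintegral_log_cone_sub q hm, mul_comm]

/-- The substitution `x = e^t` turns this into the integral for `Γ(n + 1)`. -/
lemma lintegral_exp_sub_exp :
    ∫⁻ t : ℝ, ENNReal.ofReal (Real.exp ((n + 1) * t - Real.exp t)) = ENNReal.ofReal n.factorial := by
  have h1 := lintegral_image_eq_lintegral_abs_deriv_mul (s := Set.univ) MeasurableSet.univ
    (fun x _ => (Real.hasDerivAt_exp x).hasDerivWithinAt) Real.exp_injective.injOn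
    (fun x => ENNReal.ofReal (Real.exp (-x) * x ^ ((n + 1 : ℝ) - 1)))
  rw [Set.image_univ, Real.range_exp, setLIntegral_univ] at h1
  have hInt : IntegrableOn (fun x => Real.exp (-x) * x ^ ((n + 1 : ℝ) - 1)) (Set.Ioi 0) :=
    Real.GammaIntegral_convergent (by positivity)
  rw [← ofReal_integral_eq_lintegral_ofReal hInt, ← Real.Gamma_eq_integral (by positivity),
    Real.Gamma_nat_eq_factorial] at h1
  · rw [h1]
    refine lintegral_congr fun t => ?_
    rw [abs_of_pos (Real.exp_pos t), ← ENNReal.ofReal_mul (Real.exp_pos t).le, ← Real.exp_mul,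
      ← Real.exp_add, ← Real.exp_add]
    congr 2
    ring
  · filter_upwards [ae_restrict_mem measurableSet_Ioi] with x hx
    have : (0 : ℝ) < x := hx
    positivity

lemma integral_coneDiag_exp (p : ℕ) :
    ∫ z : ℂ, ((p : ℝ) + 1) ^ 2 * (‖z‖ ^ 2) ^ p * Real.exp (-(‖z‖ ^ 2) ^ (p + 1))
      = Real.pi * (p + 1) := by
  have h := Complex.integral_rpow_mul_exp_neg_rpow (p := 2 * ((p : ℝ) + 1)) (q := 2 * (p : ℝ))
    (by have : (0 : ℝ) ≤ p := p.cast_nonneg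
        linarith) (by have : (0 : ℝ) ≤ p := p.cast_nonneg
                      linarith)
  have e (z : ℂ) : ((p : ℝ) + 1) ^ 2 * (‖z‖ ^ 2) ^ p * Real.exp (-(‖z‖ ^ 2) ^ (p + 1))
      = ((p : ℝ) + 1) ^ 2 * (‖z‖ ^ (2 * (p : ℝ)) * Real.exp (-‖z‖ ^ (2 * ((p : ℝ) + 1)))) := by
    have e1 : ‖z‖ ^ (2 * (p : ℝ)) = (‖z‖ ^ 2) ^ p := by
      rw [← pow_mul, ← Real.rpow_natCast]; push_cast; rfl
    have e2 : ‖z‖ ^ (2 * ((p : ℝ) + 1)) = (‖z‖ ^ 2) ^ (p + 1) := by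
      rw [← pow_mul, ← Real.rpow_natCast]; push_cast; rfl
    rw [e1, e2, mul_assoc]
  simp only [e]
  rw [integral_const_mul, h, show (2 * (p : ℝ) + 2) / (2 * (p + 1)) = 1 by field_simp,
    Real.Gamma_one]
  field_simp

/-- The normalization of the invariant measure. -/
def coneConst : ℝ := (∏ k, ((q k : ℝ) + 1)) * Real.pi ^ (n + 1) / n.factorial

lemma lintegral_cone {m : ℝ → ENNReal} (hm : Measurable m) :
    ∫⁻ x, m (Real.log (cone q x)) ∂coneMeasure q
      = ENNReal.ofReal (coneConst q) * ∫⁻ t, m t := by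
  have hc := (continuous_cone q).measurable
  let G : Fin (n + 1) → ℂ → ℝ := fun k z =>
    ((q k : ℝ) + 1) ^ 2 * (‖z‖ ^ 2) ^ q k * Real.exp (-(‖z‖ ^ 2) ^ (q k + 1))
  -- The constant is found from one explicit profile: at `t = log S` it equals `S^{n+1} e^{-S}`,
  -- which cancels the denominator of the density and makes the integrand a product over the
  -- coordinates.
  have hG : ∫⁻ x, ENNReal.ofReal (Real.exp ((n + 1) * Real.log (cone q x)
      - Real.exp (Real.log (cone q x)))) ∂coneMeasure q
      = ENNReal.ofReal ((∏ k, ((q k : ℝ) + 1)) * Real.pi ^ (n + 1)) := by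
    rw [lintegral_coneMeasure q (by have := Real.measurable_log; fun_prop)]
    have e : ∀ᵐ x : Fin (n + 1) → ℂ, ENNReal.ofReal (Real.exp ((n + 1) * Real.log (cone q x)
        - Real.exp (Real.log (cone q x)))) * ENNReal.ofReal (coneDensity q x)
        = ENNReal.ofReal (∏ k, G k (x k)) := by
      filter_upwards [ae_coord_ne_zero (n + 1)] with x hx
      have hS : 0 < cone q x := cone_pos fun h => hx 0 (by simp [h])
      rw [← ENNReal.ofReal_mul (Real.exp_pos _).le, Real.exp_log hS, sub_eq_add_neg, Real.exp_add]
      congr 1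
      have h1 : Real.exp ((n + 1) * Real.log (cone q x)) = cone q x ^ (n + 1) := by
        rw [← Nat.cast_succ, Real.exp_nat_mul, Real.exp_log hS]
      have h2 : Real.exp (-cone q x) = ∏ k, Real.exp (-(‖x k‖ ^ 2) ^ (q k + 1)) := by
        rw [← Real.exp_sum, cone, Finset.sum_neg_distrib]
      simp only [G]
      rw [h1, h2, coneDensity, Finset.prod_mul_distrib]
      unfold coneDiag
      field_simp
    have hval (k : Fin (n + 1)) : ∫ z, G k z = Real.pi * (q k + 1) := integral_coneDiag_exp (q k)
    have hGi (k : Fin (n + 1)) : Integrable (G k) := by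
      by_contra h
      have := hval k
      rw [integral_undef h] at this
      have : 0 < Real.pi * ((q k : ℝ) + 1) := by positivity
      linarith
    have hprod : Integrable (fun x : Fin (n + 1) → ℂ => ∏ k, G k (x k)) :=
      Integrable.fintype_prod hGi
    rw [lintegral_congr_ae e, ← ofReal_integral_eq_lintegral_ofReal hprod
      (Eventually.of_forall fun x => Finset.prod_nonneg fun k _ => by positivity),
      integral_fintype_prod_volume_eq_prod, Finset.prod_congr rfl fun k _ => hval k,
      Finset.prod_mul_distrib, Finset.prod_const, Finset.card_univ, Fintype.card_fin, mul_comm]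
  have h := lintegral_log_cone_mul q (F := fun t =>
    ENNReal.ofReal (Real.exp ((n + 1) * t - Real.exp t))) (by fun_prop) hm
  rw [hG, lintegral_exp_sub_exp] at h
  have hf : (0 : ℝ) < n.factorial := by exact_mod_cast n.factorial_pos
  have hn0 : ENNReal.ofReal n.factorial ≠ 0 := by simpa using n.factorial_ne_zero
  rw [coneConst, ENNReal.ofReal_div_of_pos hf, mul_comm, ← mul_div_assoc, h, mul_comm,
    ENNReal.mul_div_cancel_right hn0 ENNReal.ofReal_ne_top]

end ConeMeasure

/-! ### Means of plurisubharmonic functions over weighted shells -/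

section ConeMean

variable {n : ℕ} (q : Fin (n + 1) → ℕ)

/-- The mean of `f` over the shell `log (cone q) ≈ s`, with profile `m`. -/
def coneMean (f : (Fin (n + 1) → ℂ) → EReal) (m : ℝ → ℝ) (s : ℝ) : ℝ :=
  ∫ x, (f x).toReal * (m (Real.log (cone q x) - s) * coneDensity q x)

variable {q}

lemma isCompact_shell {a b : ℝ} : IsCompact {x : Fin (n + 1) → ℂ | a ≤ cone q x ∧ cone q x ≤ b} := by
  refine Metric.isCompact_of_isClosed_isBounded ?_ ?_
  · exact (isClosed_le continuous_const (continuous_cone q)).inter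
      (isClosed_le (continuous_cone q) continuous_const)
  · refine (Metric.isBounded_closedBall (x := 0) (r := 1 + |b|)).subset fun x hx => ?_
    rw [mem_closedBall_zero_iff, pi_norm_le_iff_of_nonneg (by positivity)]
    intro k
    by_contra hk
    push Not at hk
    have h0 : 1 ≤ ‖x k‖ := by linarith [abs_nonneg b]
    have h1 : ‖x k‖ ≤ (‖x k‖ ^ 2) ^ (q k + 1) := by
      rw [← pow_mul]
      exact le_self_pow₀ h0 (by positivity)
    have h2 := Finset.single_le_sum (f := fun k => (‖x k‖ ^ 2) ^ (q k + 1))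
      (fun _ _ => by positivity) (Finset.mem_univ k)
    have h3 : cone q x ≤ b := hx.2
    have h4 : (‖x k‖ ^ 2) ^ (q k + 1) ≤ cone q x := h2
    linarith [le_abs_self b]

lemma mem_shell {x : Fin (n + 1) → ℂ} (hx : 0 < cone q x) {s R : ℝ}
    (h : |Real.log (cone q x) - s| ≤ R) :
    Real.exp (s - R) ≤ cone q x ∧ cone q x ≤ Real.exp (s + R) := by
  rw [abs_le] at h
  constructor
  · rw [← Real.le_log_iff_exp_le hx]; linarith
  · rw [← Real.log_le_iff_le_exp hx]; linarith

lemma continuousOn_shell {m : ℝ → ℝ} (hm : Continuous m) (s : ℝ) :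
    ContinuousOn (fun x => m (Real.log (cone q x) - s) * coneDensity q x) {x | 0 < cone q x} := by
  have hc := (continuous_cone q).continuousOn (s := {x : Fin (n + 1) → ℂ | 0 < cone q x})
  refine ContinuousOn.mul (hm.comp_continuousOn ((hc.log fun x hx => ne_of_gt hx).sub
    continuousOn_const)) (ContinuousOn.div ?_ (hc.pow _) fun x hx => ne_of_gt (pow_pos hx _))
  unfold coneDiag
  fun_prop

lemma coneProfile_eq_zero {m : ℝ → ℝ} {R : ℝ} (hR : ∀ t, R < |t| → m t = 0) (s : ℝ)
    {x : Fin (n + 1) → ℂ} (hx : ¬ (Real.exp (s - R) ≤ cone q x ∧ cone q x ≤ Real.exp (s + R))) :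
    m (Real.log (cone q x) - s) * coneDensity q x = 0 := by
  rcases (cone_nonneg q x).eq_or_lt with h | h
  · simp [coneDensity, ← h]
  · rw [hR _ (lt_of_not_ge fun hle => hx (mem_shell h hle)), zero_mul]

variable {f : (Fin (n + 1) → ℂ) → EReal}

lemma shell_subset {s R : ℝ} (hs : s + R < 0) :
    {x : Fin (n + 1) → ℂ | Real.exp (s - R) ≤ cone q x ∧ cone q x ≤ Real.exp (s + R)}
      ⊆ polydisk (n + 1) :=
  fun _ hx => mem_polydisk_of_cone_lt_one (hx.2.trans_lt (Real.exp_lt_one_iff.2 hs))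

lemma NegPSH.integrable_coneMean (hf : NegPSH f) {m : ℝ → ℝ} (hm : Continuous m) {R : ℝ}
    (hR : ∀ t, R < |t| → m t = 0) {s : ℝ} (hs : s + R < 0) :
    Integrable fun x => (f x).toReal * (m (Real.log (cone q x) - s) * coneDensity q x) :=
  hf.integrable_mul isCompact_shell (shell_subset hs)
    ((continuousOn_shell hm s).mono fun _ hx => (Real.exp_pos _).trans_le hx.1)
    fun _ hx => coneProfile_eq_zero hR s hx

/-- In logarithmic coordinates, the mean over a shell is an integral of the convex image. -/
lemma NegPSH.coneMean_eq (hf : NegPSH f) {m : ℝ → ℝ} (hm : Continuous m) (hm0 : ∀ t, 0 ≤ m t)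
    {R : ℝ} (hR : ∀ t, R < |t| → m t = 0) {s : ℝ} (hs : s + R < 0) :
    Integrable (fun y => convexReal f ((fun k => Real.log ‖y k‖) + s • coneDir q)
      * m (Real.log (cone q y))) (coneMeasure q) ∧
    coneMean q f m s = ∫ y, convexReal f ((fun k => Real.log ‖y k‖) + s • coneDir q)
      * m (Real.log (cone q y)) ∂coneMeasure q := by
  have hc := (continuous_cone q).measurable
  have hl := Real.measurable_log
  have hmm := hm.measurable
  have hden := measurable_coneDensity q
  have hpot := hf.measurable_pot
  let φ : (Fin (n + 1) → ℂ) → ℝ := fun x => m (Real.log (cone q x) - s) * coneDensity q x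
  have hφ0 (x) : 0 ≤ φ x := mul_nonneg (hm0 _) (coneDensity_nonneg q x)
  have hφm : Measurable φ := by fun_prop
  let K := {x : Fin (n + 1) → ℂ | Real.exp (s - R) ≤ cone q x ∧ cone q x ≤ Real.exp (s + R)}
  have hK : IsCompact K := isCompact_shell
  have hKD : K ⊆ polydisk (n + 1) := shell_subset hs
  have hφK (x) (hx : x ∉ K) : φ x = 0 := coneProfile_eq_zero hR s hx
  have hφc : ContinuousOn φ K :=
    (continuousOn_shell hm s).mono fun _ hx => (Real.exp_pos _).trans_le hx.1
  obtain ⟨C, hC⟩ := hK.exists_bound_of_continuousOn hφc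
  have hfin : ∫⁻ x, pot f x * ENNReal.ofReal (φ x) < ⊤ := by
    calc ∫⁻ x, pot f x * ENNReal.ofReal (φ x)
        ≤ ∫⁻ x, K.indicator (fun x => pot f x * ENNReal.ofReal C) x := by
          refine lintegral_mono fun x => ?_
          by_cases hx : x ∈ K
          · rw [Set.indicator_of_mem hx]
            gcongr
            exact (le_abs_self _).trans (hC x hx)
          · simp [hφK x hx]
      _ = (∫⁻ x in K, pot f x) * ENNReal.ofReal C := by
          rw [lintegral_indicator hK.measurableSet, lintegral_mul_const _ hpot]
      _ < ⊤ := ENNReal.mul_lt_top (hf.lintegral_pot_lt_top hK hKD) ENNReal.ofReal_lt_top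
  have hleft : coneMean q f m s = -(∫⁻ x, pot f x * ENNReal.ofReal (φ x)).toReal := by
    rw [← integral_toReal (by fun_prop) (ae_lt_top (by fun_prop) hfin.ne), ← integral_neg, coneMean]
    congr 1
    ext x
    rw [ENNReal.toReal_mul, ENNReal.toReal_ofReal (hφ0 x), ← neg_mul]
    exact hf.mul_eq hKD hφK x
  let H : (Fin (n + 1) → ℂ) → ℝ := fun y =>
    convexReal f ((fun k => Real.log ‖y k‖) + s • coneDir q) * m (Real.log (cone q y))
  -- The shell weight is invariant under coordinate rotations, so `pot f` may be replaced by its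
  -- torus mean. Dilation by `s`, which preserves `coneMeasure q`, moves the shell to `log S ≈ 0`
  -- and shifts the argument of the convex image by `s • coneDir q`.
  have hkey : ∫⁻ x, pot f x * ENNReal.ofReal (φ x)
      = ∫⁻ y, ENNReal.ofReal (-H y) ∂coneMeasure q := by
    have hrot (c : Fin (n + 1) → ℂ) (y) (hcn : ∀ k, ‖c k‖ = 1) :
        ENNReal.ofReal (φ fun k => c k * y k) = ENNReal.ofReal (φ y) := by
      simp [φ, cone, coneDensity, coneDiag, hcn]
    rw [← hf.lintegral_torusMean (by fun_prop) hrot]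
    have htm : Measurable (torusMean (pot f)) :=
      Measurable.lintegral_prod_right' (hpot.comp measurable_mul_expI)
    have e1 (x : Fin (n + 1) → ℂ) : torusMean (pot f) x * ENNReal.ofReal (φ x)
        = (torusMean (pot f) x * ENNReal.ofReal (m (Real.log (cone q x) - s)))
          * ENNReal.ofReal (coneDensity q x) := by
      rw [mul_assoc, ← ENNReal.ofReal_mul (hm0 _)]
    have hψ : Measurable fun x =>
      torusMean (pot f) x * ENNReal.ofReal (m (Real.log (cone q x) - s)) := by fun_prop
    simp only [e1]
    rw [← lintegral_coneMeasure q hψ, ← lintegral_coneMeasure_dilate q hψ s]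
    refine lintegral_congr_ae ?_
    filter_upwards [ae_ne_zero_coneMeasure q] with y hy
    have hS : 0 < cone q y := cone_pos fun h => hy 0 (by simp [h])
    have hlog : Real.log (cone q (dilate q s y)) - s = Real.log (cone q y) := by
      rw [cone_dilate, Real.log_mul (Real.exp_ne_zero _) hS.ne', Real.log_exp]
      ring
    rw [hlog]
    by_cases hR' : R < |Real.log (cone q y)|
    · simp [H, hR _ hR']
    · have h1 : Real.log (cone q y) ≤ R := (le_abs_self _).trans (not_lt.1 hR')
      have hD : dilate q s y ∈ polydisk (n + 1) := by
        refine mem_polydisk_of_cone_lt_one (q := q) ?_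
        rw [cone_dilate]
        calc Real.exp s * cone q y ≤ Real.exp s * Real.exp R := by
              gcongr
              exact (Real.log_le_iff_le_exp hS).1 h1
          _ < 1 := by rw [← Real.exp_add]; exact Real.exp_lt_one_iff.2 hs
      have hne (k) : dilate q s y k ≠ 0 := by
        simp [dilate, hy k]
      have hu : (fun k => Real.log ‖dilate q s y k‖)
          = (fun k => Real.log ‖y k‖) + s • coneDir q := by
        ext k
        simp only [dilate, norm_smul, Real.norm_eq_abs, abs_of_pos (Real.exp_pos _), Pi.add_apply,
          Pi.smul_apply, smul_eq_mul]
        rw [Real.log_mul (Real.exp_ne_zero _) (norm_ne_zero_iff.2 (hy k)), Real.log_exp, add_comm]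
      have hneg (k) : Real.log ‖dilate q s y k‖ < 0 :=
        Real.log_neg (norm_pos_iff.2 (hne k)) (hD k)
      rw [torusMean_eq_logMean hpot hne, ← hf.ofReal_neg_convexReal hneg, hu,
        ← ENNReal.ofReal_mul (neg_nonneg.2 (convexReal_nonpos _)), neg_mul]
  have hH0 (y) : 0 ≤ -H y := neg_nonneg.2 (mul_nonpos_of_nonpos_of_nonneg (convexReal_nonpos _) (hm0 _))
  have hHm : AEStronglyMeasurable H (coneMeasure q) := by
    have hlm : Measurable (convexReal f) := by
      have htm : Measurable (torusMean (pot f)) :=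
        Measurable.lintegral_prod_right' (hpot.comp measurable_mul_expI)
      have : Measurable fun u : Fin (n + 1) → ℝ => fun k => ((Real.exp (u k) : ℝ) : ℂ) := by
        fun_prop
      exact (htm.comp this).ennreal_toReal.neg
    exact Measurable.aestronglyMeasurable (by fun_prop)
  have hHi : Integrable H (coneMeasure q) := by
    rw [← integrable_neg_iff]
    exact (lintegral_ofReal_ne_top_iff_integrable hHm.neg (Eventually.of_forall hH0)).1
      (hkey ▸ hfin.ne)
  refine ⟨hHi, ?_⟩
  rw [hleft, hkey, ← ofReal_integral_eq_lintegral_ofReal (f := fun y => -H y) hHi.neg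
    (Eventually.of_forall hH0), ENNReal.toReal_ofReal (integral_nonneg hH0), integral_neg, neg_neg]

lemma integral_log_cone {m : ℝ → ℝ} (hm : Continuous m) (hm0 : ∀ t, 0 ≤ m t) {R : ℝ}
    (hR : ∀ t, R < |t| → m t = 0) :
    Integrable (fun y => m (Real.log (cone q y))) (coneMeasure q) ∧
    ∫ y, m (Real.log (cone q y)) ∂coneMeasure q = coneConst q * ∫ t, m t := by
  have hc0 : 0 ≤ coneConst q := by unfold coneConst; positivity
  have hInt : Integrable m := by
    refine hm.integrable_of_hasCompactSupport (HasCompactSupport.intro (isCompact_Icc (a := -R) (b := R))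
      fun t ht => hR t ?_)
    by_contra h
    exact ht (abs_le.1 (not_lt.1 h))
  have h := lintegral_cone q hm.measurable.ennreal_ofReal
  rw [← ofReal_integral_eq_lintegral_ofReal hInt (Eventually.of_forall hm0),
    ← ENNReal.ofReal_mul hc0] at h
  have hms : AEStronglyMeasurable (fun y => m (Real.log (cone q y))) (coneMeasure q) := by
    have hc := (continuous_cone q).measurable
    have hl := Real.measurable_log
    have hmm := hm.measurable
    exact Measurable.aestronglyMeasurable (by fun_prop)
  have hi : Integrable (fun y => m (Real.log (cone q y))) (coneMeasure q) :=
    (lintegral_ofReal_ne_top_iff_integrable hms (Eventually.of_forall fun y => hm0 _)).1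
      (by rw [h]; exact ENNReal.ofReal_ne_top)
  refine ⟨hi, ?_⟩
  rw [← ofReal_integral_eq_lintegral_ofReal hi (Eventually.of_forall fun y => hm0 _)] at h
  exact (ENNReal.ofReal_eq_ofReal_iff (integral_nonneg fun y => hm0 _)
    (mul_nonneg hc0 (integral_nonneg hm0))).1 h

/-- The increments of the means over shells converge to the asymptotic slope. -/
lemma NegPSH.tendsto_coneMean (hf : NegPSH f) {m : ℝ → ℝ} (hm : Continuous m) (hm0 : ∀ t, 0 ≤ m t)
    {R : ℝ} (hR : ∀ t, R < |t| → m t = 0) {δ : ℝ} (hδ : 0 < δ) :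
    Tendsto (fun s => (coneMean q f m s - coneMean q f m (s - δ)) / δ) atBot
      (𝓝 (asympSlope (convexReal f) (coneDir q) * (coneConst q * ∫ t, m t))) := by
  set b := coneDir q with hb
  have hb0 : 0 ≤ b := fun k => (coneDir_pos q k).le
  -- Difference quotients of the convex image along the dilation direction. As `s → -∞` they
  -- decrease to the slope, so the quotient at a fixed `s₀` is an integrable majorant.
  let D : ℝ → (Fin (n + 1) → ℂ) → ℝ := fun s y =>
    (convexReal f ((fun k => Real.log ‖y k‖) + s • b)
      - convexReal f ((fun k => Real.log ‖y k‖) + (s - δ) • b)) / δ * m (Real.log (cone q y))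
  have hDeq {s : ℝ} (hs : s + R < 0) : Integrable (D s) (coneMeasure q) ∧
      (coneMean q f m s - coneMean q f m (s - δ)) / δ = ∫ y, D s y ∂coneMeasure q := by
    obtain ⟨i1, e1⟩ := hf.coneMean_eq (q := q) hm hm0 hR hs
    obtain ⟨i2, e2⟩ := hf.coneMean_eq (q := q) hm hm0 hR (s := s - δ) (by linarith)
    have e (y) : D s y = (convexReal f ((fun k => Real.log ‖y k‖) + s • coneDir q)
        * m (Real.log (cone q y)) - convexReal f ((fun k => Real.log ‖y k‖) + (s - δ) • coneDir q)
        * m (Real.log (cone q y))) / δ := by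
      simp only [D, hb]; ring
    have e' : D s = _ := funext e
    rw [e', e1, e2, ← integral_sub i1 i2, ← integral_div]
    exact ⟨(i1.sub i2).div_const δ, rfl⟩
  obtain ⟨-, hmi⟩ := integral_log_cone (q := q) hm hm0 hR
  rw [← hmi, ← integral_const_mul]
  obtain ⟨s₀, hs₀⟩ : ∃ s₀, s₀ + R < 0 := ⟨-R - 1, by linarith⟩
  have hmain : Tendsto (fun s => ∫ y, D s y ∂coneMeasure q) atBot
      (𝓝 (∫ y, asympSlope (convexReal f) b * m (Real.log (cone q y)) ∂coneMeasure q)) := by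
    -- On the support of the profile each `|y k|^{2 (q k + 1)}` is at most `e^R`, so a dilation by
    -- `v < -R` moves the point into the polydisk.
    have hline {y : Fin (n + 1) → ℂ} (hy : ∀ k, y k ≠ 0) (hyR : |Real.log (cone q y)| ≤ R)
        (v : ℝ) (hv : v < -R) : (fun k => Real.log ‖y k‖) + v • b ∈ negOrthant (n + 1) := fun k => by
      have hS : 0 < cone q y := cone_pos fun h => hy 0 (by simp [h])
      have h1 : (‖y k‖ ^ 2) ^ (q k + 1) ≤ Real.exp R := by
        refine le_trans ?_ ((Real.log_le_iff_le_exp hS).1 ((le_abs_self _).trans hyR))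
        exact Finset.single_le_sum (f := fun k => (‖y k‖ ^ 2) ^ (q k + 1))
          (fun _ _ => by positivity) (Finset.mem_univ k)
      have hyk := norm_pos_iff.2 (hy k)
      have h2 := (Real.log_le_iff_le_exp (by positivity)).2 h1
      rw [Real.log_pow, Real.log_pow] at h2
      push_cast at h2
      simp only [Pi.add_apply, Pi.smul_apply, smul_eq_mul, hb]
      have h3 := coneDir_mul q k v
      have hq : (0 : ℝ) < (q k : ℝ) + 1 := by positivity
      by_contra hcon
      push Not at hcon
      nlinarith
    refine tendsto_integral_filter_of_dominated_convergence (D s₀) ?_ ?_ (hDeq hs₀).1 ?_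
    · filter_upwards [eventually_lt_atBot (-R)] with s hs
      exact (hDeq (by linarith)).1.aestronglyMeasurable
    · filter_upwards [eventually_le_atBot s₀] with s hs
      filter_upwards [ae_ne_zero_coneMeasure q] with y hy
      by_cases hyR : R < |Real.log (cone q y)|
      · simp [D, hR _ hyR]
      · obtain ⟨-, h2, h3⟩ := hf.negConvex.slope_quotient hb0 (hline hy (not_lt.1 hyR)) hδ
        have h4 := h2 s (by linarith)
        have h5 := h3 s s₀ hs (by linarith)
        have h6 := hf.negConvex.asympSlope_nonneg hb0
        rw [Real.norm_eq_abs, abs_of_nonneg (mul_nonneg (h6.trans h4) (hm0 _))]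
        exact mul_le_mul_of_nonneg_right h5 (hm0 _)
    · filter_upwards [ae_ne_zero_coneMeasure q] with y hy
      by_cases hyR : R < |Real.log (cone q y)|
      · simp [D, hR _ hyR]
      · exact (hf.negConvex.slope_quotient hb0 (hline hy (not_lt.1 hyR)) hδ).1.mul_const _
  refine hmain.congr' ?_
  filter_upwards [eventually_lt_atBot (-R)] with s hs
  exact (hDeq (by linarith)).2.symm

end ConeMean

/-! ### Test functions adapted to weighted shells -/

section Profile

/-- A smooth step of width `δ`. -/
def step (δ t : ℝ) : ℝ := Real.smoothTransition (t / δ)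

/-- A smooth bump of width `δ` and mass `1`. -/
def bump (δ : ℝ) : ℝ → ℝ := deriv (step δ)

/-- The mean of `bump δ` over `[t, t + δ]`. -/
def plateau (δ t : ℝ) : ℝ := (step δ (t + δ) - step δ t) / δ

/-- A primitive of `-e^{-ct} plateau δ t`. -/
def descent (δ c t : ℝ) : ℝ := ∫ τ in t..δ, Real.exp (-c * τ) * plateau δ τ

variable {δ : ℝ} (c : ℝ)

lemma contDiff_step : ContDiff ℝ ∞ (step δ) := by
  have : ContDiff ℝ ∞ Real.smoothTransition := Real.smoothTransition.contDiff
  exact this.comp (contDiff_id.div_const δ)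

lemma step_mono (hδ : 0 < δ) : Monotone (step δ) := fun _ _ h =>
  Real.smoothTransition.monotone (by gcongr)

lemma step_of_nonpos (hδ : 0 < δ) {t : ℝ} (ht : t ≤ 0) : step δ t = 0 :=
  Real.smoothTransition.zero_of_nonpos (div_nonpos_of_nonpos_of_nonneg ht hδ.le)

lemma step_of_le (hδ : 0 < δ) {t : ℝ} (ht : δ ≤ t) : step δ t = 1 :=
  Real.smoothTransition.one_of_one_le ((one_le_div hδ).2 ht)

lemma hasDerivAt_step (t : ℝ) : HasDerivAt (step δ) (bump δ t) t :=
  (contDiff_step.differentiable (by simp) t).hasDerivAt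

lemma contDiff_bump : ContDiff ℝ ∞ (bump δ) := (contDiff_infty_iff_deriv.1 contDiff_step).2

lemma bump_nonneg (hδ : 0 < δ) (t : ℝ) : 0 ≤ bump δ t := (step_mono hδ).deriv_nonneg

lemma bump_eq_zero (hδ : 0 < δ) (t : ℝ) (ht : δ < |t|) : bump δ t = 0 := by
  rcases lt_abs.1 ht with h | h
  · have : step δ =ᶠ[𝓝 t] fun _ => 1 := by
      filter_upwards [Ioi_mem_nhds h] with s hs using step_of_le hδ hs.le
    rw [bump, this.deriv_eq, deriv_const]
  · have : step δ =ᶠ[𝓝 t] fun _ => 0 := by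
      filter_upwards [Iio_mem_nhds (show t < 0 by linarith)] with s hs using step_of_nonpos hδ hs.le
    rw [bump, this.deriv_eq, deriv_const]

lemma integral_bump (hδ : 0 < δ) : ∫ t, bump δ t = 1 := by
  have hInt : Integrable (bump δ) := by
    refine contDiff_bump.continuous.integrable_of_hasCompactSupport
      (HasCompactSupport.intro (isCompact_Icc (a := -δ) (b := δ)) fun t ht => bump_eq_zero hδ t ?_)
    by_contra h
    exact ht (abs_le.1 (not_lt.1 h))
  have h := integral_of_hasDerivAt_of_tendsto (fun t => hasDerivAt_step t) hInt
    (m := 0) (n := 1) ?_ ?_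
  · rw [h, sub_zero]
  · refine tendsto_const_nhds.congr' ?_
    filter_upwards [eventually_le_atBot 0] with t ht using (step_of_nonpos hδ ht).symm
  · refine tendsto_const_nhds.congr' ?_
    filter_upwards [eventually_ge_atTop δ] with t ht using (step_of_le hδ ht).symm

lemma contDiff_plateau : ContDiff ℝ ∞ (plateau δ) :=
  ((contDiff_step.comp (contDiff_id.add contDiff_const)).sub contDiff_step).div_const δ

lemma plateau_nonneg (hδ : 0 < δ) (t : ℝ) : 0 ≤ plateau δ t :=
  div_nonneg (sub_nonneg.2 (step_mono hδ (by linarith))) hδ.le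

lemma plateau_of_le (hδ : 0 < δ) {t : ℝ} (ht : t ≤ -δ) : plateau δ t = 0 := by
  rw [plateau, step_of_nonpos hδ (by linarith), step_of_nonpos hδ (by linarith)]; simp

lemma plateau_of_ge (hδ : 0 < δ) {t : ℝ} (ht : δ ≤ t) : plateau δ t = 0 := by
  rw [plateau, step_of_le hδ (by linarith), step_of_le hδ ht]; simp

lemma integral_plateau (hδ : 0 < δ) : ∫ t in (-δ)..δ, plateau δ t = 1 := by
  have hc : Continuous (step δ) := contDiff_step.continuous
  have hi (a b : ℝ) : IntervalIntegrable (step δ) volume a b := hc.intervalIntegrable a b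
  have hc' : Continuous fun t => step δ (t + δ) := by fun_prop
  unfold plateau
  rw [intervalIntegral.integral_div, intervalIntegral.integral_sub
    (hc'.intervalIntegrable _ _) (hi _ _),
    intervalIntegral.integral_comp_add_right (step δ), neg_add_cancel]
  have h1 : ∫ t in δ..(δ + δ), step δ t = δ := by
    rw [intervalIntegral.integral_congr (g := fun _ => (1 : ℝ)) fun t ht => ?_]
    · simp
    · rw [Set.uIcc_of_le (by linarith)] at ht
      exact step_of_le hδ ht.1
  have h2 : ∫ t in (-δ)..0, step δ t = 0 := by
    rw [intervalIntegral.integral_congr (g := fun _ => (0 : ℝ)) fun t ht => ?_]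
    · simp
    · rw [Set.uIcc_of_le (by linarith)] at ht
      exact step_of_nonpos hδ ht.2
  have h3 := intervalIntegral.integral_add_adjacent_intervals (hi 0 δ) (hi δ (δ + δ))
  have h4 := intervalIntegral.integral_add_adjacent_intervals (hi (-δ) 0) (hi 0 δ)
  rw [← h3, ← h4, h1, h2, zero_add, add_sub_cancel_left, div_self hδ.ne']

lemma continuous_descent_integrand : Continuous fun τ => Real.exp (-c * τ) * plateau δ τ := by
  have : Continuous (plateau δ) := contDiff_plateau.continuous
  fun_prop

lemma hasDerivAt_descent (t : ℝ) :
    HasDerivAt (descent δ c) (-(Real.exp (-c * t) * plateau δ t)) t :=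
  intervalIntegral.integral_hasDerivAt_left
    ((continuous_descent_integrand c).intervalIntegrable _ _)
    ((continuous_descent_integrand c).stronglyMeasurableAtFilter _ _)
    (continuous_descent_integrand c).continuousAt

lemma deriv_descent : deriv (descent δ c) = fun t => -(Real.exp (-c * t) * plateau δ t) :=
  funext fun t => (hasDerivAt_descent c t).deriv

lemma contDiff_descent : ContDiff ℝ ∞ (descent δ c) := by
  rw [contDiff_infty_iff_deriv, deriv_descent]
  refine ⟨fun t => (hasDerivAt_descent c t).differentiableAt, ?_⟩
  exact ((Real.contDiff_exp.comp (contDiff_const.mul contDiff_id)).mul contDiff_plateau).neg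

lemma hasDerivAt_plateau (t : ℝ) :
    HasDerivAt (plateau δ) ((bump δ (t + δ) - bump δ t) / δ) t :=
  (((hasDerivAt_step (t + δ)).comp_add_const t δ).sub (hasDerivAt_step t)).div_const δ

/-- The factor `e^{-ct}` makes `c g' + g''` collapse to a difference of two bumps for `g = descent δ
c`. The trace of the Hessian needs `c = n`, the mixed operator with a logarithmic weight needs `c =
0`. -/
lemma deriv_deriv_descent (t : ℝ) : deriv (deriv (descent δ c)) t
    = Real.exp (-c * t) * (c * plateau δ t + (bump δ t - bump δ (t + δ)) / δ) := by
  rw [deriv_descent]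
  have h1 : HasDerivAt (fun t => Real.exp (-c * t)) (Real.exp (-c * t) * (-c * 1)) t :=
    ((hasDerivAt_id t).const_mul (-c)).exp
  refine ((h1.mul (hasDerivAt_plateau t)).neg).deriv.trans ?_
  ring

lemma descent_antitone (hδ : 0 < δ) : Antitone (descent δ c) := by
  refine antitone_of_deriv_nonpos ((contDiff_descent c).differentiable (by simp)) fun t => ?_
  rw [deriv_descent]
  exact neg_nonpos.2 (mul_nonneg (Real.exp_pos _).le (plateau_nonneg hδ t))

lemma descent_of_ge (hδ : 0 < δ) {t : ℝ} (ht : δ ≤ t) : descent δ c t = 0 := by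
  rw [descent, intervalIntegral.integral_congr (g := fun _ => (0 : ℝ)) fun s hs => ?_]
  · simp
  · rw [Set.uIcc_of_ge ht] at hs
    simp [plateau_of_ge hδ hs.1]

lemma descent_of_le (hδ : 0 < δ) {t : ℝ} (ht : t ≤ -δ) : descent δ c t = descent δ c (-δ) := by
  have hi (a b : ℝ) := (continuous_descent_integrand (δ := δ) c).intervalIntegrable (μ := volume) a b
  rw [descent, ← intervalIntegral.integral_add_adjacent_intervals (hi t (-δ)) (hi (-δ) δ),
    intervalIntegral.integral_congr (g := fun _ => (0 : ℝ)) fun s hs => ?_]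
  · simp [descent]
  · rw [Set.uIcc_of_le ht] at hs
    simp [plateau_of_le hδ hs.2]

lemma descent_nonneg (hδ : 0 < δ) (t : ℝ) : 0 ≤ descent δ c t := by
  rcases le_total δ t with h | h
  · exact (descent_of_ge c hδ h).ge
  · exact (descent_of_ge c hδ le_rfl).ge.trans (descent_antitone c hδ h)

lemma descent_le (hδ : 0 < δ) (t : ℝ) : descent δ c t ≤ descent δ c (-δ) := by
  rcases le_total t (-δ) with h | h
  · exact (descent_of_le c hδ h).le
  · exact descent_antitone c hδ h

/-- On `[-δ, δ]`, where `plateau δ` has mass `1`, the exponential lies between `e^{-cδ}` and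
`e^{cδ}`. So the total drop is `1` up to a factor that disappears as `δ → 0`, and it is exactly `1`
for `c = 0`. -/
lemma descent_bounds (hδ : 0 < δ) (hc : 0 ≤ c) :
    Real.exp (-c * δ) ≤ descent δ c (-δ) ∧ descent δ c (-δ) ≤ Real.exp (c * δ) := by
  have hp : Continuous (plateau δ) := contDiff_plateau.continuous
  have hi := (continuous_descent_integrand (δ := δ) c).intervalIntegrable (μ := volume) (-δ) δ
  have hk (a : ℝ) : ∫ t in (-δ)..δ, a * plateau δ t = a := by
    rw [intervalIntegral.integral_const_mul, integral_plateau hδ, mul_one]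
  constructor
  · rw [← hk (Real.exp (-c * δ))]
    refine intervalIntegral.integral_mono_on (by linarith)
      ((continuous_const.mul hp).intervalIntegrable _ _) hi fun t ht => ?_
    refine mul_le_mul_of_nonneg_right (Real.exp_le_exp.2 ?_) (plateau_nonneg hδ t)
    nlinarith [ht.2]
  · rw [← hk (Real.exp (c * δ))]
    refine intervalIntegral.integral_mono_on (by linarith) hi
      ((continuous_const.mul hp).intervalIntegrable _ _) fun t ht => ?_
    refine mul_le_mul_of_nonneg_right (Real.exp_le_exp.2 ?_) (plateau_nonneg hδ t)
    nlinarith [ht.1]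

end Profile

/-! ### Shell test functions and the increments they compute. -/

section ShellTest

variable {n : ℕ} (q : Fin (n + 1) → ℕ) (δ c s : ℝ)

/-- A test function that decreases over the shell `|log (cone q) - s| ≤ δ`. -/
def shellTest (x : Fin (n + 1) → ℂ) : ℝ :=
  open Classical in
  -- `Real.log 0 = 0` would give the wrong value at the origin, where the function must continue its
  -- inner constant.
  if x = 0 then descent δ c (-δ) else descent δ c (Real.log (cone q x) - s)

variable {q δ c s} {x : Fin (n + 1) → ℂ}

lemma shellTest_eventuallyEq (hx : x ≠ 0) :
    shellTest q δ c s =ᶠ[𝓝 x] fun y => descent δ c (Real.log (cone q y) - s) := by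
  filter_upwards [isOpen_ne.mem_nhds hx] with y hy
  simp [shellTest, show y ≠ 0 from hy]

lemma shellTest_of_le (hδ : 0 < δ) (hx : cone q x ≤ Real.exp (s - δ)) :
    shellTest q δ c s x = descent δ c (-δ) := by
  unfold shellTest
  split_ifs with h
  · rfl
  · have := (Real.log_le_iff_le_exp (cone_pos h)).2 hx
    exact descent_of_le c hδ (by linarith)

lemma shellTest_of_ge (hδ : 0 < δ) (hx : Real.exp (s + δ) ≤ cone q x) :
    shellTest q δ c s x = 0 := by
  have hS : 0 < cone q x := (Real.exp_pos _).trans_le hx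
  have h : x ≠ 0 := fun h => by simp [h, cone_zero] at hS
  have := (Real.le_log_iff_exp_le hS).2 hx
  rw [shellTest, if_neg h]
  exact descent_of_ge c hδ (by linarith)

lemma shellTest_nonneg (hδ : 0 < δ) (x : Fin (n + 1) → ℂ) : 0 ≤ shellTest q δ c s x := by
  unfold shellTest
  split_ifs
  exacts [descent_nonneg c hδ _, descent_nonneg c hδ _]

lemma shellTest_le (hδ : 0 < δ) (x : Fin (n + 1) → ℂ) :
    shellTest q δ c s x ≤ descent δ c (-δ) := by
  unfold shellTest
  split_ifs
  exacts [le_rfl, descent_le c hδ _]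

lemma complexHessian_shellTest (hδ : 0 < δ) :
    complexHessian (shellTest q δ c s) x = 0 ∨
      Real.exp (s - δ) ≤ cone q x ∧ cone q x ≤ Real.exp (s + δ) := by
  by_cases h1 : cone q x < Real.exp (s - δ)
  · left
    rw [complexHessian_congr (v := fun _ => descent δ c (-δ)), complexHessian_const]
    filter_upwards [(continuous_cone q).continuousAt.eventually_lt_const h1] with y hy
    exact shellTest_of_le hδ hy.le
  by_cases h2 : Real.exp (s + δ) < cone q x
  · left
    rw [complexHessian_congr (v := fun _ => 0), complexHessian_const]
    filter_upwards [(continuous_cone q).continuousAt.eventually_const_lt h2] with y hy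
    exact shellTest_of_ge hδ hy.le
  exact Or.inr ⟨not_lt.1 h1, not_lt.1 h2⟩

lemma isTest_shellTest (hδ : 0 < δ) (hs : s + δ < 0) :
    IsTest (polydisk (n + 1)) (shellTest q δ c s) := by
  have hsub : tsupport (shellTest q δ c s)
      ⊆ {x | (0 : ℝ) ≤ cone q x ∧ cone q x ≤ Real.exp (s + δ)} := by
    refine closure_minimal (fun x hx => ⟨cone_nonneg q x, ?_⟩) isCompact_shell.isClosed
    by_contra h
    exact hx (shellTest_of_ge hδ (not_le.1 h).le)
  refine ⟨contDiff_iff_contDiffAt.2 fun x => ?_,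
    isCompact_shell.of_isClosed_subset (isClosed_tsupport _) hsub, hsub.trans fun x hx =>
      mem_polydisk_of_cone_lt_one (hx.2.trans_lt (Real.exp_lt_one_iff.2 hs))⟩
  by_cases hx : x = 0
  · subst hx
    refine (contDiffAt_const (c := descent δ c (-δ))).congr_of_eventuallyEq ?_
    have h0 : cone q 0 < Real.exp (s - δ) := by rw [cone_zero]; exact Real.exp_pos _
    filter_upwards [(continuous_cone q).continuousAt.eventually_lt_const h0] with y hy
    exact shellTest_of_le hδ hy.le
  · refine ContDiffAt.congr_of_eventuallyEq ?_ (shellTest_eventuallyEq hx)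
    exact (contDiff_descent c).contDiffAt.comp x (((contDiff_cone q).contDiffAt.log
      (cone_pos hx).ne').sub contDiffAt_const)

variable {f : (Fin (n + 1) → ℂ) → EReal}

/-- Both operators, applied to a shell test function, yield a difference quotient of bump profiles
times the invariant density; this integrates that common form. -/
lemma NegPSH.integral_coneMean_sub (hf : NegPSH f) (hδ : 0 < δ) (hs : s + δ < 0) (A : ℝ)
    {φ : (Fin (n + 1) → ℂ) → ℝ} (hφ : ∀ x ∈ polydisk (n + 1), x ≠ 0 →
      φ x = A * ((bump δ (Real.log (cone q x) - s) - bump δ (Real.log (cone q x) - (s - δ))) / δ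
        * coneDensity q x)) (hφ0 : ∀ x ∉ polydisk (n + 1), φ x = 0) :
    ∫ x, (f x).toReal * φ x
      = A * ((coneMean q f (bump δ) s - coneMean q f (bump δ) (s - δ)) / δ) := by
  have hb : Continuous (bump δ) := contDiff_bump.continuous
  have hR := bump_eq_zero hδ
  rw [coneMean, coneMean, ← integral_sub (hf.integrable_coneMean hb hR hs)
    (hf.integrable_coneMean hb hR (by linarith)), ← integral_div, ← integral_const_mul]
  refine integral_congr_ae ?_
  filter_upwards [ae_coord_ne_zero (n + 1)] with x hx
  have hx0 : x ≠ 0 := fun h => hx 0 (by simp [h])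
  by_cases hD : x ∈ polydisk (n + 1)
  · rw [hφ x hD hx0]
    ring
  · have h1 (s' : ℝ) (h : s' + δ < 0) :
        bump δ (Real.log (cone q x) - s') * coneDensity q x = 0 :=
      coneProfile_eq_zero hR s' fun hmem => hD (shell_subset h hmem)
    rw [hφ0 x hD, h1 s hs, h1 (s - δ) (by linarith)]
    simp

lemma complexHessian_shellTest_eq (hx : x ≠ 0) : complexHessian (shellTest q δ c s) x
    = complexHessian (fun y => (fun t => descent δ c (t - s)) (Real.log (cone q y))) x :=
  complexHessian_congr (shellTest_eventuallyEq hx)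

lemma contDiff_descent_sub : ContDiff ℝ ∞ fun t => descent δ c (t - s) :=
  (contDiff_descent c).comp (contDiff_id.sub contDiff_const)

lemma deriv_descent_sub : deriv (fun t => descent δ c (t - s)) = fun t => deriv (descent δ c) (t - s) :=
  funext fun _ => deriv_comp_sub_const ..

lemma deriv_deriv_descent_sub : deriv (deriv fun t => descent δ c (t - s))
    = fun t => deriv (deriv (descent δ c)) (t - s) := by
  rw [deriv_descent_sub]
  exact funext fun _ => deriv_comp_sub_const ..

/-- The trace of `dd^c f` against a radial test function. -/
lemma NegPSH.integral_trace_shellTest (hf : NegPSH f) (hδ : 0 < δ) (hs : s + δ < 0) :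
    ∫ x, (f x).toReal * (complexHessian (shellTest 0 δ n s) x).trace.re
      = Real.exp (n * s) * ((coneMean 0 f (bump δ) s - coneMean 0 f (bump δ) (s - δ)) / δ) := by
  refine hf.integral_coneMean_sub hδ hs _ (fun x _ hx => ?_) fun x hx => ?_
  · have hS := cone_pos (q := 0) hx
    rw [complexHessian_shellTest_eq hx, trace_complexHessian_comp_log hx contDiff_descent_sub,
      deriv_deriv_descent_sub, deriv_descent_sub]
    beta_reduce
    rw [deriv_deriv_descent, deriv_descent]
    beta_reduce
    -- The exponential factor contributes `e^{ns} / S^n`; with the `1 / S` from the trace this is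
    -- the invariant density `S^{-(n+1)}`, and the first-order term has already cancelled because `c
    -- = n`.
    have h1 : Real.exp (-(n : ℝ) * (Real.log (cone 0 x) - s))
        = Real.exp (n * s) / cone 0 x ^ n := by
      rw [neg_mul, mul_sub, neg_sub, Real.exp_sub, Real.exp_nat_mul (Real.log _), Real.exp_log hS]
    have h2 : coneDensity 0 x = (cone 0 x ^ (n + 1))⁻¹ := by simp [coneDensity, coneDiag]
    rw [h1, h2, show Real.log (cone 0 x) - (s - δ) = Real.log (cone 0 x) - s + δ by ring]
    field_simp
    ring
  · rw [complexHessian_of_notMem_tsupport fun h => hx ((isTest_shellTest hδ hs).supp h)]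
    simp

/-- The mixed Monge-Ampère operator with a logarithmic weight. -/
lemma NegPSH.maInt_shellTest (hf : NegPSH f) (hδ : 0 < δ) (hs : s + δ < 0) (l : ℝ)
    {w : (Fin (n + 1) → ℂ) → ℝ} (hw : ∀ x, Real.exp (s - δ) ≤ cone q x →
      complexHessian w x = complexHessian (fun y => l * Real.log (cone q y)) x) :
    maInt f w (shellTest q δ 0 s)
      = l ^ n * ((coneMean q f (bump δ) s - coneMean q f (bump δ) (s - δ)) / δ) := by
  rw [maInt_congr (v := fun y => (fun t => l * t) (Real.log (cone q y))) (isTest_shellTest hδ hs)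
    fun x _ => (complexHessian_shellTest hδ).imp_right fun h => hw x h.1]
  refine hf.integral_coneMean_sub hδ hs _ (fun x _ hx => ?_) fun x hx => ?_
  · have hd : deriv (fun t : ℝ => l * t) = fun _ => l := by
      ext t
      simp
    have e : maDensity (fun y => (fun t => l * t) (Real.log (cone q y))) (shellTest q δ 0 s) x
        = maDensity (fun y => (fun t => l * t) (Real.log (cone q y)))
          (fun y => (fun t => descent δ 0 (t - s)) (Real.log (cone q y))) x := by
      rw [maDensity, maDensity, complexHessian_shellTest_eq hx]
    rw [e, maDensity_comp_log_cone (F := fun t => l * t) (g := fun t => descent δ 0 (t - s)) hx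
      (contDiff_const.mul contDiff_id) contDiff_descent_sub (by rw [hd]; simp),
      deriv_deriv_descent_sub, hd]
    beta_reduce
    rw [deriv_deriv_descent, coneDensity,
      show Real.log (cone q x) - (s - δ) = Real.log (cone q x) - s + δ by ring]
    simp
  · exact maDensity_of_notMem fun h => hx ((isTest_shellTest hδ hs).supp h)

end ShellTest

/-! ### Positive functionals on test functions -/

section Riesz

variable {n : ℕ}

lemma IsTest.const_mul {U : Set (Fin n → ℂ)} {χ : (Fin n → ℂ) → ℝ} (h : IsTest U χ) (c : ℝ) :
    IsTest U fun x => c * χ x where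
  smooth := contDiff_const.mul h.smooth
  compact := h.compact.mul_left
  supp := (closure_mono (Function.support_mul_subset_right _ _)).trans h.supp

lemma isTest_zero {U : Set (Fin n → ℂ)} : IsTest U fun _ => 0 where
  smooth := contDiff_const
  compact := HasCompactSupport.zero
  supp := by simp [tsupport]

/-- The restriction of a test function to the polydisk. -/
def IsTest.restrict {χ : (Fin n → ℂ) → ℝ} (h : IsTest (polydisk n) χ) :
    CompactlySupportedContinuousMap (polydisk n) ℝ where
  toFun z := χ z
  continuous_toFun := h.smooth.continuous.comp continuous_subtype_val
  hasCompactSupport' := by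
    refine HasCompactSupport.intro (K := Subtype.val ⁻¹' tsupport χ) ?_
      fun z hz => image_eq_zero_of_notMem_tsupport hz
    rw [Topology.IsInducing.subtypeVal.isCompact_preimage_iff (by simpa using h.supp)]
    exact h.compact

/-- A positive linear functional on test functions is a measure. -/
lemma exists_measure_of_positive {Λ : ((Fin n → ℂ) → ℝ) → ℝ}
    (hsub : ∀ χ χ', IsTest (polydisk n) χ → IsTest (polydisk n) χ' →
      Λ (fun x => χ x - χ' x) = Λ χ - Λ χ')
    (hsmul : ∀ (c : ℝ) χ, IsTest (polydisk n) χ → Λ (fun x => c * χ x) = c * Λ χ)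
    (hpos : ∀ χ, IsTest (polydisk n) χ → (∀ x, 0 ≤ χ x) → 0 ≤ Λ χ) :
    ∃ μ : Measure (Fin n → ℂ), (∀ K, IsCompact K → K ⊆ polydisk n → μ K < ⊤) ∧
      ∀ χ, IsTest (polydisk n) χ → ∫ x, χ x ∂μ = Λ χ := by
  have hopen := isOpen_polydisk n
  have : LocallyCompactSpace (polydisk n) := hopen.locallyCompactSpace
  let E := CompactlySupportedContinuousMap (polydisk n) ℝ
  let ext : E → (Fin n → ℂ) → ℝ := fun u => Function.extend Subtype.val u 0
  have ext_mem (u : E) (z : polydisk n) : ext u z = u z := Subtype.val_injective.extend_apply _ _ _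
  have ext_not (u : E) (x : Fin n → ℂ) (hx : x ∉ polydisk n) : ext u x = 0 :=
    Function.extend_apply' _ _ _ fun ⟨z, hz⟩ => hx (hz ▸ z.2)
  have ext_add (u v : E) : ext (u + v) = fun x => ext u x - (-1) * ext v x := by
    ext x
    by_cases hx : x ∈ polydisk n
    · rw [ext_mem (u + v) ⟨x, hx⟩, ext_mem u ⟨x, hx⟩, ext_mem v ⟨x, hx⟩]
      change u _ + v _ = _
      ring
    · simp [ext_not _ x hx]
  have ext_smul (c : ℝ) (u : E) : ext (c • u) = fun x => c * ext u x := by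
    ext x
    by_cases hx : x ∈ polydisk n
    · rw [ext_mem (c • u) ⟨x, hx⟩, ext_mem u ⟨x, hx⟩]
      rfl
    · simp [ext_not _ x hx]
  have ext_restrict {χ : (Fin n → ℂ) → ℝ} (h : IsTest (polydisk n) χ) : ext h.restrict = χ := by
    ext x
    by_cases hx : x ∈ polydisk n
    · exact ext_mem h.restrict ⟨x, hx⟩
    · rw [ext_not _ x hx, image_eq_zero_of_notMem_tsupport fun h' => hx (h.supp h')]
  -- The functional is defined on the restrictions of test functions, a subspace of the compactly
  -- supported continuous functions. It is extended positively to all of them by the M. Riesz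
  -- theorem, and then represented by a measure.
  let p : Submodule ℝ E :=
    { carrier := {u | IsTest (polydisk n) (ext u)}
      add_mem' := fun {u v} hu hv => by
        simp only [Set.mem_ofPred_eq, ext_add]
        exact hu.sub (hv.const_mul (-1))
      zero_mem' := by
        have h : ext 0 = fun _ => 0 := by simpa using ext_smul 0 (0 : E)
        simp only [Set.mem_ofPred_eq, h]
        exact isTest_zero
      smul_mem' := fun c u hu => by
        simp only [Set.mem_ofPred_eq, ext_smul]
        exact hu.const_mul c }
  let F : E →ₗ.[ℝ] ℝ :=
    { domain := p
      toFun :=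
        { toFun := fun u => Λ (ext u)
          map_add' := fun u v => by
            simp only [Submodule.coe_add, ext_add]
            rw [hsub _ _ u.2 (v.2.const_mul (-1)), hsmul _ _ v.2]
            ring
          map_smul' := fun c u => by
            simp only [Submodule.coe_smul, ext_smul]
            exact hsmul _ _ u.2 } }
  let s : PointedCone ℝ E :=
    { carrier := {u | ∀ z, 0 ≤ u z}
      add_mem' := fun hu hv z => add_nonneg (hu z) (hv z)
      zero_mem' := fun z => le_rfl
      smul_mem' := fun c u hu z => mul_nonneg c.2 (hu z) }
  -- The extension theorem needs every continuous `y` to become nonnegative after adding a test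
  -- function; a multiple, by a bound of `|y|`, of a smooth cutoff equal to `1` on the support of
  -- `y` does this.
  obtain ⟨G, hG, hG0⟩ := riesz_extension s F (fun u hu => by
      refine hpos _ u.2 fun x => ?_
      by_cases hx : x ∈ polydisk n
      · rw [ext_mem _ ⟨x, hx⟩]
        exact hu _
      · rw [ext_not _ x hx]) fun y => by
    obtain ⟨ψ, hψ, hψ1, hψ2⟩ := exists_smooth_cutoff
      (y.hasCompactSupport.isCompact.image continuous_subtype_val) (by
        rintro _ ⟨z, -, rfl⟩
        exact z.2)
    obtain ⟨C, hC⟩ := y.hasCompactSupport.isCompact.exists_bound_of_continuousOn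
      y.continuous.continuousOn
    refine ⟨⟨(hψ.const_mul |C|).restrict, ?_⟩, fun z => ?_⟩
    · change IsTest _ (ext _)
      rw [ext_restrict]
      exact hψ.const_mul |C|
    · change 0 ≤ |C| * ψ z + y z
      by_cases hz : z ∈ tsupport y
      · have h1 : ψ z = 1 := hψ1.self_of_nhdsSet _ ⟨z, hz, rfl⟩
        have h2 : -|C| ≤ y z := (abs_le.1 ((hC z hz).trans (le_abs_self C))).1
        rw [h1]
        linarith
      · rw [image_eq_zero_of_notMem_tsupport hz, add_zero]
        exact mul_nonneg (abs_nonneg _) (hψ2 _).1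
  let Φ : E →ₚ[ℝ] ℝ := PositiveLinearMap.mk₀ G fun u hu => hG0 u fun z => hu z
  have hemb : MeasurableEmbedding (Subtype.val : polydisk n → Fin n → ℂ) :=
    MeasurableEmbedding.subtype_coe hopen.measurableSet
  refine ⟨(RealRMK.rieszMeasure Φ).map Subtype.val, fun K hK hKD => ?_, fun χ hχ => ?_⟩
  · rw [hemb.map_apply]
    refine IsCompact.measure_lt_top ?_
    rw [Topology.IsInducing.subtypeVal.isCompact_preimage_iff (by simpa using hKD)]
    exact hK
  · rw [hemb.integral_map]
    have h1 := RealRMK.integral_rieszMeasure Φ hχ.restrict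
    have hmem : hχ.restrict ∈ p := by
      change IsTest _ (ext _)
      rw [ext_restrict]
      exact hχ
    have h2 : Φ hχ.restrict = Λ χ := by
      have := hG ⟨hχ.restrict, hmem⟩
      change _ = Λ (ext hχ.restrict) at this
      rw [ext_restrict] at this
      exact this
    rw [← h2]
    exact h1

end Riesz

/-! ### Lelong numbers -/

section Lelong

/-- The width `δ` is fixed while `r` tends to its limit, and only afterwards is `δ → 0`; no
uniformity in `δ` is needed. -/
lemma tendsto_of_eventually_bounds {α : Type*} {l : Filter α} {a : α → ℝ} {L : ℝ} {U V : ℝ → ℝ}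
    (hU : Tendsto U (𝓝[>] 0) (𝓝 L)) (hV : Tendsto V (𝓝[>] 0) (𝓝 L))
    (h : ∀ δ > 0, ∀ᶠ r in l, V δ ≤ a r ∧ a r ≤ U δ) : Tendsto a l (𝓝 L) := by
  refine tendsto_order.2 ⟨fun b hb => ?_, fun b hb => ?_⟩
  · obtain ⟨δ, h1, h2⟩ := ((hV.eventually_const_lt hb).and self_mem_nhdsWithin).exists
    filter_upwards [h δ h2] with r hr using h1.trans_le hr.1
  · obtain ⟨δ, h1, h2⟩ := ((hU.eventually_lt_const hb).and self_mem_nhdsWithin).exists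
    filter_upwards [h δ h2] with r hr using hr.2.trans_lt h1

variable {n : ℕ}

lemma volume_euclBall : (volume (euclBall (0 : Fin n → ℂ) 1)).toReal
    = Real.pi ^ n / n.factorial := by
  have e : euclBall (0 : Fin n → ℂ) 1 = {x : Fin n → ℂ | ∑ i, ‖x i‖ ^ (2 : ℝ) < 1} := by
    ext x
    simp [euclBall]
  rw [e, Complex.volume_sum_rpow_lt_one _ one_le_two]
  have h : 2 * ((Fintype.card (Fin n) : ℕ) : ℝ) / 2 + 1 = n + 1 := by simp
  rw [h, Real.Gamma_nat_eq_factorial, ENNReal.toReal_ofReal (by positivity)]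
  norm_num

lemma complexHessian_comp_affine (u : (Fin n → ℂ) → ℝ) (c : ℝ) (x y : Fin n → ℂ) :
    complexHessian (fun z => u (c • (z - x))) y
      = ((c ^ 2 : ℝ) : ℂ) • complexHessian u (c • (y - x)) := by
  have h1 : fderiv ℝ (fun z => u (c • (z - x))) = fun y => c • fderiv ℝ u (c • (y - x)) := by
    ext1 y
    rw [fderiv_comp_sub (f := fun z => u (c • z)) x, fderiv_comp_smul]
  have h2 (y) : fderiv ℝ (fun y => c • fderiv ℝ u (c • (y - x))) y
      = c • c • fderiv ℝ (fderiv ℝ u) (c • (y - x)) := by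
    have := congrFun (fderiv_const_smul_field (𝕜 := ℝ) (f := fun y => fderiv ℝ u (c • (y - x))) c) y
    refine this.trans ?_
    change c • fderiv ℝ (fun y => fderiv ℝ u (c • (y - x))) y = _
    rw [fderiv_comp_sub (f := fun z => fderiv ℝ u (c • z)) x,
      fderiv_comp_smul (f := fderiv ℝ u)]
  ext k l
  simp only [complexHessian, secondDeriv, h1, h2, smul_apply, smul_eq_mul, Matrix.of_apply,
    Matrix.smul_apply]
  push_cast
  ring

lemma smoothPSH_normSq : SmoothPSH fun y : Fin n → ℂ => ∑ j, ‖y j‖ ^ 2 := by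
  refine ⟨(ContDiff.sum fun j _ => contDiff_normSq_coord j).contDiffOn, fun x _ b => ?_⟩
  rw [levi_eq_complexHessian, complexHessian_normSq, Matrix.one_mulVec]
  simp only [star_star, dotProduct, Complex.re_sum]
  refine mul_nonneg (by norm_num) (Finset.sum_nonneg fun k _ => ?_)
  rw [Pi.star_apply, Complex.star_def, Complex.mul_conj, Complex.ofReal_re]
  exact Complex.normSq_nonneg _

variable {f : (Fin n → ℂ) → EReal}

/-- The trace is the mixed operator with weight `|x|²`, whose Hessian and hence adjugate is the
identity; positivity then gives the measure. -/
lemma NegPSH.exists_traceMeasure (hf : NegPSH f) : ∃ σ, IsTraceMeasure f σ := by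
  have hw := smoothPSH_normSq (n := n)
  obtain ⟨σ, h1, h2⟩ := exists_measure_of_positive
    (Λ := fun χ => (2 / Real.pi) * maInt f (fun y => ∑ j, ‖y j‖ ^ 2) χ)
    (fun χ χ' h h' => by rw [hf.maInt_sub hw.smooth h h', mul_sub])
    (fun c χ _ => by rw [maInt_const_mul_right]; ring)
    (fun χ h h0 => mul_nonneg (by positivity) (hf.maInt_nonneg hw h h0))
  refine ⟨σ, h1, fun χ hχ => ?_⟩
  rw [h2 χ hχ, maInt]
  simp only [maDensity, complexHessian_normSq, Matrix.adjugate_one, Matrix.one_mul]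

end Lelong

/-! ### The classical Lelong number as a slope. -/

section LelongLimit

variable {n : ℕ} {f : (Fin (n + 1) → ℂ) → EReal}

lemma cone_zero_exponent (y : Fin n → ℂ) : cone 0 y = ∑ k, ‖y k‖ ^ 2 := by simp [cone]

lemma cone_smul (ρ : ℝ) (y : Fin n → ℂ) : cone 0 (ρ • y) = ρ ^ 2 * cone 0 y := by
  simp [cone, Finset.mul_sum, mul_pow]

/-- The trace measure against radial test functions around `x`. -/
lemma NegPSH.integral_traceMeasure (hf : NegPSH f) {σ : Measure (Fin (n + 1) → ℂ)}
    (hσ : IsTraceMeasure f σ) {x : Fin (n + 1) → ℂ} {ρ : ℝ} (hρ : 0 < ρ) (hx : ‖x‖ + ρ ≤ 1)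
    {δ s : ℝ} (hδ : 0 < δ) (hs : s + δ < 0) :
    IsTest (polydisk (n + 1)) (fun y => shellTest 0 δ n s (ρ⁻¹ • (y - x))) ∧
    ∫ y, shellTest 0 δ n s (ρ⁻¹ • (y - x)) ∂σ = (2 / Real.pi) * (ρ ^ (2 * n) * (Real.exp (n * s) *
      ((coneMean 0 (fun z => f fun k => x k + (ρ : ℂ) * z k) (bump δ) s
        - coneMean 0 (fun z => f fun k => x k + (ρ : ℂ) * z k) (bump δ) (s - δ)) / δ))) := by
  have hT := isTest_shellTest (q := (0 : Fin (n + 1) → ℕ)) (c := n) hδ hs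
  have hinv (z : Fin (n + 1) → ℂ) : ρ⁻¹ • (x + ρ • z - x) = z := by
    rw [add_sub_cancel_left, smul_smul, inv_mul_cancel₀ hρ.ne', one_smul]
  have htest : IsTest (polydisk (n + 1)) (fun y => shellTest 0 δ n s (ρ⁻¹ • (y - x))) := by
    have hc : Continuous fun z : Fin (n + 1) → ℂ => x + ρ • z := by fun_prop
    have hK := hT.compact.isCompact.image hc
    have hsub : tsupport (fun y => shellTest 0 δ n s (ρ⁻¹ • (y - x)))
        ⊆ (fun z : Fin (n + 1) → ℂ => x + ρ • z) '' tsupport (shellTest 0 δ n s) := by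
      refine closure_minimal (fun y hy => ⟨_, subset_tsupport _ hy, ?_⟩) hK.isClosed
      simp [smul_smul, mul_inv_cancel₀ hρ.ne']
    refine ⟨hT.smooth.comp (by fun_prop : ContDiff ℝ ∞ fun y => ρ⁻¹ • (y - x)),
      hK.of_isClosed_subset (isClosed_tsupport _) hsub, hsub.trans ?_⟩
    rintro _ ⟨z, hz, rfl⟩ k
    have h1 := hT.supp hz k
    have h2 := norm_le_pi_norm x k
    calc ‖x k + ρ • z k‖ ≤ ‖x k‖ + ρ * ‖z k‖ := by
          refine (norm_add_le _ _).trans ?_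
          rw [norm_smul, Real.norm_eq_abs, abs_of_pos hρ]
      _ < 1 := by nlinarith
  refine ⟨htest, ?_⟩
  rw [hσ.2 _ htest, ← (hf.recentre hρ hx).integral_trace_shellTest hδ hs]
  congr 1
  let Φ : (Fin (n + 1) → ℂ) → ℝ := fun y => (f y).toReal
    * (complexHessian (fun y => shellTest 0 δ n s (ρ⁻¹ • (y - x))) y).trace.re
  have e1 (z : Fin (n + 1) → ℂ) : Φ (x + ρ • z) = (ρ⁻¹) ^ 2 * ((f fun k => x k + (ρ : ℂ) * z k).toReal
      * (complexHessian (shellTest 0 δ n s) z).trace.re) := by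
    simp only [Φ]
    rw [complexHessian_comp_affine, hinv, Matrix.trace_smul, smul_eq_mul, Complex.re_ofReal_mul]
    have : (x + ρ • z) = fun k => x k + (ρ : ℂ) * z k := by
      ext k
      simp
    rw [this]
    ring
  have h2 := Measure.integral_comp_smul (volume : Measure (Fin (n + 1) → ℂ)) (fun z => Φ (x + z)) ρ
  rw [integral_add_left_eq_self] at h2
  simp only [e1, integral_const_mul] at h2
  have hd : Module.finrank ℝ (Fin (n + 1) → ℂ) = 2 * n + 2 := by
    simp [Module.finrank_pi_fintype]
    ring
  rw [hd, abs_of_pos (by positivity), smul_eq_mul] at h2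
  have h3 : ∫ y, Φ y = ρ ^ (2 * n + 2) * (ρ⁻¹ ^ 2 * ∫ z, (f fun k => x k + (ρ : ℂ) * z k).toReal
      * (complexHessian (shellTest 0 δ n s) z).trace.re) := by
    rw [h2]
    field_simp
  rw [show (∫ y, (f y).toReal * _) = ∫ y, Φ y from rfl, h3, pow_add]
  field_simp

/-- The Lelong number is the asymptotic slope of the convex image. -/
lemma NegPSH.tendsto_lelong (hf : NegPSH f) {σ : Measure (Fin (n + 1) → ℂ)}
    (hσ : IsTraceMeasure f σ) {x : Fin (n + 1) → ℂ} {ρ : ℝ} (hρ : 0 < ρ) (hx : ‖x‖ + ρ ≤ 1) :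
    Tendsto (fun r : ℝ => (σ (euclBall x r)).toReal /
        ((volume (euclBall (0 : Fin n → ℂ) 1)).toReal * r ^ (2 * n)))
      (𝓝[>] 0) (𝓝 (asympSlope (convexReal fun z => f fun k => x k + (ρ : ℂ) * z k) 1)) := by
  set g : (Fin (n + 1) → ℂ) → EReal := fun z => f fun k => x k + (ρ : ℂ) * z k with hg
  have hgN : NegPSH g := hf.recentre hρ hx
  set ν := asympSlope (convexReal g) 1 with hν
  have hfac : (0 : ℝ) < n.factorial := by exact_mod_cast n.factorial_pos
  rw [volume_euclBall]
  -- increments of the means over spheres, normalized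
  let Q : ℝ → ℝ → ℝ := fun δ s => (2 / Real.pi) *
    ((coneMean 0 g (bump δ) s - coneMean 0 g (bump δ) (s - δ)) / δ) / (Real.pi ^ n / n.factorial)
  have hQ {δ : ℝ} (hδ : 0 < δ) : Tendsto (Q δ) atBot (𝓝 ν) := by
    have h := hgN.tendsto_coneMean (q := 0) contDiff_bump.continuous (bump_nonneg hδ)
      (bump_eq_zero hδ) hδ
    -- Dilating `|x|²` by `e^s` dilates the coordinates by `e^{s/2}`, so the slope appears halved;
    -- the normalizing constants compensate.
    have h1 : coneDir (0 : Fin (n + 1) → ℕ) = (2 : ℝ)⁻¹ • (1 : Fin (n + 1) → ℝ) := by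
      ext k
      simp [coneDir]
    rw [integral_bump hδ, h1, hgN.negConvex.asympSlope_smul (by intro k; simp) (by norm_num)] at h
    have h2 := (h.const_mul (2 / Real.pi)).div_const (Real.pi ^ n / n.factorial)
    convert h2 using 2
    simp only [coneConst, Pi.zero_apply, Nat.cast_zero, zero_add, Finset.prod_const_one]
    field_simp
    ring
  have hlog : Tendsto (fun r : ℝ => Real.log ((r / ρ) ^ 2)) (𝓝[>] 0) atBot := by
    have h1 : Tendsto (fun r : ℝ => (r / ρ) ^ 2) (𝓝[>] 0) (𝓝[>] 0) := by
      refine tendsto_nhdsWithin_iff.2 ⟨?_, ?_⟩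
      · have : Continuous fun r : ℝ => (r / ρ) ^ 2 := by fun_prop
        simpa using (this.tendsto 0).mono_left nhdsWithin_le_nhds
      · filter_upwards [self_mem_nhdsWithin] with r hr
        have : (0 : ℝ) < r := hr
        exact Set.mem_Ioi.2 (by positivity)
    exact Real.tendsto_log_nhdsGT_zero.comp h1
  have hball (y : Fin (n + 1) → ℂ) (r : ℝ) :
      y ∈ euclBall x r ↔ cone 0 (ρ⁻¹ • (y - x)) < (r / ρ) ^ 2 := by
    rw [cone_smul, cone_zero_exponent, euclBall, Set.mem_ofPred_eq, div_pow, inv_pow,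
      inv_mul_eq_div, div_lt_div_iff_of_pos_right (by positivity)]
    rfl
  have hopen (r : ℝ) : MeasurableSet (euclBall x r) := by
    refine (isOpen_lt (f := fun y : Fin (n + 1) → ℂ => ∑ k, ‖y k - x k‖ ^ 2) (by fun_prop)
      continuous_const).measurableSet
  have hexp : Continuous fun δ : ℝ => Real.exp (n * δ) := by fun_prop
  refine tendsto_of_eventually_bounds (U := fun δ => Real.exp (n * δ) * Real.exp (n * δ) * (ν + δ))
    (V := fun δ => (ν - δ) / (Real.exp (n * δ) * Real.exp (n * δ))) ?_ ?_ fun δ hδ => ?_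
  · have : Continuous fun δ : ℝ => Real.exp (n * δ) * Real.exp (n * δ) * (ν + δ) := by fun_prop
    simpa using (this.tendsto 0).mono_left nhdsWithin_le_nhds
  · have : Continuous fun δ : ℝ => (ν - δ) / (Real.exp (n * δ) * Real.exp (n * δ)) :=
      Continuous.div (by fun_prop) (by fun_prop) fun δ => by positivity
    simpa using (this.tendsto 0).mono_left nhdsWithin_le_nhds
  obtain ⟨hZ1, hZ2⟩ := descent_bounds (n : ℝ) hδ n.cast_nonneg
  have hZ0 : 0 < descent δ n (-δ) := (Real.exp_pos _).trans_le hZ1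
  set Z := descent δ n (-δ) with hZ
  have hE := Real.exp_pos (n * δ)
  have hZ1' : 1 ≤ Real.exp (n * δ) * Z := by
    have h := mul_le_mul_of_nonneg_left hZ1 hE.le
    rwa [← Real.exp_add, neg_mul, add_neg_cancel, Real.exp_zero] at h
  have hQ1 := (hQ hδ).comp (tendsto_atBot_add_const_right _ δ hlog)
  have hQ2 := (hQ hδ).comp (tendsto_atBot_add_const_right _ (-δ) hlog)
  have hν0 : 0 ≤ ν := hgN.negConvex.asympSlope_nonneg fun k => by simp
  filter_upwards [hQ1.eventually_le_const (show ν < ν + δ by linarith),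
    hQ2.eventually_const_le (show ν - δ < ν by linarith),
    hlog.eventually_lt_atBot (-(2 * δ)), self_mem_nhdsWithin] with r h1 h2 h3 hr
  have hr0 : (0 : ℝ) < r := hr
  set t := Real.log ((r / ρ) ^ 2) with ht
  have het : Real.exp t = (r / ρ) ^ 2 := Real.exp_log (by positivity)
  have hrn : r ^ (2 * n) = ρ ^ (2 * n) * Real.exp (n * t) := by
    rw [Real.exp_nat_mul, het, ← pow_mul, div_pow]
    field_simp
  have hP : 0 < Real.pi ^ n / (n.factorial : ℝ) * r ^ (2 * n) := by positivity
  have hI {s : ℝ} (hs : s + δ < 0) : Integrable (fun y => shellTest 0 δ n s (ρ⁻¹ • (y - x))) σ ∧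
      ∫ y, shellTest 0 δ n s (ρ⁻¹ • (y - x)) ∂σ
        = Real.exp (n * (s - t)) * Q δ s * (Real.pi ^ n / n.factorial * r ^ (2 * n)) := by
    obtain ⟨hT, hTi⟩ := hf.integral_traceMeasure hσ hρ hx hδ hs
    refine ⟨?_, ?_⟩
    · have hfin := hσ.1 _ hT.compact hT.supp
      rw [← integrableOn_iff_integrable_of_support_subset (subset_tsupport _)]
      exact hT.smooth.continuous.continuousOn.integrableOn_of_subset_isCompact hT.compact
        (isClosed_tsupport _).measurableSet subset_rfl hfin.ne
    · rw [hTi, hrn, mul_sub, Real.exp_sub]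
      simp only [Q]
      field_simp
      rfl
  -- The ball is `log (|y - x|² / ρ²) < t`. The test function of the shell at `t + δ` equals its
  -- maximum `Z` on the ball, and that of the shell at `t - δ` is at most `Z` and vanishes off the
  -- ball. This sandwiches `Z * σ(B)`, with `Z` within a factor `e^{±nδ}` of `1`.
  have hsub : euclBall x r ⊆ {y | cone 0 (ρ⁻¹ • (y - x)) ≤ Real.exp (t + δ - δ)} := fun y hy => by
    rw [Set.mem_ofPred_eq, add_sub_cancel_right, het]
    exact ((hball y r).1 hy).le
  have hmarkov : Z * (σ (euclBall x r)).toReal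
      ≤ ∫ y, shellTest 0 δ n (t + δ) (ρ⁻¹ • (y - x)) ∂σ ∧ σ (euclBall x r) ≠ ⊤ := by
    obtain ⟨hi, -⟩ := hI (s := t + δ) (by linarith)
    have hge (y) (hy : y ∈ euclBall x r) : Z ≤ shellTest 0 δ n (t + δ) (ρ⁻¹ • (y - x)) :=
      (shellTest_of_le hδ (hsub hy)).ge
    have hfin : σ (euclBall x r) ≠ ⊤ :=
      ne_top_of_le_ne_top (hi.measure_ge_lt_top hZ0).ne (measure_mono hge)
    refine ⟨?_, hfin⟩
    have := setIntegral_mono_on (μ := σ) (f := fun _ => Z) (integrableOn_const hfin)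
      hi.integrableOn (hopen r) hge
    rw [setIntegral_const, smul_eq_mul, mul_comm] at this
    exact this.trans (setIntegral_le_integral hi
      (Eventually.of_forall fun y => shellTest_nonneg hδ _))
  constructor
  · obtain ⟨hi, he⟩ := hI (s := t + -δ) (by linarith)
    have hle : ∫ y, shellTest 0 δ n (t + -δ) (ρ⁻¹ • (y - x)) ∂σ ≤ Z * (σ (euclBall x r)).toReal := by
      have h4 : ∫ y, (euclBall x r).indicator (fun _ => Z) y ∂σ = Z * (σ (euclBall x r)).toReal := by
        rw [integral_indicator (hopen r), setIntegral_const, smul_eq_mul, mul_comm]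
        rfl
      rw [← h4]
      refine integral_mono hi ((integrable_indicator_iff (hopen r)).2
        (integrableOn_const hmarkov.2)) fun y => ?_
      by_cases hy : y ∈ euclBall x r
      · rw [Set.indicator_of_mem hy]
        exact shellTest_le hδ _
      · rw [Set.indicator_of_notMem hy]
        refine (shellTest_of_ge hδ ?_).le
        rw [show t + -δ + δ = t by ring, het]
        exact not_lt.1 fun h => hy ((hball y r).2 h)
    rw [he, show t + -δ - t = -δ by ring, mul_neg, Real.exp_neg] at hle
    rw [le_div_iff₀ hP, div_mul_eq_mul_div, div_le_iff₀ (by positivity)]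
    have h2' : ν - δ ≤ Q δ (t + -δ) := h2
    have h5 := mul_le_mul_of_nonneg_right h2' hP.le
    have h6 : Q δ (t + -δ) * (Real.pi ^ n / n.factorial * r ^ (2 * n))
        ≤ Real.exp (n * δ) * (Z * (σ (euclBall x r)).toReal) := by
      have := mul_le_mul_of_nonneg_left hle hE.le
      refine le_trans (le_of_eq ?_) this
      field_simp
    have h7 : Real.exp (n * δ) * (Z * (σ (euclBall x r)).toReal)
        ≤ Real.exp (n * δ) * (Real.exp (n * δ) * (σ (euclBall x r)).toReal) := by gcongr
    linarith
  · obtain ⟨hi, he⟩ := hI (s := t + δ) (by linarith)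
    have hle := hmarkov.1
    rw [he, add_sub_cancel_left] at hle
    rw [div_le_iff₀ hP]
    have h1' : Q δ (t + δ) ≤ ν + δ := h1
    have h5 : (σ (euclBall x r)).toReal
        ≤ Real.exp (n * δ) * (Z * (σ (euclBall x r)).toReal) := by
      have := mul_le_mul_of_nonneg_right hZ1' (ENNReal.toReal_nonneg (a := σ (euclBall x r)))
      linarith
    calc (σ (euclBall x r)).toReal ≤ Real.exp (n * δ) * (Real.exp (n * δ) * Q δ (t + δ)
          * (Real.pi ^ n / n.factorial * r ^ (2 * n))) := h5.trans (by gcongr)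
      _ ≤ Real.exp (n * δ) * (Real.exp (n * δ) * (ν + δ)
          * (Real.pi ^ n / n.factorial * r ^ (2 * n))) := by gcongr
      _ = _ := by ring

end LelongLimit

/-! ### Logarithms of sums of radial functions -/

section LogSum

variable {n : ℕ}

/-- Cauchy-Schwarz for the complex numbers `A k + i B k`, whose moduli are at most `√(S k) √(L k)`.
-/
lemma sq_sum_add_sq_sum_le {ι : Type*} (s : Finset ι) {A B S L : ι → ℝ} (hS : ∀ k, 0 ≤ S k)
    (hL : ∀ k, 0 ≤ L k) (h : ∀ k, A k ^ 2 + B k ^ 2 ≤ S k * L k) :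
    (∑ k ∈ s, A k) ^ 2 + (∑ k ∈ s, B k) ^ 2 ≤ (∑ k ∈ s, S k) * ∑ k ∈ s, L k := by
  let z : ι → ℂ := fun k => ⟨A k, B k⟩
  have hz (w : ℂ) : ‖w‖ ^ 2 = w.re ^ 2 + w.im ^ 2 := by
    rw [← Complex.normSq_eq_norm_sq, Complex.normSq_apply]; ring
  have h1 : ‖∑ k ∈ s, z k‖ ^ 2 = (∑ k ∈ s, A k) ^ 2 + (∑ k ∈ s, B k) ^ 2 := by
    rw [hz, Complex.re_sum, Complex.im_sum]
  have h2 (k : ι) : ‖z k‖ ≤ √(S k) * √(L k) := by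
    rw [← Real.sqrt_mul (hS k)]
    exact Real.le_sqrt_of_sq_le ((hz _).trans_le (h k))
  rw [← h1]
  calc ‖∑ k ∈ s, z k‖ ^ 2 ≤ (∑ k ∈ s, √(S k) * √(L k)) ^ 2 := by
        gcongr
        exact (norm_sum_le _ _).trans (Finset.sum_le_sum fun k _ => h2 k)
    _ ≤ (∑ k ∈ s, √(S k) ^ 2) * ∑ k ∈ s, √(L k) ^ 2 := Finset.sum_mul_sq_le_sq_mul_sq _ _ _
    _ = _ := by simp only [Real.sq_sqrt (hS _), Real.sq_sqrt (hL _)]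

/-- `log ∑ G_k(|x_k|²)` has nonnegative Levi form if all `log G_k(|x_k|²)` do. -/
lemma levi_log_sum_nonneg {G : Fin n → ℝ → ℝ} {x : Fin n → ℂ}
    (hG : ∀ k, ContDiffAt ℝ 2 (G k) (‖x k‖ ^ 2)) (h0 : ∀ k, 0 ≤ G k (‖x k‖ ^ 2))
    (h1 : ∀ k, 0 ≤ deriv (G k) (‖x k‖ ^ 2) + ‖x k‖ ^ 2 * deriv (deriv (G k)) (‖x k‖ ^ 2))
    (h2 : ∀ k, ‖x k‖ ^ 2 * deriv (G k) (‖x k‖ ^ 2) ^ 2 ≤ G k (‖x k‖ ^ 2) *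
      (deriv (G k) (‖x k‖ ^ 2) + ‖x k‖ ^ 2 * deriv (deriv (G k)) (‖x k‖ ^ 2)))
    (hpos : 0 < ∑ k, G k (‖x k‖ ^ 2)) (b : Fin n → ℂ) :
    0 ≤ levi (fun y => Real.log (∑ k, G k (‖y k‖ ^ 2))) x b := by
  have hu (k : Fin n) : ContDiffAt ℝ 2 (fun y : Fin n → ℂ => ‖y k‖ ^ 2) x :=
    ((contDiff_normSq_coord k).of_le two_le_infty).contDiffAt
  have hS (k : Fin n) : ContDiffAt ℝ 2 (fun y : Fin n → ℂ => G k (‖y k‖ ^ 2)) x :=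
    (hG k).comp x (hu k)
  have hsum : ContDiffAt ℝ 2 (fun y : Fin n → ℂ => ∑ k, G k (‖y k‖ ^ 2)) x :=
    ContDiffAt.sum fun k _ => hS k
  have hlevi_sum (s : Finset (Fin n)) : levi (fun y : Fin n → ℂ => ∑ k ∈ s, G k (‖y k‖ ^ 2)) x b
      = ∑ k ∈ s, levi (fun y : Fin n → ℂ => G k (‖y k‖ ^ 2)) x b := by
    induction s using Finset.cons_induction with
    | empty => simp [levi]
    | cons i s hi ih =>
      simp only [Finset.sum_cons]
      rw [levi_add (hS i) (ContDiffAt.sum fun k _ => hS k), ih]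
  have hfd (c : Fin n → ℂ) : fderiv ℝ (fun y : Fin n → ℂ => ∑ k, G k (‖y k‖ ^ 2)) x c
      = ∑ k, fderiv ℝ (fun y : Fin n → ℂ => G k (‖y k‖ ^ 2)) x c := by
    rw [fderiv_fun_sum fun k _ => (hS k).differentiableAt (by norm_num), sum_apply]
  have hfk (k : Fin n) (c : Fin n → ℂ) : fderiv ℝ (fun y : Fin n → ℂ => G k (‖y k‖ ^ 2)) x c
      = deriv (G k) (‖x k‖ ^ 2) * (2 * ((x k).re * (c k).re + (x k).im * (c k).im)) := by
    have h3 := (((hG k).differentiableAt (by norm_num)).hasDerivAt.comp_hasFDerivAt x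
      ((hu k).differentiableAt (by norm_num)).hasFDerivAt).fderiv
    rw [← (fderiv_fderiv_normSq_coord k x c 0).2]
    exact congrArg (fun L => L c) h3
  have hx2 (k : Fin n) : ‖x k‖ ^ 2 = (x k).re ^ 2 + (x k).im ^ 2 := by
    rw [← Complex.normSq_eq_norm_sq, Complex.normSq_apply]; ring
  have hlk (k : Fin n) : levi (fun y : Fin n → ℂ => G k (‖y k‖ ^ 2)) x b
      = 4 * ((b k).re ^ 2 + (b k).im ^ 2) * (deriv (G k) (‖x k‖ ^ 2)
        + ‖x k‖ ^ 2 * deriv (deriv (G k)) (‖x k‖ ^ 2)) := by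
    rw [levi_comp (hu k) (hG k), levi, (fderiv_fderiv_normSq_coord k x b b).1,
      (fderiv_fderiv_normSq_coord k x (Complex.I • b) (Complex.I • b)).1,
      (fderiv_fderiv_normSq_coord k x b 0).2, (fderiv_fderiv_normSq_coord k x (Complex.I • b) 0).2]
    simp
    rw [hx2 k]
    ring
  rw [levi_comp (u := fun y : Fin n → ℂ => ∑ k, G k (‖y k‖ ^ 2)) (G := Real.log) hsum
    (Real.contDiffAt_log.2 hpos.ne'), Real.deriv_log', deriv_inv, hlevi_sum, hfd, hfd]
  -- Hypothesis `h2` says that each summand has squared gradient at most its value times its Levi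
  -- form. Cauchy-Schwarz gives the same for the sum, and this is nonnegativity of the Levi form of
  -- its logarithm.
  have key := sq_sum_add_sq_sum_le Finset.univ h0
    (L := fun k => levi (fun y : Fin n → ℂ => G k (‖y k‖ ^ 2)) x b)
    (A := fun k => fderiv ℝ (fun y : Fin n → ℂ => G k (‖y k‖ ^ 2)) x b)
    (B := fun k => fderiv ℝ (fun y : Fin n → ℂ => G k (‖y k‖ ^ 2)) x (Complex.I • b))
    (fun k => by rw [hlk]; exact mul_nonneg (by positivity) (h1 k)) fun k => by
      rw [hfk, hfk, hlk]
      have h3 := mul_le_mul_of_nonneg_left (h2 k)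
        (show 0 ≤ 4 * ((b k).re ^ 2 + (b k).im ^ 2) by positivity)
      refine le_trans (le_of_eq ?_) (h3.trans (le_of_eq (by ring)))
      simp
      rw [hx2 k]
      ring
  set S := ∑ k, G k (‖x k‖ ^ 2)
  rw [neg_mul, ← sub_eq_add_neg, sub_nonneg, inv_mul_eq_div, inv_mul_eq_div,
    div_le_div_iff₀ (by positivity) hpos]
  nlinarith

end LogSum

/-! ### The regularized logarithm of a cone function -/

section RegLog

variable {n : ℕ} (q : Fin (n + 1) → ℕ) (T : ℝ)

lemma ramp_of_one_le {t : ℝ} (ht : 1 ≤ t) : ramp t = t - 1 + ramp 1 := by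
  have hi (a b : ℝ) := Real.smoothTransition.continuous.intervalIntegrable (μ := volume) a b
  have h : ∫ s in (1)..t, Real.smoothTransition s = t - 1 := by
    rw [intervalIntegral.integral_congr (g := fun _ => (1 : ℝ)) fun s hs => ?_]
    · simp
    · rw [Set.uIcc_of_le ht] at hs
      exact Real.smoothTransition.one_of_one_le hs.1
  rw [ramp, ← intervalIntegral.integral_add_adjacent_intervals (hi 0 1) (hi 1 t), h, ramp]
  ring

lemma ramp_of_nonpos {t : ℝ} (ht : t ≤ 0) : ramp t = 0 := by
  rw [ramp, intervalIntegral.integral_congr (g := fun _ => (0 : ℝ)) fun s hs => ?_]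
  · simp
  · rw [Set.uIcc_of_ge ht] at hs
    exact Real.smoothTransition.zero_of_nonpos hs.2

/-- A smooth function that equals `log (cone q)` where the latter is at least `T + 1`. -/
def regLog (x : Fin (n + 1) → ℂ) : ℝ :=
  open Classical in
  -- Beyond `1` the ramp is `t - 1 + ramp 1`; the added constant restores the exact value of the
  -- logarithm there.
  (if x = 0 then 0 else ramp (Real.log (cone q x) - T)) + (T + 1 - ramp 1)

variable {q T}

lemma regLog_eventuallyEq {x : Fin (n + 1) → ℂ} (hx : x ≠ 0) : regLog q T =ᶠ[𝓝 x]
    fun y => (fun t => ramp (t - T) + (T + 1 - ramp 1)) (Real.log (cone q y)) := by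
  filter_upwards [isOpen_ne.mem_nhds hx] with y hy
  simp [regLog, show y ≠ 0 from hy]

lemma regLog_eventuallyEq_zero : regLog q T =ᶠ[𝓝 0] fun _ => T + 1 - ramp 1 := by
  have h0 : cone q 0 < Real.exp T := by rw [cone_zero]; exact Real.exp_pos _
  filter_upwards [(continuous_cone q).continuousAt.eventually_lt_const h0] with y hy
  unfold regLog
  split_ifs with h
  · ring
  · have := (Real.log_lt_iff_lt_exp (cone_pos h)).2 hy
    rw [ramp_of_nonpos (by linarith), zero_add]

lemma contDiff_ramp_affine (T d : ℝ) : ContDiff ℝ ∞ fun t => ramp (t - T) + d :=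
  (contDiff_ramp.comp (contDiff_id.sub contDiff_const)).add contDiff_const

lemma deriv_ramp_affine (T d : ℝ) :
    deriv (fun t => ramp (t - T) + d) = fun t => Real.smoothTransition (t - T) := by
  ext t
  rw [deriv_add_const, deriv_comp_sub_const, deriv_ramp]

lemma contDiff_regLog : ContDiff ℝ ∞ (regLog q T) := by
  refine contDiff_iff_contDiffAt.2 fun x => ?_
  by_cases hx : x = 0
  · subst hx
    exact contDiffAt_const.congr_of_eventuallyEq regLog_eventuallyEq_zero
  · refine ContDiffAt.congr_of_eventuallyEq ?_ (regLog_eventuallyEq hx)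
    exact (contDiff_ramp_affine T _).contDiffAt.comp x
      ((contDiff_cone q).contDiffAt.log (cone_pos hx).ne')

/-- For monomials the Cauchy-Schwarz hypothesis of `levi_log_sum_nonneg` holds with equality: `log
|x_k|^{2 (q_k + 1)}` is pluriharmonic off its zeros. -/
lemma levi_log_cone_nonneg {x : Fin (n + 1) → ℂ} (hx : x ≠ 0) (b : Fin (n + 1) → ℂ) :
    0 ≤ levi (fun y => Real.log (cone q y)) x b := by
  have hd (k : Fin (n + 1)) (t : ℝ) : t * deriv (deriv fun t : ℝ => t ^ (q k + 1)) t
      = ((q k : ℝ) + 1) * (q k * t ^ q k) := by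
    rw [deriv_pow_succ]
    rcases Nat.eq_zero_or_pos (q k) with h0 | h0
    · simp [h0]
    · have : t ^ q k = t ^ (q k - 1) * t := by rw [← pow_succ, Nat.sub_add_cancel h0]
      simp [this]
      ring
  refine levi_log_sum_nonneg (G := fun k t => t ^ (q k + 1))
    (fun k => (contDiff_id.pow _).contDiffAt) (fun k => by positivity) (fun k => ?_) (fun k => ?_)
    (cone_pos hx) b
  · rw [hd, deriv_pow_succ]; positivity
  · rw [hd, deriv_pow_succ]
    refine le_of_eq ?_
    ring

lemma smoothPSH_regLog : SmoothPSH (regLog q T) := by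
  refine ⟨contDiff_regLog.contDiffOn, fun x _ b => ?_⟩
  by_cases hx : x = 0
  · subst hx
    rw [levi_congr regLog_eventuallyEq_zero]
    simp [levi]
  · rw [levi_congr (regLog_eventuallyEq hx), levi_comp
      (((contDiff_cone q).contDiffAt.log (cone_pos hx).ne').of_le two_le_infty)
      ((contDiff_ramp_affine T _).of_le two_le_infty).contDiffAt, deriv_ramp_affine,
      deriv_comp_sub_const]
    exact add_nonneg (mul_nonneg (Real.smoothTransition.nonneg _) (levi_log_cone_nonneg hx b))
      (mul_nonneg (deriv_smoothTransition_nonneg _) (by positivity))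

lemma regLog_eq {x : Fin (n + 1) → ℂ} (hx : Real.exp (T + 1) ≤ cone q x) :
    regLog q T x = Real.log (cone q x) := by
  have hS : 0 < cone q x := (Real.exp_pos _).trans_le hx
  have h : x ≠ 0 := fun h => by simp [h, cone_zero] at hS
  have := (Real.le_log_iff_exp_le hS).2 hx
  rw [regLog, if_neg h, ramp_of_one_le (by linarith)]
  ring

lemma complexHessian_regLog {x : Fin (n + 1) → ℂ} (hx : Real.exp (T + 1) < cone q x) :
    complexHessian (regLog q T) x = complexHessian (fun y => Real.log (cone q y)) x := by
  refine complexHessian_congr ?_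
  filter_upwards [(continuous_cone q).continuousAt.eventually_const_lt hx] with y hy
  exact regLog_eq hy.le

/-! ### Comparison with logarithmic weights -/

variable {f : (Fin (n + 1) → ℂ) → EReal}

/-- The increments of the means over shells. -/
def coneInc (q : Fin (n + 1) → ℕ) (f : (Fin (n + 1) → ℂ) → EReal) (s : ℝ) : ℝ :=
  coneMean q f (bump 1) s - coneMean q f (bump 1) (s - 1)

lemma NegPSH.maInt_regLog (hf : NegPSH f) {s l d : ℝ} (hs : s + 1 < 0) (hT : T + 1 < s - 1) :
    maInt f (fun x => l * regLog q T x + d) (shellTest q 1 0 s) = l ^ n * coneInc q f s := by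
  rw [hf.maInt_shellTest one_pos hs l, div_one, coneInc]
  intro x hx
  rw [complexHessian_affine, complexHessian_const_mul, complexHessian_regLog
    ((Real.exp_lt_exp.2 hT).trans_le hx)]

lemma shellTest_mono {δ s s' : ℝ} (hδ : 0 < δ) (h : s' ≤ s) (x : Fin (n + 1) → ℂ) :
    shellTest q δ 0 s' x ≤ shellTest q δ 0 s x := by
  unfold shellTest
  split_ifs
  · exact le_rfl
  · exact descent_antitone 0 hδ (by linarith)

variable {w : (Fin (n + 1) → ℂ) → ℝ} {s s' l d : ℝ}

/-- Upper bound for the mass of an arbitrary weight: on the inner shell `w` lies above `l log S + d`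
by more than `1`, on the outer one below it. The glued weight then transfers the mass to the outer
shell, where it is computed explicitly. -/
lemma NegPSH.maInt_le_coneInc (hf : NegPSH f) (hw : SmoothPSH w) (hl : 0 ≤ l) (hs : s + 1 < 0)
    (hs' : s' ≤ s)
    (h1 : ∀ x, Real.exp (s' - 1) ≤ cone q x → cone q x ≤ Real.exp (s' + 1) →
      l * Real.log (cone q x) + d + 1 < w x)
    (h2 : ∀ x, Real.exp (s - 1) ≤ cone q x → cone q x ≤ Real.exp (s + 1) →
      w x < l * Real.log (cone q x) + d) :
    maInt f w (shellTest q 1 0 s') ≤ l ^ n * coneInc q f s := by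
  -- With `T = s' - 3` the regularized logarithm coincides with `log S` on both shells.
  have hT : s' - 3 + 1 < s' - 1 := by linarith
  rw [← hf.maInt_regLog (T := s' - 3) (d := d) hs (by linarith)]
  refine hf.maInt_le_of_lt hw ((smoothPSH_regLog).affine hl d) (isTest_shellTest one_pos hs)
    (isTest_shellTest one_pos (by linarith)) (shellTest_mono one_pos hs') (fun x _ => ?_) fun x _ => ?_
  · refine (complexHessian_shellTest one_pos).imp_right fun h => ?_
    rw [regLog_eq ((Real.exp_le_exp.2 (by linarith)).trans h.1)]
    exact h1 x h.1 h.2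
  · refine (complexHessian_shellTest one_pos).imp_right fun h => ?_
    rw [regLog_eq ((Real.exp_le_exp.2 (by linarith)).trans h.1)]
    exact h2 x h.1 h.2

/-- The reverse comparison: now the logarithm is dominant on the inner shell and an affine image `m
w + d` of the weight on the outer one. -/
lemma NegPSH.coneInc_le_maInt (hf : NegPSH f) (hw : SmoothPSH w) (hl : 0 ≤ l) {m : ℝ} (hm : 0 ≤ m)
    (hs : s + 1 < 0) (hs' : s' ≤ s)
    (h1 : ∀ x, Real.exp (s' - 1) ≤ cone q x → cone q x ≤ Real.exp (s' + 1) →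
      m * w x + d + 1 < l * Real.log (cone q x))
    (h2 : ∀ x, Real.exp (s - 1) ≤ cone q x → cone q x ≤ Real.exp (s + 1) →
      l * Real.log (cone q x) < m * w x + d) :
    l ^ n * coneInc q f s' ≤ m ^ n * maInt f w (shellTest q 1 0 s) := by
  rw [← hf.maInt_regLog (T := s' - 3) (d := 0) (by linarith) (by linarith)]
  have e := maInt_affine_left (f := f) w (shellTest q 1 0 s) m d
  rw [Nat.add_sub_cancel] at e
  rw [← e]
  refine hf.maInt_le_of_lt ((smoothPSH_regLog).affine hl 0) (hw.affine hm d)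
    (isTest_shellTest one_pos hs) (isTest_shellTest one_pos (by linarith))
    (shellTest_mono one_pos hs') (fun x _ => ?_) fun x _ => ?_
  · refine (complexHessian_shellTest one_pos).imp_right fun h => ?_
    rw [regLog_eq ((Real.exp_le_exp.2 (by linarith)).trans h.1), add_zero]
    exact h1 x h.1 h.2
  · refine (complexHessian_shellTest one_pos).imp_right fun h => ?_
    rw [regLog_eq ((Real.exp_le_exp.2 (by linarith)).trans h.1), add_zero]
    exact h2 x h.1 h.2

end RegLog

/-! ### Generalized Lelong numbers -/

section Weight

variable {n : ℕ} {a : Fin (n + 1) → ℝ} {P c : ℝ} {q : Fin (n + 1) → ℕ} {x : Fin (n + 1) → ℂ}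

/-- Take `q k + 1 = ⌈P / a k⌉` with `P = (∑ a) / (c - 1)`. Rounding up costs at most `1`, which is
at most `(c - 1) P / a k`. -/
lemma exists_exponents (ha : ∀ k, 0 < a k) (hc : 1 < c) : ∃ P : ℝ, 0 < P ∧ ∃ q : Fin (n + 1) → ℕ,
    (∀ k, P / a k ≤ (q k : ℝ) + 1) ∧ ∀ k, (q k : ℝ) + 1 ≤ c * (P / a k) := by
  have hA : 0 < ∑ k, a k := Finset.sum_pos (fun k _ => ha k) Finset.univ_nonempty
  have hP : 0 < (∑ k, a k) / (c - 1) := div_pos hA (by linarith)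
  have hd (k) : 0 < (∑ k, a k) / (c - 1) / a k := div_pos hP (ha k)
  have e (k) : ((⌈(∑ k, a k) / (c - 1) / a k⌉₊ - 1 : ℕ) : ℝ) + 1
      = ⌈(∑ k, a k) / (c - 1) / a k⌉₊ := by
    exact_mod_cast Nat.sub_add_cancel (Nat.ceil_pos.2 (hd k))
  refine ⟨_, hP, fun k => ⌈(∑ k, a k) / (c - 1) / a k⌉₊ - 1, fun k => ?_, fun k => ?_⟩
  · rw [e]; exact Nat.le_ceil _
  · rw [e]
    refine (Nat.ceil_lt_add_one (hd k).le).le.trans ?_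
    have h1 : (c - 1) * ((∑ k, a k) / (c - 1) / a k) = (∑ k, a k) / a k := by
      field_simp [show c - 1 ≠ 0 by linarith]
    have h2 : 1 ≤ (∑ k, a k) / a k := (one_le_div (ha k)).2
      (Finset.single_le_sum (fun k _ => (ha k).le) (Finset.mem_univ k))
    linarith

lemma weight_term {k : Fin (n + 1)} (hx : x k ≠ 0) :
    (((a k)⁻¹ : ℝ) : EReal) * ENNReal.log ‖x k‖ₑ = (((a k)⁻¹ * Real.log ‖x k‖ : ℝ) : EReal) := by
  rw [← ofReal_norm, ENNReal.log_ofReal_of_pos (norm_pos_iff.2 hx), EReal.coe_mul]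

lemma log_coord_le {k : Fin (n + 1)} (hx : x k ≠ 0) :
    2 * ((q k : ℝ) + 1) * Real.log ‖x k‖ ≤ Real.log (cone q x) := by
  have h0 : 0 < ‖x k‖ := norm_pos_iff.2 hx
  have h : (‖x k‖ ^ 2) ^ (q k + 1) ≤ cone q x := Finset.single_le_sum
    (f := fun k => (‖x k‖ ^ 2) ^ (q k + 1)) (fun _ _ => by positivity) (Finset.mem_univ k)
  have h2 := Real.log_le_log (by positivity) h
  rw [Real.log_pow, Real.log_pow] at h2
  push_cast at h2
  linarith

/-- Some summand of the cone function is at least the average, which costs `log (n + 1)`. Since `log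
|x k| ≤ 0`, replacing `q k + 1` by the smaller `P / a k` increases the right-hand side. -/
lemma le_weight (hP : 0 < P) (hq1 : ∀ k, P / a k ≤ (q k : ℝ) + 1)
    (hx : x ∈ polydisk (n + 1)) (hx0 : x ≠ 0) :
    (((2 * P)⁻¹ * (Real.log (cone q x) - Real.log (n + 1)) : ℝ) : EReal) ≤ weight a x := by
  have hS := cone_pos (q := q) hx0
  obtain ⟨k, -, hk⟩ := Finset.exists_le_of_sum_le (s := Finset.univ)
    (f := fun _ : Fin (n + 1) => cone q x / (n + 1)) (g := fun k => (‖x k‖ ^ 2) ^ (q k + 1))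
    Finset.univ_nonempty (by
      rw [Finset.sum_const, Finset.card_univ, Fintype.card_fin, nsmul_eq_mul]
      push_cast
      rw [mul_div_cancel₀ _ (by positivity)]
      exact le_rfl)
  have hk0 : x k ≠ 0 := fun h => by
    have : 0 < cone q x / (n + 1) := by positivity
    simp only [h] at hk
    simp at hk
    linarith
  refine le_trans ?_ (le_iSup _ k)
  rw [weight_term hk0, EReal.coe_le_coe_iff]
  have h0 : 0 < ‖x k‖ := norm_pos_iff.2 hk0
  have h1 := Real.log_le_log (by positivity) hk
  rw [Real.log_div hS.ne' (by positivity), Real.log_pow, Real.log_pow] at h1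
  push_cast at h1
  have hl : Real.log ‖x k‖ ≤ 0 := Real.log_nonpos h0.le (hx k).le
  have h2 := mul_le_mul_of_nonpos_right (hq1 k) hl
  rw [inv_mul_le_iff₀ (by positivity)]
  calc _ ≤ ((q k : ℝ) + 1) * (2 * Real.log ‖x k‖) := h1
    _ ≤ 2 * (P / a k * Real.log ‖x k‖) := by linarith
    _ = _ := by ring

/-- Each summand is at most the whole cone function; here the upper bound on the exponents is used,
again with `log |x k| ≤ 0`, and it costs the factor `c`. -/
lemma weight_le (ha : ∀ k, 0 < a k) (hP : 0 < P) (hc : 0 < c)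
    (hq2 : ∀ k, (q k : ℝ) + 1 ≤ c * (P / a k)) (hx : x ∈ polydisk (n + 1)) :
    weight a x ≤ (((2 * P)⁻¹ * (Real.log (cone q x) / c) : ℝ) : EReal) := by
  refine iSup_le fun k => ?_
  by_cases hk : x k = 0
  · have h : (0 : EReal) < (((a k)⁻¹ : ℝ) : EReal) := by exact_mod_cast inv_pos.2 (ha k)
    rw [hk, enorm_zero, ENNReal.log_zero, EReal.mul_bot_of_pos h]
    exact bot_le
  · rw [weight_term hk, EReal.coe_le_coe_iff]
    have h0 : 0 < ‖x k‖ := norm_pos_iff.2 hk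
    have hl : Real.log ‖x k‖ ≤ 0 := Real.log_nonpos h0.le (hx k).le
    have h1 := log_coord_le (q := q) hk
    have h2 := mul_le_mul_of_nonpos_right (hq2 k) hl
    rw [le_inv_mul_iff₀ (by positivity), le_div_iff₀ hc]
    calc 2 * P * ((a k)⁻¹ * Real.log ‖x k‖) * c = 2 * (c * (P / a k) * Real.log ‖x k‖) := by ring
      _ ≤ _ := by linarith

/-- A decreasing sequence eventually lies below any continuous majorant of its limit. -/
lemma IsDecreasingApprox.eventually_lt {φ : (Fin n → ℂ) → EReal} {w : ℕ → (Fin n → ℂ) → ℝ}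
    (hw : IsDecreasingApprox φ w) {K : Set (Fin n → ℂ)} (hK : IsCompact K) (hKD : K ⊆ polydisk n)
    {v : (Fin n → ℂ) → ℝ} (hv : ContinuousOn v K) (h : ∀ x ∈ K, φ x < (v x : EReal)) :
    ∀ᶠ j in atTop, ∀ x ∈ K, w j x < v x := by
  by_contra hcon
  have hcl (j : ℕ) : IsClosed (K ∩ {x | v x ≤ w j x}) := by
    have hc : ContinuousOn (fun x => w j x - v x) K := ((hw.smooth j).continuousOn.mono hKD).sub hv
    have := hc.preimage_isClosed_of_isClosed hK.isClosed (isClosed_Ici (a := (0 : ℝ)))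
    convert this using 2
    ext x
    simp
  -- Dini's argument: if the claim fails, the decreasing compact sets where `w j ≥ v` are all
  -- nonempty and share a point, at which `w j` could not converge to a value below `v`.
  obtain ⟨x, hx⟩ := IsCompact.nonempty_iInter_of_sequence_nonempty_isCompact_isClosed
    (fun j => K ∩ {x | v x ≤ w j x})
    (fun j x hx => ⟨hx.1, hx.2.trans (hw.antitone x (hKD hx.1) (Nat.le_succ j))⟩) (fun j => by
      by_contra hne
      refine hcon (eventually_atTop.2 ⟨j, fun i hi x hx => ?_⟩)
      by_contra hlt
      exact hne ⟨x, hx, (not_lt.1 hlt).trans (hw.antitone x (hKD hx) hi)⟩)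
    (hK.of_isClosed_subset (hcl 0) Set.inter_subset_left) hcl
  rw [Set.mem_iInter] at hx
  obtain ⟨j, hj⟩ := ((hw.tendsto x (hKD (hx 0).1)).eventually_lt_const (h x (hx 0).1)).exists
  exact absurd (EReal.coe_lt_coe_iff.1 hj) (not_lt.2 (hx j).2)

lemma IsDecreasingApprox.le {φ : (Fin n → ℂ) → EReal} {w : ℕ → (Fin n → ℂ) → ℝ}
    (hw : IsDecreasingApprox φ w) {x : Fin n → ℂ} (hx : x ∈ polydisk n) (j : ℕ) :
    φ x ≤ (w j x : EReal) :=
  le_of_tendsto (hw.tendsto x hx) (by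
    filter_upwards [eventually_ge_atTop j] with i hi
    exact EReal.coe_le_coe_iff.2 (hw.antitone x hx hi))

end Weight

/-! ### The generalized Lelong number as a slope. -/

section Limit

variable {n : ℕ} {f : (Fin (n + 1) → ℂ) → EReal} {q : Fin (n + 1) → ℕ}

/-- With `c = 0` the shell test function drops from exactly `1` to `0`, so it lies between the
indicator functions of two sublevel sets of `cone q`. -/
lemma shell_measure_bounds {μ : Measure (Fin (n + 1) → ℂ)}
    (hμ : ∀ K, IsCompact K → K ⊆ polydisk (n + 1) → μ K < ⊤) {s : ℝ} (hs : s + 1 < 0) :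
    (μ {x | cone q x ≤ Real.exp (s - 1)}).toReal ≤ ∫ x, shellTest q 1 0 s x ∂μ ∧
    ∫ x, shellTest q 1 0 s x ∂μ ≤ (μ {x | cone q x ≤ Real.exp (s + 1)}).toReal ∧
    μ {x | cone q x ≤ Real.exp (s + 1)} < ⊤ := by
  have hZ : descent 1 0 (-1) = 1 := by
    obtain ⟨h1, h2⟩ := descent_bounds (δ := 1) 0 one_pos le_rfl
    simp only [neg_zero, zero_mul, Real.exp_zero] at h1 h2
    exact le_antisymm h2 h1
  have hset (t : ℝ) : {x | cone q x ≤ Real.exp t}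
      = {x : Fin (n + 1) → ℂ | 0 ≤ cone q x ∧ cone q x ≤ Real.exp t} := by
    ext x
    simp [cone_nonneg q x]
  have hm (t : ℝ) : MeasurableSet {x | cone q x ≤ Real.exp t} := by
    rw [hset]; exact isCompact_shell.isClosed.measurableSet
  have hf (t : ℝ) (ht : t < 0) : μ {x | cone q x ≤ Real.exp t} < ⊤ := by
    rw [hset]
    exact hμ _ isCompact_shell fun x hx =>
      mem_polydisk_of_cone_lt_one (hx.2.trans_lt (Real.exp_lt_one_iff.2 ht))
  have hT := isTest_shellTest (q := q) (c := 0) one_pos hs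
  have hi : Integrable (shellTest q 1 0 s) μ := by
    rw [← integrableOn_iff_integrable_of_support_subset (subset_tsupport _)]
    exact hT.smooth.continuous.continuousOn.integrableOn_of_subset_isCompact hT.compact
      (isClosed_tsupport _).measurableSet subset_rfl (hμ _ hT.compact hT.supp).ne
  have hind (t : ℝ) (ht : t < 0) :
      Integrable ({x | cone q x ≤ Real.exp t}.indicator fun _ => (1 : ℝ)) μ ∧
      ∫ x, {x | cone q x ≤ Real.exp t}.indicator (fun _ => (1 : ℝ)) x ∂μ
        = (μ {x | cone q x ≤ Real.exp t}).toReal := by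
    refine ⟨(integrable_indicator_iff (hm t)).2 (integrableOn_const (hf t ht).ne), ?_⟩
    rw [integral_indicator (hm t), setIntegral_const, smul_eq_mul, mul_one]
    rfl
  refine ⟨?_, ?_, hf _ hs⟩
  · rw [← (hind (s - 1) (by linarith)).2]
    refine integral_mono (hind _ (by linarith)).1 hi fun x => ?_
    by_cases hx : cone q x ≤ Real.exp (s - 1)
    · rw [Set.indicator_of_mem (by exact hx), shellTest_of_le one_pos hx, hZ]
    · rw [Set.indicator_of_notMem (by exact hx)]
      exact shellTest_nonneg one_pos x
  · rw [← (hind (s + 1) hs).2]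
    refine integral_mono hi (hind _ hs).1 fun x => ?_
    by_cases hx : cone q x ≤ Real.exp (s + 1)
    · rw [Set.indicator_of_mem (by exact hx)]
      exact (shellTest_le one_pos x).trans hZ.le
    · rw [Set.indicator_of_notMem (by exact hx)]
      exact (shellTest_of_ge one_pos (not_le.1 hx).le).le

/-- After cancellation of `π` and `n!` the limit is `2 P` times the slope in direction `coneDir q`,
times `∏ (q k + 1) / P^{n+1}`. Since `a / (2 P c) ≤ coneDir q ≤ a / (2 P)`, monotonicity and
homogeneity of slopes bound the first factor, and the choice of exponents bounds the product. -/
lemma NegPSH.tendsto_coneInc (hf : NegPSH f) {a : Fin (n + 1) → ℝ} (ha : ∀ k, 0 < a k) {P c : ℝ}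
    (hP : 0 < P) (hc : 0 < c) (hq1 : ∀ k, P / a k ≤ (q k : ℝ) + 1)
    (hq2 : ∀ k, (q k : ℝ) + 1 ≤ c * (P / a k)) :
    ∃ L, Tendsto (fun s => (2 / Real.pi) ^ (n + 1) * n.factorial * ((2 * P)⁻¹ ^ n * coneInc q f s))
        atBot (𝓝 L) ∧
      asympSlope (convexReal f) a / (∏ k, a k) / c ≤ L ∧
      L ≤ c ^ (n + 1) * (asympSlope (convexReal f) a / ∏ k, a k) := by
  have h := hf.tendsto_coneMean (q := q) contDiff_bump.continuous (bump_nonneg one_pos)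
    (bump_eq_zero one_pos) one_pos
  simp only [div_one, integral_bump one_pos, mul_one] at h
  refine ⟨_, (h.const_mul _).const_mul _, ?_⟩
  have hfac : (0 : ℝ) < n.factorial := by exact_mod_cast n.factorial_pos
  have hprod : 0 < ∏ k, a k := Finset.prod_pos fun k _ => ha k
  have ha0 : 0 ≤ a := fun k => (ha k).le
  have hb0 : 0 ≤ coneDir q := fun k => (coneDir_pos q k).le
  have hs0 : 0 ≤ asympSlope (convexReal f) (coneDir q) := hf.negConvex.asympSlope_nonneg hb0
  have hν0 : 0 ≤ asympSlope (convexReal f) a := hf.negConvex.asympSlope_nonneg ha0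
  have hinv (k) : (P / a k)⁻¹ = a k / P := inv_div _ _
  have hup : asympSlope (convexReal f) (coneDir q) ≤ (2 * P)⁻¹ * asympSlope (convexReal f) a := by
    rw [← hf.negConvex.asympSlope_smul ha0 (by positivity)]
    refine hf.negConvex.asympSlope_mono hb0 fun k => ?_
    have := inv_anti₀ (div_pos hP (ha k)) (hq1 k)
    rw [hinv] at this
    rw [coneDir, mul_inv, Pi.smul_apply, smul_eq_mul, mul_inv]
    calc _ ≤ (2 : ℝ)⁻¹ * (a k / P) := by gcongr
      _ = _ := by ring
  have hlow : (2 * P * c)⁻¹ * asympSlope (convexReal f) a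
      ≤ asympSlope (convexReal f) (coneDir q) := by
    rw [← hf.negConvex.asympSlope_smul ha0 (by positivity)]
    refine hf.negConvex.asympSlope_mono (smul_nonneg (by positivity) ha0) fun k => ?_
    have h0 : 0 < (q k : ℝ) + 1 := by positivity
    have := inv_anti₀ h0 (hq2 k)
    rw [mul_inv, hinv] at this
    rw [coneDir, Pi.smul_apply, smul_eq_mul]
    calc _ = (2 : ℝ)⁻¹ * (c⁻¹ * (a k / P)) := by ring
      _ ≤ 2⁻¹ * ((q k : ℝ) + 1)⁻¹ := mul_le_mul_of_nonneg_left this (by norm_num)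
      _ = _ := (mul_inv _ _).symm
  have hp1 : P ^ (n + 1) / ∏ k, a k ≤ ∏ k, ((q k : ℝ) + 1) := by
    calc P ^ (n + 1) / ∏ k, a k = ∏ k, (P / a k) := by simp [Finset.prod_div_distrib]
      _ ≤ _ := Finset.prod_le_prod (fun k _ => (div_pos hP (ha k)).le) fun k _ => hq1 k
  have hp2 : ∏ k, ((q k : ℝ) + 1) ≤ c ^ (n + 1) * (P ^ (n + 1) / ∏ k, a k) := by
    calc ∏ k, ((q k : ℝ) + 1) ≤ ∏ k, (c * (P / a k)) :=
          Finset.prod_le_prod (fun k _ => by positivity) fun k _ => hq2 k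
      _ = _ := by simp [Finset.prod_mul_distrib, Finset.prod_div_distrib]
  have e (m : ℝ) (p : ℝ) : (2 / Real.pi) ^ (n + 1) * n.factorial * ((2 * P)⁻¹ ^ n *
      (m * (p * Real.pi ^ (n + 1) / n.factorial))) = 2 * P * m * (p / P ^ (n + 1)) := by
    rw [div_pow, inv_pow, mul_pow]
    field_simp
    ring
  rw [coneConst, e]
  constructor
  · calc asympSlope (convexReal f) a / (∏ k, a k) / c
        = 2 * P * ((2 * P * c)⁻¹ * asympSlope (convexReal f) a)
          * (P ^ (n + 1) / (∏ k, a k) / P ^ (n + 1)) := by field_simp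
      _ ≤ _ := by gcongr
  · calc _ ≤ 2 * P * ((2 * P)⁻¹ * asympSlope (convexReal f) a)
          * (c ^ (n + 1) * (P ^ (n + 1) / ∏ k, a k) / P ^ (n + 1)) := by gcongr
      _ = _ := by field_simp

set_option maxHeartbeats 1000000 in
/-- The generalized Lelong number is the normalized asymptotic slope. -/
lemma NegPSH.tendsto_mixedMA (hf : NegPSH f) {a : Fin (n + 1) → ℝ} (ha : ∀ k, 0 < a k)
    {μ : Measure (Fin (n + 1) → ℂ)} (hμ : IsMixedMAMeasure f (weight a) μ) :
    Tendsto (fun t : ℝ => (μ {x | weight a x < (t : EReal)}).toReal) atBot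
      (𝓝 (asympSlope (convexReal f) a / ∏ k, a k)) := by
  obtain ⟨hfin, w, hw, hlim⟩ := hμ
  have hsm (j : ℕ) : SmoothPSH (w j) := smoothPSH_of_pshOn (hw.smooth j) (hw.psh j)
  set ν := asympSlope (convexReal f) a / ∏ k, a k with hν
  have hν0 : 0 ≤ ν := div_nonneg (hf.negConvex.asympSlope_nonneg fun k => (ha k).le)
    (Finset.prod_nonneg fun k _ => (ha k).le)
  have hC0 : 0 < (2 / Real.pi) ^ (n + 1) * (n.factorial : ℝ) := by
    have : (0 : ℝ) < n.factorial := by exact_mod_cast n.factorial_pos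
    positivity
  set C₀ := (2 / Real.pi) ^ (n + 1) * (n.factorial : ℝ) with hC₀
  refine tendsto_of_eventually_bounds
    (U := fun κ => (1 + κ) ^ n * ((1 + κ) ^ (n + 1) * ν + κ))
    (V := fun κ => (ν / (1 + κ) - κ) / (1 + κ) ^ n) ?_ ?_ fun κ hκ => ?_
  · have : Continuous fun κ : ℝ => (1 + κ) ^ n * ((1 + κ) ^ (n + 1) * ν + κ) := by fun_prop
    simpa using (this.tendsto 0).mono_left nhdsWithin_le_nhds
  · have : ContinuousAt (fun κ : ℝ => (ν / (1 + κ) - κ) / (1 + κ) ^ n) 0 := by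
      refine ContinuousAt.div (ContinuousAt.sub (ContinuousAt.div (by fun_prop) (by fun_prop)
        (by norm_num)) (by fun_prop)) (by fun_prop) (by norm_num)
    simpa using this.tendsto.mono_left nhdsWithin_le_nhds
  -- This `c` lies strictly between `1` and `1 + κ`, and `(1 + κ) / c = 1 + κ / 2`. So weights
  -- multiplied by `1 + κ` are still separated from the rounding error `c`.
  set c := (2 + 2 * κ) / (2 + κ) with hc
  have hc1 : 1 < c := by rw [hc, one_lt_div (by linarith)]; linarith
  have hc2 : c ≤ 1 + κ := by rw [hc, div_le_iff₀ (by linarith)]; nlinarith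
  have hc0 : 0 < c := by linarith
  obtain ⟨P, hP, q, hq1, hq2⟩ := exists_exponents ha hc1
  obtain ⟨L, hL, hL1, hL2⟩ := hf.tendsto_coneInc ha hP hc0 hq1 hq2
  rw [← hν] at hL1 hL2
  set l := (2 * P)⁻¹ with hl
  have hl0 : 0 < l := by positivity
  have hlP : l * (2 * P) = 1 := inv_mul_cancel₀ (by positivity)
  set E := Real.log (n + 1) with hE
  have hE0 : 0 ≤ E := Real.log_nonneg (by linarith [n.cast_nonneg (α := ℝ)])
  -- comparison of `w j` with the logarithm of the cone function
  have hne {x : Fin (n + 1) → ℂ} {s : ℝ} (h : Real.exp s ≤ cone q x) : x ≠ 0 := fun h0 => by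
    rw [h0, cone_zero] at h
    exact absurd h (not_le.2 (Real.exp_pos _))
  have hD {x : Fin (n + 1) → ℂ} {s : ℝ} (hs : s < 0) (h : cone q x ≤ Real.exp s) :
      x ∈ polydisk (n + 1) :=
    mem_polydisk_of_cone_lt_one (h.trans_lt (Real.exp_lt_one_iff.2 hs))
  have hwlow {x : Fin (n + 1) → ℂ} (hx : x ∈ polydisk (n + 1)) (hx0 : x ≠ 0) (j : ℕ) :
      l * (Real.log (cone q x) - E) ≤ w j x :=
    EReal.coe_le_coe_iff.1 ((le_weight hP hq1 hx hx0).trans (hw.le hx j))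
  have hdini {s α β : ℝ} (hs : s + 1 < 0) (h : ∀ τ, s - 1 ≤ τ → τ ≤ s + 1 →
      l * (τ / c) < α * τ + β) : ∀ᶠ j in atTop, ∀ x, Real.exp (s - 1) ≤ cone q x →
        cone q x ≤ Real.exp (s + 1) → w j x < α * Real.log (cone q x) + β := by
    have hlogc : ContinuousOn (fun x => α * Real.log (cone q x) + β)
        {x | Real.exp (s - 1) ≤ cone q x ∧ cone q x ≤ Real.exp (s + 1)} :=
      (continuousOn_const.mul ((continuous_cone q).continuousOn.log fun x hx =>
        ((Real.exp_pos _).trans_le hx.1).ne')).add continuousOn_const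
    refine (hw.eventually_lt isCompact_shell (shell_subset hs) hlogc fun x hx => ?_).mono
      fun j hj x h1 h2 => hj x ⟨h1, h2⟩
    have hS : 0 < cone q x := (Real.exp_pos _).trans_le hx.1
    refine (weight_le ha hP hc0 hq2 (shell_subset hs hx)).trans_lt (EReal.coe_lt_coe_iff.2 ?_)
    exact h _ ((Real.le_log_iff_exp_le hS).2 hx.1) ((Real.log_le_iff_le_exp hS).2 hx.2)
  have hcinv : 1 + κ - c⁻¹ ≤ 3 * κ / 2 := by
    rw [hc, inv_div, tsub_le_iff_right, ← tsub_le_iff_left, le_div_iff₀ (by linarith)]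
    nlinarith
  have hck : c⁻¹ * (1 + κ) = 1 + κ / 2 := by
    rw [hc, inv_div]
    field_simp
  have hcpos := inv_pos.2 hc0
  -- the relevant shells
  have hs1 : Tendsto (fun t : ℝ => 2 * P * t + E + 1) atBot atBot :=
    tendsto_atBot_add_const_right _ _ (tendsto_atBot_add_const_right _ _
      (tendsto_id.const_mul_atBot (by positivity)))
  have hs2 : Tendsto (fun t : ℝ => 2 * P * c * t - 2) atBot atBot :=
    tendsto_atBot_add_const_right _ _ (tendsto_id.const_mul_atBot (by positivity))
  have hV1 := hL.comp (hs1.atBot_div_const (two_pos))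
  have hV2 := hL.comp (hs2.const_mul_atBot (show (0 : ℝ) < 4 by norm_num))
  filter_upwards [hV1.eventually_le_const (show L < L + κ by linarith),
    hV2.eventually_const_le (show L - κ < L by linarith),
    hs1.eventually_lt_atBot (-4 * (3 + (l * E + 2) / (l * κ))),
    hs2.eventually_lt_atBot (-(2 + ((1 + κ) * (l * E) + 2) / (l * κ))), hs1.eventually_lt_atBot (-2),
    hs2.eventually_lt_atBot (-2), eventually_lt_atBot (0 : ℝ)] with t hv1 hv2 ht1 ht2 ht3 ht4 ht0
  simp only [Function.comp_apply] at hv1 hv2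
  -- Chosen so that `{φ_a < t}` lies in `{log S ≤ s - 1}`, and `{log S ≤ r + 1}` lies in `{φ_a < t}`
  -- with `r` as below.
  set s := 2 * P * t + E + 1 with hs
  set r := 2 * P * c * t - 2 with hr
  have hbig1 : l * E + 2 < l * κ * (-s / 4 - 5 / 2) := by
    have : (l * E + 2) / (l * κ) < -s / 4 - 5 / 2 := by linarith
    rw [div_lt_iff₀ (by positivity)] at this; linarith
  have hbig2 : (1 + κ) * (l * E) + 2 < l * κ * (-r - 3 / 2) := by
    have : ((1 + κ) * (l * E) + 2) / (l * κ) < -r - 3 / 2 := by linarith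
    rw [div_lt_iff₀ (by positivity)] at this; linarith
  have hlκ : 0 < l * κ := by positivity
  have hub : ∫ x, shellTest q 1 0 s x ∂μ ≤ (1 + κ) ^ n * (L + κ) := by
    refine le_of_tendsto (hlim _ (isTest_shellTest one_pos (by linarith))) ?_
    -- The line of slope `(1 + κ) l` is placed below every `w j` on the shell at `s`. This forces an
    -- offset of about `κ l |s|`, while at `s / 2` the difference of slopes, at most `3 κ l / 2`,
    -- costs only about `3 κ l |s| / 4`. So for `t` very negative the line lies above the limit
    -- weight there, and above `w j` for large `j`.
    refine (hdini (s := s / 2) (α := (1 + κ) * l) (β := -(κ * l * (s + 1)) - l * E - 2)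
      (by linarith) fun τ h1 h2 => ?_).mono fun j hj => ?_
    rotate_left
    · have h := hf.maInt_le_coneInc (q := q) (s := s / 2) (s' := s) (l := (1 + κ) * l)
        (d := -(κ * l * (s + 1)) - l * E - 2) (hsm j) (by positivity) (by linarith) (by linarith)
        (fun x h1 h2 => ?_) hj
      · calc mixedMA f (w j) (shellTest q 1 0 s)
            ≤ C₀ * (((1 + κ) * l) ^ n * coneInc q f (s / 2)) := mul_le_mul_of_nonneg_left h hC0.le
          _ = (1 + κ) ^ n * (C₀ * (l ^ n * coneInc q f (s / 2))) := by rw [mul_pow]; ring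
          _ ≤ _ := by gcongr
      · have hS : 0 < cone q x := (Real.exp_pos _).trans_le h1
        have h3 := hwlow (hD (by linarith) h2) (hne h1) j
        have h4 := (Real.log_le_iff_le_exp hS).2 h2
        nlinarith
    · have h3 : 0 < -τ := by linarith
      have h4 := mul_le_mul_of_nonneg_left hcinv (mul_pos hl0 h3).le
      have h5 : l * κ * (-τ) ≤ l * κ * (1 - s / 2) := by gcongr; linarith
      rw [div_eq_mul_inv]
      nlinarith
  have hlb : (L - κ) / (1 + κ) ^ n ≤ ∫ x, shellTest q 1 0 r x ∂μ := by
    refine ge_of_tendsto (hlim _ (isTest_shellTest one_pos (by linarith))) ?_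
    -- Here `(1 + κ) w j` plus a constant must lie above `l log S` on the shell at `r`, which costs
    -- an offset of about `κ l |r|`. At `4 r` the excess slope `κ l / 2` gains about `2 κ l |r|`,
    -- enough to reverse the order. The number `β` is the resulting inequality solved for `w j`.
    refine (hdini (s := 4 * r) (α := l / (1 + κ))
      (β := -(-(κ * l * (r - 1)) + (1 + κ) * (l * E) + 2) / (1 + κ))
      (by linarith) fun τ h1 h2 => ?_).mono fun j hj => ?_
    rotate_left
    · have h := hf.coneInc_le_maInt (q := q) (s := r) (s' := 4 * r) (l := l) (m := 1 + κ)
        (d := -(κ * l * (r - 1)) + (1 + κ) * (l * E) + 1) (hsm j) hl0.le (by positivity)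
        (by linarith) (by linarith) (fun x h1 h2 => ?_) fun x h1 h2 => ?_
      · rw [div_le_iff₀ (by positivity)]
        calc L - κ ≤ C₀ * (l ^ n * coneInc q f (4 * r)) := hv2
          _ ≤ C₀ * ((1 + κ) ^ n * maInt f (w j) (shellTest q 1 0 r)) :=
            mul_le_mul_of_nonneg_left h hC0.le
          _ = C₀ * maInt f (w j) (shellTest q 1 0 r) * (1 + κ) ^ n := by ring
      · have h3 := hj x h1 h2
        rw [div_mul_eq_mul_div, ← add_div, lt_div_iff₀ (by positivity)] at h3
        linarith
      · have hS : 0 < cone q x := (Real.exp_pos _).trans_le h1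
        have h3 := mul_le_mul_of_nonneg_left (hwlow (hD (by linarith) h2) (hne h1) j)
          (show 0 ≤ 1 + κ by positivity)
        have h4 := (Real.le_log_iff_exp_le hS).2 h1
        nlinarith
    · rw [div_mul_eq_mul_div, ← add_div, lt_div_iff₀ (by positivity), div_eq_mul_inv]
      have h3 : l * (τ * c⁻¹) * (1 + κ) = l * τ * (1 + κ / 2) := by rw [← hck]; ring
      rw [h3]
      nlinarith
  obtain ⟨hm1, -, hm3⟩ := shell_measure_bounds (q := q) hfin (s := s) (by linarith)
  obtain ⟨-, hm4, hm5⟩ := shell_measure_bounds (q := q) hfin (s := r) (by linarith)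
  have hwD {x : Fin (n + 1) → ℂ} (hx : weight a x < (t : EReal)) : x ∈ polydisk (n + 1) := fun k => by
    by_cases hk : x k = 0
    · simp [hk]
    · have h1 := (le_iSup (fun k => (((a k)⁻¹ : ℝ) : EReal) * ENNReal.log ‖x k‖ₑ) k).trans_lt hx
      rw [weight_term hk, EReal.coe_lt_coe_iff, inv_mul_lt_iff₀ (ha k)] at h1
      exact (Real.log_neg_iff (norm_pos_iff.2 hk)).1 (h1.trans (mul_neg_of_pos_of_neg (ha k) ht0))
  have hsub1 : {x | weight a x < (t : EReal)} ⊆ {x | cone q x ≤ Real.exp (s - 1)} := fun x hx => by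
    by_cases hx0 : x = 0
    · rw [hx0, Set.mem_ofPred_eq, cone_zero]; positivity
    · have h1 := EReal.coe_lt_coe_iff.1 ((le_weight hP hq1 (hwD hx) hx0).trans_lt hx)
      rw [inv_mul_lt_iff₀ (by positivity)] at h1
      exact (Real.log_le_iff_le_exp (cone_pos hx0)).1 (by linarith)
  have hsub2 : {x | cone q x ≤ Real.exp (r + 1)} ⊆ {x | weight a x < (t : EReal)} := fun x hx => by
    by_cases hx0 : x = 0
    · refine lt_of_le_of_lt (iSup_le fun k => ?_) (EReal.bot_lt_coe t)
      have h : (0 : EReal) < (((a k)⁻¹ : ℝ) : EReal) := by exact_mod_cast inv_pos.2 (ha k)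
      rw [hx0, Pi.zero_apply, enorm_zero, ENNReal.log_zero, EReal.mul_bot_of_pos h]
    · refine (weight_le ha hP hc0 hq2 (hD (by linarith) hx)).trans_lt (EReal.coe_lt_coe_iff.2 ?_)
      have h1 := (Real.log_le_iff_le_exp (cone_pos hx0)).2 hx
      rw [inv_mul_lt_iff₀ (by positivity), div_lt_iff₀ hc0]
      linarith
  have hfinA : μ {x | cone q x ≤ Real.exp (s - 1)} ≠ ⊤ :=
    ne_top_of_le_ne_top hm3.ne (measure_mono fun x hx => le_trans hx
      (Real.exp_le_exp.2 (by linarith)))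
  constructor
  · calc (ν / (1 + κ) - κ) / (1 + κ) ^ n ≤ (L - κ) / (1 + κ) ^ n := by
          refine div_le_div_of_nonneg_right (sub_le_sub_right (le_trans ?_ hL1) _) (by positivity)
          exact div_le_div_of_nonneg_left hν0 hc0 hc2
      _ ≤ _ := hlb.trans (hm4.trans (ENNReal.toReal_mono
          (ne_top_of_le_ne_top hfinA (measure_mono hsub1)) (measure_mono hsub2)))
  · calc _ ≤ (1 + κ) ^ n * (L + κ) :=
          (ENNReal.toReal_mono hfinA (measure_mono hsub1)).trans (hm1.trans hub)
      _ ≤ _ := by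
          refine mul_le_mul_of_nonneg_left (add_le_add_left (hL2.trans ?_) _) (by positivity)
          exact mul_le_mul_of_nonneg_right (pow_le_pow_left₀ hc0.le hc2 _) hν0

end Limit

/-! ### Existence of the mixed Monge–Ampère measures -/

lemma pshOn_of_levi_nonneg {n : ℕ} {w : (Fin n → ℂ) → ℝ} (hw : ContDiff ℝ ∞ w)
    (h : ∀ x b, 0 ≤ levi w x b) (U : Set (Fin n → ℂ)) : PSHOn (fun x => (w x : EReal)) U := by
  have hc := hw.continuous
  refine ⟨fun x _ => EReal.coe_lt_top _,
    (continuous_coe_real_ereal.comp hc).upperSemicontinuous.upperSemicontinuousOn U,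
    fun x b _ => ?_⟩
  have hγ : Differentiable ℂ fun z : ℂ => x + z • b := by fun_prop
  have hγs : ContDiff ℝ ∞ fun z : ℂ => x + z • b := (hγ.contDiff (n := ∞)).restrict_scalars ℝ
  have h1 := le_integral_circle_of_levi_nonneg (hw.comp hγs) fun z _ => by
    rw [levi_comp_holomorphic hγ (hw.of_le two_le_infty).contDiffAt]
    exact h _ _
  have hexp := continuous_expI
  have hcont : Continuous fun θ => w (x + expI θ • b) := by fun_prop
  have h2 := eIntegral_coe (integrable_angle_of_continuous hcont)
  simp only [expI] at h2
  rw [h2, EReal.coe_le_coe_iff, integral_angle]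
  simp only [Function.comp_apply, zero_smul, add_zero, expI] at h1
  rwa [le_inv_mul_iff₀ (by positivity)]

/-! ### An explicit smooth approximation of the weight. -/

section SoftMax

variable {n : ℕ} (a : Fin (n + 1) → ℝ) (ε : ℝ) (x : Fin (n + 1) → ℂ)

/-- A smooth plurisubharmonic majorant of `weight a`. -/
def softMax : ℝ := ε * Real.log (∑ k, (‖x k‖ ^ 2 + ε) ^ (2 * a k * ε)⁻¹)

variable {a ε x}

lemma softMax_base_pos (hε : 0 < ε) (k : Fin (n + 1)) : 0 < ‖x k‖ ^ 2 + ε := by positivity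

lemma softMax_sum_pos (hε : 0 < ε) : 0 < ∑ k, (‖x k‖ ^ 2 + ε) ^ (2 * a k * ε)⁻¹ :=
  Finset.sum_pos (fun k _ => Real.rpow_pos_of_pos (softMax_base_pos hε k) _)
    Finset.univ_nonempty

lemma contDiff_softMax (hε : 0 < ε) : ContDiff ℝ ∞ (softMax a ε) :=
  contDiff_const.mul ((ContDiff.sum fun k _ => ((contDiff_normSq_coord k).add
    contDiff_const).rpow_const_of_ne fun _ => (softMax_base_pos hε k).ne').log
      fun _ => (softMax_sum_pos hε).ne')

/-- Each power `(|x_k|² + ε)^r` has plurisubharmonic logarithm, so `levi_log_sum_nonneg` applies;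
the positive shift `ε` gives the slack `h0` in the Cauchy-Schwarz hypothesis. -/
lemma levi_softMax_nonneg (ha : ∀ k, 0 < a k) (hε : 0 < ε) (b : Fin (n + 1) → ℂ) :
    0 ≤ levi (softMax a ε) x b := by
  unfold softMax
  rw [levi_const_mul]
  refine mul_nonneg hε.le ?_
  have hd (r t : ℝ) (ht : t + ε ≠ 0) :
      HasDerivAt (fun t => (t + ε) ^ r) (r * (t + ε) ^ (r - 1)) t := by
    have := (Real.hasDerivAt_rpow_const (p := r) (Or.inl ht)).comp t
      ((hasDerivAt_id t).add_const ε)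
    simp only [id, mul_one] at this
    exact this
  have hτ (k) := softMax_base_pos (x := x) hε k
  have e1 (r : ℝ) (k) := (hd r _ (hτ k).ne').deriv
  have e2 (r : ℝ) (k) : deriv (deriv fun t => (t + ε) ^ r) (‖x k‖ ^ 2)
      = r * ((r - 1) * (‖x k‖ ^ 2 + ε) ^ (r - 2)) := by
    have h : (deriv fun t => (t + ε) ^ r) =ᶠ[𝓝 (‖x k‖ ^ 2)] fun t => r * (t + ε) ^ (r - 1) := by
      have : ∀ᶠ t in 𝓝 (‖x k‖ ^ 2), t + ε ≠ 0 :=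
        (continuous_add_const ε).continuousAt.eventually_ne (hτ k).ne'
      filter_upwards [this] with t ht using (hd r t ht).deriv
    rw [h.deriv_eq, ((hd (r - 1) _ (hτ k).ne').const_mul r).deriv]
    ring_nf
  have p1 (r : ℝ) (k) : (‖x k‖ ^ 2 + ε) ^ (r - 1) = (‖x k‖ ^ 2 + ε) ^ (r - 2) * (‖x k‖ ^ 2 + ε) := by
    rw [← Real.rpow_add_one (hτ k).ne']; ring_nf
  have p2 (r : ℝ) (k) : (‖x k‖ ^ 2 + ε) ^ r = (‖x k‖ ^ 2 + ε) ^ (r - 2) * (‖x k‖ ^ 2 + ε) ^ 2 := by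
    rw [← Real.rpow_natCast (_ + ε), ← Real.rpow_add (hτ k)]; norm_num
  have hr (k) : 0 < (2 * a k * ε)⁻¹ := by have := ha k; positivity
  have hB (k) : 0 < (‖x k‖ ^ 2 + ε) ^ ((2 * a k * ε)⁻¹ - 2) := Real.rpow_pos_of_pos (hτ k) _
  refine levi_log_sum_nonneg (G := fun k t => (t + ε) ^ (2 * a k * ε)⁻¹)
    (fun k => (contDiffAt_id.add contDiffAt_const).rpow_const_of_ne (hτ k).ne')
    (fun k => (Real.rpow_pos_of_pos (hτ k) _).le) (fun k => ?_) (fun k => ?_)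
    (softMax_sum_pos hε) b
  · have := hr k
    have := hB k
    rw [e1, e2, p1]
    calc (0 : ℝ) ≤ (2 * a k * ε)⁻¹ * (‖x k‖ ^ 2 + ε) ^ ((2 * a k * ε)⁻¹ - 2) *
          (ε + (2 * a k * ε)⁻¹ * ‖x k‖ ^ 2) := by positivity
      _ = _ := by ring
  · have := hr k
    have := hB k
    have h0 : 0 ≤ (2 * a k * ε)⁻¹ * ε * ((‖x k‖ ^ 2 + ε) ^ ((2 * a k * ε)⁻¹ - 2)) ^ 2 *
        (‖x k‖ ^ 2 + ε) ^ 2 := by positivity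
    rw [e1, e2, p1, p2 (2 * a k * ε)⁻¹ k]
    refine sub_nonneg.1 (h0.trans_eq ?_)
    ring

/-- Halving `ε` lowers the shift and doubles the exponents; with `∑ b_k² ≤ (∑ b_k)²` the sum is at
most the square of the old one, and the halved prefactor absorbs the square. Dyadic steps thus give
monotonicity. -/
lemma softMax_half_le (hε : 0 < ε) (ha : ∀ k, 0 < a k) : softMax a (2⁻¹ * ε) x ≤ softMax a ε x := by
  have h (k) : (‖x k‖ ^ 2 + 2⁻¹ * ε) ^ (2 * a k * (2⁻¹ * ε))⁻¹
      ≤ ((‖x k‖ ^ 2 + ε) ^ (2 * a k * ε)⁻¹) ^ 2 := by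
    have := ha k
    rw [← Real.rpow_mul_natCast (softMax_base_pos hε k).le]
    have e : (2 * a k * ε)⁻¹ * (2 : ℕ) = (2 * a k * (2⁻¹ * ε))⁻¹ := by
      push_cast; field_simp
    rw [e]
    exact Real.rpow_le_rpow (softMax_base_pos (by positivity) k).le (by linarith) (by positivity)
  have h2 : Real.log (∑ k, (‖x k‖ ^ 2 + 2⁻¹ * ε) ^ (2 * a k * (2⁻¹ * ε))⁻¹)
      ≤ 2 * Real.log (∑ k, (‖x k‖ ^ 2 + ε) ^ (2 * a k * ε)⁻¹) := by
    rw [show (2 : ℝ) = (2 : ℕ) from rfl, ← Real.log_pow]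
    refine Real.log_le_log (softMax_sum_pos (by positivity))
      ((Finset.sum_le_sum fun k _ => h k).trans ?_)
    exact Finset.sum_sq_le_sq_sum_of_nonneg
      fun k _ => (Real.rpow_pos_of_pos (softMax_base_pos hε k) _).le
  unfold softMax
  nlinarith

lemma weight_le_softMax (hε : 0 < ε) (ha : ∀ k, 0 < a k) :
    weight a x ≤ (softMax a ε x : EReal) := by
  refine iSup_le fun k => ?_
  have hak := ha k
  by_cases hk : x k = 0
  · have h : (0 : EReal) < (((a k)⁻¹ : ℝ) : EReal) := by exact_mod_cast inv_pos.2 hak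
    rw [hk, enorm_zero, ENNReal.log_zero, EReal.mul_bot_of_pos h]
    exact bot_le
  · rw [weight_term hk, EReal.coe_le_coe_iff]
    have h0 : 0 < ‖x k‖ := norm_pos_iff.2 hk
    have hτ := softMax_base_pos (x := x) hε k
    have h1 : (‖x k‖ ^ 2 + ε) ^ (2 * a k * ε)⁻¹ ≤ ∑ k, (‖x k‖ ^ 2 + ε) ^ (2 * a k * ε)⁻¹ :=
      Finset.single_le_sum (f := fun k => (‖x k‖ ^ 2 + ε) ^ (2 * a k * ε)⁻¹)
        (fun k _ => (Real.rpow_pos_of_pos (softMax_base_pos hε k) _).le) (Finset.mem_univ k)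
    have h2 := Real.log_le_log (Real.rpow_pos_of_pos hτ _) h1
    rw [Real.log_rpow hτ] at h2
    have h3 : Real.log (‖x k‖ ^ 2) ≤ Real.log (‖x k‖ ^ 2 + ε) :=
      Real.log_le_log (by positivity) (by linarith)
    rw [Real.log_pow] at h3
    push_cast at h3
    calc (a k)⁻¹ * Real.log ‖x k‖ = ε * ((2 * a k * ε)⁻¹ * (2 * Real.log ‖x k‖)) := by field_simp
      _ ≤ ε * ((2 * a k * ε)⁻¹ * Real.log (‖x k‖ ^ 2 + ε)) := by gcongr
      _ ≤ softMax a ε x := mul_le_mul_of_nonneg_left h2 hε.le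

lemma softMax_le (hε : 0 < ε) (ha : ∀ k, 0 < a k) {v : ℝ}
    (h : ∀ k, ‖x k‖ ^ 2 + ε ≤ Real.exp (2 * a k * v)) :
    softMax a ε x ≤ v + ε * Real.log (n + 1) := by
  have h1 (k) : (‖x k‖ ^ 2 + ε) ^ (2 * a k * ε)⁻¹ ≤ Real.exp (v / ε) := by
    have := ha k
    refine (Real.rpow_le_rpow (softMax_base_pos hε k).le (h k) (by positivity)).trans_eq ?_
    rw [← Real.exp_mul]
    congr 1
    field_simp
  have h2 : ∑ k, (‖x k‖ ^ 2 + ε) ^ (2 * a k * ε)⁻¹ ≤ (n + 1) * Real.exp (v / ε) := by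
    refine (Finset.sum_le_sum fun k _ => h1 k).trans_eq ?_
    simp
  have h3 := Real.log_le_log (softMax_sum_pos hε) h2
  rw [Real.log_mul (by positivity) (Real.exp_pos _).ne', Real.log_exp] at h3
  calc softMax a ε x ≤ ε * (Real.log (n + 1) + v / ε) := mul_le_mul_of_nonneg_left h3 hε.le
    _ = _ := by field_simp; ring

lemma isDecreasingApprox_softMax (ha : ∀ k, 0 < a k) :
    IsDecreasingApprox (weight a) fun j => softMax a (2⁻¹ ^ j) where
  smooth j := (contDiff_softMax (by positivity)).contDiffOn
  psh j := pshOn_of_levi_nonneg (contDiff_softMax (by positivity))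
    (fun x b => levi_softMax_nonneg ha (by positivity) b) _
  antitone x _ := antitone_nat_of_succ_le fun j => by
    rw [pow_succ']
    exact softMax_half_le (by positivity) ha
  tendsto x _ := by
    have hε : Tendsto (fun j : ℕ => (2⁻¹ : ℝ) ^ j) atTop (𝓝 0) :=
      tendsto_pow_atTop_nhds_zero_of_lt_one (by norm_num) (by norm_num)
    refine tendsto_order.2 ⟨fun b hb => Eventually.of_forall fun j =>
      hb.trans_le (weight_le_softMax (by positivity) ha), fun b hb => ?_⟩
    obtain ⟨v, hv1, hv2⟩ := EReal.lt_iff_exists_real_btwn.1 hb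
    obtain ⟨v', hv3, hv4⟩ := EReal.lt_iff_exists_real_btwn.1 hv1
    rw [EReal.coe_lt_coe_iff] at hv4
    have hk (k) : ‖x k‖ ^ 2 < Real.exp (2 * a k * v') := by
      by_cases hk : x k = 0
      · simp [hk, Real.exp_pos]
      · have h1 := (le_iSup (fun k => (((a k)⁻¹ : ℝ) : EReal) * ENNReal.log ‖x k‖ₑ) k).trans_lt hv3
        rw [weight_term hk, EReal.coe_lt_coe_iff, inv_mul_lt_iff₀ (ha k)] at h1
        have h0 : 0 < ‖x k‖ := norm_pos_iff.2 hk
        rw [← Real.log_lt_iff_lt_exp (by positivity), Real.log_pow]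
        push_cast
        linarith
    have h1 : ∀ᶠ j : ℕ in atTop, ∀ k, ‖x k‖ ^ 2 + 2⁻¹ ^ j ≤ Real.exp (2 * a k * v') :=
      eventually_all.2 fun k => by
        filter_upwards [hε.eventually_lt_const (sub_pos.2 (hk k))] with j hj
        linarith
    have h2 : Tendsto (fun j : ℕ => v' + 2⁻¹ ^ j * Real.log (n + 1)) atTop (𝓝 v') := by
      simpa using (hε.mul_const (Real.log (n + 1))).const_add v'
    filter_upwards [h1, h2.eventually_lt_const hv4] with j hj hj'
    exact (EReal.coe_lt_coe_iff.2 ((softMax_le (by positivity) ha hj).trans_lt hj')).trans hv2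

end SoftMax

/-! ### Mass bounds and weak compactness. -/

section Existence

variable {n : ℕ} {f : (Fin (n + 1) → ℂ) → EReal}

/-- An exhausting sequence of cutoff functions. -/
def shellCutoff (n i : ℕ) : (Fin (n + 1) → ℂ) → ℝ := shellTest (fun _ => i) 1 0 (-5)

lemma isTest_shellCutoff (i : ℕ) : IsTest (polydisk (n + 1)) (shellCutoff n i) :=
  isTest_shellTest one_pos (by norm_num)

/-- For large exponents the cone function is small on a given compact subset, so its fixed sublevel
sets exhaust the polydisk. -/
lemma exists_shellCutoff_eq_one {K : Set (Fin (n + 1) → ℂ)} (hK : IsCompact K)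
    (hKD : K ⊆ polydisk (n + 1)) : ∃ i, ∀ x ∈ K, shellCutoff n i x = 1 := by
  obtain ⟨r, hr0, hr1, hr⟩ : ∃ r : ℝ, 0 ≤ r ∧ r < 1 ∧ ∀ x ∈ K, ‖x‖ ≤ r := by
    rcases K.eq_empty_or_nonempty with h | h
    · exact ⟨0, le_rfl, one_pos, by simp [h]⟩
    · obtain ⟨x, hx, hmax⟩ := hK.exists_isMaxOn h continuous_norm.continuousOn
      exact ⟨‖x‖, norm_nonneg x, by simpa [polydisk_eq_ball] using hKD hx, hmax⟩
  have hlim : Tendsto (fun i : ℕ => ((n : ℝ) + 1) * (r ^ 2) ^ (i + 1)) atTop (𝓝 0) := by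
    have := (tendsto_pow_atTop_nhds_zero_of_lt_one (sq_nonneg r) (by nlinarith)).comp
      (tendsto_add_atTop_nat 1)
    simpa using this.const_mul ((n : ℝ) + 1)
  obtain ⟨i, hi⟩ := (hlim.eventually_lt_const (Real.exp_pos (-5 - 1))).exists
  refine ⟨i, fun x hx => ?_⟩
  have h : cone (fun _ => i) x ≤ Real.exp (-5 - 1) := by
    refine le_trans (le_trans (Finset.sum_le_sum (g := fun _ => (r ^ 2) ^ (i + 1)) fun k _ => ?_)
      (le_of_eq (by simp))) hi.le
    have := (norm_le_pi_norm x k).trans (hr x hx)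
    gcongr
  rw [shellCutoff, shellTest_of_le one_pos h]
  obtain ⟨h1, h2⟩ := descent_bounds (δ := 1) 0 one_pos le_rfl
  simp only [neg_zero, zero_mul, Real.exp_zero] at h1 h2
  exact le_antisymm h2 h1

/-- All `w j` lie between the weight and `w 0`, hence are bounded below on the inner shell and above
on the outer shell uniformly in `j`. Comparison with one steep multiple of `log S` bounds all the
masses. -/
lemma NegPSH.exists_mass_bound (hf : NegPSH f) {a : Fin (n + 1) → ℝ} (ha : ∀ k, 0 < a k)
    {w : ℕ → (Fin (n + 1) → ℂ) → ℝ} (hw : IsDecreasingApprox (weight a) w) (i : ℕ) :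
    ∃ C, ∀ j, maInt f (w j) (shellCutoff n i) ≤ C := by
  have hA : 0 < ∑ k, (a k)⁻¹ :=
    Finset.sum_pos (fun k _ => inv_pos.2 (ha k)) Finset.univ_nonempty
  set P : ℝ := (i + 1) / ∑ k, (a k)⁻¹ with hP
  have hP0 : 0 < P := by positivity
  have hq (k) : P / a k ≤ (i : ℝ) + 1 := by
    rw [hP, div_div, div_le_iff₀ (mul_pos hA (ha k))]
    have h1 : 1 ≤ (∑ k, (a k)⁻¹) * a k := by
      rw [← inv_le_iff_one_le_mul₀ (ha k)]
      exact Finset.single_le_sum (f := fun k => (a k)⁻¹) (fun k _ => (inv_pos.2 (ha k)).le)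
        (Finset.mem_univ k)
    exact le_mul_of_one_le_right (by positivity) h1
  have hD {x : Fin (n + 1) → ℂ} {s : ℝ} (hs : s < 0) (h : cone (fun _ => i) x ≤ Real.exp s) :
      x ∈ polydisk (n + 1) :=
    mem_polydisk_of_cone_lt_one (h.trans_lt (Real.exp_lt_one_iff.2 hs))
  obtain ⟨m, hm⟩ := (isCompact_shell (q := fun _ : Fin (n + 1) => i)).exists_bound_of_continuousOn
    ((hw.smooth 0).continuousOn.mono (shell_subset (s := -2) (R := 1) (by norm_num)))
  set m' := (2 * P)⁻¹ * (6 + Real.log (n + 1)) with hm'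
  have hlog : 0 ≤ Real.log ((n : ℝ) + 1) := Real.log_nonneg (by linarith [n.cast_nonneg (α := ℝ)])
  have hm'0 : 0 ≤ m' := by positivity
  -- The line `M log S + 7 M / 2` is at most `-M / 2` on the shell at `-5` and at least `M / 2` on
  -- the shell at `-2`; this `M` makes it clear both bounds `-m'` and `|m|` with room for the `1`
  -- needed in gluing.
  set M := 2 * (m' + |m|) + 4 with hM
  refine ⟨M ^ n * coneInc (fun _ => i) f (-2), fun j => hf.maInt_le_coneInc (s' := -5)
    (d := 7 / 2 * M) (smoothPSH_of_pshOn (hw.smooth j) (hw.psh j)) (by positivity) (by norm_num)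
    (by norm_num) (fun x h1 h2 => ?_) fun x h1 h2 => ?_⟩
  · have hx0 : x ≠ 0 := fun h0 => by
      rw [h0, cone_zero] at h1
      exact absurd h1 (not_le.2 (Real.exp_pos _))
    have h3 := EReal.coe_le_coe_iff.1 ((le_weight hP0 hq (hD (by norm_num) h2) hx0).trans
      (hw.le (hD (by norm_num) h2) j))
    have h4 := (Real.le_log_iff_exp_le (cone_pos hx0)).2 h1
    have h5 := (Real.log_le_iff_le_exp (cone_pos hx0)).2 h2
    have h6 : -m' ≤ w j x := by
      refine le_trans ?_ h3
      rw [hm', ← mul_neg]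
      exact mul_le_mul_of_nonneg_left (by linarith) (by positivity)
    have hM0 : 0 ≤ M := by positivity
    nlinarith [abs_nonneg m]
  · have hx := hD (by norm_num) h2
    have h3 := (abs_le.1 (hm x ⟨h1, h2⟩)).2.trans (le_abs_self m)
    have h4 := hw.antitone x hx (Nat.zero_le j)
    have h5 := (Real.le_log_iff_exp_le ((Real.exp_pos _).trans_le h1)).2 h1
    have hM0 : 0 ≤ M := by positivity
    simp only at h4
    nlinarith

lemma NegPSH.abs_maInt_le (hf : NegPSH f) {w χ ψ : (Fin (n + 1) → ℂ) → ℝ} (hw : SmoothPSH w)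
    (hχ : IsTest (polydisk (n + 1)) χ) (hψ : IsTest (polydisk (n + 1)) ψ) {M : ℝ}
    (h : ∀ x, |χ x| ≤ M * ψ x) : |maInt f w χ| ≤ M * maInt f w ψ := by
  have h1 := hf.maInt_mono hw (hψ.const_mul M) hχ fun x => (abs_le.1 (h x)).2
  have h2 := hf.maInt_mono hw hχ (hψ.const_mul (-M)) fun x => by linarith [(abs_le.1 (h x)).1]
  rw [maInt_const_mul_right] at h1 h2
  exact abs_le.2 ⟨by linarith, h1⟩

/-- The test functions on whose support the `i`-th cutoff function is `1`. -/
def cutoffTests (n i : ℕ) : Set ((Fin (n + 1) → ℂ) → ℝ) :=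
  {χ | IsTest (polydisk (n + 1)) χ ∧ ∀ x ∈ tsupport χ, shellCutoff n i x = 1}

/-- Continuous functions on a closed ball form a separable metric space, and so does any subset.
Outside both supports the difference vanishes, inside them the cutoff is `1`, so the uniform
estimate carries the cutoff as a factor. -/
lemma exists_dense_cutoffTests (i : ℕ) : ∃ η : ℕ → (Fin (n + 1) → ℂ) → ℝ,
    (∀ m, η m ∈ cutoffTests n i) ∧ ∀ χ ∈ cutoffTests n i, ∀ ε > 0, ∃ m, ∀ x,
      |χ x - η m x| ≤ ε * shellCutoff n i x := by
  let B := Metric.closedBall (0 : Fin (n + 1) → ℂ) 1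
  have : CompactSpace B := isCompact_iff_compactSpace.1 (isCompact_closedBall _ _)
  let T : Set C(B, ℝ) := {g | ∃ χ ∈ cutoffTests n i, ∀ x : B, g x = χ x}
  have : Nonempty T := ⟨⟨0, fun _ => 0, ⟨isTest_zero, fun x hx => by simp [tsupport] at hx⟩,
    fun _ => rfl⟩⟩
  choose η hη hηe using fun m : ℕ => (TopologicalSpace.denseSeq T m).2
  refine ⟨η, hη, fun χ hχ ε hε => ?_⟩
  let g : T := ⟨⟨fun x => χ x, hχ.1.smooth.continuous.comp continuous_subtype_val⟩, χ, hχ,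
    fun _ => rfl⟩
  obtain ⟨_, ⟨m, rfl⟩, hm⟩ := Metric.mem_closure_iff.1 (TopologicalSpace.denseRange_denseSeq T g) ε hε
  refine ⟨m, fun x => ?_⟩
  have hψ0 : 0 ≤ shellCutoff n i x := shellTest_nonneg one_pos x
  by_cases hx : x ∈ tsupport χ ∪ tsupport (η m)
  · have hx1 : shellCutoff n i x = 1 := hx.elim (hχ.2 x) ((hη m).2 x)
    have hxB : x ∈ B := Metric.ball_subset_closedBall (by
      rw [← polydisk_eq_ball]
      exact hx.elim (fun h => hχ.1.supp h) fun h => (hη m).1.supp h)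
    have := (ContinuousMap.dist_apply_le_dist (f := g.1) (g := (TopologicalSpace.denseSeq T m).1)
      ⟨x, hxB⟩).trans hm.le
    rw [hηe m, Real.dist_eq] at this
    rw [hx1, mul_one]
    exact this
  · rw [Set.mem_union, not_or] at hx
    rw [image_eq_zero_of_notMem_tsupport hx.1, image_eq_zero_of_notMem_tsupport hx.2, sub_zero,
      abs_zero]
    positivity

/-- The diagonal argument, as sequential compactness of a countable product of intervals. -/
lemma exists_subseq_tendsto_of_bounded {ι : Type*} [Countable ι] {u : ℕ → ι → ℝ} {b : ι → ℝ}
    (h : ∀ p j, |u j p| ≤ b p) :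
    ∃ φ : ℕ → ℕ, StrictMono φ ∧ ∀ p, ∃ l, Tendsto (fun j => u (φ j) p) atTop (𝓝 l) := by
  have hK : IsCompact (Set.univ.pi fun p => Set.Icc (-b p) (b p)) :=
    isCompact_univ_pi fun p => isCompact_Icc
  obtain ⟨L, -, φ, hφ, hL⟩ := hK.tendsto_subseq (x := u) fun j p _ => abs_le.1 (h p j)
  exact ⟨φ, hφ, fun p => ⟨L p, tendsto_pi_nhds.1 hL p⟩⟩

/-- Weak compactness of the mixed Monge–Ampère measures. -/
lemma NegPSH.exists_subseq (hf : NegPSH f) {w : ℕ → (Fin (n + 1) → ℂ) → ℝ}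
    (hw : ∀ j, SmoothPSH (w j)) (hC : ∀ i, ∃ C, ∀ j, maInt f (w j) (shellCutoff n i) ≤ C) :
    ∃ φ : ℕ → ℕ, StrictMono φ ∧ ∀ χ, IsTest (polydisk (n + 1)) χ →
      ∃ l, Tendsto (fun j => maInt f (w (φ j)) χ) atTop (𝓝 l) := by
  choose C hC using hC
  choose η hη hdense using exists_dense_cutoffTests (n := n)
  have hψ (i) (j) : 0 ≤ maInt f (w j) (shellCutoff n i) :=
    hf.maInt_nonneg (hw j) (isTest_shellCutoff i) fun x => shellTest_nonneg one_pos x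
  have hbd (p : ℕ × ℕ) : ∃ b, ∀ j, |maInt f (w j) (η p.1 p.2)| ≤ b := by
    obtain ⟨hT, h1⟩ := hη p.1 p.2
    obtain ⟨M, hM⟩ := hT.compact.exists_bound_of_continuous hT.smooth.continuous
    have hM0 : 0 ≤ M := (norm_nonneg _).trans (hM 0)
    refine ⟨M * C p.1, fun j => (hf.abs_maInt_le (hw j) hT (isTest_shellCutoff p.1)
      fun x => ?_).trans (mul_le_mul_of_nonneg_left (hC _ j) hM0)⟩
    by_cases hx : x ∈ tsupport (η p.1 p.2)
    · rw [h1 x hx, mul_one]; exact hM x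
    · rw [image_eq_zero_of_notMem_tsupport hx, abs_zero]
      exact mul_nonneg hM0 (shellTest_nonneg one_pos x)
  choose b hb using hbd
  obtain ⟨φ, hφ, hL⟩ := exists_subseq_tendsto_of_bounded hb
  refine ⟨φ, hφ, fun χ hχ => cauchySeq_tendsto_of_complete (Metric.cauchySeq_iff'.2 fun ε hε => ?_)⟩
  obtain ⟨i, hi⟩ := exists_shellCutoff_eq_one hχ.compact hχ.supp
  have hC0 : 0 ≤ C i := (hψ i 0).trans (hC i 0)
  -- Approximation relative to the cutoff turns into an error of at most `ε / 3` in the functional,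
  -- uniformly in `j`, by positivity and the mass bound `C i`.
  obtain ⟨m, hm⟩ := hdense i χ ⟨hχ, hi⟩ (ε / (3 * (C i + 1))) (by positivity)
  have hclose (j) : |maInt f (w j) χ - maInt f (w j) (η i m)| < ε / 3 := by
    rw [← hf.maInt_sub (hw j).smooth hχ (hη i m).1]
    refine (hf.abs_maInt_le (hw j) (hχ.sub (hη i m).1) (isTest_shellCutoff i) hm).trans_lt ?_
    calc _ ≤ ε / (3 * (C i + 1)) * C i := mul_le_mul_of_nonneg_left (hC i j) (by positivity)
      _ < ε / (3 * (C i + 1)) * (C i + 1) :=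
        mul_lt_mul_of_pos_left (by linarith) (by positivity)
      _ = ε / 3 := by field_simp
  obtain ⟨L, hL⟩ := hL (i, m)
  obtain ⟨N, hN⟩ := Metric.cauchySeq_iff'.1 hL.cauchySeq (ε / 3) (by positivity)
  refine ⟨N, fun j hj => ?_⟩
  have h1 := abs_lt.1 (hclose (φ j))
  have h2 := abs_lt.1 (hclose (φ N))
  have h3 := hN j hj
  simp only [Real.dist_eq] at h3 ⊢
  have h3 := abs_lt.1 h3
  exact abs_lt.2 ⟨by linarith, by linarith⟩

/-- A subsequence of the explicit approximation still decreases to the weight, so convergence along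
it is all that existence requires. Independence of the approximation is not needed here:
`NegPSH.tendsto_mixedMA` treats every admissible measure. -/
lemma NegPSH.exists_mixedMAMeasure (hf : NegPSH f) {a : Fin (n + 1) → ℝ} (ha : ∀ k, 0 < a k) :
    ∃ μ, IsMixedMAMeasure f (weight a) μ := by
  have hw := isDecreasingApprox_softMax ha
  have hs (j) := smoothPSH_of_pshOn (hw.smooth j) (hw.psh j)
  obtain ⟨φ, hφ, hlim⟩ := hf.exists_subseq hs (hf.exists_mass_bound ha hw)
  have hlim' (χ) (hχ : IsTest (polydisk (n + 1)) χ) :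
      Tendsto (fun j => mixedMA f (softMax a (2⁻¹ ^ φ j)) χ) atTop
        (𝓝 (limUnder atTop fun j => mixedMA f (softMax a (2⁻¹ ^ φ j)) χ)) :=
    tendsto_nhds_limUnder ⟨_, (hlim χ hχ).choose_spec.const_mul
      ((2 / Real.pi) ^ (n + 1) * (n.factorial : ℝ))⟩
  obtain ⟨μ, h1, h2⟩ := exists_measure_of_positive
    (Λ := fun χ => limUnder atTop fun j => mixedMA f (softMax a (2⁻¹ ^ φ j)) χ)
    (fun χ χ' h h' => tendsto_nhds_unique (hlim' _ (h.sub h')) <|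
      ((hlim' χ h).sub (hlim' χ' h')).congr fun j => by
        refine (mul_sub _ _ _).symm.trans (congrArg _ ?_)
        exact (hf.maInt_sub (hs (φ j)).smooth h h').symm)
    (fun c χ h => tendsto_nhds_unique (hlim' _ (h.const_mul c)) <|
      ((hlim' χ h).const_mul c).congr fun j => by
        refine (mul_left_comm _ _ _).trans (congrArg _ ?_)
        exact (maInt_const_mul_right _ _ _).symm)
    (fun χ h h0 => ge_of_tendsto' (hlim' χ h) fun j =>
      mul_nonneg (by positivity) (hf.maInt_nonneg (hs (φ j)) h h0))
  refine ⟨μ, h1, fun j => softMax a (2⁻¹ ^ φ j), ⟨fun j => hw.smooth _, fun j => hw.psh _,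
    fun x hx => (hw.antitone x hx).comp_monotone hφ.monotone,
    fun x hx => (hw.tendsto x hx).comp hφ.tendsto_atTop⟩, fun χ hχ => ?_⟩
  rw [h2 χ hχ]
  exact hlim' χ hχ

/-- The generalized Lelong numbers are the asymptotic slopes of the convex image. -/
lemma NegPSH.isDirectionalLelongNumber (hf : NegPSH f) {a : Fin (n + 1) → ℝ}
    (ha : ∀ k, 0 < a k) : IsDirectionalLelongNumber f a (asympSlope (convexReal f) a) :=
  ⟨_, ⟨hf.exists_mixedMAMeasure ha, fun _ hμ => hf.tendsto_mixedMA ha hμ⟩,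
    (mul_div_cancel₀ _ (Finset.prod_pos fun k _ => ha k).ne').symm⟩

end Existence

/-! ### Lelong numbers at points and along coordinate hyperplanes. -/

section Lelong

variable {n : ℕ} {f : (Fin (n + 1) → ℂ) → EReal} {x : Fin (n + 1) → ℂ} {ρ : ℝ}

lemma NegPSH.isLelongNumber (hf : NegPSH f) (hρ : 0 < ρ) (hx : ‖x‖ + ρ ≤ 1) :
    IsLelongNumber f x (asympSlope (convexReal fun z => f fun k => x k + (ρ : ℂ) * z k) 1) := by
  obtain ⟨σ, hσ⟩ := hf.exists_traceMeasure
  exact ⟨σ, hσ, hf.tendsto_lelong hσ hρ hx⟩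

lemma NegPSH.isLelongNumber_zero (hf : NegPSH f) :
    IsLelongNumber f 0 (asympSlope (convexReal f) 1) := by
  simpa using hf.isLelongNumber (x := 0) one_pos (by simp)

/-- Every point of `{x_k = 0}` has Lelong number at least the slope in direction `k`, and one point
over a generic `y` attains it; so the infimum is even a minimum. -/
lemma NegPSH.isGenericLelongNumber (hf : NegPSH f) {k : Fin (n + 1)} {y : Fin n → ℂ}
    (hy : y ∈ polydisk n) {g : (Fin 1 → ℂ) → EReal} (hg : NegPSH g)
    (hgl : ∀ v < 0, logMean (pot g) (fun _ => v) = sliceMean f k v y)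
    (hgs : asympSlope (convexReal g) 1 = asympSlope (convexReal f) (Pi.single k 1)) :
    IsGenericLelongNumber f k (asympSlope (convexReal f) (Pi.single k 1)) := by
  have hρ {x : Fin (n + 1) → ℂ} (hx : x ∈ polydisk (n + 1)) : 0 < 1 - ‖x‖ := by
    rw [polydisk_eq_ball, mem_ball_zero_iff] at hx; linarith
  refine ⟨fun x hx _ => ⟨_, hf.isLelongNumber (hρ hx) (by linarith)⟩, ?_, fun m hm => ?_⟩
  · rintro m ⟨x, hx, hxk, σ, hσ, hm⟩
    -- The limit formula holds for any trace measure, so Lelong numbers are unique without proving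
    -- that the measure is.
    rw [tendsto_nhds_unique hm (hf.tendsto_lelong hσ (hρ hx) (by linarith))]
    exact hf.le_asympSlope_recentre (hρ hx) (by linarith) k hxk
  · have hx : k.insertNth 0 y ∈ polydisk (n + 1) := fun l => by
      rcases Fin.eq_self_or_eq_succAbove k l with rfl | ⟨i, rfl⟩
      · simp
      · simpa using hy i
    refine (hm ⟨_, hx, by simp, hf.isLelongNumber (hρ hx) (by linarith)⟩).trans ?_
    rw [← hgs]
    exact hf.asympSlope_recentre_le (hρ hx) (by linarith) k (by simp) hg (by simpa using hgl)

end Lelong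

end Pluri

end

theorem mainTheorem11 (n : ℕ) (Ω : Set (Fin (n + 1) → ℂ)) (hΩ : IsOpen Ω)
    (hD : Pluri.polydisk (n + 1) ⊆ Ω)
    (f : (Fin (n + 1) → ℂ) → EReal) (hf : Pluri.PSHOn f Ω)
    (hneg : ∀ x ∈ Pluri.polydisk (n + 1), f x ≤ 0)
    (hne : ∃ x ∈ Pluri.polydisk (n + 1), f x ≠ ⊥) :
    -- the convex image is finite
    (∀ u ∈ Pluri.logDomain Ω, Pluri.convexImage f u ≠ ⊥ ∧ Pluri.convexImage f u ≠ ⊤) ∧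
    -- a) for a general direction `a`
    (∀ a : Fin (n + 1) → ℝ, (∀ k, 0 < a k) →
      ∃ N : ℝ, Pluri.IsDirectionalLelongNumber f a N ∧
        ∀ u ∈ Pluri.logDomain Ω,
          Tendsto (fun v : ℝ => ((v⁻¹ : ℝ) : EReal) *
            Pluri.convexImage f (fun k => u k + a k * v)) atBot (𝓝 (N : EReal))) ∧
    ∃ (ν : ℝ) (νk : Fin (n + 1) → ℝ),
      -- a) for `a = (1, …, 1)`
      Pluri.IsLelongNumber f 0 ν ∧
      (∀ u ∈ Pluri.logDomain Ω,
        Tendsto (fun v : ℝ => ((v⁻¹ : ℝ) : EReal) * Pluri.convexImage f (fun k => u k + v))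
          atBot (𝓝 (ν : EReal)) ∧
        -- the left and right derivatives in `v` exist and have the same limit
        ∃ dl dr : ℝ → ℝ,
          (∀ v < 0,
            HasDerivWithinAt (fun s : ℝ => (Pluri.convexImage f (fun k => u k + s)).toReal)
              (dl v) (Set.Iio v) v ∧
            HasDerivWithinAt (fun s : ℝ => (Pluri.convexImage f (fun k => u k + s)).toReal)
              (dr v) (Set.Ioi v) v) ∧
          Tendsto dl atBot (𝓝 ν) ∧ Tendsto dr atBot (𝓝 ν)) ∧
      -- b)
      (∀ k : Fin (n + 1), Pluri.IsGenericLelongNumber f k (νk k) ∧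
        (∀ u ∈ Pluri.logDomain Ω,
          Tendsto (fun v : ℝ => ((v⁻¹ : ℝ) : EReal) *
            Pluri.convexImage f (Function.update u k (u k + v))) atBot (𝓝 (νk k : EReal))) ∧
        ∃ E : Set (Fin n → ℂ), Pluri.IsPluripolarIn E (Pluri.polydisk n) ∧
          ∀ y ∈ Pluri.polydisk n, y ∉ E → ∀ r : ℝ, 0 < r → r ≤ 1 →
            Tendsto (fun w : ℝ => (((Real.log w)⁻¹ : ℝ) : EReal) * Pluri.partialMean f k (w * r) y)
              (𝓝[>] 0) (𝓝 (νk k : EReal))) ∧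
      -- c)
      ∑ k, νk k ≤ ν := by
  have hfD := Pluri.isNegPSH_of_pshOn hD hf hneg hne
  refine ⟨fun u hu => Pluri.convexImage_finite hΩ hf hfD hu, fun a ha =>
    ⟨_, hfD.isDirectionalLelongNumber ha, fun u hu =>
      Pluri.tendsto_convexImage hΩ hf hfD hu fun k => (ha k).le⟩,
    _, _, hfD.isLelongNumber_zero, fun u hu => ⟨?_, Pluri.exists_deriv_convexImage hΩ hf hfD hu⟩,
    fun k => ?_, hfD.negConvex.sum_asympSlope_le⟩
  · simpa using Pluri.tendsto_convexImage hΩ hf hfD hu (d := 1) zero_le_one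
  · obtain ⟨E, hE, ⟨y, hy, hyE⟩, h⟩ := hfD.exists_pluripolar k
    obtain ⟨g, hg, hgl, hgs⟩ := h y hy hyE
    refine ⟨hfD.isGenericLelongNumber hy hg hgl hgs,
      fun u hu => Pluri.tendsto_convexImage_update hΩ hf hfD hu k, E, hE, fun z hz hzE r hr hr1 => ?_⟩
    obtain ⟨g', hg', hgl', hgs'⟩ := h z hz hzE
    rw [← hgs']
    exact hfD.tendsto_partialMean k hz hg' hgl' hr hr1
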